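/- **Setting.** Let $D=[-\pi,\pi]^2$ be the flat torus, $\langle f,g\rangle=⨍_D fg$ the normalised $L^2$ pairing ($⨍_D=\frac1{4\pi^2}\int_D$), and $\nabla^\perp=(-\partial_y,\partial_x)$. Let $\Lambda=\mathbb Z\times\mathbb N_{\ge1}$, and for $l=(j,k)\in\Lambda$ put $|l|^2=j^2+k^2$. Let $(b_l)_{l\in\Lambda}$ be the orthonormal basis (for $\langle\cdot,\cdot\rangle$) of the functions odd in $y$ given by $\sqrt2\sin(ky)$ for $j=0$, $2\cos(jx)\sin(ky)$ for $j>0$ and $2\sin(jx)\sin(ky)$ for $j<0$; write $\hat u_l=\langle u,b_l\rangle$. For $s\in\mathbb R$ let $\mathcal H^s$ be the space of the series $u=\sum_l\hat u_l b_l$ with real coefficients and $\|u\|_{\mathcal H^s}^2=\sum_l|l|^{2s}\hat u_l^2<\infty$, and let $\mathcal H^s(D\times D)$ be the space of the series $H=\sum_{l,l'}H_{l,l'}\,b_l\otimes b_{l'}$ with $\sum_{l,l'}(|l|^2+|l'|^2)^sH_{l,l'}^2<\infty$. Let $\beta\ne0$, $\alpha,\mu,T>0$, and let $h$ be a real function on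 the channel $\mathbb R\times[0,\pi]$, smooth up to the boundary and $2\pi$-periodic in $x$, extended to $D$ as an odd function of $y$. Put $G=(\mu-\Delta)^{-1}h$ and $\bar q=\mu G+\beta y$, and $\sigma_l^2=\frac{|l|^2}{\alpha(\mu+|l|^2)}$. **Gibbs measures.** The barotropic quasi-geostrophic system is $$\partial_tq+\nabla^\perp\psi\cdot\nabla q=0,\quad q=\Delta\psi'+h+\beta y,\quad \psi=-Vy+\psi',\quad \tfrac{dV}{dt}=-⨍_D\partial_xh\,\psi'.$$ Its Gibbs measure $\nu_{\alpha,\mu}$, formally proportional to $e^{-\alpha(\mu E+Q)}dV\,dq$ with $E=\frac12V^2+\frac12⨍_D|\nabla\psi'|^2$ and $Q=\beta V+\frac12⨍_D(q-\beta y)^2$, is the law of $(V,q)$ for which $V\sim N(-\frac\beta\mu,\frac1{\alpha\mu})$ and $\hat q_l\sim N(\hat{\bar q}_l,\sigma_l^2)$, $l\in\Lambda$, are all independent. The measure $\eta_{\alpha,\mu}$ is the law of the centred variables $U=V+\frac\beta\mu$, $\omega=q-\bar q$; that is, $U\sim N(0,\frac1{\alpha\mu})$ and $\hat\omega_l\sim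 N(0,\sigma_l^2)$ are independent. **The nonlinear term.** For $\phi\in C^\infty(D)$ let $H_\phi$ be the symmetric kernel with coefficients $$(H_\phi)_{l,l'}=\tfrac12⨍_D\big(\nabla^\perp\Delta^{-1}b_l\cdot\nabla b_{l'}+\nabla^\perp\Delta^{-1}b_{l'}\cdot\nabla b_l\big)\phi ,$$ so that formally $\langle\omega\otimes\omega,H_\phi\rangle=⨍_D(\nabla^\perp\Delta^{-1}\omega\cdot\nabla\omega)\phi$. Fix $\delta>0$. Symmetric kernels $H^n\in\mathcal H^{2+2\delta}(D\times D)$ *approximate* $H\in\mathcal H^0(D\times D)$ if $\sum_lH^n_{l,l}\sigma_l^2\to0$ and $\sum_{l,l'}(H^n_{l,l'}-H_{l,l'})^2\sigma_l^2\sigma_{l'}^2\to0$. If $\omega_t$ has law $\eta_{\alpha,\mu}$ for every $t\in[0,T]$, then $s\mapsto\langle\omega_s\diamond\omega_s,H_\phi\rangle$ denotes the common limit in $L^2([0,T],L^2(\mathbb P))$ of $s\mapsto\langle\omega_s\otimes\omega_s,H^n\rangle=\sum_{l,l'}H^n_{l,l'}\hat\omega_{s,l}\hat\omega_{s,l'}$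 along all approximations $(H^n)$ of $H_\phi$ (a double Itô–Wiener integral). The existence of approximations and of this common limit is part of the claim. **Theorem.** For every $\delta>0$ there are, on some probability space $(\Omega,\mathcal F,\mathbb P)$, a stationary process $(V_t,q_t)_{t\in[0,T]}$ with law $\nu_{\alpha,\mu}$ at every time, and correspondingly the stationary process $(U_t,\omega_t)=(V_t+\frac\beta\mu,\,q_t-\bar q)$ with law $\eta_{\alpha,\mu}$ at every time, both with trajectories in $C([0,T],\mathbb R\times\mathcal H^{-1-\delta})$, which solve the barotropic quasi-geostrophic system in the weak vorticity formulation: for every $\phi\in C^\infty(D)$, $\mathbb P$-almost surely, for all $t\in[0,T]$, $$\langle\omega_t,\phi\rangle=\langle\omega_0,\phi\rangle-\int_0^t\langle\omega_s\diamond\omega_s,H_\phi\rangle\,ds-\int_0^t\langle L\omega_s,\phi\rangle\,ds,$$ $$U_t-U_0=\int_0^t⨍_Dh\,\big(\partial_x\Delta^{-1}\omega_s+\partial_xG\big)\,dz\,ds,$$ where $$L\omega=\Big(U-\frac\beta\mu\Big)\partial_x\omega+\mu U\partial_xG+\nabla^\perp G\cdot\nabla\omega+\mu\nabla^\perp\Delta^{-1}\omega\cdot\nabla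 G+\beta\,\partial_x\Delta^{-1}\omega$$ is paired with $\phi$ in the sense of distributions, i.e. $$\langle L\omega,\phi\rangle=-\Big(U-\frac\beta\mu\Big)\langle\omega,\partial_x\phi\rangle-\mu U\langle G,\partial_x\phi\rangle-\langle\omega-\mu\Delta^{-1}\omega,\nabla^\perp G\cdot\nabla\phi\rangle-\beta\langle\Delta^{-1}\omega,\partial_x\phi\rangle ,$$ the pairings of $\omega_s$ being absolutely convergent series $\langle u,f\rangle=\sum_l\hat u_l\hat f_l$ almost surely for almost every $s$, and all the integrands in $s$ being integrable on $[0,T]$. -/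

import Mathlib

open MeasureTheory ProbabilityTheory Filter Topology Set
open scoped NNReal ENNReal

noncomputable section

namespace BQG

/-! ### Functions on the torus `D = [-π, π]²` -/

/-- A fundamental domain of the torus. All integrals over it are normalised averages `⨍`, and so are
all `L²` pairings below: `⟨f, g⟩ = ⨍_D f g`. -/
def torusBox : Set (ℝ × ℝ) := Icc (-Real.pi) Real.pi ×ˢ Icc (-Real.pi) Real.pi

/-- Partial derivative in `x`. -/
def dx (f : ℝ × ℝ → ℝ) (z : ℝ × ℝ) : ℝ := deriv (fun x => f (x, z.2)) z.1

/-- Partial derivative in `y`. -/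
def dy (f : ℝ × ℝ → ℝ) (z : ℝ × ℝ) : ℝ := deriv (fun y => f (z.1, y)) z.2

/-- `∇^⊥ψ · ∇f`, where `∇^⊥ = (-∂_y, ∂_x)`. -/
def jac (ψ f : ℝ × ℝ → ℝ) (z : ℝ × ℝ) : ℝ := -dy ψ z * dx f z + dx ψ z * dy f z

/-- Smooth functions on the torus, as smooth doubly periodic functions on the plane. -/
def IsTest (φ : ℝ × ℝ → ℝ) : Prop :=
  ContDiff ℝ (⊤ : ℕ∞) φ ∧ ∀ x y : ℝ,
    φ (x + 2 * Real.pi, y) = φ (x, y) ∧ φ (x, y + 2 * Real.pi) = φ (x, y)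

/-- Smooth topography on the periodic channel: `h` is smooth up to the walls `y = 0` and `y = π`
and `2π`-periodic in `x`. Nothing is required of its values on the walls. -/
def IsTopography (h : ℝ × ℝ → ℝ) : Prop :=
  ContDiffOn ℝ (⊤ : ℕ∞) h (univ ×ˢ Icc 0 Real.pi) ∧
    ∀ x : ℝ, ∀ y ∈ Icc (0 : ℝ) Real.pi, h (x + 2 * Real.pi, y) = h (x, y)

/-- Extension of a function on the channel `0 ≤ y ≤ π` to `-π ≤ y ≤ π` as an odd function of `y`. -/
def oddExt (f : ℝ × ℝ → ℝ) (z : ℝ × ℝ) : ℝ :=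
  if 0 < z.2 then f z else if z.2 < 0 then -f (z.1, -z.2) else 0

/-! ### Fourier series of functions that are odd in `y` -/

/-- The index set `Λ` of pairs `(j, k)`, `j` an integer and `k` a positive integer. -/
abbrev Mode : Type := ℤ × ℕ+

/-- The eigenvalue `j² + k²` of `-Δ`. -/
def lam (l : Mode) : ℝ := (l.1 : ℝ) ^ 2 + (l.2 : ℝ) ^ 2

/-- The real Fourier basis of the functions odd in `y`, orthonormal for `⟨f, g⟩ = ⨍_D f g`:
the real form of `√2 e^{ijx} sin(ky)`. -/
def basisFn (l : Mode) (z : ℝ × ℝ) : ℝ :=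
  (if l.1 = 0 then Real.sqrt 2
    else if 0 < l.1 then 2 * Real.cos ((l.1 : ℝ) * z.1)
    else 2 * Real.sin ((l.1 : ℝ) * z.1)) * Real.sin ((l.2 : ℝ) * z.2)

/-- The Fourier coefficient `⟨f, b_l⟩`. -/
def fourier (f : ℝ × ℝ → ℝ) (l : Mode) : ℝ := ⨍ z in torusBox, f z * basisFn l z

/-- The Sobolev space `𝓗^s` of distributions on the torus that are odd in `y`. It is realised on the
Hilbert space `ℓ²(Λ)` of the rescaled coefficients `(j² + k²)^{s/2} û_{j,k}`. -/
def OddSobolev (_s : ℝ) : Type := lp (fun _ : Mode => ℝ) 2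

instance (s : ℝ) : NormedAddCommGroup (OddSobolev s) :=
  inferInstanceAs (NormedAddCommGroup (lp (fun _ : Mode => ℝ) 2))

instance (s : ℝ) : InnerProductSpace ℝ (OddSobolev s) :=
  inferInstanceAs (InnerProductSpace ℝ (lp (fun _ : Mode => ℝ) 2))

instance (s : ℝ) : MeasurableSpace (OddSobolev s) := borel _

instance (s : ℝ) : BorelSpace (OddSobolev s) := ⟨rfl⟩

/-- The Fourier coefficients `û_l` of `u ∈ 𝓗^s`, so that `u = ∑ û_l b_l`. -/
def coeff {s : ℝ} (u : OddSobolev s) (l : Mode) : ℝ :=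
  lam l ^ (-(s / 2)) * (show lp (fun _ : Mode => ℝ) 2 from u) l

theorem lam_pos (l : Mode) : 0 < lam l := by
  have : (0 : ℝ) < (l.2 : ℝ) := by exact_mod_cast l.2.pos
  unfold lam
  positivity

/-- `‖u‖² = ∑ (j² + k²)^s |û_{j,k}|²`. -/
theorem hasSum_norm_sq {s : ℝ} (u : OddSobolev s) :
    HasSum (fun l => lam l ^ s * coeff u l ^ 2) (‖u‖ ^ 2) := by
  have key := lp.hasSum_norm (p := 2) (by norm_num) (show lp (fun _ : Mode => ℝ) 2 from u)
  have e : ∀ l, lam l ^ s * coeff u l ^ 2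
      = ‖(show lp (fun _ : Mode => ℝ) 2 from u) l‖ ^ (2 : ℝ≥0∞).toReal := by
    intro l
    have hl := lam_pos l
    have h1 : (lam l ^ (-(s / 2))) ^ 2 = (lam l ^ s)⁻¹ := by
      rw [← Real.rpow_natCast, ← Real.rpow_mul hl.le, ← Real.rpow_neg hl.le]
      congr 1
      push_cast
      ring
    have h2 : lam l ^ s ≠ 0 := (Real.rpow_pos_of_pos hl s).ne'
    simp only [coeff, mul_pow, h1, ENNReal.toReal_ofNat, Real.rpow_ofNat, Real.norm_eq_abs, sq_abs]
    field_simp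
  simp_rw [e]
  have e2 : ‖(show lp (fun _ : Mode => ℝ) 2 from u)‖ ^ (2 : ℝ≥0∞).toReal = ‖u‖ ^ 2 := by
    simp only [ENNReal.toReal_ofNat, Real.rpow_ofNat]
    rfl
  exact e2 ▸ key

/-- Every coefficient sequence of finite `𝓗^s`-norm belongs to an element of `𝓗^s`. -/
theorem exists_coeff_eq {s : ℝ} (c : Mode → ℝ) (hc : Summable fun l => lam l ^ s * c l ^ 2) :
    ∃ u : OddSobolev s, coeff u = c := by
  have hm : Memℓp (fun l : Mode => lam l ^ (s / 2) * c l) 2 := by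
    rw [memℓp_gen_iff (by norm_num)]
    refine hc.congr fun l => ?_
    have hl := lam_pos l
    have h1 : (lam l ^ (s / 2)) ^ 2 = lam l ^ s := by
      rw [← Real.rpow_natCast, ← Real.rpow_mul hl.le]
      congr 1
      push_cast
      ring
    simp only [ENNReal.toReal_ofNat, Real.rpow_ofNat, Real.norm_eq_abs, sq_abs, mul_pow, h1]
  refine ⟨(⟨_, hm⟩ : lp (fun _ : Mode => ℝ) 2), funext fun l => ?_⟩
  change lam l ^ (-(s / 2)) * (lam l ^ (s / 2) * c l) = c l
  rw [← mul_assoc, ← Real.rpow_add (lam_pos l)]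
  simp

/-- The coefficients of `Δ⁻¹ u`. -/
def invLap (c : Mode → ℝ) (l : Mode) : ℝ := -c l / lam l

/-- The pairing `⟨u, f⟩` of a distribution odd in `y`, given by its coefficients, and a function. -/
def pair (c : Mode → ℝ) (f : ℝ × ℝ → ℝ) : ℝ := ∑' l, c l * fourier f l

/-- The series that defines the pairing `⟨u, f⟩` converges absolutely. -/
def Pairable (c : Mode → ℝ) (f : ℝ × ℝ → ℝ) : Prop := Summable fun l => c l * fourier f l

/-! ### The Gibbs measures -/

/-- The variance `σ_l² = (j² + k²) / (α (μ + j² + k²))` of the Fourier modes. -/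
def modeVar (α μ : ℝ) (l : Mode) : ℝ := lam l / (α * (μ + lam l))

/-- `(μ - Δ)⁻¹ h`, for the odd extension of `h`. -/
def resolvent (μ : ℝ) (h : ℝ × ℝ → ℝ) (z : ℝ × ℝ) : ℝ :=
  ∑' l, fourier (oddExt h) l / (μ + lam l) * basisFn l z

/-- The Fourier coefficients of the mean `q̄ = μ (μ - Δ)⁻¹ h + β y`. -/
def meanCoeff (β μ : ℝ) (h : ℝ × ℝ → ℝ) (l : Mode) : ℝ :=
  μ / (μ + lam l) * fourier (oddExt h) l + β * fourier (fun z => z.2) l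

/-- The centred Gaussian measure `η_{α,μ}` as the law of `U` and of the Fourier coefficients of `ω`:
`U ∼ N(0, 1/(αμ))` and `ω` are independent, `ω` having covariance `α⁻¹ (1 - μ Δ⁻¹)⁻¹`, an operator
that is diagonal in the Fourier basis. -/
def eta (α μ : ℝ) : Measure (ℝ × (Mode → ℝ)) :=
  (gaussianReal 0 (1 / (α * μ)).toNNReal).prod
    (Measure.infinitePi fun l => gaussianReal 0 (modeVar α μ l).toNNReal)

/-- The Gibbs measure `ν_{α,μ}` as the law of `V` and of the Fourier coefficients of `q`: `V` has mean
`-β/μ` and `q` has mean `q̄`, with the same covariances as under `η_{α,μ}`. -/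
def nu (α β μ : ℝ) (h : ℝ × ℝ → ℝ) : Measure (ℝ × (Mode → ℝ)) :=
  (gaussianReal (-β / μ) (1 / (α * μ)).toNNReal).prod
    (Measure.infinitePi fun l => gaussianReal (meanCoeff β μ h l) (modeVar α μ l).toNNReal)

/-! ### The nonlinear term as a double stochastic integral -/

/-- Fourier coefficients of the symmetric kernel `H_φ`, the one for which
`⨍_D (∇^⊥Δ⁻¹ω · ∇ω) φ = ⟨ω ⊗ ω, H_φ⟩` for trigonometric polynomials `ω`: the symmetrisation of
`(l, l') ↦ ⨍_D (∇^⊥Δ⁻¹b_l · ∇b_{l'}) φ`, with `Δ⁻¹ b_l = -b_l / (j² + k²)`. -/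
def kernel (φ : ℝ × ℝ → ℝ) (l l' : Mode) : ℝ :=
  (1 / 2) *
    ((⨍ z in torusBox, jac (fun p => -basisFn l p / lam l) (basisFn l') z * φ z) +
      ⨍ z in torusBox, jac (fun p => -basisFn l' p / lam l') (basisFn l) z * φ z)

/-- `H` belongs to the Sobolev space `𝓗^s(D × D)`. -/
def MemSobolev₂ (s : ℝ) (H : Mode → Mode → ℝ) : Prop :=
  Summable fun p : Mode × Mode => (lam p.1 + lam p.2) ^ s * H p.1 p.2 ^ 2

/-- `⟨ω ⊗ ω, H⟩`, where `ω` has Fourier coefficients `c`. -/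
def tensorPair (c : Mode → ℝ) (H : Mode → Mode → ℝ) : ℝ :=
  ∑' p : Mode × Mode, H p.1 p.2 * (c p.1 * c p.2)

/-- The symmetric kernels `Hn n ∈ 𝓗^{2+2δ}(D × D)` approximate `H ∈ 𝓗⁰(D × D)`: their traces
weighted by the variances tend to zero, and they converge to `H` in the weighted `ℓ²`-sense. -/
structure IsApprox (α μ δ : ℝ) (H : Mode → Mode → ℝ) (Hn : ℕ → Mode → Mode → ℝ) : Prop where
  mem_limit : MemSobolev₂ 0 H
  mem : ∀ n, MemSobolev₂ (2 + 2 * δ) (Hn n)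
  symm : ∀ n l l', Hn n l l' = Hn n l' l
  trace : Tendsto (fun n => ∑' l, Hn n l l * modeVar α μ l) atTop (𝓝 0)
  conv : Tendsto (fun n => ∑' p : Mode × Mode,
    (Hn n p.1 p.2 - H p.1 p.2) ^ 2 * modeVar α μ p.1 * modeVar α μ p.2) atTop (𝓝 0)

variable {Ω : Type} [MeasurableSpace Ω]

/-- `N` is (a version of) the process `s ↦ ⟨ω_s ◇ ω_s, H⟩`: the limit in `L²([0,T], L²(P))` of
`s ↦ ⟨ω_s ⊗ ω_s, Hⁿ⟩` along every approximation `Hⁿ` of `H`; approximations exist. -/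
structure IsDiamond (α μ δ T : ℝ) (P : Measure Ω) (ω : ℝ → Ω → OddSobolev (-1 - δ))
    (H : Mode → Mode → ℝ) (N : ℝ → Ω → ℝ) : Prop where
  memLp : MemLp (fun p : ℝ × Ω => N p.1 p.2) 2 ((volume.restrict (Icc 0 T)).prod P)
  exists_approx : ∃ Hn, IsApprox α μ δ H Hn
  tendsto : ∀ Hn, IsApprox α μ δ H Hn →
    Tendsto (fun n => eLpNorm
      (fun p : ℝ × Ω => tensorPair (coeff (ω p.1 p.2)) (Hn n) - N p.1 p.2) 2
      ((volume.restrict (Icc 0 T)).prod P)) atTop (𝓝 0)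

/-! ### Weak solutions -/

/-- The pairing `⟨Lω, φ⟩` of the affine term
`Lω = (U - β/μ) ∂ₓω + μ U ∂ₓG + ∇^⊥G · ∇ω + ∇^⊥Δ⁻¹ω · μ∇G + β ∂ₓΔ⁻¹ω`, `G = (μ - Δ)⁻¹ h`,
with a smooth function `φ`, every derivative of a distribution being moved onto the smoother
factor; for the fourth term one uses `⟨∇^⊥χ · ∇G, φ⟩ = ⟨χ, ∇^⊥G · ∇φ⟩`. -/
def affinePair (β μ : ℝ) (h : ℝ × ℝ → ℝ) (U : ℝ) (c : Mode → ℝ) (φ : ℝ × ℝ → ℝ) : ℝ :=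
  -(U - β / μ) * pair c (dx φ)
    - μ * U * (⨍ z in torusBox, resolvent μ h z * dx φ z)
    - pair c (jac (resolvent μ h) φ)
    + μ * pair (invLap c) (jac (resolvent μ h) φ)
    - β * pair (invLap c) (dx φ)

/-- The topographic stress `⨍_D h (∂ₓΔ⁻¹ω + ∂ₓ(μ - Δ)⁻¹h)`, where `⟨h, ∂ₓΔ⁻¹ω⟩ = -⟨Δ⁻¹ω, ∂ₓh⟩`. -/
def stress (μ : ℝ) (h : ℝ × ℝ → ℝ) (c : Mode → ℝ) : ℝ :=
  -pair (invLap c) (dx (oddExt h)) + ⨍ z in torusBox, oddExt h z * dx (resolvent μ h) z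

/-- The process `(U, ω)` on `[0, T]` solves the centred system
`∂ₜω + ∇^⊥Δ⁻¹ω · ∇ω + Lω = 0`, `dU/dt = ⨍_D h (∂ₓΔ⁻¹ω + ∂ₓ(μ - Δ)⁻¹h)` in the weak vorticity
formulation. All integrands are required to be well defined and integrable. -/
structure IsWeakVorticitySolution (α β μ δ T : ℝ) (h : ℝ × ℝ → ℝ) (P : Measure Ω)
    (U : ℝ → Ω → ℝ) (ω : ℝ → Ω → OddSobolev (-1 - δ)) : Prop where
  vorticity : ∀ φ, IsTest φ → ∃ N : ℝ → Ω → ℝ, IsDiamond α μ δ T P ω (kernel φ) N ∧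
    ∀ᵐ w ∂P,
      (∀ᵐ s ∂volume.restrict (Icc 0 T), Pairable (coeff (ω s w)) (jac (resolvent μ h) φ)) ∧
      IntervalIntegrable (fun s => N s w) volume 0 T ∧
      IntervalIntegrable (fun s => affinePair β μ h (U s w) (coeff (ω s w)) φ) volume 0 T ∧
      ∀ t ∈ Icc 0 T,
        pair (coeff (ω t w)) φ = pair (coeff (ω 0 w)) φ - (∫ s in (0 : ℝ)..t, N s w)
          - ∫ s in (0 : ℝ)..t, affinePair β μ h (U s w) (coeff (ω s w)) φ
  meanFlow : ∀ᵐ w ∂P,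
    (∀ᵐ s ∂volume.restrict (Icc 0 T), Pairable (invLap (coeff (ω s w))) (dx (oddExt h))) ∧
    IntervalIntegrable (fun s => stress μ h (coeff (ω s w))) volume 0 T ∧
    ∀ t ∈ Icc 0 T, U t w - U 0 w = ∫ s in (0 : ℝ)..t, stress μ h (coeff (ω s w))

/-- `X` is a stationary process on `[0, T]` with continuous trajectories: its finite-dimensional laws
are invariant under time shifts that stay within `[0, T]`. -/
structure IsStationaryProcess {E : Type} [TopologicalSpace E] [MeasurableSpace E] (T : ℝ)
    (P : Measure Ω) (X : ℝ → Ω → E) : Prop where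
  measurable : ∀ t ∈ Icc 0 T, Measurable (X t)
  continuousOn : ∀ w, ContinuousOn (fun t => X t w) (Icc 0 T)
  stationary : ∀ (n : ℕ) (t : Fin n → ℝ) (r : ℝ), (∀ i, t i ∈ Icc 0 T) →
    (∀ i, t i + r ∈ Icc 0 T) →
    IdentDistrib (fun w i => X (t i) w) (fun w i => X (t i + r) w) P P

end BQG

end

open scoped BoundedContinuousFunction

noncomputable section

/-! Write the centred system in the coordinates x_none = √(αμ) U and x_l = ω̂_l / σ_l, in which
`eta` becomes the product `stdG` of standard Gaussians. The equation takes the form ẋ_i = Σ_j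
ρ_ij(x) x_j, where ρ(x) is antisymmetric and affine in x, and ρ_ij does not depend on x_i or x_j. It
is thus a superposition of rotations of coordinate planes, each with an angular velocity that is
constant along its own rotation. Every such rotation preserves `stdG`. This structure,
`IsRotational`, contains both Liouville's theorem and the conservation of μE + Q. It comes from the
total antisymmetry of the triad coefficients and from 1/σ_l² = α(1 + μ/|l|²), by which the
differences 1/|l'|² − 1/|l|² produced by Biot–Savart are differences of inverse variances divided by
αμ (`isRotational_rates`, `quadRate_symm`).

To construct a solution, keep finitely many modes and compose the plane rotations over a short time
τ. This Lie splitting gives a map Φ that preserves the infinite product measure exactly, with (Φ −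
id)/τ close in L² to the truncated drift (`IsRotational.exists_splitting`). The Galerkin equation
itself is never solved. Iterating Φ from a Gaussian point and interpolating linearly gives random
paths. Invariance turns an L² bound on the velocity into a bound on the time integral of its square,
hence into Hölder continuity of exponent 1/2 and tightness, component by component. Prokhorov's
theorem yields a limit process. Gaussian marginals and stationarity survive because characteristic
functions converge.

The equation survives because the truncated drifts converge in L²(`stdG`): a drift is a linear form
plus a quadratic form with zero diagonal, and square summable symmetrised coefficients suffice for a
Wiener integral of order one or two. A truncated drift is continuous on path space, so its defect
passes to the weak limit, and invariance of the marginals bounds the error of exchanging it for the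
limiting drift (`IsApproxFlow.ae_defect_eq_zero`). The result is
`IsRotational.exists_stationary_flow`.

The analytic core is the bound |H_{b_m}(l, l')| ≤ 64 |m|⁴ / |l|² of `abs_kernel_basisFn_le`. For
given l and m at most twelve l' interact, and in a triad | |l|² − |l'|² | is at most of order |m|
(|l| + |l'|). Since Σ |l|⁻⁴ converges over a two-dimensional lattice, the kernels are square
summable, with norms that are polynomial in m.

Polynomial growth in m is harmless in two places. Moments of the maximum in time are available in
every order with the same growth |m|⁸, so a sufficiently high moment places the paths in 𝓗^{-1-δ}
(`ae_mem_regularPaths`). The Fourier coefficients of a test function φ decay faster than any power,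
so the equations of the modes can be multiplied by φ̂_m and summed, which gives the weak
formulation. Finally, the trace and the weighted ℓ²-distance in `IsApprox` are exactly the
quantities that control the second moment of a quadratic form in Gaussian variables, and this
identifies the double Wiener integral with the limit along every approximation. -/

namespace BQG

/-! ### The standard Gaussian measure on a product of lines -/

section Gaussian

variable {ι : Type}

/-- The law of a family of independent standard Gaussian variables. -/
def stdG (ι : Type) : Measure (ι → ℝ) := Measure.infinitePi fun _ => gaussianReal 0 1

instance : IsProbabilityMeasure (stdG ι) := by unfold stdG; infer_instance

theorem measurePreserving_eval_stdG (i : ι) :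
    MeasurePreserving (fun x : ι → ℝ => x i) (stdG ι) (gaussianReal 0 1) :=
  measurePreserving_eval_infinitePi _ i

theorem memLp_eval (i : ι) {p : ℝ≥0∞} (hp : p ≠ ∞) :
    MemLp (fun x : ι → ℝ => x i) p (stdG ι) :=
  (memLp_id_gaussianReal' p hp).comp_measurePreserving (measurePreserving_eval_stdG i)

theorem memLp_mul_eval (i j : ι) {p : ℝ≥0∞} (hp : p ≠ ∞) :
    MemLp (fun x : ι → ℝ => x i * x j) p (stdG ι) := by
  have h := (memLp_eval (p := 2 * p) j (by finiteness)).mul (r := p) (memLp_eval i (p := 2 * p) (by finiteness))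
    (hpqr := ⟨by
      rw [ENNReal.mul_inv (by simp) (by simp), ← add_mul, ENNReal.inv_two_add_inv_two, one_mul]⟩)
  exact h

/-- Overwriting two coordinates by independent Gaussian variables. -/
def insertTwo [DecidableEq ι] (i j : ι) (p : (ι → ℝ) × (ℝ × ℝ)) : ι → ℝ :=
  Function.update (Function.update p.1 i p.2.1) j p.2.2

theorem measurable_insertTwo [DecidableEq ι] (i j : ι) : Measurable (insertTwo i j) := by
  refine measurable_pi_lambda _ fun k => ?_
  simp only [insertTwo, Function.update_apply]
  split_ifs <;> fun_prop

/-- A product measure is determined by boxes, and the preimage of a box is a box in the remaining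
coordinates times two sets on the line. With this, a map acting in one coordinate plane can be
treated as a skew product over the other coordinates. -/
theorem measurePreserving_insertTwo [DecidableEq ι] {i j : ι} (hij : i ≠ j) :
    MeasurePreserving (insertTwo i j)
      ((stdG ι).prod ((gaussianReal 0 1).prod (gaussianReal 0 1))) (stdG ι) := by
  refine ⟨measurable_insertTwo i j, ?_⟩
  refine Measure.eq_infinitePi _ fun s t ht => ?_
  rw [Measure.map_apply (measurable_insertTwo i j)
    (MeasurableSet.pi s.countable_toSet fun k _ => ht k)]
  have e : insertTwo i j ⁻¹' ((s : Set ι).pi t)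
      = (((s.erase i).erase j : Finset ι) : Set ι).pi t
        ×ˢ ((if i ∈ s then t i else univ) ×ˢ (if j ∈ s then t j else univ)) := by
    ext ⟨y, a, b⟩
    simp only [insertTwo, mem_preimage, Set.mem_pi, Finset.mem_coe, mem_prod, Finset.mem_erase]
    constructor
    · intro h
      refine ⟨fun k hk => ?_, ?_, ?_⟩
      · have := h k hk.2.2
        simpa [Function.update_apply, hk.1, hk.2.1] using this
      · split_ifs with hi
        · have := h i hi
          simpa [Function.update_apply, hij] using this
        · trivial
      · split_ifs with hj
        · have := h j hj
          simpa using this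
        · trivial
    · rintro ⟨h1, h2, h3⟩ k hk
      by_cases hkj : k = j
      · subst hkj
        simpa [hk] using h3
      by_cases hki : k = i
      · subst hki
        simpa [hk, Function.update_apply, hkj] using h2
      · simpa [Function.update_apply, hki, hkj] using h1 k ⟨hkj, hki, hk⟩
  rw [e, Measure.prod_prod, Measure.prod_prod, stdG, Measure.infinitePi_pi _ (fun k _ => ht k)]
  have hi : (if i ∈ s then gaussianReal 0 1 (t i) else 1)
      = gaussianReal 0 1 (if i ∈ s then t i else univ) := by split_ifs <;> simp
  have hj : (if j ∈ s then gaussianReal 0 1 (t j) else 1)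
      = gaussianReal 0 1 (if j ∈ s then t j else univ) := by split_ifs <;> simp
  rw [← hi, ← hj]
  have step : ∀ (u : Finset ι) (k : ι), ∏ l ∈ u, gaussianReal 0 1 (t l)
      = (∏ l ∈ u.erase k, gaussianReal 0 1 (t l)) * if k ∈ u then gaussianReal 0 1 (t k) else 1 := by
    intro u k
    by_cases hk : k ∈ u
    · simp [hk, Finset.prod_erase_mul]
    · simp [hk]
  rw [step s i, step (s.erase i) j]
  simp only [Finset.mem_erase, hij.symm, ne_eq, not_false_eq_true, true_and]
  ring

/-- Rotation by the angle `θ` in the plane of the coordinates `i` and `j`. -/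
def planeRot [DecidableEq ι] (i j : ι) (θ : ℝ) (x : ι → ℝ) : ι → ℝ :=
  insertTwo i j (x, (Real.cos θ * x i + Real.sin θ * x j, -Real.sin θ * x i + Real.cos θ * x j))

theorem map_rotation_gaussian (θ : ℝ) :
    Measure.map (fun p : ℝ × ℝ => (Real.cos θ * p.1 + Real.sin θ * p.2,
      -Real.sin θ * p.1 + Real.cos θ * p.2)) ((gaussianReal 0 1).prod (gaussianReal 0 1))
      = (gaussianReal 0 1).prod (gaussianReal 0 1) := by
  have h := IsGaussian.map_rotation_eq_self (μ := gaussianReal 0 1)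
    (by simp) θ
  convert h using 2
  ext p <;> simp [ContinuousLinearMap.rotation_apply]

/-- A rotation in a coordinate plane preserves the Gaussian measure, also when its angle depends on
the other coordinates. -/
theorem measurePreserving_planeRot [DecidableEq ι] {i j : ι} (hij : i ≠ j) {r : (ι → ℝ) → ℝ}
    (hr : Measurable r) (hr' : ∀ x p, r (insertTwo i j (x, p)) = r x) :
    MeasurePreserving (fun x => planeRot i j (r x) x) (stdG ι) (stdG ι) := by
  have hm : Measurable fun x : ι → ℝ => planeRot i j (r x) x := by
    unfold planeRot
    exact (measurable_insertTwo i j).comp (by fun_prop)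
  refine ⟨hm, ?_⟩
  have hI := measurePreserving_insertTwo hij
  -- With the two coordinates resampled independently, the angle depends on the base point alone,
  -- and each fibre map is a fixed rotation of the Gaussian plane.
  have hS : MeasurePreserving (fun p : (ι → ℝ) × (ℝ × ℝ) =>
      (id p.1, (fun (x : ι → ℝ) (q : ℝ × ℝ) => (Real.cos (r x) * q.1 + Real.sin (r x) * q.2,
        -Real.sin (r x) * q.1 + Real.cos (r x) * q.2)) p.1 p.2))
      ((stdG ι).prod ((gaussianReal 0 1).prod (gaussianReal 0 1)))
      ((stdG ι).prod ((gaussianReal 0 1).prod (gaussianReal 0 1))) := by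
    refine (MeasurePreserving.id _).skew_product (by unfold Function.uncurry; fun_prop)
      (ae_of_all _ fun x => map_rotation_gaussian (r x))
  have hc := hI.comp hS
  rw [← hI.map_eq]
  conv_lhs => rw [Measure.map_map hm hI.measurable]
  conv_rhs => rw [hI.map_eq, ← hc.map_eq]
  congr 1
  ext ⟨x, a, b⟩ k
  have h1 : insertTwo i j (x, (a, b)) i = a := by simp [insertTwo, hij]
  have h2 : insertTwo i j (x, (a, b)) j = b := by simp [insertTwo]
  simp only [Function.comp_apply, planeRot, hr', h1, h2, id]
  simp only [insertTwo, Function.update_apply]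
  split_ifs <;> rfl

/-- Changing the sign of one coordinate preserves the Gaussian measure. -/
theorem measurePreserving_flip [DecidableEq ι] (i : ι) :
    MeasurePreserving (fun (x : ι → ℝ) k => if k = i then -x k else x k) (stdG ι) (stdG ι) := by
  refine ⟨measurable_pi_lambda _ fun k => by split_ifs <;> fun_prop, ?_⟩
  have := Measure.infinitePi_map_pi (μ := fun _ : ι => gaussianReal 0 1)
    (f := fun k (y : ℝ) => if k = i then -y else y) (fun k => by split_ifs <;> fun_prop)
  unfold stdG
  rw [this]
  congr 1
  ext1 k
  split_ifs
  · rw [gaussianReal_map_neg, neg_zero]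
  · exact Measure.map_id

/-- The sign change is a measure-preserving equivalence, so the integral equals its own negative,
without any integrability. It removes all mixed moments in which some coordinate occurs to an odd
power. -/
theorem integral_eq_zero_of_flip [DecidableEq ι] (i : ι) {f : (ι → ℝ) → ℝ}
    (h : ∀ x, f (fun k => if k = i then -x k else x k) = -f x) : ∫ x, f x ∂stdG ι = 0 := by
  have h1 := (measurePreserving_flip i).integral_comp' (g := f)
    (f := (MeasurableEquiv.ofInvolutive (fun (x : ι → ℝ) k => if k = i then -x k else x k)
      (fun x => by ext k; by_cases hk : k = i <;> simp [hk]) (measurePreserving_flip i).measurable))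
  have h2 : ∀ x, MeasurableEquiv.ofInvolutive (fun (x : ι → ℝ) k => if k = i then -x k else x k)
      (fun x => by ext k; by_cases hk : k = i <;> simp [hk]) (measurePreserving_flip i).measurable x
      = fun k => if k = i then -x k else x k := fun x => rfl
  simp only [h2, h, integral_neg] at h1
  linarith

/-- The fourth moment of a standard Gaussian variable. -/
def fourthMoment : ℝ := ∫ x, x ^ 4 ∂gaussianReal 0 1

theorem fourthMoment_nonneg : 0 ≤ fourthMoment := integral_nonneg fun x => by positivity

theorem integral_eval_sq (i : ι) : ∫ x, x i ^ 2 ∂stdG ι = 1 := by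
  have h := variance_fun_id_gaussianReal (μ := 0) (v := 1)
  rw [variance_of_integral_eq_zero (by fun_prop) (by simp)] at h
  have := (measurePreserving_eval_stdG i).map_eq
  rw [← this, integral_map (measurable_pi_apply _).aemeasurable (by fun_prop)] at h
  simpa using h

theorem integral_eval_mul (i j : ι) [DecidableEq ι] :
    ∫ x, x i * x j ∂stdG ι = if i = j then 1 else 0 := by
  split_ifs with h
  · subst h
    simp_rw [← sq]
    exact integral_eval_sq i
  · refine integral_eq_zero_of_flip i fun x => ?_
    simp [Ne.symm h]

theorem integral_eval_sq_mul_sq {i j : ι} (h : i ≠ j) : ∫ x, x i ^ 2 * x j ^ 2 ∂stdG ι = 1 := by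
  have hi : IndepFun (fun x : ι → ℝ => x i) (fun x => x j) (stdG ι) :=
    (iIndepFun_infinitePi (P := fun _ : ι => gaussianReal 0 1) (X := fun _ y => y)
      (by fun_prop)).indepFun h
  have := (hi.comp (φ := fun y => y ^ 2) (ψ := fun y => y ^ 2) (by fun_prop)
    (by fun_prop)).integral_fun_mul_eq_mul_integral
    (((measurable_pi_apply i).pow_const 2).aestronglyMeasurable)
    (((measurable_pi_apply j).pow_const 2).aestronglyMeasurable)
  simp only [Function.comp_apply, integral_eval_sq] at this
  simpa using this

/-- Wick's formula. The fourth moment is left unevaluated: on the total diagonal the three pairings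
count 3, and the last term corrects this to `fourthMoment`. Only its nonnegativity is used later. -/
theorem integral_eval_four [DecidableEq ι] (a b c d : ι) :
    ∫ x, x a * x b * (x c * x d) ∂stdG ι
      = (if a = b then 1 else 0) * (if c = d then 1 else 0)
        + (if a = c then 1 else 0) * (if b = d then 1 else 0)
        + (if a = d then 1 else 0) * (if b = c then 1 else 0)
        + (fourthMoment - 3) * (if a = b ∧ a = c ∧ a = d then 1 else 0) := by
  have flip1 : ∀ a b c d : ι, a ≠ b → a ≠ c → a ≠ d →
      ∫ x, x a * x b * (x c * x d) ∂stdG ι = 0 := by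
    intro a b c d h1 h2 h3
    refine integral_eq_zero_of_flip a fun x => ?_
    simp [h1.symm, h2.symm, h3.symm]
  have sq2 : ∀ a c : ι, a ≠ c → ∫ x, x a * x a * (x c * x c) ∂stdG ι = 1 := by
    intro a c h
    simpa [sq] using integral_eval_sq_mul_sq h
  by_cases hab : a = b
  · subst hab
    by_cases hcd : c = d
    · subst hcd
      by_cases hac : a = c
      · subst hac
        have h4 : ∫ x, x a * x a * (x a * x a) ∂stdG ι = fourthMoment := by
          rw [fourthMoment, ← (measurePreserving_eval_stdG a).map_eq,
            integral_map (measurable_pi_apply _).aemeasurable (by fun_prop)]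
          congr 1
          ext x
          ring
        rw [h4]
        simp
        ring
      · rw [sq2 a c hac]
        simp [hac]
    · by_cases hac : a = c
      · have had : a ≠ d := hac ▸ hcd
        have := flip1 d a a c had.symm had.symm (Ne.symm hcd)
        rw [show (fun x : ι → ℝ => x a * x a * (x c * x d)) = fun x => x d * x a * (x a * x c) by
          ext x; ring, this]
        simp [hcd, had]
      · have := flip1 c a a d (Ne.symm hac) (Ne.symm hac) hcd
        rw [show (fun x : ι → ℝ => x a * x a * (x c * x d)) = fun x => x c * x a * (x a * x d) by
          ext x; ring, this]
        simp [hcd, hac]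
  · by_cases hac : a = c
    · subst hac
      by_cases hbd : b = d
      · subst hbd
        have := sq2 a b hab
        rw [show (fun x : ι → ℝ => x a * x b * (x a * x b)) = fun x => x a * x a * (x b * x b) by
          ext x; ring, this]
        simp [hab]
      · have := flip1 b a a d (Ne.symm hab) (Ne.symm hab) hbd
        rw [show (fun x : ι → ℝ => x a * x b * (x a * x d)) = fun x => x b * x a * (x a * x d) by
          ext x; ring, this]
        simp [hab, hbd, Ne.symm hab]
    · by_cases had : a = d
      · subst had
        by_cases hbc : b = c
        · subst hbc
          have := sq2 a b hab
          rw [show (fun x : ι → ℝ => x a * x b * (x b * x a)) = fun x => x a * x a * (x b * x b) by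
            ext x; ring, this]
          simp [hab]
        · have := flip1 b a c a (Ne.symm hab) hbc (Ne.symm hab)
          rw [show (fun x : ι → ℝ => x a * x b * (x c * x a)) = fun x => x b * x a * (x c * x a) by
            ext x; ring, this]
          simp [hab, hbc, hac]
      · rw [flip1 a b c d hab hac had]
        simp [hab, hac, had]

theorem integrable_eval_four (a b c d : ι) :
    Integrable (fun x : ι → ℝ => x a * x b * (x c * x d)) (stdG ι) :=
  (memLp_mul_eval c d (p := 2) (by simp)).integrable_mul (memLp_mul_eval a b (p := 2) (by simp))
    |>.congr (ae_of_all _ fun x => by simp [mul_comm])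

/-- The second moment of a quadratic form in independent standard Gaussian variables. -/
theorem integral_quadForm_sq_le [DecidableEq ι] (s : Finset ι) (A : ι → ι → ℝ) :
    ∫ x, (∑ a ∈ s, ∑ b ∈ s, A a b * (x a * x b)) ^ 2 ∂stdG ι
      ≤ (∑ a ∈ s, A a a) ^ 2 + (2 + fourthMoment) * ∑ a ∈ s, ∑ b ∈ s, A a b ^ 2 := by
  have e : ∀ x : ι → ℝ, (∑ a ∈ s, ∑ b ∈ s, A a b * (x a * x b)) ^ 2
      = ∑ a ∈ s, ∑ b ∈ s, ∑ c ∈ s, ∑ d ∈ s, A a b * A c d * (x a * x b * (x c * x d)) := by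
    intro x
    rw [sq, Finset.sum_mul]
    refine Finset.sum_congr rfl fun a _ => ?_
    rw [Finset.sum_mul]
    refine Finset.sum_congr rfl fun b _ => ?_
    rw [Finset.mul_sum]
    refine Finset.sum_congr rfl fun c _ => ?_
    rw [Finset.mul_sum]
    refine Finset.sum_congr rfl fun d _ => ?_
    ring
  have hi : ∀ a b c d, Integrable (fun x : ι → ℝ => A a b * A c d * (x a * x b * (x c * x d)))
      (stdG ι) := fun a b c d => (integrable_eval_four a b c d).const_mul _
  simp_rw [e]
  rw [integral_finsetSum _ fun a _ => integrable_finsetSum _ fun b _ =>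
    integrable_finsetSum _ fun c _ => integrable_finsetSum _ fun d _ => hi a b c d]
  have e2 : ∀ a ∈ s, ∫ x, ∑ b ∈ s, ∑ c ∈ s, ∑ d ∈ s, A a b * A c d * (x a * x b * (x c * x d)) ∂stdG ι
      = A a a * (∑ c ∈ s, A c c) + (∑ b ∈ s, A a b ^ 2) + (∑ b ∈ s, A a b * A b a)
        + (fourthMoment - 3) * A a a ^ 2 := by
    intro a ha
    rw [integral_finsetSum _ fun b _ =>
      integrable_finsetSum _ fun c _ => integrable_finsetSum _ fun d _ => hi a b c d]
    have e3 : ∀ b ∈ s, ∫ x, ∑ c ∈ s, ∑ d ∈ s, A a b * A c d * (x a * x b * (x c * x d)) ∂stdG ι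
        = (if a = b then A a b * ∑ c ∈ s, A c c else 0) + A a b ^ 2 + A a b * A b a
          + (if a = b then (fourthMoment - 3) * A a b ^ 2 else 0) := by
      intro b hb
      rw [integral_finsetSum _ fun c _ => integrable_finsetSum _ fun d _ => hi a b c d]
      simp_rw [integral_finsetSum s (fun d _ => hi a b _ d), integral_const_mul,
        integral_eval_four, mul_add, Finset.sum_add_distrib]
      congr 1
      · congr 1
        · congr 1
          · by_cases hab : a = b
            · simp [hab, Finset.mul_sum]
            · simp [hab]
          · rw [Finset.sum_eq_single a (fun c _ hc => by simp [Ne.symm hc]) (by simp [ha]),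
              Finset.sum_eq_single b (fun c _ hc => by simp [Ne.symm hc]) (by simp [hb])]
            simp [sq]
        · rw [Finset.sum_eq_single b (fun c _ hc => by simp [Ne.symm hc]) (by simp [hb]),
              Finset.sum_eq_single a (fun c _ hc => by simp [Ne.symm hc]) (by simp [ha])]
          simp
      · by_cases hab : a = b
        · subst hab
          rw [Finset.sum_eq_single a (fun c _ hc => by simp [Ne.symm hc]) (by simp [ha]),
              Finset.sum_eq_single a (fun c _ hc => by simp [Ne.symm hc]) (by simp [ha])]
          simp
          ring
        · simp [hab]
    rw [Finset.sum_congr rfl e3, Finset.sum_add_distrib, Finset.sum_add_distrib,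
      Finset.sum_add_distrib, Finset.sum_ite_eq, Finset.sum_ite_eq]
    simp [ha]
  rw [Finset.sum_congr rfl e2]
  simp only [Finset.sum_add_distrib, ← Finset.sum_mul, ← Finset.mul_sum]
  -- Of the three pairings one gives the squared trace and two cost the sum of squares each, the
  -- crossed one by 2uv ≤ u² + v². In the diagonal correction the −3 is dropped, which gives the
  -- constant 2 + `fourthMoment`.
  have h1 : ∑ a ∈ s, ∑ b ∈ s, A a b * A b a ≤ ∑ a ∈ s, ∑ b ∈ s, A a b ^ 2 := by
    have h2 : ∑ a ∈ s, ∑ b ∈ s, A b a ^ 2 = ∑ a ∈ s, ∑ b ∈ s, A a b ^ 2 := Finset.sum_comm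
    have h3 : ∑ a ∈ s, ∑ b ∈ s, 2 * (A a b * A b a)
        ≤ ∑ a ∈ s, ∑ b ∈ s, (A a b ^ 2 + A b a ^ 2) :=
      Finset.sum_le_sum fun a _ => Finset.sum_le_sum fun b _ => by
        nlinarith [sq_nonneg (A a b - A b a)]
    simp only [← Finset.mul_sum, Finset.sum_add_distrib] at h3
    linarith
  have h4 : ∑ a ∈ s, A a a ^ 2 ≤ ∑ a ∈ s, ∑ b ∈ s, A a b ^ 2 :=
    Finset.sum_le_sum fun a ha =>
      Finset.single_le_sum (f := fun b => A a b ^ 2) (fun b _ => sq_nonneg _) ha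
  have h5 : 0 ≤ ∑ a ∈ s, A a a ^ 2 := Finset.sum_nonneg fun a _ => sq_nonneg _
  nlinarith [mul_le_mul_of_nonneg_left h4 fourthMoment_nonneg]

theorem memLp_quadForm (s : Finset ι) (A : ι → ι → ℝ) :
    MemLp (fun x : ι → ℝ => ∑ a ∈ s, ∑ b ∈ s, A a b * (x a * x b)) 2 (stdG ι) :=
  memLp_finsetSum _ fun a _ => memLp_finsetSum _ fun b _ =>
    (memLp_mul_eval a b (by simp)).const_mul _

theorem eLpNorm_two_le_of_integral_sq_le {Ω : Type*} [MeasurableSpace Ω] {P : Measure Ω}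
    {f : Ω → ℝ} (hf : MemLp f 2 P) {C : ℝ} (h : ∫ x, f x ^ 2 ∂P ≤ C) :
    eLpNorm f 2 P ≤ ENNReal.ofReal (Real.sqrt C) := by
  rw [hf.eLpNorm_eq_integral_rpow_norm (by simp) (by simp)]
  refine ENNReal.ofReal_le_ofReal ?_
  simp only [ENNReal.toReal_ofNat, Real.rpow_ofNat, Real.norm_eq_abs, sq_abs]
  rw [Real.sqrt_eq_rpow]
  norm_num
  exact Real.rpow_le_rpow (integral_nonneg fun x => sq_nonneg _) h (by norm_num)

theorem eLpNorm_quadForm_le [DecidableEq ι] (s : Finset ι) (A : ι → ι → ℝ) :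
    eLpNorm (fun x : ι → ℝ => ∑ a ∈ s, ∑ b ∈ s, A a b * (x a * x b)) 2 (stdG ι)
      ≤ ENNReal.ofReal (Real.sqrt
        ((∑ a ∈ s, A a a) ^ 2 + (2 + fourthMoment) * ∑ a ∈ s, ∑ b ∈ s, A a b ^ 2)) :=
  eLpNorm_two_le_of_integral_sq_le (memLp_quadForm s A) (integral_quadForm_sq_le s A)

theorem integral_linForm_sq [DecidableEq ι] (s : Finset ι) (A : ι → ℝ) :
    ∫ x, (∑ a ∈ s, A a * x a) ^ 2 ∂stdG ι = ∑ a ∈ s, A a ^ 2 := by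
  have e : ∀ x : ι → ℝ, (∑ a ∈ s, A a * x a) ^ 2
      = ∑ a ∈ s, ∑ b ∈ s, A a * A b * (x a * x b) := by
    intro x
    rw [sq, Finset.sum_mul_sum]
    exact Finset.sum_congr rfl fun a _ => Finset.sum_congr rfl fun b _ => by ring
  have hi : ∀ a b, Integrable (fun x : ι → ℝ => A a * A b * (x a * x b)) (stdG ι) :=
    fun a b => ((memLp_mul_eval a b (p := 1) (by simp)).integrable le_rfl).const_mul _
  simp_rw [e]
  rw [integral_finsetSum _ fun a _ => integrable_finsetSum _ fun b _ => hi a b]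
  refine Finset.sum_congr rfl fun a ha => ?_
  rw [integral_finsetSum _ fun b _ => hi a b]
  simp_rw [integral_const_mul, integral_eval_mul]
  simp [ha, sq]

/-- A Cauchy net of square integrable functions has a measurable limit. -/
theorem exists_measurable_limit {Ω : Type*} [MeasurableSpace Ω] {P : Measure Ω}
    {f : Finset ι → Ω → ℝ} (hf : ∀ s, MemLp (f s) 2 P)
    (hC : ∀ ε : ℝ, 0 < ε → ∃ s₀, ∀ s, s₀ ⊆ s →
      eLpNorm (f s - f s₀) 2 P ≤ ENNReal.ofReal ε) :
    ∃ g : Ω → ℝ, Measurable g ∧ MemLp g 2 P ∧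
      Tendsto (fun s => eLpNorm (f s - g) 2 P) atTop (𝓝 0) := by
  classical
  have hcau : CauchySeq fun s => (hf s).toLp (f s) := by
    rw [Metric.cauchySeq_iff']
    intro ε hε
    obtain ⟨s₀, h⟩ := hC (ε / 2) (by positivity)
    refine ⟨s₀, fun s hs => ?_⟩
    rw [dist_edist, Lp.edist_toLp_toLp]
    refine (ENNReal.toReal_mono (by simp) (h s hs)).trans_lt ?_
    rw [ENNReal.toReal_ofReal (by positivity)]
    linarith
  obtain ⟨G, hG⟩ := cauchySeq_tendsto_of_complete hcau
  obtain ⟨g, hgm, hge⟩ := (Lp.aestronglyMeasurable G)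
  refine ⟨g, hgm.measurable, (memLp_congr_ae hge).1 (Lp.memLp G), ?_⟩
  rw [tendsto_iff_edist_tendsto_0] at hG
  refine hG.congr fun s => ?_
  rw [Lp.edist_def]
  refine eLpNorm_congr_ae ?_
  filter_upwards [(hf s).coeFn_toLp, hge] with x h1 h2
  simp [h1, h2]

/-- Off-diagonal square summable coefficients define a double Wiener integral. -/
theorem exists_quadForm_limit [DecidableEq ι] {A : ι → ι → ℝ}
    (hA : Summable fun p : ι × ι => A p.1 p.2 ^ 2) (h0 : ∀ a, A a a = 0) :
    ∃ g : (ι → ℝ) → ℝ, Measurable g ∧ MemLp g 2 (stdG ι) ∧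
      Tendsto (fun s : Finset ι => eLpNorm
        ((fun x : ι → ℝ => ∑ a ∈ s, ∑ b ∈ s, A a b * (x a * x b)) - g) 2 (stdG ι))
        atTop (𝓝 0) := by
  refine exists_measurable_limit (fun s => memLp_quadForm s A) fun ε hε => ?_
  have hM : 0 < 2 + fourthMoment := by linarith [fourthMoment_nonneg]
  obtain ⟨u, hu⟩ := summable_iff_vanishing_norm.1 hA (ε ^ 2 / (2 + fourthMoment)) (by positivity)
  -- The square s₀ × s₀ contains u, so the pairs outside it carry at most the small remainder of the
  -- squares.
  set s₀ := u.image Prod.fst ∪ u.image Prod.snd with hs₀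
  refine ⟨s₀, fun s hs => ?_⟩
  -- The difference of the two sections is the quadratic form of B. Its trace vanishes with the
  -- diagonal of A, so only the tail of the squares enters the second moment.
  let B : ι → ι → ℝ := fun a b => if a ∈ s₀ ∧ b ∈ s₀ then 0 else A a b
  have e : ((fun x : ι → ℝ => ∑ a ∈ s, ∑ b ∈ s, A a b * (x a * x b))
      - fun x : ι → ℝ => ∑ a ∈ s₀, ∑ b ∈ s₀, A a b * (x a * x b))
      = fun x : ι → ℝ => ∑ a ∈ s, ∑ b ∈ s, B a b * (x a * x b) := by
    ext x
    simp only [Pi.sub_apply, ← Finset.sum_product', B]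
    have hsub : s₀ ×ˢ s₀ ⊆ s ×ˢ s := Finset.product_subset_product hs hs
    rw [← Finset.sum_sdiff hsub, ← Finset.sum_sdiff (f := fun p : ι × ι =>
      (if p.1 ∈ s₀ ∧ p.2 ∈ s₀ then 0 else A p.1 p.2) * (x p.1 * x p.2)) hsub]
    have h1 : ∑ p ∈ s₀ ×ˢ s₀, (if p.1 ∈ s₀ ∧ p.2 ∈ s₀ then 0 else A p.1 p.2) * (x p.1 * x p.2) = 0 :=
      Finset.sum_eq_zero fun p hp => by simp [Finset.mem_product.1 hp]
    rw [h1, add_zero, add_sub_cancel_right]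
    refine Finset.sum_congr rfl fun p hp => ?_
    have : ¬(p.1 ∈ s₀ ∧ p.2 ∈ s₀) := by
      simpa [Finset.mem_product] using (Finset.mem_sdiff.1 hp).2
    rw [if_neg this]
  rw [e]
  refine (eLpNorm_quadForm_le s B).trans (ENNReal.ofReal_le_ofReal ?_)
  refine Real.sqrt_le_iff.2 ⟨hε.le, ?_⟩
  have hB0 : ∑ a ∈ s, B a a = 0 := Finset.sum_eq_zero fun a _ => by
    simp only [B, h0, ite_self]
  have hB : ∑ a ∈ s, ∑ b ∈ s, B a b ^ 2 < ε ^ 2 / (2 + fourthMoment) := by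
    rw [← Finset.sum_product' s s fun a b => B a b ^ 2]
    have h2 : ∑ p ∈ s ×ˢ s, B p.1 p.2 ^ 2
        = ∑ p ∈ (s ×ˢ s).filter (fun p => ¬(p.1 ∈ s₀ ∧ p.2 ∈ s₀)), A p.1 p.2 ^ 2 := by
      rw [Finset.sum_filter]
      refine Finset.sum_congr rfl fun p _ => ?_
      by_cases h : p.1 ∈ s₀ ∧ p.2 ∈ s₀ <;> simp [B, h]
    rw [h2]
    refine lt_of_abs_lt (hu _ ?_)
    rw [Finset.disjoint_left]
    intro p hp hpu
    refine (Finset.mem_filter.1 hp).2 ⟨?_, ?_⟩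
    · exact Finset.mem_union_left _ (Finset.mem_image_of_mem _ hpu)
    · exact Finset.mem_union_right _ (Finset.mem_image_of_mem _ hpu)
  rw [hB0]
  rw [lt_div_iff₀ hM] at hB
  nlinarith

/-- Square summable coefficients define a Wiener integral. -/
theorem exists_linForm_limit [DecidableEq ι] {A : ι → ℝ} (hA : Summable fun a => A a ^ 2) :
    ∃ g : (ι → ℝ) → ℝ, Measurable g ∧ MemLp g 2 (stdG ι) ∧
      Tendsto (fun s : Finset ι => eLpNorm
        ((fun x : ι → ℝ => ∑ a ∈ s, A a * x a) - g) 2 (stdG ι)) atTop (𝓝 0) := by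
  have hL : ∀ s : Finset ι, MemLp (fun x : ι → ℝ => ∑ a ∈ s, A a * x a) 2 (stdG ι) := fun s =>
    memLp_finsetSum _ fun a _ => (memLp_eval a (by simp)).const_mul _
  refine exists_measurable_limit hL fun ε hε => ?_
  obtain ⟨s₀, hu⟩ := summable_iff_vanishing_norm.1 hA (ε ^ 2) (by positivity)
  refine ⟨s₀, fun s hs => ?_⟩
  have e : ((fun x : ι → ℝ => ∑ a ∈ s, A a * x a) - fun x : ι → ℝ => ∑ a ∈ s₀, A a * x a)
      = fun x : ι → ℝ => ∑ a ∈ s \ s₀, A a * x a := by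
    ext x
    simp [← Finset.sum_sdiff hs]
  rw [e]
  have h1 : MemLp (fun x : ι → ℝ => ∑ a ∈ s \ s₀, A a * x a) 2 (stdG ι) := hL _
  refine (eLpNorm_two_le_of_integral_sq_le h1 (integral_linForm_sq _ A).le).trans
    (ENNReal.ofReal_le_ofReal (Real.sqrt_le_iff.2 ⟨hε.le, ?_⟩))
  exact (lt_of_abs_lt (hu (s \ s₀) Finset.sdiff_disjoint)).le

end Gaussian


/-! ### Splitting a quadratic vector field into rotations -/

section Splitting

variable {ι : Type}

/-- The affine angular velocity of the pair `(i, j)`, truncated to the modes in `s`. -/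
def rate (a₀ : ι → ι → ℝ) (a : ι → ι → ι → ℝ) (s : Finset ι) (i j : ι) (x : ι → ℝ) : ℝ :=
  a₀ i j + ∑ k ∈ s, a i j k * x k

/-- The vector field `x ↦ ρ(x) x`, truncated to the modes in `s`. -/
def drift (a₀ : ι → ι → ℝ) (a : ι → ι → ι → ℝ) (s : Finset ι) (i : ι) (x : ι → ℝ) : ℝ :=
  ∑ j ∈ s, rate a₀ a s i j x * x j

/-- The coefficients of a vector field that is a superposition of rotations in the coordinate planes,
with angular velocities that do not depend on the coordinates of the plane. -/
structure IsRotational (a₀ : ι → ι → ℝ) (a : ι → ι → ι → ℝ) : Prop where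
  anti₀ : ∀ i j, a₀ i j = -a₀ j i
  anti : ∀ i j k, a i j k = -a j i k
  diag : ∀ i j, a i j i = 0

variable {a₀ : ι → ι → ℝ} {a : ι → ι → ι → ℝ} {s : Finset ι}

theorem IsRotational.rate_anti (h : IsRotational a₀ a) (i j : ι) (x : ι → ℝ) :
    rate a₀ a s i j x = -rate a₀ a s j i x := by
  unfold rate
  rw [h.anti₀ i j, neg_add, ← Finset.sum_neg_distrib]
  congr 1
  exact Finset.sum_congr rfl fun k _ => by rw [h.anti i j k]; ring

theorem measurable_rate (i j : ι) : Measurable (rate a₀ a s i j) := by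
  unfold rate
  exact measurable_const.add (Finset.measurable_sum _ fun k _ =>
    (measurable_pi_apply k).const_mul _)

theorem measurable_drift (i : ι) : Measurable (drift a₀ a s i) := by
  unfold drift
  exact Finset.measurable_sum _ fun k _ => (measurable_rate i k).mul (measurable_pi_apply k)

theorem memLp_drift (i : ι) : MemLp (drift a₀ a s i) 2 (stdG ι) := by
  unfold drift rate
  refine memLp_finsetSum _ fun j _ => ?_
  simp only [add_mul, Finset.sum_mul]
  refine ((memLp_eval j (by simp)).const_mul _).add (memLp_finsetSum _ fun k _ => ?_)
  simp only [mul_assoc]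
  exact (memLp_mul_eval k j (by simp)).const_mul _

theorem abs_le_one_add_sum_sq {k : ι} (hk : k ∈ s) (x : ι → ℝ) :
    |x k| ≤ Real.sqrt (1 + ∑ l ∈ s, x l ^ 2) := by
  rw [← Real.sqrt_sq_eq_abs]
  refine Real.sqrt_le_sqrt ?_
  have := Finset.single_le_sum (f := fun l => x l ^ 2) (fun l _ => sq_nonneg _) hk
  linarith

variable [DecidableEq ι]

theorem planeRot_apply (i j : ι) (θ : ℝ) (x : ι → ℝ) (k : ι) :
    planeRot i j θ x k = if k = j then -Real.sin θ * x i + Real.cos θ * x j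
      else if k = i then Real.cos θ * x i + Real.sin θ * x j else x k := by
  simp [planeRot, insertTwo, Function.update_apply]

/-- `diag` kills the coefficient of x_i, and together with `anti` that of x_j. The angular velocity
is therefore constant along its own rotation, as `measurePreserving_planeRot` requires. -/
theorem IsRotational.rate_insertTwo (h : IsRotational a₀ a) (i j : ι) (x : ι → ℝ) (p : ℝ × ℝ) :
    rate a₀ a s i j (insertTwo i j (x, p)) = rate a₀ a s i j x := by
  unfold rate
  congr 1
  refine Finset.sum_congr rfl fun k _ => ?_
  by_cases hj : k = j
  · subst hj
    rw [h.anti, h.diag]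
    simp
  by_cases hi : k = i
  · subst hi
    simp [h.diag]
  · simp [insertTwo, hi, hj]

/-- One rotation of the splitting scheme. -/
def splitPiece (a₀ : ι → ι → ℝ) (a : ι → ι → ι → ℝ) (s : Finset ι) (p : ι × ι) (τ : ℝ)
    (x : ι → ℝ) : ι → ℝ :=
  -- Half of the rate, because (i, j) and (j, i) both occur in `offDiag` and generate the same
  -- rotation.
  planeRot p.1 p.2 (τ * (rate a₀ a s p.1 p.2 x / 2)) x

/-- The composition of the rotations in a list of planes. -/
def splitStep (a₀ : ι → ι → ℝ) (a : ι → ι → ι → ℝ) (s : Finset ι) (τ : ℝ) :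
    List (ι × ι) → (ι → ℝ) → ι → ℝ
  | [], x => x
  | p :: L, x => splitPiece a₀ a s p τ (splitStep a₀ a s τ L x)

/-- The generator of one rotation. -/
def pieceField (a₀ : ι → ι → ℝ) (a : ι → ι → ι → ℝ) (s : Finset ι) (p : ι × ι) (k : ι)
    (x : ι → ℝ) : ℝ :=
  if k = p.2 then -(rate a₀ a s p.1 p.2 x / 2) * x p.1
    else if k = p.1 then rate a₀ a s p.1 p.2 x / 2 * x p.2 else 0

theorem IsRotational.measurePreserving_splitStep (h : IsRotational a₀ a) (τ : ℝ)
    {L : List (ι × ι)} (hL : ∀ p ∈ L, p.1 ≠ p.2) :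
    MeasurePreserving (splitStep a₀ a s τ L) (stdG ι) (stdG ι) := by
  induction L with
  | nil => exact MeasurePreserving.id _
  | cons p L ih =>
    have h1 := ih fun q hq => hL q (List.mem_cons_of_mem _ hq)
    have h2 : MeasurePreserving (splitPiece a₀ a s p τ) (stdG ι) (stdG ι) :=
      measurePreserving_planeRot (hL p List.mem_cons_self)
        (((measurable_rate p.1 p.2).div_const 2).const_mul τ)
        fun x q => by rw [h.rate_insertTwo]
    exact h2.comp h1

theorem splitStep_zero (L : List (ι × ι)) (x : ι → ℝ) : splitStep a₀ a s 0 L x = x := by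
  induction L with
  | nil => rfl
  | cons p L ih =>
    ext k
    simp only [splitStep, splitPiece, ih, planeRot_apply]
    split_ifs with h1 h2
    · simp [h1]
    · simp [h2]
    · rfl

/-- All factors are the identity at τ = 0, so to first order the composition adds up the generators.
The angle τ r(τ) has derivative r(0) there, although the rate is evaluated at a point that itself
moves with τ. -/
theorem hasDerivAt_splitStep (L : List (ι × ι)) (x : ι → ℝ) (k : ι) :
    HasDerivAt (fun τ => splitStep a₀ a s τ L x k)
      ((L.map fun p => pieceField a₀ a s p k x).sum) 0 := by
  induction L generalizing k with
  | nil => simpa [splitStep] using hasDerivAt_const (0 : ℝ) (x k)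
  | cons p L ih =>
    have hr : DifferentiableAt ℝ
        (fun τ => rate a₀ a s p.1 p.2 (splitStep a₀ a s τ L x) / 2) 0 := by
      unfold rate
      refine DifferentiableAt.div_const (DifferentiableAt.const_add _ ?_) _
      exact DifferentiableAt.fun_sum fun k _ => (ih k).differentiableAt.const_mul _
    have hθ : HasDerivAt (fun τ => τ * (rate a₀ a s p.1 p.2 (splitStep a₀ a s τ L x) / 2))
        (rate a₀ a s p.1 p.2 x / 2) 0 := by
      have := (hasDerivAt_id (0 : ℝ)).mul hr.hasDerivAt
      simpa [splitStep_zero, Pi.mul_def] using this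
    have hc := hθ.cos
    have hs := hθ.sin
    simp only [zero_mul, Real.sin_zero, Real.cos_zero, neg_zero, one_mul] at hc hs
    simp only [splitStep, splitPiece, planeRot_apply, List.map_cons, List.sum_cons]
    by_cases h1 : k = p.2
    · subst h1
      have := (hs.neg.mul (ih p.1)).add (hc.mul (ih p.2))
      simp only [if_true, pieceField]
      refine this.congr_deriv ?_
      simp [splitStep_zero, pieceField]
    by_cases h2 : k = p.1
    · subst h2
      have := (hc.mul (ih p.1)).add (hs.mul (ih p.2))
      simp only [h1, if_true, if_false, pieceField]
      refine this.congr_deriv ?_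
      simp [splitStep_zero, add_comm, pieceField]
    · simpa [h1, h2, pieceField] using ih k

theorem sum_sq_planeRot {i j : ι} (hi : i ∈ s) (hj : j ∈ s) (hij : i ≠ j) (θ : ℝ) (x : ι → ℝ) :
    ∑ k ∈ s, planeRot i j θ x k ^ 2 = ∑ k ∈ s, x k ^ 2 := by
  have hj' : j ∈ s.erase i := Finset.mem_erase.2 ⟨hij.symm, hj⟩
  rw [← Finset.add_sum_erase _ _ hi, ← Finset.add_sum_erase _ _ hj',
    ← Finset.add_sum_erase s (fun k => x k ^ 2) hi, ← Finset.add_sum_erase _ _ hj', ← add_assoc,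
    ← add_assoc]
  congr 1
  · simp only [planeRot_apply, hij, if_true, if_false]
    have := Real.sin_sq_add_cos_sq θ
    linear_combination (x i ^ 2 + x j ^ 2) * this
  · refine Finset.sum_congr rfl fun k hk => ?_
    rw [Finset.mem_erase, Finset.mem_erase] at hk
    simp [planeRot_apply, hk.1, hk.2.1]

/-- Rotations conserve the truncated energy exactly. Every rate along the composition is therefore
controlled by the starting point, uniformly in τ, which provides the dominating function for the L²
limit τ → 0. -/
theorem sum_sq_splitStep (τ : ℝ) {L : List (ι × ι)} (hL : ∀ p ∈ L, p ∈ s.offDiag) (x : ι → ℝ) :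
    ∑ k ∈ s, splitStep a₀ a s τ L x k ^ 2 = ∑ k ∈ s, x k ^ 2 := by
  induction L with
  | nil => rfl
  | cons p L ih =>
    have hp := Finset.mem_offDiag.1 (hL p List.mem_cons_self)
    rw [← ih fun q hq => hL q (List.mem_cons_of_mem _ hq)]
    exact sum_sq_planeRot hp.1 hp.2.1 hp.2.2 _ _

/-- Both the rate and the rotated coordinates are at most a multiple of M = √(1 + Σ x²), and the
displacement is their product times |τ|. -/
theorem abs_splitPiece_sub_le {p : ι × ι} (hp : p ∈ s.offDiag) (τ : ℝ) (x : ι → ℝ) (k : ι) :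
    |splitPiece a₀ a s p τ x k - x k| ≤ |τ| * ((|a₀ p.1 p.2| + ∑ l ∈ s, |a p.1 p.2 l|) *
      (1 + ∑ l ∈ s, x l ^ 2)) := by
  obtain ⟨h1, h2, h3⟩ := Finset.mem_offDiag.1 hp
  set M := Real.sqrt (1 + ∑ l ∈ s, x l ^ 2) with hM
  have hN : 0 ≤ ∑ l ∈ s, x l ^ 2 := Finset.sum_nonneg fun l _ => sq_nonneg _
  have hM1 : 1 ≤ M := Real.one_le_sqrt.2 (by linarith)
  have hMsq : M * M = 1 + ∑ l ∈ s, x l ^ 2 := Real.mul_self_sqrt (by linarith)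
  have hx : ∀ l ∈ s, |x l| ≤ M := fun l hl => abs_le_one_add_sum_sq hl x
  set R := |a₀ p.1 p.2| + ∑ l ∈ s, |a p.1 p.2 l| with hR
  have hR0 : 0 ≤ R := add_nonneg (abs_nonneg _) (Finset.sum_nonneg fun l _ => abs_nonneg _)
  have hrate : |rate a₀ a s p.1 p.2 x| ≤ R * M := by
    unfold rate
    refine (abs_add_le _ _).trans ?_
    rw [hR, add_mul, Finset.sum_mul]
    refine add_le_add (le_mul_of_one_le_right (abs_nonneg _) hM1) ?_
    refine (Finset.abs_sum_le_sum_abs _ _).trans (Finset.sum_le_sum fun l hl => ?_)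
    rw [abs_mul]
    exact mul_le_mul_of_nonneg_left (hx l hl) (abs_nonneg _)
  set θ := τ * (rate a₀ a s p.1 p.2 x / 2) with hθ
  have hθa : |θ| * 2 ≤ |τ| * (R * M) := by
    rw [hθ, abs_mul, abs_div, abs_two]
    have := mul_le_mul_of_nonneg_left hrate (abs_nonneg τ)
    linarith
  have hsin : |Real.sin θ| ≤ |θ| := Real.abs_sin_le_abs
  have hcos : |Real.cos θ - 1| ≤ |θ| := by
    have h5 : Real.cos θ ≤ 1 := Real.cos_le_one θ
    by_cases h6 : |θ| ≤ 1
    · rw [abs_sub_comm, abs_of_nonneg (by linarith)]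
      have h7 := Real.one_sub_sq_div_two_le_cos (x := θ)
      rw [← sq_abs] at h7
      nlinarith [abs_nonneg θ]
    · by_cases h8 : |θ| ≤ 2
      · rw [abs_sub_comm, abs_of_nonneg (by linarith)]
        have h7 := Real.one_sub_sq_div_two_le_cos (x := θ)
        rw [← sq_abs] at h7
        nlinarith [abs_nonneg θ]
      · rw [abs_sub_comm, abs_of_nonneg (by linarith)]
        linarith [Real.neg_one_le_cos θ]
  have key : ∀ u v y z : ℝ, |u| ≤ |θ| → |v| ≤ |θ| → |y| ≤ M → |z| ≤ M →
      |u * y + v * z| ≤ |τ| * (R * (1 + ∑ l ∈ s, x l ^ 2)) := by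
    intro u v y z hu hv hy hz
    have hM0 : 0 ≤ M := by linarith
    calc |u * y + v * z| ≤ |u| * |y| + |v| * |z| := by
          rw [← abs_mul, ← abs_mul]; exact abs_add_le _ _
      _ ≤ |θ| * M + |θ| * M := add_le_add (mul_le_mul hu hy (abs_nonneg _) (abs_nonneg _))
          (mul_le_mul hv hz (abs_nonneg _) (abs_nonneg _))
      _ = (|θ| * 2) * M := by ring
      _ ≤ |τ| * (R * M) * M := mul_le_mul_of_nonneg_right hθa hM0
      _ = _ := by rw [← hMsq]; ring
  simp only [splitPiece, planeRot_apply]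
  rw [← hθ]
  split_ifs with e1 e2
  · rw [e1, show -Real.sin θ * x p.1 + Real.cos θ * x p.2 - x p.2
      = -Real.sin θ * x p.1 + (Real.cos θ - 1) * x p.2 by ring]
    exact key _ _ _ _ (by rwa [abs_neg]) hcos (hx _ h1) (hx _ h2)
  · rw [e2, show Real.cos θ * x p.1 + Real.sin θ * x p.2 - x p.1
      = (Real.cos θ - 1) * x p.1 + Real.sin θ * x p.2 by ring]
    exact key _ _ _ _ hcos hsin (hx _ h1) (hx _ h2)
  · rw [sub_self, abs_zero]
    positivity

theorem exists_abs_splitStep_sub_le {L : List (ι × ι)} (hL : ∀ p ∈ L, p ∈ s.offDiag) :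
    ∃ C : ℝ, ∀ (τ : ℝ) (x : ι → ℝ) (k : ι),
      |splitStep a₀ a s τ L x k - x k| ≤ |τ| * (C * (1 + ∑ l ∈ s, x l ^ 2)) := by
  induction L with
  | nil => exact ⟨0, fun τ x k => by simp [splitStep]⟩
  | cons p L ih =>
    have hL' : ∀ q ∈ L, q ∈ s.offDiag := fun q hq => hL q (List.mem_cons_of_mem _ hq)
    obtain ⟨C, hC⟩ := ih hL'
    refine ⟨(|a₀ p.1 p.2| + ∑ l ∈ s, |a p.1 p.2 l|) + C, fun τ x k => ?_⟩
    have h1 := abs_splitPiece_sub_le (a₀ := a₀) (a := a) (hL p List.mem_cons_self) τ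
      (splitStep a₀ a s τ L x) k
    rw [sum_sq_splitStep τ hL'] at h1
    have h2 := abs_sub_le (splitStep a₀ a s τ (p :: L) x k) (splitStep a₀ a s τ L x k) (x k)
    simp only [splitStep] at h2 ⊢
    refine h2.trans ((add_le_add h1 (hC τ x k)).trans_eq (by ring))

theorem splitStep_apply_of_notMem (τ : ℝ) {L : List (ι × ι)} (hL : ∀ p ∈ L, p ∈ s.offDiag)
    (x : ι → ℝ) {k : ι} (hk : k ∉ s) : splitStep a₀ a s τ L x k = x k := by
  induction L with
  | nil => rfl
  | cons p L ih =>
    obtain ⟨h1, h2, -⟩ := Finset.mem_offDiag.1 (hL p List.mem_cons_self)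
    have e1 : k ≠ p.1 := fun h => hk (h ▸ h1)
    have e2 : k ≠ p.2 := fun h => hk (h ▸ h2)
    simp only [splitStep, splitPiece, planeRot_apply, e1, e2, if_false]
    exact ih fun q hq => hL q (List.mem_cons_of_mem _ hq)

/-- By antisymmetry of the rate the pairs (k, j) and (j, k) contribute equally to the coordinate k,
and the two halves make up the full rate. Diagonal rates vanish, so summing over `offDiag` loses
nothing. -/
theorem IsRotational.sum_pieceField (h : IsRotational a₀ a) {k : ι} (hk : k ∈ s) (x : ι → ℝ) :
    (s.offDiag.toList.map fun p => pieceField a₀ a s p k x).sum = drift a₀ a s k x := by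
  rw [Finset.sum_map_toList]
  have e : ∀ p ∈ s.offDiag, pieceField a₀ a s p k x
      = (if p.1 = k then rate a₀ a s k p.2 x / 2 * x p.2 else 0)
        + if p.2 = k then rate a₀ a s k p.1 x / 2 * x p.1 else 0 := by
    rintro ⟨i, j⟩ hp
    obtain ⟨-, -, h3⟩ := Finset.mem_offDiag.1 hp
    simp only [pieceField] at h3 ⊢
    by_cases h1 : k = j
    · subst h1
      simp only [if_true, h3, if_false]
      rw [h.rate_anti i k]
      ring
    · by_cases h2 : k = i
      · subst h2
        simp [h1, Ne.symm h3]
      · simp [h1, h2, Ne.symm h1, Ne.symm h2]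
  have hd : ∀ i, rate a₀ a s i i x = 0 := fun i => by
    have := h.rate_anti (s := s) i i x
    linarith
  rw [Finset.sum_congr rfl e, Finset.sum_add_distrib]
  have e1 : ∑ p ∈ s.offDiag, (if p.1 = k then rate a₀ a s k p.2 x / 2 * x p.2 else 0)
      = ∑ j ∈ s, rate a₀ a s k j x / 2 * x j := by
    have : ∑ p ∈ s.offDiag, (if p.1 = k then rate a₀ a s k p.2 x / 2 * x p.2 else 0)
        = ∑ p ∈ s ×ˢ s, (if p.1 = k then rate a₀ a s k p.2 x / 2 * x p.2 else 0) := by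
      refine Finset.sum_subset (fun p hp => ?_) fun p hp hp' => ?_
      · rw [Finset.mem_offDiag] at hp
        exact Finset.mem_product.2 ⟨hp.1, hp.2.1⟩
      · rw [Finset.mem_product] at hp
        rw [Finset.mem_offDiag] at hp'
        have : p.1 = p.2 := by
          by_contra hne
          exact hp' ⟨hp.1, hp.2, hne⟩
        split_ifs with h4
        · rw [← this, h4, hd]
          simp
        · rfl
    rw [this, Finset.sum_product, Finset.sum_eq_single k (fun i _ hi => by simp [hi])
      (by simp [hk])]
    simp
  have e2 : ∑ p ∈ s.offDiag, (if p.2 = k then rate a₀ a s k p.1 x / 2 * x p.1 else 0)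
      = ∑ p ∈ s.offDiag, (if p.1 = k then rate a₀ a s k p.2 x / 2 * x p.2 else 0) := by
    refine Finset.sum_bij (fun p _ => p.swap) (fun p hp => ?_) (fun p _ q _ hpq => ?_)
      (fun p hp => ?_) fun p _ => ?_
    · rw [Finset.mem_offDiag] at hp ⊢
      exact ⟨hp.2.1, hp.1, hp.2.2.symm⟩
    · exact Prod.swap_injective hpq
    · refine ⟨p.swap, ?_, Prod.swap_swap p⟩
      rw [Finset.mem_offDiag] at hp ⊢
      exact ⟨hp.2.1, hp.1, hp.2.2.symm⟩
    · rfl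
  rw [e2, e1, drift, ← Finset.sum_add_distrib]
  exact Finset.sum_congr rfl fun j _ => by ring

/-- A rotational vector field is approximated by difference quotients of maps that preserve the
Gaussian measure. -/
theorem IsRotational.exists_splitting (h : IsRotational a₀ a) (s : Finset ι) {ε : ℝ} (hε : 0 < ε) :
    ∃ τ ∈ Ioo 0 ε, ∃ Φ : (ι → ℝ) → ι → ℝ, MeasurePreserving Φ (stdG ι) (stdG ι) ∧
      (∀ x, ∀ i ∉ s, Φ x i = x i) ∧
      ∀ i ∈ s, eLpNorm (fun x => (Φ x i - x i) / τ - drift a₀ a s i x) 2 (stdG ι)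
        ≤ ENNReal.ofReal ε := by
  obtain ⟨L, hLs⟩ : ∃ L, L = s.offDiag.toList := ⟨_, rfl⟩
  have hL : ∀ p ∈ L, p ∈ s.offDiag := fun p hp => Finset.mem_toList.1 (hLs ▸ hp)
  have hMP : ∀ τ, MeasurePreserving (splitStep a₀ a s τ L) (stdG ι) (stdG ι) := fun τ =>
    h.measurePreserving_splitStep τ fun p hp => (Finset.mem_offDiag.1 (hL p hp)).2.2
  obtain ⟨C, hC⟩ := exists_abs_splitStep_sub_le (a₀ := a₀) (a := a) hL
  have hm : ∀ τ i, Measurable fun x => (splitStep a₀ a s τ L x i - x i) / τ - drift a₀ a s i x :=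
    fun τ i => ((((measurable_pi_apply i).comp (hMP τ).measurable).sub
      (measurable_pi_apply i)).div_const τ).sub (measurable_drift i)
  have hG : MemLp (fun x : ι → ℝ => C * (1 + ∑ l ∈ s, x l ^ 2)) 2 (stdG ι) := by
    have h1 : MemLp (fun x : ι → ℝ => ∑ l ∈ s, x l ^ 2) 2 (stdG ι) :=
      memLp_finsetSum s fun l _ => by simpa only [sq] using memLp_mul_eval l l (by simp)
    exact ((memLp_const (1 : ℝ)).add h1).const_mul C
  -- A dominating function free of τ, from the displacement bound linear in τ. The pointwise limit
  -- then comes from `hasDerivAt_splitStep`.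
  have hb : ∀ (i : ι) (τ : ℝ), 0 < τ → ∀ x, ((splitStep a₀ a s τ L x i - x i) / τ
      - drift a₀ a s i x) ^ 2 ≤ 2 * (C * (1 + ∑ l ∈ s, x l ^ 2)) ^ 2 + 2 * drift a₀ a s i x ^ 2 := by
    intro i τ hτ x
    have h1 := hC τ x i
    rw [abs_of_pos hτ] at h1
    have h2 : |(splitStep a₀ a s τ L x i - x i) / τ| ≤ C * (1 + ∑ l ∈ s, x l ^ 2) := by
      rw [abs_div, abs_of_pos hτ, div_le_iff₀ hτ]
      linarith
    have h3 := sq_le_sq' (by linarith [neg_abs_le ((splitStep a₀ a s τ L x i - x i) / τ)])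
      (le_trans (le_abs_self _) h2)
    nlinarith [sq_nonneg ((splitStep a₀ a s τ L x i - x i) / τ + drift a₀ a s i x)]
  have hbi : ∀ i, Integrable (fun x : ι → ℝ => 2 * (C * (1 + ∑ l ∈ s, x l ^ 2)) ^ 2
      + 2 * drift a₀ a s i x ^ 2) (stdG ι) := fun i =>
    (hG.integrable_sq.const_mul 2).add ((memLp_drift i).integrable_sq.const_mul 2)
  have hlim : ∀ i ∈ s, Tendsto (fun τ => ∫ x, ((splitStep a₀ a s τ L x i - x i) / τ
      - drift a₀ a s i x) ^ 2 ∂stdG ι) (𝓝[>] 0) (𝓝 0) := by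
    intro i hi
    have := tendsto_integral_filter_of_dominated_convergence (μ := stdG ι) (l := 𝓝[>] (0 : ℝ))
      (F := fun τ x => ((splitStep a₀ a s τ L x i - x i) / τ - drift a₀ a s i x) ^ 2)
      (f := fun _ => 0) _ (Eventually.of_forall fun τ => ((hm τ i).pow_const 2).aestronglyMeasurable)
      ?_ (hbi i) (ae_of_all _ fun x => ?_)
    · simpa using this
    · filter_upwards [self_mem_nhdsWithin] with τ hτ
      refine ae_of_all _ fun x => ?_
      rw [Real.norm_eq_abs, abs_of_nonneg (sq_nonneg _)]
      exact hb i τ hτ x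
    · have h1 := hasDerivAt_splitStep (a₀ := a₀) (a := a) (s := s) L x i
      rw [hLs, h.sum_pieceField hi, ← hLs] at h1
      have h2 := h1.tendsto_slope.mono_left
        (nhdsWithin_mono (0 : ℝ) (fun y (hy : 0 < y) => ne_of_gt hy))
      have h3 := (h2.sub_const (drift a₀ a s i x)).pow 2
      simp only [sub_self, ne_eq, OfNat.ofNat_ne_zero, not_false_eq_true, zero_pow] at h3
      refine h3.congr fun τ => ?_
      simp [slope_def_field, splitStep_zero]
  have hev : ∀ᶠ τ in 𝓝[>] (0 : ℝ), ∀ i ∈ s, ∫ x, ((splitStep a₀ a s τ L x i - x i) / τ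
      - drift a₀ a s i x) ^ 2 ∂stdG ι ≤ ε ^ 2 := by
    rw [Finset.eventually_all]
    exact fun i hi => ((hlim i hi).eventually_lt_const (by positivity : 0 < ε ^ 2)).mono
      fun τ hτ => hτ.le
  obtain ⟨τ, hτ1, hτ2⟩ := (hev.and (Ioo_mem_nhdsGT hε)).exists
  refine ⟨τ, hτ2, splitStep a₀ a s τ L, hMP τ, fun x i hi => splitStep_apply_of_notMem τ hL x hi,
    fun i hi => ?_⟩
  have hmem : MemLp (fun x => (splitStep a₀ a s τ L x i - x i) / τ - drift a₀ a s i x) 2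
      (stdG ι) := by
    rw [memLp_two_iff_integrable_sq (hm τ i).aestronglyMeasurable]
    refine (hbi i).mono' ((hm τ i).pow_const 2).aestronglyMeasurable (ae_of_all _ fun x => ?_)
    rw [Real.norm_eq_abs, abs_of_nonneg (sq_nonneg _)]
    exact hb i τ hτ2.1 x
  have := eLpNorm_two_le_of_integral_sq_le hmem (hτ1 i hi)
  rwa [Real.sqrt_sq hε.le] at this

end Splitting


/-! ### Piecewise linear interpolation -/

section Interpolation

/-- The time spent in the `k`-th time step before time `t`. -/
def ramp (τ : ℝ) (k : ℕ) (t : ℝ) : ℝ := min t ((k + 1) * τ) - min t (k * τ)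

theorem continuous_ramp (τ : ℝ) (k : ℕ) : Continuous (ramp τ k) := by unfold ramp; fun_prop

/-- The piecewise linear interpolation of a sequence with mesh `τ`. -/
def interp (τ : ℝ) (N : ℕ) (u : ℕ → ℝ) (t : ℝ) : ℝ :=
  u 0 + ∑ k ∈ Finset.range N, (u (k + 1) - u k) / τ * ramp τ k t

theorem continuous_interp (τ : ℝ) (N : ℕ) (u : ℕ → ℝ) : Continuous (interp τ N u) := by
  unfold interp
  exact continuous_const.add (continuous_finsetSum _ fun k _ =>
    continuous_const.mul (continuous_ramp τ k))

variable {τ : ℝ} {N : ℕ} {u : ℕ → ℝ}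

theorem ramp_of_le (hτ : 0 < τ) {k : ℕ} {t : ℝ} (h : (k + 1) * τ ≤ t) : ramp τ k t = τ := by
  have : (k : ℝ) * τ ≤ t := by nlinarith
  rw [ramp, min_eq_right h, min_eq_right this]
  ring

theorem ramp_of_mem {k : ℕ} {t : ℝ} (h₁ : k * τ ≤ t) (h₂ : t ≤ (k + 1) * τ) :
    ramp τ k t = t - k * τ := by
  rw [ramp, min_eq_left h₂, min_eq_right h₁]

theorem ramp_of_ge (hτ : 0 < τ) {k : ℕ} {t : ℝ} (h : t ≤ k * τ) : ramp τ k t = 0 := by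
  have : t ≤ (k + 1) * τ := by nlinarith
  rw [ramp, min_eq_left h, min_eq_left this, sub_self]

theorem interp_zero (hτ : 0 < τ) : interp τ N u 0 = u 0 := by
  unfold interp
  rw [Finset.sum_eq_zero fun k _ => by rw [ramp_of_ge hτ (by positivity), mul_zero], add_zero]

theorem interp_of_mem (hτ : 0 < τ) {k : ℕ} (hk : k < N) {t : ℝ} (h₁ : k * τ ≤ t)
    (h₂ : t ≤ (k + 1) * τ) : interp τ N u t = u k + (u (k + 1) - u k) / τ * (t - k * τ) := by
  unfold interp
  have e : ∑ j ∈ Finset.range N, (u (j + 1) - u j) / τ * ramp τ j t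
      = ∑ j ∈ Finset.range (k + 1), (u (j + 1) - u j) / τ * ramp τ j t := by
    refine (Finset.sum_subset (Finset.range_mono hk) fun j _ hj => ?_).symm
    rw [Finset.mem_range, not_lt] at hj
    have : ((k : ℝ) + 1) ≤ j := by exact_mod_cast hj
    rw [ramp_of_ge hτ (h₂.trans (mul_le_mul_of_nonneg_right this hτ.le)), mul_zero]
  rw [e, Finset.sum_range_succ, ramp_of_mem h₁ h₂]
  have e2 : ∑ j ∈ Finset.range k, (u (j + 1) - u j) / τ * ramp τ j t
      = ∑ j ∈ Finset.range k, (u (j + 1) - u j) := by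
    refine Finset.sum_congr rfl fun j hj => ?_
    have : ((j : ℝ) + 1) ≤ k := by exact_mod_cast Finset.mem_range.1 hj
    rw [ramp_of_le hτ ((mul_le_mul_of_nonneg_right this hτ.le).trans h₁), div_mul_cancel₀ _ hτ.ne']
  rw [e2, Finset.sum_range_sub]
  ring

theorem floor_bounds (hτ : 0 < τ) {t : ℝ} (ht : 0 ≤ t) :
    (⌊t / τ⌋₊ : ℝ) * τ ≤ t ∧ t < (⌊t / τ⌋₊ + 1) * τ :=
  ⟨(le_div_iff₀ hτ).1 (Nat.floor_le (by positivity)), (div_lt_iff₀ hτ).1 (Nat.lt_floor_add_one _)⟩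

theorem floor_lt_of_lt (hτ : 0 < τ) {t : ℝ} (ht : 0 ≤ t) (htN : t < N * τ) : ⌊t / τ⌋₊ < N := by
  rw [Nat.floor_lt (by positivity), div_lt_iff₀ hτ]
  exact htN

theorem interp_eq (hτ : 0 < τ) {t : ℝ} (ht : 0 ≤ t) (htN : t < N * τ) :
    interp τ N u t = u ⌊t / τ⌋₊
      + (u (⌊t / τ⌋₊ + 1) - u ⌊t / τ⌋₊) / τ * (t - ⌊t / τ⌋₊ * τ) :=
  interp_of_mem hτ (floor_lt_of_lt hτ ht htN) (floor_bounds hτ ht).1 (floor_bounds hτ ht).2.le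

theorem abs_interp_sub_le (hτ : 0 < τ) {t : ℝ} (ht : 0 ≤ t) (htN : t < N * τ) :
    |interp τ N u t - u ⌊t / τ⌋₊| ≤ |u (⌊t / τ⌋₊ + 1) - u ⌊t / τ⌋₊| := by
  obtain ⟨h1, h2⟩ := floor_bounds hτ ht
  rw [interp_eq hτ ht htN, add_sub_cancel_left, div_mul_eq_mul_div, abs_div, abs_mul,
    abs_of_pos hτ, div_le_iff₀ hτ, abs_of_nonneg (by linarith : 0 ≤ t - ⌊t / τ⌋₊ * τ)]
  exact mul_le_mul_of_nonneg_left (by linarith) (abs_nonneg _)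

theorem abs_interp_le (hτ : 0 < τ) {t : ℝ} (ht : 0 ≤ t) (htN : t < N * τ) :
    |interp τ N u t| ≤ max |u ⌊t / τ⌋₊| |u (⌊t / τ⌋₊ + 1)| := by
  obtain ⟨h1, h2⟩ := floor_bounds hτ ht
  rw [interp_eq hτ ht htN]
  set k := ⌊t / τ⌋₊
  set r := (t - k * τ) / τ with hr
  have hr0 : 0 ≤ r := div_nonneg (by linarith) hτ.le
  have hr1 : r ≤ 1 := by rw [hr, div_le_one hτ]; linarith
  have e : u k + (u (k + 1) - u k) / τ * (t - k * τ) = (1 - r) * u k + r * u (k + 1) := by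
    rw [hr]; field_simp; ring
  rw [e]
  refine (abs_add_le _ _).trans ?_
  rw [abs_mul, abs_mul, abs_of_nonneg hr0, abs_of_nonneg (by linarith : 0 ≤ 1 - r)]
  nlinarith [mul_le_mul_of_nonneg_left (le_max_left |u k| |u (k + 1)|)
    (by linarith : 0 ≤ 1 - r), mul_le_mul_of_nonneg_left (le_max_right |u k| |u (k + 1)|) hr0]

/-- A discrete chain rule for |·|^p, to be telescoped along an orbit. For p = 0 the factor p makes
the truncated exponent p − 1 irrelevant. -/
theorem abs_pow_sub_pow_le (x y : ℝ) (p : ℕ) :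
    |x| ^ p ≤ |y| ^ p + p * (|x - y| * (|y| + |x|) ^ (p - 1)) := by
  induction p with
  | zero => simp
  | succ p ih =>
    rcases Nat.eq_zero_or_pos p with rfl | hp
    · simp
      have := abs_sub_abs_le_abs_sub x y
      linarith
    have e : (|y| + |x|) ^ p = (|y| + |x|) ^ (p - 1) * (|y| + |x|) := by
      rw [← pow_succ, Nat.sub_add_cancel hp]
    have h1 : |x| ^ p ≤ (|y| + |x|) ^ p := pow_le_pow_left₀ (abs_nonneg _) (by simp) _
    have h2 : |x| ≤ |y| + |x - y| := by
      have := abs_sub_abs_le_abs_sub x y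
      linarith
    have hX : 0 ≤ |x - y| * (|y| + |x|) ^ (p - 1) := by positivity
    rw [Nat.add_sub_cancel, e, pow_succ, pow_succ]
    rw [e] at h1
    push_cast
    have hx := abs_nonneg x
    have hy := abs_nonneg y
    have hd := abs_nonneg (x - y)
    have hp0 : (0 : ℝ) ≤ p := Nat.cast_nonneg p
    calc |x| ^ p * |x| ≤ |x| ^ p * (|y| + |x - y|) := by gcongr
      _ = |x| ^ p * |y| + |x - y| * |x| ^ p := by ring
      _ ≤ (|y| ^ p + p * (|x - y| * (|y| + |x|) ^ (p - 1))) * |y|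
          + |x - y| * ((|y| + |x|) ^ (p - 1) * (|y| + |x|)) := by gcongr
      _ ≤ _ := by nlinarith [mul_nonneg (mul_nonneg hp0 hX) hx]

theorem abs_pow_le_sum (p : ℕ) {k : ℕ} (hk : k ≤ N) :
    |u k| ^ p ≤ |u 0| ^ p + ∑ j ∈ Finset.range N,
      p * (|u (j + 1) - u j| * (|u j| + |u (j + 1)|) ^ (p - 1)) := by
  have h : ∀ k, |u k| ^ p ≤ |u 0| ^ p + ∑ j ∈ Finset.range k,
      p * (|u (j + 1) - u j| * (|u j| + |u (j + 1)|) ^ (p - 1)) := by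
    intro k
    induction k with
    | zero => simp
    | succ k ih =>
      rw [Finset.sum_range_succ, ← add_assoc]
      exact (abs_pow_sub_pow_le _ (u k) p).trans (by linarith)
  refine (h k).trans (add_le_add_right ?_ _)
  exact Finset.sum_le_sum_of_subset_of_nonneg (Finset.range_mono hk) fun j _ _ => by positivity

/-- The right side does not depend on t and is linear in the increments up to a power of the values.
High moments of the maximum thus need only an L² bound on the velocity, because the values
themselves are Gaussian. -/
theorem abs_interp_pow_le (hτ : 0 < τ) (p : ℕ) {t : ℝ} (ht : 0 ≤ t) (htN : t < N * τ) :
    |interp τ N u t| ^ p ≤ |u 0| ^ p + ∑ j ∈ Finset.range N,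
      p * (|u (j + 1) - u j| * (|u j| + |u (j + 1)|) ^ (p - 1)) := by
  have h := abs_interp_le (u := u) hτ ht htN
  have hk := floor_lt_of_lt hτ ht htN
  rcases max_choice |u ⌊t / τ⌋₊| |u (⌊t / τ⌋₊ + 1)| with e | e
  · rw [e] at h
    exact (pow_le_pow_left₀ (abs_nonneg _) h p).trans (abs_pow_le_sum p hk.le)
  · rw [e] at h
    exact (pow_le_pow_left₀ (abs_nonneg _) h p).trans (abs_pow_le_sum p hk)

theorem ramp_mono (hτ : 0 < τ) (k : ℕ) : Monotone (ramp τ k) := by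
  intro s t hst
  unfold ramp
  have h1 : (k : ℝ) * τ ≤ (k + 1) * τ := by nlinarith
  rcases le_total s (k * τ) with h2 | h2
  · rw [min_eq_left h2, min_eq_left (h2.trans h1), sub_self, sub_nonneg]
    exact min_le_min_left _ h1
  · rw [min_eq_right h2, min_eq_right (h2.trans hst)]
    exact sub_le_sub_right (min_le_min_right _ hst) _

theorem sum_ramp {t : ℝ} (ht : 0 ≤ t) (htN : t ≤ N * τ) :
    ∑ k ∈ Finset.range N, ramp τ k t = t := by
  have : ∑ k ∈ Finset.range N, ramp τ k t = min t (N * τ) - min t ((0 : ℕ) * τ) := by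
    rw [← Finset.sum_range_sub (fun k : ℕ => min t (k * τ))]
    refine Finset.sum_congr rfl fun k _ => ?_
    rw [ramp]
    push_cast
    rfl
  rw [this, min_eq_left htN]
  simp [ht]

theorem ramp_nonneg (hτ : 0 < τ) (k : ℕ) (t : ℝ) : 0 ≤ ramp τ k t := by
  unfold ramp
  have h1 : (k : ℝ) * τ ≤ (k + 1) * τ := by nlinarith
  linarith [min_le_min_left t h1]

theorem ramp_le (hτ : 0 < τ) (k : ℕ) (t : ℝ) : ramp τ k t ≤ τ := by
  have := ramp_mono hτ k (le_max_left t ((k + 1) * τ))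
  rwa [ramp_of_le hτ (le_max_right _ _)] at this

/-- Interpolations with square summable increments are Hölder continuous of exponent `1/2`. -/
theorem interp_sub_sq_le (hτ : 0 < τ) {s t : ℝ} (hs : 0 ≤ s) (hst : s ≤ t) (htN : t ≤ N * τ) :
    (interp τ N u t - interp τ N u s) ^ 2
      ≤ (∑ k ∈ Finset.range N, τ * ((u (k + 1) - u k) / τ) ^ 2) * (t - s) := by
  have e : interp τ N u t - interp τ N u s
      = ∑ k ∈ Finset.range N, (u (k + 1) - u k) / τ * (ramp τ k t - ramp τ k s) := by
    simp only [interp, mul_sub, Finset.sum_sub_distrib]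
    ring
  have h0 : ∀ k, 0 ≤ ramp τ k t - ramp τ k s := fun k => sub_nonneg.2 (ramp_mono hτ k hst)
  have hsum : ∑ k ∈ Finset.range N, (ramp τ k t - ramp τ k s) = t - s := by
    rw [Finset.sum_sub_distrib, sum_ramp (hs.trans hst) htN, sum_ramp hs (hst.trans htN)]
  -- Cauchy–Schwarz with the times spent in the steps between s and t as weights. They add up to t −
  -- s, and each is at most τ.
  have hcs := Finset.sum_sq_le_sum_mul_sum_of_sq_le_mul (Finset.range N)
    (r := fun k => (u (k + 1) - u k) / τ * (ramp τ k t - ramp τ k s))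
    (f := fun k => ((u (k + 1) - u k) / τ) ^ 2 * (ramp τ k t - ramp τ k s))
    (g := fun k => ramp τ k t - ramp τ k s) (fun k _ => mul_nonneg (sq_nonneg _) (h0 k))
    (fun k _ => h0 k) (fun k _ => by ring_nf; rfl)
  rw [hsum, ← e] at hcs
  refine hcs.trans (mul_le_mul_of_nonneg_right ?_ (by linarith))
  refine Finset.sum_le_sum fun k _ => ?_
  rw [mul_comm]
  refine mul_le_mul_of_nonneg_right ?_ (sq_nonneg _)
  linarith [ramp_le hτ k t, ramp_nonneg hτ k s]

theorem intervalIntegrable_comp_floor (v : ℕ → ℝ) (hτ : 0 < τ) {t : ℝ} (ht : 0 ≤ t) :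
    IntervalIntegrable (fun s => v ⌊s / τ⌋₊) volume 0 t := by
  have hm : Measurable fun s : ℝ => v ⌊s / τ⌋₊ :=
    (measurable_from_nat (f := v)).comp (Nat.measurable_floor.comp (measurable_id.div_const τ))
  rw [intervalIntegrable_iff_integrableOn_Ioc_of_le ht]
  refine Measure.integrableOn_of_bounded (M := ∑ k ∈ Finset.range (⌊t / τ⌋₊ + 1), |v k|) (by simp)
    hm.aestronglyMeasurable ?_
  refine (ae_restrict_iff' measurableSet_Ioc).2 (ae_of_all _ fun s hs => ?_)
  rw [Real.norm_eq_abs]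
  refine Finset.single_le_sum (f := fun k => |v k|) (fun k _ => abs_nonneg _) ?_
  rw [Finset.mem_range, Nat.lt_succ_iff]
  exact Nat.floor_le_floor (div_le_div_of_nonneg_right hs.2 hτ.le)

/-- The step function is the right derivative of the interpolation everywhere, corners included, and
right derivatives suffice for the fundamental theorem of calculus. -/
theorem interp_sub_eq_integral (hτ : 0 < τ) {t : ℝ} (ht : 0 ≤ t) (htN : t < N * τ) :
    interp τ N u t - u 0
      = ∫ s in (0 : ℝ)..t, (u (⌊s / τ⌋₊ + 1) - u ⌊s / τ⌋₊) / τ := by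
  rw [← interp_zero (u := u) (N := N) hτ]
  symm
  refine intervalIntegral.integral_eq_sub_of_hasDeriv_right_of_le ht
    (continuous_interp τ N u).continuousOn (fun s hs => ?_)
    (intervalIntegrable_comp_floor (fun k => (u (k + 1) - u k) / τ) hτ ht)
  set k := ⌊s / τ⌋₊ with hk
  obtain ⟨h1, h2⟩ := floor_bounds hτ hs.1.le
  have hkN : k < N := floor_lt_of_lt hτ hs.1.le (hs.2.trans htN)
  have hd : HasDerivAt (fun r => u k + (u (k + 1) - u k) / τ * (r - k * τ))
      ((u (k + 1) - u k) / τ) s := by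
    simpa using (((hasDerivAt_id s).sub_const (k * τ)).const_mul
      ((u (k + 1) - u k) / τ)).const_add (u k)
  refine hd.hasDerivWithinAt.congr_of_eventuallyEq ?_ (interp_of_mem hτ hkN h1 h2.le)
  filter_upwards [self_mem_nhdsWithin, mem_nhdsWithin_of_mem_nhds (Iio_mem_nhds h2)] with r hr1 hr2
  exact interp_of_mem hτ hkN (h1.trans (le_of_lt hr1)) (le_of_lt hr2)

end Interpolation


/-! ### Processes obtained by iterating a map that preserves the Gaussian measure -/

section Approximation

instance (T : ℝ) : MeasurableSpace C(Icc (0 : ℝ) T, ℝ) := borel _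

instance (T : ℝ) : BorelSpace C(Icc (0 : ℝ) T, ℝ) := ⟨rfl⟩

variable {ι : Type}

/-- The number of time steps. -/
def steps (T τ : ℝ) : ℕ := ⌈T / τ⌉₊ + 1

/-- The extra step in `steps` makes the inequality strict, so that at t = T the index ⌊t/τ⌋ and its
successor still belong to the interpolation. -/
theorem lt_steps_mul {T τ : ℝ} (hτ : 0 < τ) : T < steps T τ * τ := by
  have h := (div_le_iff₀ hτ).1 (Nat.le_ceil (T / τ))
  rw [steps]
  push_cast
  nlinarith

theorem steps_mul_le {T τ : ℝ} (hT : 0 < T) (hτ : 0 < τ) : steps T τ * τ ≤ T + 2 * τ := by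
  have h := Nat.ceil_lt_add_one (div_nonneg hT.le hτ.le)
  rw [steps]
  push_cast
  have h2 : T / τ * τ = T := div_mul_cancel₀ _ hτ.ne'
  nlinarith

/-- The interpolated orbit of `x` under `Φ`. -/
def orbitPath (T τ : ℝ) (Φ : (ι → ℝ) → ι → ℝ) (x : ι → ℝ) (i : ι) : C(Icc (0 : ℝ) T, ℝ) :=
  ⟨fun t => interp τ (steps T τ) (fun k => Φ^[k] x i) t,
    (continuous_interp _ _ _).comp continuous_subtype_val⟩

/-- For the Borel structure of uniform convergence: each component is a finite combination of fixed
continuous functions with measurable coefficients. -/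
theorem measurable_orbitPath {T τ : ℝ} {Φ : (ι → ℝ) → ι → ℝ} (hΦ : Measurable Φ) :
    Measurable (orbitPath T τ Φ) := by
  refine measurable_pi_lambda _ fun i => ?_
  have e : (fun x => orbitPath T τ Φ x i) = fun x => x i • (1 : C(Icc (0 : ℝ) T, ℝ))
      + ∑ k ∈ Finset.range (steps T τ), ((Φ^[k + 1] x i - Φ^[k] x i) / τ) •
        (⟨fun t => ramp τ k t, (continuous_ramp τ k).comp continuous_subtype_val⟩ :
          C(Icc (0 : ℝ) T, ℝ)) := by
    ext x t
    simp [orbitPath, interp]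
  rw [e]
  have hk : ∀ k, Measurable fun x => Φ^[k] x i := fun k =>
    (measurable_pi_apply i).comp (hΦ.iterate k)
  have hs : ∀ (f : C(Icc (0 : ℝ) T, ℝ)), Measurable fun r : ℝ => r • f := fun f =>
    (continuous_id.smul continuous_const).measurable
  exact ((hs 1).comp (measurable_pi_apply i)).add (Finset.measurable_sum _ fun k _ =>
    (hs _).comp (((hk (k + 1)).sub (hk k)).div_const τ))

theorem eLpNorm_increment_le {Φ : (ι → ℝ) → ι → ℝ} {τ κ : ℝ} (hτ : 0 < τ) {i : ι}
    (h : eLpNorm (fun x => (Φ x i - x i) / τ) 2 (stdG ι) ≤ ENNReal.ofReal κ) :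
    eLpNorm (fun x => Φ x i - x i) 2 (stdG ι) ≤ ENNReal.ofReal (τ * κ) := by
  have e : (fun x => Φ x i - x i) = τ • fun x : ι → ℝ => (Φ x i - x i) / τ := by
    ext x
    simp only [Pi.smul_apply, smul_eq_mul]
    field_simp
  rw [e, eLpNorm_const_smul, ENNReal.ofReal_mul hτ.le]
  refine mul_le_mul' (le_of_eq ?_) h
  rw [Real.enorm_eq_ofReal_abs, abs_of_pos hτ]

/-- Cauchy–Schwarz. The increment has L² norm at most τκ, and x_i and Φ(x)_i are both standard
Gaussian by invariance, so the other factor has a norm that depends on q alone. -/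
theorem lintegral_increment_mul_le (q : ℕ) : ∃ B : ℝ, 0 ≤ B ∧ ∀ (ι : Type) (Φ : (ι → ℝ) → ι → ℝ)
    (τ κ : ℝ) (i : ι), MeasurePreserving Φ (stdG ι) (stdG ι) → 0 < τ → 0 ≤ κ →
    eLpNorm (fun x => (Φ x i - x i) / τ) 2 (stdG ι) ≤ ENNReal.ofReal κ →
    ∫⁻ x, ENNReal.ofReal (|Φ x i - x i| * (|x i| + |Φ x i|) ^ q) ∂stdG ι
      ≤ ENNReal.ofReal (τ * κ * B) := by
  have hg : MemLp (fun y : ℝ => |y| ^ q) 2 (gaussianReal 0 1) := by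
    rcases Nat.eq_zero_or_pos q with rfl | hq
    · simpa using memLp_const (1 : ℝ)
    have h1 : MemLp (id : ℝ → ℝ) (2 * q) (gaussianReal 0 1) :=
      memLp_id_gaussianReal' _ (by finiteness)
    have h2 := h1.norm_rpow_div (q : ℝ≥0∞)
    rw [ENNReal.mul_div_cancel_right (by simp [hq.ne']) (by simp)] at h2
    simpa using h2
  set D := (eLpNorm (fun y : ℝ => |y| ^ q) 2 (gaussianReal 0 1)).toReal with hD
  have hD' : eLpNorm (fun y : ℝ => |y| ^ q) 2 (gaussianReal 0 1) = ENNReal.ofReal D :=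
    (ENNReal.ofReal_toReal hg.2.ne).symm
  have hD0 : 0 ≤ D := ENNReal.toReal_nonneg
  refine ⟨2 ^ q * (D + D), by positivity, fun ι Φ τ κ i hΦ hτ hκ h => ?_⟩
  have hi : MeasurePreserving (fun x : ι → ℝ => Φ x i) (stdG ι) (gaussianReal 0 1) :=
    (measurePreserving_eval_stdG i).comp hΦ
  have h0 := measurePreserving_eval_stdG (ι := ι) i
  have m1 : Measurable fun x : ι → ℝ => Φ x i := hi.measurable
  have m0 : Measurable fun x : ι → ℝ => x i := measurable_pi_apply i
  have e1 : eLpNorm (fun x : ι → ℝ => |Φ x i| ^ q) 2 (stdG ι) = ENNReal.ofReal D := by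
    rw [← hD', ← eLpNorm_comp_measurePreserving hg.1 hi]; rfl
  have e0 : eLpNorm (fun x : ι → ℝ => |x i| ^ q) 2 (stdG ι) = ENNReal.ofReal D := by
    rw [← hD', ← eLpNorm_comp_measurePreserving hg.1 h0]; rfl
  have hB : eLpNorm (fun x : ι → ℝ => (|x i| + |Φ x i|) ^ q) 2 (stdG ι)
      ≤ ENNReal.ofReal (2 ^ q * (D + D)) := by
    calc eLpNorm (fun x : ι → ℝ => (|x i| + |Φ x i|) ^ q) 2 (stdG ι)
        ≤ eLpNorm ((2 : ℝ) ^ q • ((fun x : ι → ℝ => |x i| ^ q) + fun x => |Φ x i| ^ q)) 2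
          (stdG ι) := by
          refine eLpNorm_mono_real fun x => ?_
          rw [Real.norm_eq_abs, abs_of_nonneg (by positivity)]
          simp only [Pi.smul_apply, Pi.add_apply, smul_eq_mul]
          refine (add_pow_le (abs_nonneg _) (abs_nonneg _) q).trans ?_
          exact mul_le_mul_of_nonneg_right
            (pow_le_pow_right₀ (by norm_num) (Nat.sub_le _ _)) (by positivity)
      _ ≤ ENNReal.ofReal (2 ^ q) * (ENNReal.ofReal D + ENNReal.ofReal D) := by
          rw [eLpNorm_const_smul, Real.enorm_eq_ofReal_abs, abs_of_nonneg (by positivity)]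
          refine mul_le_mul_right ?_ _
          have := eLpNorm_add_le (μ := stdG ι) (p := 2)
            (f := fun x : ι → ℝ => |x i| ^ q) (g := fun x => |Φ x i| ^ q)
            (m0.abs.pow_const q).aestronglyMeasurable (m1.abs.pow_const q).aestronglyMeasurable
            (by norm_num)
          rwa [e0, e1] at this
      _ = _ := by rw [← ENNReal.ofReal_add hD0 hD0, ← ENNReal.ofReal_mul (by positivity)]
  have hmul := eLpNorm_smul_le_mul_eLpNorm (μ := stdG ι) (p := 2) (q := 2) (r := 1)
    (f := fun x : ι → ℝ => (|x i| + |Φ x i|) ^ q) (φ := fun x : ι → ℝ => Φ x i - x i)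
    ((m0.abs.add m1.abs).pow_const q).aestronglyMeasurable (m1.sub m0).aestronglyMeasurable
  rw [eLpNorm_one_eq_lintegral_enorm] at hmul
  calc ∫⁻ x, ENNReal.ofReal (|Φ x i - x i| * (|x i| + |Φ x i|) ^ q) ∂stdG ι
      = ∫⁻ x, ‖((fun x : ι → ℝ => Φ x i - x i) • fun x : ι → ℝ => (|x i| + |Φ x i|) ^ q) x‖ₑ
          ∂stdG ι := by
        refine lintegral_congr fun x => ?_
        rw [Real.enorm_eq_ofReal_abs, Pi.smul_apply', smul_eq_mul, abs_mul,
          abs_of_nonneg (by positivity : (0 : ℝ) ≤ (|x i| + |Φ x i|) ^ q)]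
    _ ≤ _ := hmul
    _ ≤ ENNReal.ofReal (τ * κ) * ENNReal.ofReal (2 ^ q * (D + D)) :=
        mul_le_mul' (eLpNorm_increment_le hτ h) hB
    _ = _ := by rw [← ENNReal.ofReal_mul (by positivity)]

/-- Moments of the maximum of an orbit. -/
theorem lintegral_orbitPath_pow_le {T : ℝ} (hT : 0 < T) {p : ℕ} (hp : p ≠ 0) :
    ∃ C : ℝ, 0 ≤ C ∧ ∀ (ι : Type) (Φ : (ι → ℝ) → ι → ℝ) (τ κ : ℝ) (i : ι),
      MeasurePreserving Φ (stdG ι) (stdG ι) → 0 < τ → τ ≤ 1 → 0 ≤ κ →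
      eLpNorm (fun x => (Φ x i - x i) / τ) 2 (stdG ι) ≤ ENNReal.ofReal κ →
      ∫⁻ x, ‖orbitPath T τ Φ x i‖ₑ ^ p ∂stdG ι ≤ ENNReal.ofReal (C * (1 + κ)) := by
  obtain ⟨B, hB0, hB⟩ := lintegral_increment_mul_le (p - 1)
  have hg : Integrable (fun y : ℝ => |y| ^ p) (gaussianReal 0 1) := by
    have h1 : MemLp (id : ℝ → ℝ) p (gaussianReal 0 1) := memLp_id_gaussianReal' _ (by simp)
    simpa using h1.integrable_norm_pow hp
  set A := ∫ y, |y| ^ p ∂gaussianReal 0 1 with hA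
  have hA0 : 0 ≤ A := integral_nonneg fun y => by positivity
  refine ⟨A + (T + 2) * p * B, by positivity, fun ι Φ τ κ i hΦ hτ hτ1 hκ h => ?_⟩
  have hΦm := hΦ.measurable
  set J : (ι → ℝ) → ℝ := fun x => |Φ x i - x i| * (|x i| + |Φ x i|) ^ (p - 1) with hJ
  have hJm : Measurable J := by
    have m1 : Measurable fun x : ι → ℝ => Φ x i := (measurable_pi_apply i).comp hΦm
    fun_prop
  have hJ0 : ∀ x, 0 ≤ J x := fun x => by positivity
  have hb : ∀ x, ‖orbitPath T τ Φ x i‖ₑ ^ p ≤ ENNReal.ofReal (|x i| ^ p)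
      + ∑ j ∈ Finset.range (steps T τ), ENNReal.ofReal p * ENNReal.ofReal (J (Φ^[j] x)) := by
    intro x
    set S : ℝ := |x i| ^ p + ∑ j ∈ Finset.range (steps T τ), p * J (Φ^[j] x) with hS
    have hS0 : 0 ≤ S := add_nonneg (by positivity)
      (Finset.sum_nonneg fun j _ => mul_nonneg (Nat.cast_nonneg _) (hJ0 _))
    have h1 : ‖orbitPath T τ Φ x i‖ ≤ S ^ ((p : ℝ)⁻¹) := by
      refine (ContinuousMap.norm_le _ (by positivity)).2 fun t => ?_
      have h2 := abs_interp_pow_le (u := fun k => Φ^[k] x i) hτ p t.2.1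
        (t.2.2.trans_lt (lt_steps_mul hτ))
      rw [← Real.pow_rpow_inv_natCast (norm_nonneg _) hp]
      refine Real.rpow_le_rpow (by positivity) (h2.trans_eq ?_) (by positivity)
      simp only [hS, hJ, Function.iterate_succ_apply']
      rfl
    have h2 : ‖orbitPath T τ Φ x i‖ ^ p ≤ S := by
      refine (pow_le_pow_left₀ (norm_nonneg _) h1 p).trans_eq ?_
      rw [Real.rpow_inv_natCast_pow hS0 hp]
    rw [← ofReal_norm, ← ENNReal.ofReal_pow (norm_nonneg _)]
    refine (ENNReal.ofReal_le_ofReal h2).trans_eq ?_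
    rw [hS, ENNReal.ofReal_add (by positivity)
      (Finset.sum_nonneg fun j _ => mul_nonneg (Nat.cast_nonneg _) (hJ0 _)),
      ENNReal.ofReal_sum_of_nonneg fun j _ => mul_nonneg (Nat.cast_nonneg _) (hJ0 _)]
    congr 1
    exact Finset.sum_congr rfl fun j _ => ENNReal.ofReal_mul (Nat.cast_nonneg _)
  have hN := steps_mul_le hT hτ
  -- By invariance all terms of the telescoped sum have the same integral, of order τκ. There are
  -- about T/τ of them, so τ drops out.
  calc ∫⁻ x, ‖orbitPath T τ Φ x i‖ₑ ^ p ∂stdG ι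
      ≤ ∫⁻ x, (ENNReal.ofReal (|x i| ^ p)
        + ∑ j ∈ Finset.range (steps T τ), ENNReal.ofReal p * ENNReal.ofReal (J (Φ^[j] x)))
          ∂stdG ι := lintegral_mono hb
    _ = ENNReal.ofReal A + ∑ j ∈ Finset.range (steps T τ),
          ENNReal.ofReal p * ∫⁻ x, ENNReal.ofReal (J x) ∂stdG ι := by
        have hmj : ∀ j, Measurable fun x => ENNReal.ofReal p * ENNReal.ofReal (J (Φ^[j] x)) :=
          fun j => ((hJm.comp (hΦm.iterate j)).ennreal_ofReal).const_mul _
        rw [lintegral_add_left (((measurable_pi_apply i).abs.pow_const p).ennreal_ofReal),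
          lintegral_finsetSum _ fun j _ => hmj j]
        congr 1
        · rw [(measurePreserving_eval_stdG i).lintegral_comp
            (f := fun y => ENNReal.ofReal (|y| ^ p)) (by fun_prop), hA,
            ofReal_integral_eq_lintegral_ofReal hg (ae_of_all _ fun y => by positivity)]
        · refine Finset.sum_congr rfl fun j _ => ?_
          have hJj : Measurable fun x => ENNReal.ofReal (J (Φ^[j] x)) :=
            (hJm.comp (hΦm.iterate j)).ennreal_ofReal
          rw [lintegral_const_mul _ hJj, (hΦ.iterate j).lintegral_comp (f := fun y => ENNReal.ofReal (J y)) hJm.ennreal_ofReal]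
    _ ≤ ENNReal.ofReal A + ∑ j ∈ Finset.range (steps T τ),
          ENNReal.ofReal p * ENNReal.ofReal (τ * κ * B) := by
        gcongr
        exact hB ι Φ τ κ i hΦ hτ hκ h
    _ = ENNReal.ofReal (A + steps T τ * (p * (τ * κ * B))) := by
        rw [Finset.sum_const, Finset.card_range, nsmul_eq_mul,
          ENNReal.ofReal_add hA0 (by positivity), ENNReal.ofReal_mul (Nat.cast_nonneg _),
          ENNReal.ofReal_natCast, ENNReal.ofReal_natCast, ENNReal.ofReal_mul (Nat.cast_nonneg _),
          ENNReal.ofReal_natCast]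
    _ ≤ _ := by
        refine ENNReal.ofReal_le_ofReal ?_
        have h3 : (steps T τ : ℝ) * (p * (τ * κ * B)) ≤ (T + 2) * p * B * κ := by
          have : (steps T τ : ℝ) * τ ≤ T + 2 := by linarith
          calc (steps T τ : ℝ) * (p * (τ * κ * B)) = (steps T τ * τ) * (p * B * κ) := by ring
            _ ≤ (T + 2) * (p * B * κ) := mul_le_mul_of_nonneg_right this (by positivity)
            _ = _ := by ring
        have h4 : 0 ≤ A * κ := by positivity
        have h5 : 0 ≤ (T + 2) * p * B := by positivity
        nlinarith

/-- The squared `L²`-norm in time of the velocity of an orbit. -/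
theorem lintegral_sum_increment_sq_le {T : ℝ} (hT : 0 < T) {Φ : (ι → ℝ) → ι → ℝ} {τ κ : ℝ} {i : ι}
    (hΦ : MeasurePreserving Φ (stdG ι) (stdG ι)) (hτ : 0 < τ) (hτ1 : τ ≤ 1) (hκ : 0 ≤ κ)
    (h : eLpNorm (fun x => (Φ x i - x i) / τ) 2 (stdG ι) ≤ ENNReal.ofReal κ) :
    ∫⁻ x, ENNReal.ofReal (∑ k ∈ Finset.range (steps T τ),
      τ * ((Φ^[k + 1] x i - Φ^[k] x i) / τ) ^ 2) ∂stdG ι ≤ ENNReal.ofReal ((T + 2) * κ ^ 2) := by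
  have hΦm := hΦ.measurable
  set J : (ι → ℝ) → ℝ := fun x => (Φ x i - x i) / τ with hJ
  have hJm : Measurable J := by
    have m1 : Measurable fun x : ι → ℝ => Φ x i := (measurable_pi_apply i).comp hΦm
    fun_prop
  have e2 : ∫⁻ x, ENNReal.ofReal (J x ^ 2) ∂stdG ι ≤ ENNReal.ofReal (κ ^ 2) := by
    have h1 := eLpNorm_nnreal_pow_eq_lintegral (μ := stdG ι) (f := J) (p := 2) (by norm_num)
    have h2 : ∫⁻ x, ENNReal.ofReal (J x ^ 2) ∂stdG ι = eLpNorm J 2 (stdG ι) ^ 2 := by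
      have h3 : eLpNorm J (2 : ℝ≥0) (stdG ι) = eLpNorm J 2 (stdG ι) := by norm_num
      rw [h3] at h1
      have h4 : ((2 : ℝ≥0) : ℝ) = (2 : ℕ) := by norm_num
      rw [h4, ENNReal.rpow_natCast] at h1
      rw [h1]
      refine lintegral_congr fun x => ?_
      rw [ENNReal.rpow_natCast, Real.enorm_eq_ofReal_abs, ← ENNReal.ofReal_pow (abs_nonneg _),
        sq_abs]
    rw [h2, ENNReal.ofReal_pow hκ]
    exact pow_le_pow_left' h 2
  have hN := steps_mul_le hT hτ
  calc ∫⁻ x, ENNReal.ofReal (∑ k ∈ Finset.range (steps T τ),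
        τ * ((Φ^[k + 1] x i - Φ^[k] x i) / τ) ^ 2) ∂stdG ι
      = ∫⁻ x, ∑ k ∈ Finset.range (steps T τ), ENNReal.ofReal τ
          * ENNReal.ofReal (J (Φ^[k] x) ^ 2) ∂stdG ι := by
        refine lintegral_congr fun x => ?_
        rw [ENNReal.ofReal_sum_of_nonneg fun k _ => by positivity]
        refine Finset.sum_congr rfl fun k _ => ?_
        rw [ENNReal.ofReal_mul hτ.le, Function.iterate_succ_apply']
    _ = ∑ k ∈ Finset.range (steps T τ), ENNReal.ofReal τ
          * ∫⁻ x, ENNReal.ofReal (J x ^ 2) ∂stdG ι := by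
        have hmk : ∀ k, Measurable fun x => ENNReal.ofReal (J (Φ^[k] x) ^ 2) := fun k =>
          ((hJm.comp (hΦm.iterate k)).pow_const 2).ennreal_ofReal
        rw [lintegral_finsetSum _ fun k _ => (hmk k).const_mul _]
        refine Finset.sum_congr rfl fun k _ => ?_
        rw [lintegral_const_mul _ (hmk k), (hΦ.iterate k).lintegral_comp
          (f := fun y => ENNReal.ofReal (J y ^ 2)) (hJm.pow_const 2).ennreal_ofReal]
    _ ≤ ∑ k ∈ Finset.range (steps T τ), ENNReal.ofReal τ * ENNReal.ofReal (κ ^ 2) := by gcongr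
    _ = ENNReal.ofReal (steps T τ * (τ * κ ^ 2)) := by
        rw [Finset.sum_const, Finset.card_range, nsmul_eq_mul, ENNReal.ofReal_mul (Nat.cast_nonneg _),
          ENNReal.ofReal_natCast, ENNReal.ofReal_mul hτ.le]
    _ ≤ _ := by
        refine ENNReal.ofReal_le_ofReal ?_
        rw [← mul_assoc]
        exact mul_le_mul_of_nonneg_right (by linarith) (sq_nonneg _)

/-- The orbit at time `t` without interpolation. -/
def orbitStep (τ : ℝ) (Φ : (ι → ℝ) → ι → ℝ) (t : ℝ) (x : ι → ℝ) : ι → ℝ := Φ^[⌊t / τ⌋₊] x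

theorem measurePreserving_orbitStep {Φ : (ι → ℝ) → ι → ℝ}
    (hΦ : MeasurePreserving Φ (stdG ι) (stdG ι)) (τ t : ℝ) :
    MeasurePreserving (orbitStep τ Φ t) (stdG ι) (stdG ι) := hΦ.iterate _

theorem measurable_orbitStep {Φ : (ι → ℝ) → ι → ℝ} (hΦ : Measurable Φ) (τ : ℝ) :
    Measurable fun p : ℝ × (ι → ℝ) => orbitStep τ Φ p.1 p.2 := by
  have h1 : Measurable fun p : ℕ × (ι → ℝ) => Φ^[p.1] p.2 :=
    measurable_from_prod_countable_right fun n => hΦ.iterate n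
  exact h1.comp (f := fun p : ℝ × (ι → ℝ) => (⌊p.1 / τ⌋₊, p.2))
    ((Nat.measurable_floor.comp (measurable_fst.div_const τ)).prodMk measurable_snd)

/-- Within a time step the interpolation strays by at most one increment of Φ, taken at a point with
Gaussian law. The continuous path can thus be traded for the orbit, whose law is exactly invariant.
-/
theorem eLpNorm_orbitPath_sub_le {T : ℝ} {Φ : (ι → ℝ) → ι → ℝ} {τ κ : ℝ} {i : ι}
    (hΦ : MeasurePreserving Φ (stdG ι) (stdG ι)) (hτ : 0 < τ)
    (h : eLpNorm (fun x => (Φ x i - x i) / τ) 2 (stdG ι) ≤ ENNReal.ofReal κ)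
    (t : Icc (0 : ℝ) T) :
    eLpNorm (fun x => orbitPath T τ Φ x i t - orbitStep τ Φ t x i) 2 (stdG ι)
      ≤ ENNReal.ofReal (τ * κ) := by
  have m1 : Measurable fun x : ι → ℝ => Φ x i := (measurable_pi_apply i).comp hΦ.measurable
  refine le_trans ?_ (eLpNorm_increment_le hτ h)
  rw [← eLpNorm_comp_measurePreserving (g := fun x => Φ x i - x i)
    ((m1.sub (measurable_pi_apply i)).aestronglyMeasurable)
    (measurePreserving_orbitStep hΦ τ (t : ℝ))]
  refine eLpNorm_mono fun x => ?_
  have := abs_interp_sub_le (u := fun k => Φ^[k] x i) hτ t.2.1 (t.2.2.trans_lt (lt_steps_mul hτ))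
  simp only [Function.iterate_succ_apply'] at this
  exact this

/-- The law of the orbit is nearly invariant under time shifts. -/
theorem eLpNorm_orbitStep_shift_le {Φ : (ι → ℝ) → ι → ℝ} {τ κ : ℝ} {i : ι}
    (hΦ : MeasurePreserving Φ (stdG ι) (stdG ι)) (hτ : 0 < τ)
    (h : eLpNorm (fun x => (Φ x i - x i) / τ) 2 (stdG ι) ≤ ENNReal.ofReal κ)
    {t r : ℝ} (ht : 0 ≤ t) (hr : 0 ≤ r) :
    eLpNorm (fun x => orbitStep τ Φ (t + r) x i - orbitStep τ Φ t (orbitStep τ Φ r x) i) 2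
      (stdG ι) ≤ ENNReal.ofReal (τ * κ) := by
  have m1 : Measurable fun x : ι → ℝ => Φ x i := (measurable_pi_apply i).comp hΦ.measurable
  have e : ∀ x, orbitStep τ Φ t (orbitStep τ Φ r x) = Φ^[⌊t / τ⌋₊ + ⌊r / τ⌋₊] x := fun x => by
    rw [Function.iterate_add_apply]; rfl
  -- The floor of a sum exceeds the sum of the floors by 0 or 1, so shifting time and composing
  -- differ by at most one application of Φ.
  have h1 : ⌊t / τ⌋₊ + ⌊r / τ⌋₊ ≤ ⌊(t + r) / τ⌋₊ := by
    rw [add_div]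
    refine Nat.le_floor ?_
    push_cast
    exact add_le_add (Nat.floor_le (by positivity)) (Nat.floor_le (by positivity))
  have h2 : ⌊(t + r) / τ⌋₊ ≤ ⌊t / τ⌋₊ + ⌊r / τ⌋₊ + 1 := by
    rw [← Nat.lt_succ_iff, Nat.floor_lt (by positivity), add_div]
    have := Nat.lt_floor_add_one (t / τ)
    have := Nat.lt_floor_add_one (r / τ)
    push_cast
    linarith
  rcases h1.eq_or_lt with h3 | h3
  · have : (fun x => orbitStep τ Φ (t + r) x i - orbitStep τ Φ t (orbitStep τ Φ r x) i)
        = fun _ : ι → ℝ => (0 : ℝ) := by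
      ext x
      rw [e, h3]
      exact sub_self _
    rw [this]
    simp
  · have h4 : ⌊(t + r) / τ⌋₊ = (⌊t / τ⌋₊ + ⌊r / τ⌋₊) + 1 := by omega
    have : (fun x => orbitStep τ Φ (t + r) x i - orbitStep τ Φ t (orbitStep τ Φ r x) i)
        = (fun x => Φ x i - x i) ∘ Φ^[⌊t / τ⌋₊ + ⌊r / τ⌋₊] := by
      ext x
      rw [e, orbitStep, h4, Function.iterate_succ_apply']
      rfl
    rw [this, eLpNorm_comp_measurePreserving (g := fun x => Φ x i - x i)
      ((m1.sub (measurable_pi_apply i)).aestronglyMeasurable) (hΦ.iterate _)]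
    exact eLpNorm_increment_le hτ h

end Approximation


/-! ### Compactness of the laws of the approximations -/

section Compactness

/-- A set of paths that are uniformly bounded at `0` and uniformly Hölder continuous. -/
def holderSet (T M : ℝ) (h0 : (0 : ℝ) ∈ Icc 0 T) : Set C(Icc (0 : ℝ) T, ℝ) :=
  {f | |f ⟨0, h0⟩| ≤ M ∧ ∀ s t : Icc (0 : ℝ) T, (f t - f s) ^ 2 ≤ M * dist t s}

/-- Arzelà–Ascoli. The conditions are closed under pointwise convergence and confine the values to a
fixed interval, and the common Hölder modulus gives equicontinuity. -/
theorem isCompact_holderSet (T M : ℝ) (h0 : (0 : ℝ) ∈ Icc 0 T) : IsCompact (holderSet T M h0) := by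
  have hb : Tendsto (fun d : ℝ => Real.sqrt (M * d)) (𝓝 0) (𝓝 0) := by
    have : Continuous fun d : ℝ => Real.sqrt (M * d) := by fun_prop
    simpa using this.tendsto 0
  have hmod : ∀ g : Icc (0 : ℝ) T → ℝ, (∀ s t, (g t - g s) ^ 2 ≤ M * dist t s) → ∀ s t,
      dist (g s) (g t) ≤ Real.sqrt (M * dist s t) := by
    intro g hg s t
    rw [Real.dist_eq]
    exact Real.abs_le_sqrt (hg t s)
  refine ArzelaAscoli.isCompact_of_equicontinuous _ ?_ ?_
  · have e : ContinuousMap.toFun '' holderSet T M h0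
        = {g : Icc (0 : ℝ) T → ℝ | |g ⟨0, h0⟩| ≤ M ∧ ∀ s t, (g t - g s) ^ 2 ≤ M * dist t s} := by
      ext g
      constructor
      · rintro ⟨f, hf, rfl⟩
        exact hf
      · intro hg
        have hc : Continuous g := (Metric.equicontinuous_of_continuity_modulus _ hb
          (fun _ : Unit => g) fun s t _ => hmod g hg.2 s t).continuous ()
        exact ⟨⟨g, hc⟩, hg, rfl⟩
    rw [e]
    refine IsCompact.of_isClosed_subset (isCompact_univ_pi fun _ : Icc (0 : ℝ) T =>
      isCompact_Icc (a := -(M + Real.sqrt (M * T))) (b := M + Real.sqrt (M * T))) ?_ ?_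
    · have h1 : IsClosed {g : Icc (0 : ℝ) T → ℝ | |g ⟨0, h0⟩| ≤ M} :=
        isClosed_le (continuous_apply _).abs continuous_const
      have h2 : IsClosed (⋂ s, ⋂ t, {g : Icc (0 : ℝ) T → ℝ | (g t - g s) ^ 2 ≤ M * dist t s}) :=
        isClosed_iInter fun s => isClosed_iInter fun t =>
          isClosed_le (f := fun g : Icc (0 : ℝ) T → ℝ => (g t - g s) ^ 2)
            (((continuous_apply t).sub (continuous_apply s)).pow 2) continuous_const
      convert h1.inter h2 using 1
      ext g
      simp only [mem_inter_iff, mem_iInter, mem_ofPred_eq]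
    · intro g hg t _
      have h1 := hmod g hg.2 t ⟨0, h0⟩
      have hM : 0 ≤ M := (abs_nonneg _).trans hg.1
      have h2 : dist t ⟨0, h0⟩ ≤ T := by
        rw [Subtype.dist_eq, Real.dist_eq, sub_zero, abs_of_nonneg t.2.1]
        exact t.2.2
      have h3 : |g t - g ⟨0, h0⟩| ≤ Real.sqrt (M * T) :=
        h1.trans (Real.sqrt_le_sqrt (mul_le_mul_of_nonneg_left h2 hM))
      have h4 := abs_sub_abs_le_abs_sub (g t) (g ⟨0, h0⟩)
      rw [mem_Icc, ← abs_le]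
      linarith [hg.1]
  · exact Metric.equicontinuous_of_continuity_modulus _ hb _ fun s t f => hmod _ f.2.2 s t

variable {ι : Type}

/-- Tychonoff's theorem, with the admissible error ε split into a summable family over the countably
many factors. -/
theorem isTightMeasureSet_pi [Countable ι] {X : ι → Type} [∀ i, TopologicalSpace (X i)]
    [∀ i, MeasurableSpace (X i)] {S : Set (Measure (∀ i, X i))}
    (h : ∀ i, ∀ ε : ℝ≥0∞, ε ≠ 0 → ∃ K : Set (X i), IsCompact K ∧
      ∀ μ ∈ S, μ {x | x i ∉ K} ≤ ε) : IsTightMeasureSet S := by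
  rw [isTightMeasureSet_iff_exists_isCompact_measure_compl_le]
  intro ε hε
  obtain ⟨ε', h1, h2⟩ := ENNReal.exists_pos_sum_of_countable' hε.ne' ι
  choose K hK hKS using fun i => h i (ε' i) (h1 i).ne'
  refine ⟨Set.pi univ K, isCompact_univ_pi hK, fun μ hμ => ?_⟩
  have e : (Set.pi univ K)ᶜ = ⋃ i, {x : ∀ i, X i | x i ∉ K i} := by
    ext x
    simp
  rw [e]
  exact (measure_iUnion_le _).trans
    ((ENNReal.tsum_le_tsum fun i => hKS i μ hμ).trans h2.le)

/-- Markov's inequality for the initial value and for the discrete energy Σ τ (Δu/τ)², which bounds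
the squared Hölder constant by `interp_sub_sq_le`. -/
theorem measure_orbitPath_notMem_holderSet_le {T : ℝ} (hT : 0 < T) {Φ : (ι → ℝ) → ι → ℝ} {τ κ : ℝ}
    {i : ι} (hΦ : MeasurePreserving Φ (stdG ι) (stdG ι)) (hτ : 0 < τ) (hτ1 : τ ≤ 1) (hκ : 0 ≤ κ)
    (h : eLpNorm (fun x => (Φ x i - x i) / τ) 2 (stdG ι) ≤ ENNReal.ofReal κ) {M : ℝ} (hM : 0 < M) :
    stdG ι {x | orbitPath T τ Φ x i ∉ holderSet T M ⟨le_rfl, hT.le⟩}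
      ≤ (∫⁻ x, ‖x i‖ₑ ∂stdG ι + ENNReal.ofReal ((T + 2) * κ ^ 2)) / ENNReal.ofReal M := by
  set D : (ι → ℝ) → ℝ := fun x => ∑ k ∈ Finset.range (steps T τ),
      τ * ((Φ^[k + 1] x i - Φ^[k] x i) / τ) ^ 2 with hD
  have hDm : Measurable D := by
    refine Finset.measurable_sum _ fun k _ => ?_
    have hk : ∀ k, Measurable fun x => Φ^[k] x i := fun k =>
      (measurable_pi_apply i).comp (hΦ.measurable.iterate k)
    exact ((((hk (k + 1)).sub (hk k)).div_const τ).pow_const 2).const_mul τ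
  have hsub : {x | orbitPath T τ Φ x i ∉ holderSet T M ⟨le_rfl, hT.le⟩}
      ⊆ {x | ENNReal.ofReal M ≤ ‖x i‖ₑ} ∪ {x | ENNReal.ofReal M ≤ ENNReal.ofReal (D x)} := by
    intro x hx
    by_contra hcon
    simp only [mem_union, mem_ofPred_eq, not_or, not_le] at hcon
    refine hx ⟨?_, fun s t => ?_⟩
    · have e : orbitPath T τ Φ x i ⟨0, ⟨le_rfl, hT.le⟩⟩ = x i :=
        interp_zero (u := fun k => Φ^[k] x i) hτ
      rw [e]
      have := hcon.1
      rw [Real.enorm_eq_ofReal_abs, ENNReal.ofReal_lt_ofReal_iff hM] at this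
      exact this.le
    · have h1 := hcon.2
      rw [ENNReal.ofReal_lt_ofReal_iff hM] at h1
      have key : ∀ s t : Icc (0 : ℝ) T, (s : ℝ) ≤ t →
          (orbitPath T τ Φ x i t - orbitPath T τ Φ x i s) ^ 2 ≤ M * dist t s := by
        intro s t hst
        have h2 := interp_sub_sq_le (u := fun k => Φ^[k] x i) hτ s.2.1 hst
          (t.2.2.trans (lt_steps_mul (T := T) hτ).le)
        refine h2.trans ?_
        rw [Subtype.dist_eq, Real.dist_eq, abs_of_nonneg (by linarith)]
        exact mul_le_mul_of_nonneg_right h1.le (by linarith)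
      rcases le_total (s : ℝ) t with hst | hst
      · exact key s t hst
      · have := key t s hst
        rw [dist_comm, ← neg_sub, neg_sq]
        exact this
  refine (measure_mono hsub).trans ((measure_union_le _ _).trans ?_)
  rw [ENNReal.add_div]
  have hM' : ENNReal.ofReal M ≠ 0 := by simpa using hM
  refine add_le_add ?_ ?_
  · exact meas_ge_le_lintegral_div (measurable_pi_apply i).enorm.aemeasurable hM' (by simp)
  · refine (meas_ge_le_lintegral_div hDm.ennreal_ofReal.aemeasurable hM' (by simp)).trans ?_
    exact ENNReal.div_le_div_right (lintegral_sum_increment_sq_le hT hΦ hτ hτ1 hκ h) _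

/-- Measure preserving maps with uniformly bounded velocities. -/
structure IsApproxFlow (κ : ι → ℝ) (τ : ℕ → ℝ) (Φ : ℕ → (ι → ℝ) → ι → ℝ) : Prop where
  measurePreserving : ∀ n, MeasurePreserving (Φ n) (stdG ι) (stdG ι)
  pos : ∀ n, 0 < τ n
  le_one : ∀ n, τ n ≤ 1
  tendsto : Tendsto τ atTop (𝓝 0)
  nonneg : ∀ i, 0 ≤ κ i
  bound : ∀ n i, eLpNorm (fun x => (Φ n x i - x i) / τ n) 2 (stdG ι) ≤ ENNReal.ofReal (κ i)

variable {κ : ι → ℝ} {τ : ℕ → ℝ} {Φ : ℕ → (ι → ℝ) → ι → ℝ}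

theorem IsApproxFlow.measurable_orbitPath (h : IsApproxFlow κ τ Φ) (T : ℝ) (n : ℕ) :
    Measurable (orbitPath T (τ n) (Φ n)) :=
  BQG.measurable_orbitPath (h.measurePreserving n).measurable

/-- A limit law of the approximations, by Prokhorov's theorem. -/
theorem IsApproxFlow.exists_limit [Countable ι] (h : IsApproxFlow κ τ Φ) {T : ℝ} (hT : 0 < T) :
    ∃ P : Measure (ι → C(Icc (0 : ℝ) T, ℝ)), IsProbabilityMeasure P ∧ ∃ U : Filter ℕ, U.NeBot ∧
      U ≤ atTop ∧ ∀ f : (ι → C(Icc (0 : ℝ) T, ℝ)) →ᵇ ℝ,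
        Tendsto (fun n => ∫ x, f (orbitPath T (τ n) (Φ n) x) ∂stdG ι) U (𝓝 (∫ w, f w ∂P)) := by
  have hm := h.measurable_orbitPath T
  let μ : ℕ → ProbabilityMeasure (ι → C(Icc (0 : ℝ) T, ℝ)) := fun n =>
    ⟨(stdG ι).map (orbitPath T (τ n) (Φ n)),
      Measure.isProbabilityMeasure_map (hm n).aemeasurable⟩
  have htight : IsTightMeasureSet
      {((ν : ProbabilityMeasure (ι → C(Icc (0 : ℝ) T, ℝ))) :
        Measure (ι → C(Icc (0 : ℝ) T, ℝ))) | ν ∈ range μ} := by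
    refine isTightMeasureSet_pi fun i ε hε => ?_
    set D : ℝ≥0∞ := ∫⁻ x, ‖x i‖ₑ ∂stdG ι + ENNReal.ofReal ((T + 2) * κ i ^ 2) with hD
    have hDfin : D ≠ ∞ := by
      have h1 := (memLp_eval (ι := ι) i (p := 1) (by simp)).2
      rw [eLpNorm_one_eq_lintegral_enorm] at h1
      exact ENNReal.add_ne_top.2 ⟨h1.ne, by simp⟩
    have hlim : Tendsto (fun M : ℝ => D / ENNReal.ofReal M) atTop (𝓝 0) := by
      have := ENNReal.Tendsto.const_div (a := D) ENNReal.tendsto_ofReal_atTop (Or.inr hDfin)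
      simpa using this
    obtain ⟨M, hM1, hM2⟩ := ((hlim.eventually_le_const (pos_iff_ne_zero.2 hε)).and
      (eventually_gt_atTop 0)).exists
    refine ⟨_, isCompact_holderSet T M ⟨le_rfl, hT.le⟩, ?_⟩
    rintro _ ⟨_, ⟨n, rfl⟩, rfl⟩
    change (stdG ι).map (orbitPath T (τ n) (Φ n)) _ ≤ ε
    rw [Measure.map_apply (hm n)]
    · exact (measure_orbitPath_notMem_holderSet_le hT (h.measurePreserving n) (h.pos n)
        (h.le_one n) (h.nonneg i) (h.bound n i) hM2).trans hM1
    · exact (measurable_pi_apply (X := fun _ : ι => C(Icc (0 : ℝ) T, ℝ)) i)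
        (isCompact_holderSet T M ⟨le_rfl, hT.le⟩).measurableSet.compl
  have hcomp := isCompact_closure_of_isTightMeasureSet htight
  -- An ultrafilter finer than `atTop` takes the place of a subsequence: its image converges in the
  -- compact closure.
  let U : Ultrafilter ℕ := hyperfilter ℕ
  obtain ⟨P, -, hP⟩ := hcomp.ultrafilter_le_nhds (U.map μ) (by
    rw [le_principal_iff, Ultrafilter.mem_coe, Ultrafilter.mem_map]
    exact mem_of_superset univ_mem fun n _ => subset_closure ⟨n, rfl⟩)
  refine ⟨P, inferInstance, U, inferInstance, by
    rw [← Nat.cofinite_eq_atTop]; exact hyperfilter_le_cofinite, fun f => ?_⟩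
  have h1 : Tendsto μ U (𝓝 P) := hP
  have h2 := (ProbabilityMeasure.tendsto_iff_forall_integral_tendsto.1 h1) f
  refine h2.congr fun n => ?_
  change ∫ w, f w ∂((stdG ι).map (orbitPath T (τ n) (Φ n))) = _
  rw [integral_map (hm n).aemeasurable f.continuous.aestronglyMeasurable]

end Compactness

/-! ### Finite-dimensional distributions -/

section Laws

theorem measurable_cos_sum {Ω : Type*} [MeasurableSpace Ω] {κ : Type} (I : Finset κ) (θ : κ → ℝ)
    (c : ℝ) {f : κ → Ω → ℝ} (hf : ∀ k, Measurable (f k)) :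
    Measurable fun x => Real.cos (∑ k ∈ I, θ k * f k x + c) :=
  Real.measurable_cos.comp ((Finset.measurable_sum _ fun k _ => (hf k).const_mul _).add_const c)

theorem measurable_eval_path {T : ℝ} {ι : Type} (i : ι) (t : Icc (0 : ℝ) T) :
    Measurable fun w : ι → C(Icc (0 : ℝ) T, ℝ) => w i t :=
  (continuous_eval_const t).measurable.comp (measurable_pi_apply i)

/-- A finite measure on a product of lines is determined by its characteristic function. -/
theorem ext_of_integral_cos {κ : Type} {μ ν : Measure (κ → ℝ)} [IsFiniteMeasure μ]
    [IsFiniteMeasure ν] (h : ∀ (I : Finset κ) (θ : κ → ℝ) (c : ℝ),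
      ∫ x, Real.cos (∑ k ∈ I, θ k * x k + c) ∂μ = ∫ x, Real.cos (∑ k ∈ I, θ k * x k + c) ∂ν) :
    μ = ν := by
  classical
  have hproj : ∀ I : Finset κ, μ.map I.restrict = ν.map I.restrict := by
    intro I
    refine Measure.ext_of_charFunDual ?_
    ext L
    rw [charFunDual_apply, charFunDual_apply, integral_map (by fun_prop) (by fun_prop),
      integral_map (by fun_prop) (by fun_prop)]
    set θ : κ → ℝ := fun k => if hk : k ∈ I then L (Pi.single ⟨k, hk⟩ 1) else 0 with hθ
    have hL : ∀ x : κ → ℝ, L (I.restrict x) = ∑ k ∈ I, θ k * x k := by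
      intro x
      have h1 : I.restrict x = ∑ k : I, x k • (Pi.single k (1 : ℝ) : I → ℝ) := by
        ext j
        simp [Finset.sum_apply, Pi.single_apply]
      rw [h1, map_sum, ← Finset.sum_coe_sort I]
      refine Finset.sum_congr rfl fun k _ => ?_
      simp [hθ, mul_comm]
    -- The phase c makes one family of cosines deliver both parts of the characteristic function:
    -- the real part with c = 0, the imaginary part with c = −π/2.
    have hexp : ∀ (ρ : Measure (κ → ℝ)) [IsFiniteMeasure ρ],
        ∫ x, Complex.exp ((L (I.restrict x) : ℂ) * Complex.I) ∂ρ
          = (∫ x, Real.cos (∑ k ∈ I, θ k * x k + 0) ∂ρ : ℝ)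
            + (∫ x, Real.cos (∑ k ∈ I, θ k * x k + -(Real.pi / 2)) ∂ρ : ℝ) * Complex.I := by
      intro ρ _
      have hi : ∀ c : ℝ, Integrable (fun x : κ → ℝ => Real.cos (∑ k ∈ I, θ k * x k + c)) ρ :=
        fun c => Integrable.of_bound (C := 1)
          (measurable_cos_sum I θ c measurable_pi_apply).aestronglyMeasurable (ae_of_all _ fun x => Real.abs_cos_le_one _)
      rw [← integral_complex_ofReal, ← integral_complex_ofReal, ← integral_mul_const,
        ← integral_add (hi 0).ofReal ((hi _).ofReal.mul_const _)]
      refine integral_congr_ae (ae_of_all _ fun x => ?_)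
      simp only
      rw [hL, Complex.exp_mul_I, ← Complex.ofReal_cos, ← Complex.ofReal_sin, add_zero,
        ← sub_eq_add_neg, Real.cos_sub_pi_div_two]
    rw [hexp μ, hexp ν, h, h]
  exact IsProjectiveLimit.unique (P := fun I => ν.map I.restrict) hproj fun I => rfl

/-- The cosine is 1-Lipschitz and the L² norm dominates the L¹ norm on a probability space, so
families close in L² have close characteristic functions. -/
theorem abs_integral_cos_sub_le {Ω : Type*} [MeasurableSpace Ω] {P : Measure Ω}
    [IsProbabilityMeasure P] {κ : Type} (I : Finset κ) (θ : κ → ℝ) (c : ℝ) {f g : κ → Ω → ℝ}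
    (hf : ∀ k, Measurable (f k)) (hg : ∀ k, Measurable (g k)) {ε : κ → ℝ} (hε : ∀ k, 0 ≤ ε k)
    (h : ∀ k ∈ I, eLpNorm (fun x => f k x - g k x) 2 P ≤ ENNReal.ofReal (ε k)) :
    |∫ x, Real.cos (∑ k ∈ I, θ k * f k x + c) ∂P - ∫ x, Real.cos (∑ k ∈ I, θ k * g k x + c) ∂P|
      ≤ ∑ k ∈ I, |θ k| * ε k := by
  have hi : ∀ (f : κ → Ω → ℝ), (∀ k, Measurable (f k)) →
      Integrable (fun x => Real.cos (∑ k ∈ I, θ k * f k x + c)) P := fun f hf =>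
    Integrable.of_bound (C := 1)
      (measurable_cos_sum I θ c hf).aestronglyMeasurable (ae_of_all _ fun x => Real.abs_cos_le_one _)
  rw [← integral_sub (hi f hf) (hi g hg)]
  have hnorm : ∀ k ∈ I, Integrable (fun x => |f k x - g k x|) P ∧
      ∫ x, |f k x - g k x| ∂P ≤ ε k := by
    intro k hk
    have hm : AEStronglyMeasurable (fun x => f k x - g k x) P :=
      ((hf k).sub (hg k)).aestronglyMeasurable
    have h1 : eLpNorm (fun x => f k x - g k x) 1 P ≤ ENNReal.ofReal (ε k) :=
      (eLpNorm_le_eLpNorm_of_exponent_le (by norm_num) hm).trans (h k hk)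
    have h2 : Integrable (fun x => f k x - g k x) P :=
      memLp_one_iff_integrable.1 ⟨hm, h1.trans_lt ENNReal.ofReal_lt_top⟩
    refine ⟨h2.abs, ?_⟩
    rw [eLpNorm_one_eq_lintegral_enorm, ← ofReal_integral_norm_eq_lintegral_enorm h2,
      ENNReal.ofReal_le_ofReal_iff (hε k)] at h1
    exact h1
  calc |∫ x, (Real.cos (∑ k ∈ I, θ k * f k x + c) - Real.cos (∑ k ∈ I, θ k * g k x + c)) ∂P|
      ≤ ∫ x, ∑ k ∈ I, |θ k| * |f k x - g k x| ∂P := by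
        rw [← Real.norm_eq_abs]
        refine norm_integral_le_of_norm_le (integrable_finsetSum _ fun k hk =>
          (hnorm k hk).1.const_mul _) (ae_of_all _ fun x => ?_)
        rw [Real.norm_eq_abs]
        refine (Real.abs_cos_sub_cos_le _ _).trans ?_
        rw [add_sub_add_right_eq_sub, ← Finset.sum_sub_distrib]
        refine (Finset.abs_sum_le_sum_abs _ _).trans (Finset.sum_le_sum fun k _ => ?_)
        rw [← mul_sub, abs_mul]
    _ = ∑ k ∈ I, |θ k| * ∫ x, |f k x - g k x| ∂P := by
        rw [integral_finsetSum _ fun k hk => (hnorm k hk).1.const_mul _]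
        simp_rw [integral_const_mul]
    _ ≤ _ := Finset.sum_le_sum fun k hk =>
        mul_le_mul_of_nonneg_left (hnorm k hk).2 (abs_nonneg _)

variable {ι : Type} {κ : ι → ℝ} {τ : ℕ → ℝ} {Φ : ℕ → (ι → ℝ) → ι → ℝ}

/-- Characteristic functions of the limit process are limits of those of the orbits. -/
theorem IsApproxFlow.tendsto_integral_cos (h : IsApproxFlow κ τ Φ) {T : ℝ}
    {P : Measure (ι → C(Icc (0 : ℝ) T, ℝ))} {U : Filter ℕ} (hU : U ≤ atTop)
    (hP : ∀ f : (ι → C(Icc (0 : ℝ) T, ℝ)) →ᵇ ℝ,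
      Tendsto (fun n => ∫ x, f (orbitPath T (τ n) (Φ n) x) ∂stdG ι) U (𝓝 (∫ w, f w ∂P)))
    {κ' : Type} (I : Finset κ') (θ : κ' → ℝ) (c : ℝ) (t : κ' → Icc (0 : ℝ) T) (i : κ' → ι) :
    Tendsto (fun n => ∫ x, Real.cos (∑ k ∈ I, θ k * orbitStep (τ n) (Φ n) (t k) x (i k) + c) ∂stdG ι)
      U (𝓝 (∫ w, Real.cos (∑ k ∈ I, θ k * w (i k) (t k) + c) ∂P)) := by
  let f : (ι → C(Icc (0 : ℝ) T, ℝ)) →ᵇ ℝ := BoundedContinuousFunction.ofNormedAddCommGroup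
    (fun w => Real.cos (∑ k ∈ I, θ k * w (i k) (t k) + c))
    (by
      refine Real.continuous_cos.comp (Continuous.add (continuous_finsetSum _ fun k _ =>
        continuous_const.mul ?_) continuous_const)
      exact (continuous_eval_const (t k)).comp (continuous_apply (i k)))
    1 fun w => Real.abs_cos_le_one _
  have h1 := hP f
  refine (tendsto_iff_of_dist ?_).1 h1
  have h2 : Tendsto (fun n => ∑ k ∈ I, |θ k| * (τ n * κ (i k))) U (𝓝 0) := by
    have : Tendsto (fun n => ∑ k ∈ I, |θ k| * (τ n * κ (i k))) U
        (𝓝 (∑ k ∈ I, |θ k| * (0 * κ (i k)))) :=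
      tendsto_finsetSum _ fun k _ => ((h.tendsto.mono_left hU).mul_const _).const_mul _
    simpa using this
  refine squeeze_zero (fun n => dist_nonneg) (fun n => ?_) h2
  rw [Real.dist_eq]
  refine abs_integral_cos_sub_le I θ c (f := fun k x => orbitPath T (τ n) (Φ n) x (i k) (t k))
    (g := fun k x => orbitStep (τ n) (Φ n) (t k) x (i k)) (fun k => ?_) (fun k => ?_)
    (fun k => mul_nonneg (h.pos n).le (h.nonneg _)) fun k _ => ?_
  · exact (measurable_eval_path (i k) (t k)).comp (h.measurable_orbitPath T n)
  · exact (measurable_pi_apply (i k)).comp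
      (measurePreserving_orbitStep (h.measurePreserving n) _ _).measurable
  · exact eLpNorm_orbitPath_sub_le (h.measurePreserving n) (h.pos n) (h.bound n _) (t k)

/-- The limit process has the Gaussian law at every time. -/
theorem IsApproxFlow.map_eval_eq (h : IsApproxFlow κ τ Φ) {T : ℝ}
    {P : Measure (ι → C(Icc (0 : ℝ) T, ℝ))} [IsProbabilityMeasure P] {U : Filter ℕ} [U.NeBot]
    (hU : U ≤ atTop) (hP : ∀ f : (ι → C(Icc (0 : ℝ) T, ℝ)) →ᵇ ℝ,
      Tendsto (fun n => ∫ x, f (orbitPath T (τ n) (Φ n) x) ∂stdG ι) U (𝓝 (∫ w, f w ∂P)))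
    (t : Icc (0 : ℝ) T) : P.map (fun w i => w i t) = stdG ι := by
  have hm : Measurable fun (w : ι → C(Icc (0 : ℝ) T, ℝ)) i => w i t :=
    measurable_pi_lambda _ fun i => measurable_eval_path i t
  have := Measure.isProbabilityMeasure_map (μ := P) hm.aemeasurable
  refine ext_of_integral_cos fun I θ c => ?_
  rw [integral_map hm.aemeasurable
    (measurable_cos_sum I θ c measurable_pi_apply).aestronglyMeasurable]
  refine tendsto_nhds_unique (h.tendsto_integral_cos hU hP I θ c (fun _ => t) id) ?_
  refine tendsto_const_nhds.congr fun n => ?_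
  have hMP := measurePreserving_orbitStep (h.measurePreserving n) (τ n) (t : ℝ)
  rw [← hMP.map_eq, integral_map hMP.measurable.aemeasurable
    (measurable_cos_sum I θ c measurable_pi_apply).aestronglyMeasurable, hMP.map_eq]
  rfl

/-- The limit process is stationary. -/
theorem IsApproxFlow.map_shift_eq (h : IsApproxFlow κ τ Φ) {T : ℝ}
    {P : Measure (ι → C(Icc (0 : ℝ) T, ℝ))} [IsProbabilityMeasure P] {U : Filter ℕ} [U.NeBot]
    (hU : U ≤ atTop) (hP : ∀ f : (ι → C(Icc (0 : ℝ) T, ℝ)) →ᵇ ℝ,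
      Tendsto (fun n => ∫ x, f (orbitPath T (τ n) (Φ n) x) ∂stdG ι) U (𝓝 (∫ w, f w ∂P)))
    {κ' : Type} (t t' : κ' → Icc (0 : ℝ) T) {r : ℝ} (hr : 0 ≤ r) (ht : ∀ k, (t' k : ℝ) = t k + r)
    (i : κ' → ι) :
    P.map (fun w k => w (i k) (t' k)) = P.map (fun w k => w (i k) (t k)) := by
  have hm : ∀ t : κ' → Icc (0 : ℝ) T,
      Measurable fun (w : ι → C(Icc (0 : ℝ) T, ℝ)) k => w (i k) (t k) := fun t =>
    measurable_pi_lambda _ fun k => measurable_eval_path (i k) (t k)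
  have h1 := Measure.isProbabilityMeasure_map (μ := P) (hm t).aemeasurable
  have h2 := Measure.isProbabilityMeasure_map (μ := P) (hm t').aemeasurable
  have hcos : ∀ (I : Finset κ') (θ : κ' → ℝ) (c : ℝ),
      Measurable fun x : κ' → ℝ => Real.cos (∑ k ∈ I, θ k * x k + c) := fun I θ c =>
    measurable_cos_sum I θ c measurable_pi_apply
  refine ext_of_integral_cos fun I θ c => ?_
  rw [integral_map (hm t').aemeasurable (hcos I θ c).aestronglyMeasurable,
    integral_map (hm t).aemeasurable (hcos I θ c).aestronglyMeasurable]
  refine tendsto_nhds_unique (h.tendsto_integral_cos hU hP I θ c t' i) ?_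
  refine (tendsto_iff_of_dist ?_).1 (h.tendsto_integral_cos hU hP I θ c t i)
  have h3 : Tendsto (fun n => ∑ k ∈ I, |θ k| * (τ n * κ (i k))) U (𝓝 0) := by
    have : Tendsto (fun n => ∑ k ∈ I, |θ k| * (τ n * κ (i k))) U
        (𝓝 (∑ k ∈ I, |θ k| * (0 * κ (i k)))) :=
      tendsto_finsetSum _ fun k _ => ((h.tendsto.mono_left hU).mul_const _).const_mul _
    simpa using this
  refine squeeze_zero (fun n => dist_nonneg) (fun n => ?_) h3
  have hms : ∀ s k, Measurable fun x => orbitStep (τ n) (Φ n) s x (i k) := fun s k =>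
    (measurable_pi_apply (i k)).comp
      (measurePreserving_orbitStep (h.measurePreserving n) _ _).measurable
  have hMP := measurePreserving_orbitStep (h.measurePreserving n) (τ n) r
  -- By invariance the starting point may be replaced by its image at time r. Up to one step of Φ
  -- this is the time shift.
  have e : ∫ x, Real.cos (∑ k ∈ I, θ k * orbitStep (τ n) (Φ n) (t k) x (i k) + c) ∂stdG ι
      = ∫ x, Real.cos (∑ k ∈ I, θ k * orbitStep (τ n) (Φ n) (t k)
          (orbitStep (τ n) (Φ n) r x) (i k) + c) ∂stdG ι := by
    conv_lhs => rw [← hMP.map_eq]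
    rw [integral_map hMP.measurable.aemeasurable]
    exact (measurable_cos_sum I θ c fun k => hms _ k).aestronglyMeasurable
  rw [dist_comm, Real.dist_eq, e]
  refine abs_integral_cos_sub_le I θ c
    (f := fun k x => orbitStep (τ n) (Φ n) (t' k) x (i k))
    (g := fun k x => orbitStep (τ n) (Φ n) (t k) (orbitStep (τ n) (Φ n) r x) (i k))
    (fun k => hms _ k) (fun k => (hms _ k).comp hMP.measurable)
    (fun k => mul_nonneg (h.pos n).le (h.nonneg _)) fun k _ => ?_
  simp only [ht]
  exact eLpNorm_orbitStep_shift_le (h.measurePreserving n) (h.pos n) (h.bound n _) (t k).2.1 hr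

end Laws


/-! ### The limit process -/

section Limit

variable {ι : Type} {κ : ι → ℝ} {τ : ℕ → ℝ} {Φ : ℕ → (ι → ℝ) → ι → ℝ}

/-- Moments of the maximum of the limit process. -/
theorem lintegral_path_pow_le {T : ℝ} (hT : 0 < T) {p : ℕ} (hp : p ≠ 0) :
    ∃ C : ℝ, 0 ≤ C ∧ ∀ (ι : Type) (_ : Countable ι) (κ : ι → ℝ) (τ : ℕ → ℝ)
      (Φ : ℕ → (ι → ℝ) → ι → ℝ) (P : Measure (ι → C(Icc (0 : ℝ) T, ℝ))) (U : Filter ℕ),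
      IsApproxFlow κ τ Φ → IsProbabilityMeasure P → U.NeBot →
      (∀ f : (ι → C(Icc (0 : ℝ) T, ℝ)) →ᵇ ℝ,
        Tendsto (fun n => ∫ x, f (orbitPath T (τ n) (Φ n) x) ∂stdG ι) U (𝓝 (∫ w, f w ∂P))) →
      ∀ i, ∫⁻ w, ‖w i‖ₑ ^ p ∂P ≤ ENNReal.ofReal (C * (1 + κ i)) := by
  obtain ⟨C, hC0, hC⟩ := lintegral_orbitPath_pow_le hT hp
  refine ⟨C, hC0, fun ι _ κ τ Φ P U h hPr hU hP i => ?_⟩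
  have hCκ : 0 ≤ C * (1 + κ i) := mul_nonneg hC0 (by linarith [h.nonneg i])
  have hcont : Continuous fun w : ι → C(Icc (0 : ℝ) T, ℝ) => ‖w i‖ ^ p :=
    (continuous_apply i).norm.pow p
  -- Weak convergence only tests bounded continuous functions, so the power is cut off at M. Fatou's
  -- lemma removes the cut-off.
  have hM : ∀ M : ℕ, ∫⁻ w, ENNReal.ofReal (min (‖w i‖ ^ p) M) ∂P
      ≤ ENNReal.ofReal (C * (1 + κ i)) := by
    intro M
    have hb : ∀ w : ι → C(Icc (0 : ℝ) T, ℝ), ‖min (‖w i‖ ^ p) (M : ℝ)‖ ≤ M := fun w => by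
      rw [Real.norm_eq_abs, abs_of_nonneg (by positivity)]
      exact min_le_right _ _
    let f : (ι → C(Icc (0 : ℝ) T, ℝ)) →ᵇ ℝ := BoundedContinuousFunction.ofNormedAddCommGroup
      (fun w => min (‖w i‖ ^ p) (M : ℝ)) (hcont.min continuous_const) M hb
    have hf0 : ∀ w, 0 ≤ f w := fun w => by
      change 0 ≤ min (‖w i‖ ^ p) (M : ℝ)
      positivity
    have h1 : ∫ w, f w ∂P ≤ C * (1 + κ i) := by
      refine le_of_tendsto (hP f) (Eventually.of_forall fun n => ?_)
      have hm : Measurable fun x => f (orbitPath T (τ n) (Φ n) x) :=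
        f.continuous.measurable.comp (h.measurable_orbitPath T n)
      rw [integral_eq_lintegral_of_nonneg_ae (ae_of_all _ fun x => hf0 _) hm.aestronglyMeasurable]
      refine ENNReal.toReal_le_of_le_ofReal hCκ (le_trans (lintegral_mono fun x => ?_)
        (hC ι (Φ n) (τ n) (κ i) i (h.measurePreserving n) (h.pos n) (h.le_one n) (h.nonneg i)
          (h.bound n i)))
      rw [← ofReal_norm, ← ENNReal.ofReal_pow (norm_nonneg _)]
      exact ENNReal.ofReal_le_ofReal (min_le_left _ _)
    have hfi : Integrable f P := f.integrable _
    calc ∫⁻ w, ENNReal.ofReal (f w) ∂P = ENNReal.ofReal (∫ w, f w ∂P) :=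
          (ofReal_integral_eq_lintegral_ofReal hfi (ae_of_all _ hf0)).symm
      _ ≤ _ := ENNReal.ofReal_le_ofReal h1
  have hlim : ∀ w : ι → C(Icc (0 : ℝ) T, ℝ),
      liminf (fun M : ℕ => ENNReal.ofReal (min (‖w i‖ ^ p) M)) atTop = ‖w i‖ₑ ^ p := by
    intro w
    refine Tendsto.liminf_eq ?_
    rw [← ofReal_norm, ← ENNReal.ofReal_pow (norm_nonneg _)]
    refine tendsto_const_nhds.congr' ?_
    filter_upwards [eventually_ge_atTop ⌈‖w i‖ ^ p⌉₊] with M hM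
    rw [min_eq_left (Nat.ceil_le.1 hM)]
  calc ∫⁻ w, ‖w i‖ₑ ^ p ∂P
      = ∫⁻ w, liminf (fun M : ℕ => ENNReal.ofReal (min (‖w i‖ ^ p) M)) atTop ∂P :=
        lintegral_congr fun w => (hlim w).symm
    _ ≤ liminf (fun M : ℕ => ∫⁻ w, ENNReal.ofReal (min (‖w i‖ ^ p) M) ∂P) atTop :=
        lintegral_liminf_le fun M => (hcont.min continuous_const).measurable.ennreal_ofReal
    _ ≤ _ := liminf_le_of_le (by isBoundedDefault) fun b hb => by
        obtain ⟨M, hM'⟩ := hb.exists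
        exact hM'.trans (hM M)

/-- The value of a path at time `r`, clamped to `[0, T]`. -/
def pathAt {T : ℝ} (hT : 0 ≤ T) (r : ℝ) (w : ι → C(Icc (0 : ℝ) T, ℝ)) (i : ι) : ℝ :=
  w i (projIcc 0 T hT r)

theorem measurable_pathAt {T : ℝ} (hT : 0 ≤ T) :
    Measurable fun p : ℝ × (ι → C(Icc (0 : ℝ) T, ℝ)) => pathAt hT p.1 p.2 := by
  refine measurable_pi_lambda _ fun i => ?_
  have h1 : Continuous fun p : ℝ × C(Icc (0 : ℝ) T, ℝ) => p.2 (projIcc 0 T hT p.1) :=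
    continuous_snd.eval (continuous_projIcc.comp continuous_fst)
  exact h1.measurable.comp
    (measurable_fst.prodMk ((measurable_pi_apply i).comp measurable_snd))

theorem measurable_pathAt_right {T : ℝ} (hT : 0 ≤ T) (r : ℝ) :
    Measurable (pathAt hT r : (ι → C(Icc (0 : ℝ) T, ℝ)) → ι → ℝ) :=
  (measurable_pathAt hT).comp measurable_prodMk_left

theorem continuous_pathAt {T : ℝ} (hT : 0 ≤ T) (i : ι) :
    Continuous fun p : (ι → C(Icc (0 : ℝ) T, ℝ)) × ℝ => pathAt hT p.2 p.1 i :=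
  ((continuous_apply i).comp continuous_fst).eval (continuous_projIcc.comp continuous_snd)

variable {a₀ : ι → ι → ℝ} {a : ι → ι → ι → ℝ}

theorem continuous_drift (s : Finset ι) (i : ι) : Continuous (drift a₀ a s i) := by
  unfold drift rate
  fun_prop

theorem continuous_drift_pathAt {T : ℝ} (hT : 0 ≤ T) (s : Finset ι) (i : ι) :
    Continuous fun p : (ι → C(Icc (0 : ℝ) T, ℝ)) × ℝ => drift a₀ a s i (pathAt hT p.2 p.1) :=
  (continuous_drift s i).comp (continuous_pi fun j => continuous_pathAt hT j)

theorem eLpNorm_mul_le_of_le {Ω : Type*} [MeasurableSpace Ω] {P : Measure Ω} {f g : Ω → ℝ}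
    (hf : Measurable f) (hg : Measurable g) {A B : ℝ} (hA : 0 ≤ A)
    (h₁ : eLpNorm f 2 P ≤ ENNReal.ofReal A) (h₂ : eLpNorm g 2 P ≤ ENNReal.ofReal B) :
    eLpNorm (fun x => f x * g x) 1 P ≤ ENNReal.ofReal (A * B) := by
  have := eLpNorm_smul_le_mul_eLpNorm (μ := P) (p := 2) (q := 2) (r := 1) (f := g) (φ := f)
    hg.aestronglyMeasurable hf.aestronglyMeasurable
  rw [ENNReal.ofReal_mul hA]
  exact this.trans (mul_le_mul' h₁ h₂)

theorem eLpNorm_const_mul_le {Ω : Type*} [MeasurableSpace Ω] {P : Measure Ω} {f : Ω → ℝ}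
    {p : ℝ≥0∞} (c : ℝ) {A : ℝ} (h : eLpNorm f p P ≤ ENNReal.ofReal A) :
    eLpNorm (fun x => c * f x) p P ≤ ENNReal.ofReal (|c| * A) := by
  rw [ENNReal.ofReal_mul (abs_nonneg c), ← Real.enorm_eq_ofReal_abs]
  exact (eLpNorm_const_smul_le (c := c) (f := f)).trans (mul_le_mul_right h _)

theorem eLpNorm_sum_le_ofReal {Ω κ' : Type*} [MeasurableSpace Ω] {P : Measure Ω} {p : ℝ≥0∞}
    (hp : 1 ≤ p) (s : Finset κ') {f : κ' → Ω → ℝ} (hf : ∀ k, Measurable (f k)) {A : κ' → ℝ}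
    (hA : ∀ k ∈ s, 0 ≤ A k) (h : ∀ k ∈ s, eLpNorm (f k) p P ≤ ENNReal.ofReal (A k)) :
    eLpNorm (fun x => ∑ k ∈ s, f k x) p P ≤ ENNReal.ofReal (∑ k ∈ s, A k) := by
  rw [ENNReal.ofReal_sum_of_nonneg hA]
  have := eLpNorm_sum_le (μ := P) (p := p) (s := s) (f := f)
    (fun k _ => (hf k).aestronglyMeasurable) hp
  have e : (fun x => ∑ k ∈ s, f k x) = ∑ k ∈ s, f k := by
    ext x
    simp
  rw [e]
  exact this.trans (Finset.sum_le_sum h)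

theorem eLpNorm_add_le_ofReal {Ω : Type*} [MeasurableSpace Ω] {P : Measure Ω} {p : ℝ≥0∞}
    (hp : 1 ≤ p) {f g : Ω → ℝ} (hf : Measurable f) (hg : Measurable g) {A B : ℝ}
    (hA : 0 ≤ A) (hB : 0 ≤ B) (h₁ : eLpNorm f p P ≤ ENNReal.ofReal A)
    (h₂ : eLpNorm g p P ≤ ENNReal.ofReal B) :
    eLpNorm (fun x => f x + g x) p P ≤ ENNReal.ofReal (A + B) := by
  rw [ENNReal.ofReal_add hA hB]
  exact (eLpNorm_add_le hf.aestronglyMeasurable hg.aestronglyMeasurable hp).trans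
    (add_le_add h₁ h₂)

/-- Stability of the drift under small perturbations. -/
theorem eLpNorm_drift_sub_le (hκ : ∀ i, 0 ≤ κ i) {Ω : Type*} [MeasurableSpace Ω] {P : Measure Ω}
    [IsProbabilityMeasure P] {Z Y : Ω → ι → ℝ} (hZ : Measurable Z) (hY : Measurable Y) {d : ℝ}
    (hd : 0 ≤ d) (hd1 : d ≤ 1)
    (h : ∀ j, eLpNorm (fun x => Y x j - Z x j) 2 P ≤ ENNReal.ofReal (d * κ j))
    (hZ1 : ∀ j, eLpNorm (fun x => Z x j) 2 P ≤ ENNReal.ofReal 1) (s : Finset ι) (i : ι) :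
    eLpNorm (fun x => drift a₀ a s i (Y x) - drift a₀ a s i (Z x)) 1 P
      ≤ ENNReal.ofReal (d * ∑ j ∈ s, (|a₀ i j| * κ j
        + ∑ k ∈ s, |a i j k| * (κ k * (1 + κ j) + κ j))) := by
  have mZ : ∀ j, Measurable fun x => Z x j := fun j => (measurable_pi_apply j).comp hZ
  have mY : ∀ j, Measurable fun x => Y x j := fun j => (measurable_pi_apply j).comp hY
  have mD : ∀ j, Measurable fun x => Y x j - Z x j := fun j => (mY j).sub (mZ j)
  -- Differences of products are split so that every term contains one factor Y − Z. Products of two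
  -- L² functions are the reason for the L¹ norm on the left side.
  have e : (fun x => drift a₀ a s i (Y x) - drift a₀ a s i (Z x))
      = fun x => ∑ j ∈ s, (a₀ i j * (Y x j - Z x j)
        + ∑ k ∈ s, a i j k * ((Y x k - Z x k) * Y x j + Z x k * (Y x j - Z x j))) := by
    ext x
    unfold drift rate
    rw [← Finset.sum_sub_distrib]
    refine Finset.sum_congr rfl fun j _ => ?_
    rw [add_mul, add_mul, Finset.sum_mul, Finset.sum_mul, add_sub_add_comm,
      ← Finset.sum_sub_distrib]
    congr 1
    · ring
    · exact Finset.sum_congr rfl fun k _ => by ring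
  have hY1 : ∀ j, eLpNorm (fun x => Y x j) 2 P ≤ ENNReal.ofReal (1 + κ j) := by
    intro j
    have h1 := eLpNorm_add_le_ofReal (P := P) (p := 2) (by norm_num) (mZ j) (mD j) zero_le_one
      (mul_nonneg hd (hκ j)) (hZ1 j) (h j)
    simp only [add_sub_cancel] at h1
    refine h1.trans (ENNReal.ofReal_le_ofReal ?_)
    have := mul_le_mul_of_nonneg_right hd1 (hκ j)
    linarith
  rw [e, Finset.mul_sum]
  have hpos : ∀ j k, 0 ≤ κ k * (1 + κ j) + κ j := fun j k => by
    have := hκ j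
    have := hκ k
    positivity
  refine eLpNorm_sum_le_ofReal le_rfl s (fun j => ?_) (fun j _ => ?_) fun j _ => ?_
  · exact ((mD j).const_mul _).add (Finset.measurable_sum _ fun k _ =>
      (((mD k).mul (mY j)).add ((mZ k).mul (mD j))).const_mul _)
  · exact mul_nonneg hd (add_nonneg (mul_nonneg (abs_nonneg _) (hκ j))
      (Finset.sum_nonneg fun k _ => mul_nonneg (abs_nonneg _) (hpos j k)))
  · rw [mul_add, Finset.mul_sum]
    refine eLpNorm_add_le_ofReal le_rfl ((mD j).const_mul _) (Finset.measurable_sum _ fun k _ =>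
      (((mD k).mul (mY j)).add ((mZ k).mul (mD j))).const_mul _)
      (mul_nonneg hd (mul_nonneg (abs_nonneg _) (hκ j)))
      (Finset.sum_nonneg fun k _ => mul_nonneg hd (mul_nonneg (abs_nonneg _) (hpos j k))) ?_ ?_
    · have h1 : eLpNorm (fun x => Y x j - Z x j) 1 P ≤ ENNReal.ofReal (d * κ j) :=
        (eLpNorm_le_eLpNorm_of_exponent_le (by norm_num) (mD j).aestronglyMeasurable).trans (h j)
      refine (eLpNorm_const_mul_le (a₀ i j) h1).trans_eq ?_
      congr 1
      ring
    · refine eLpNorm_sum_le_ofReal le_rfl s (fun k => ?_) (fun k _ => ?_) fun k _ => ?_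
      · exact (((mD k).mul (mY j)).add ((mZ k).mul (mD j))).const_mul _
      · exact mul_nonneg hd (mul_nonneg (abs_nonneg _) (hpos j k))
      · have h1 := eLpNorm_mul_le_of_le (mD k) (mY j) (mul_nonneg hd (hκ k)) (h k) (hY1 j)
        have h2 := eLpNorm_mul_le_of_le (mZ k) (mD j) zero_le_one (hZ1 k) (h j)
        have h3 := eLpNorm_add_le_ofReal le_rfl ((mD k).mul (mY j)) ((mZ k).mul (mD j))
          (mul_nonneg (mul_nonneg hd (hκ k)) (by linarith [hκ j]))
          (mul_nonneg zero_le_one (mul_nonneg hd (hκ j))) h1 h2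
        refine (eLpNorm_const_mul_le (a i j k) h3).trans_eq ?_
        congr 1
        ring

theorem eLpNorm_eval_stdG (i : ι) : eLpNorm (fun x : ι → ℝ => x i) 2 (stdG ι)
    ≤ ENNReal.ofReal 1 := by
  have := eLpNorm_two_le_of_integral_sq_le (memLp_eval i (by simp)) (integral_eval_sq i).le
  rwa [Real.sqrt_one] at this

/-- The defect of the truncated equation along an approximate orbit. -/
theorem IsApproxFlow.lintegral_defect_le (h : IsApproxFlow κ τ Φ) {T : ℝ} (hT : 0 < T) {n : ℕ}
    {i : ι} {s : Finset ι} {η : ℝ≥0∞}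
    (hη : eLpNorm (fun x => (Φ n x i - x i) / τ n - drift a₀ a s i x) 1 (stdG ι) ≤ η)
    (t : Icc (0 : ℝ) T) :
    ∫⁻ x, ‖orbitPath T (τ n) (Φ n) x i t - x i
      - ∫ r in (0 : ℝ)..t, drift a₀ a s i (pathAt hT.le r (orbitPath T (τ n) (Φ n) x))‖ₑ ∂stdG ι
    ≤ ENNReal.ofReal T * (η + ENNReal.ofReal (τ n * ∑ j ∈ s, (|a₀ i j| * κ j
        + ∑ k ∈ s, |a i j k| * (κ k * (1 + κ j) + κ j)))) := by
  have hMP := h.measurePreserving n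
  have hτ := h.pos n
  have mΦ : Measurable fun x : ι → ℝ => Φ n x i := (measurable_pi_apply i).comp hMP.measurable
  set β : (ι → ℝ) → ℝ := fun x => (Φ n x i - x i) / τ n with hβ
  have mβ : Measurable β := (mΦ.sub (measurable_pi_apply i)).div_const _
  set g : ℝ → (ι → ℝ) → ℝ := fun r x => β (orbitStep (τ n) (Φ n) r x)
    - drift a₀ a s i (pathAt hT.le r (orbitPath T (τ n) (Φ n) x)) with hg
  have mZ := measurable_orbitStep hMP.measurable (τ n)
  have mY : Measurable fun p : ℝ × (ι → ℝ) => pathAt hT.le p.1 (orbitPath T (τ n) (Φ n) p.2) :=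
    (measurable_pathAt hT.le).comp
      (measurable_fst.prodMk ((h.measurable_orbitPath T n).comp measurable_snd))
  have mg : Measurable fun p : ℝ × (ι → ℝ) => g p.1 p.2 :=
    (mβ.comp mZ).sub ((measurable_drift i).comp mY)
  have hpoint : ∀ x, ‖orbitPath T (τ n) (Φ n) x i t - x i
      - ∫ r in (0 : ℝ)..t, drift a₀ a s i (pathAt hT.le r (orbitPath T (τ n) (Φ n) x))‖ₑ
      ≤ ∫⁻ r in Ioc 0 T, ‖g r x‖ₑ := by
    intro x
    have h1 : orbitPath T (τ n) (Φ n) x i t - x i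
        = ∫ r in (0 : ℝ)..t, β (orbitStep (τ n) (Φ n) r x) := by
      have := interp_sub_eq_integral (u := fun k => (Φ n)^[k] x i) hτ t.2.1
        (t.2.2.trans_lt (lt_steps_mul hτ))
      simp only [Function.iterate_succ_apply'] at this
      exact this
    have i1 : IntervalIntegrable (fun r => β (orbitStep (τ n) (Φ n) r x)) volume 0 t :=
      intervalIntegrable_comp_floor (fun k => β ((Φ n)^[k] x)) hτ t.2.1
    have i2 : IntervalIntegrable (fun r => drift a₀ a s i
        (pathAt hT.le r (orbitPath T (τ n) (Φ n) x))) volume 0 t :=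
      ((continuous_drift_pathAt hT.le s i).comp (Continuous.prodMk_right _)).intervalIntegrable _ _
    rw [h1, ← intervalIntegral.integral_sub i1 i2, intervalIntegral.integral_of_le t.2.1]
    refine (enorm_integral_le_lintegral_enorm _).trans ?_
    exact lintegral_mono_set (Ioc_subset_Ioc_right t.2.2)
  calc _ ≤ ∫⁻ x, (∫⁻ r in Ioc 0 T, ‖g r x‖ₑ) ∂stdG ι := lintegral_mono hpoint
    _ = ∫⁻ r in Ioc 0 T, (∫⁻ x, ‖g r x‖ₑ ∂stdG ι) := by
        rw [lintegral_lintegral_swap]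
        exact (mg.comp measurable_swap).enorm.aemeasurable
    _ ≤ ∫⁻ r in Ioc 0 T, (η + ENNReal.ofReal (τ n * ∑ j ∈ s, (|a₀ i j| * κ j
        + ∑ k ∈ s, |a i j k| * (κ k * (1 + κ j) + κ j)))) := by
        refine setLIntegral_mono measurable_const fun r hr => ?_
        have hZr := measurePreserving_orbitStep hMP (τ n) r
        have hYr : Measurable fun x => pathAt hT.le r (orbitPath T (τ n) (Φ n) x) :=
          (measurable_pathAt_right hT.le r).comp (h.measurable_orbitPath T n)
        rw [← eLpNorm_one_eq_lintegral_enorm]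
        have hstep := eLpNorm_drift_sub_le (a₀ := a₀) (a := a) h.nonneg hZr.measurable hYr hτ.le
          (h.le_one n) (fun j => by
            have := eLpNorm_orbitPath_sub_le hMP hτ (h.bound n j) ⟨r, hr.1.le, hr.2⟩
            have e : ∀ x, pathAt hT.le r (orbitPath T (τ n) (Φ n) x) j
                = orbitPath T (τ n) (Φ n) x j ⟨r, hr.1.le, hr.2⟩ := fun x => by
              rw [pathAt, projIcc_of_mem hT.le ⟨hr.1.le, hr.2⟩]
            simp only [e]
            exact this)
          (fun j => by
            have := eLpNorm_comp_measurePreserving (p := 2)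
              (measurable_pi_apply j).aestronglyMeasurable hZr
            exact this.trans_le (eLpNorm_eval_stdG j)) s i
        -- Two errors: the velocity of Φ against the drift, both at the orbit point, where
        -- invariance gives the norm η; and the drift along the interpolated path against the drift
        -- at the orbit point, which is small with τ.
        have e : g r = (fun x => β x - drift a₀ a s i x) ∘ orbitStep (τ n) (Φ n) r
            - fun x => (drift a₀ a s i (pathAt hT.le r (orbitPath T (τ n) (Φ n) x))
              - drift a₀ a s i (orbitStep (τ n) (Φ n) r x)) := by
          ext x
          simp [hg]
        rw [e]
        have mβd : Measurable fun x => β x - drift a₀ a s i x := mβ.sub (measurable_drift i)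
        refine (eLpNorm_sub_le (mβd.comp hZr.measurable).aestronglyMeasurable
          (((measurable_drift i).comp hYr).sub
            ((measurable_drift i).comp hZr.measurable)).aestronglyMeasurable le_rfl).trans ?_
        refine add_le_add ?_ hstep
        rw [eLpNorm_comp_measurePreserving mβd.aestronglyMeasurable hZr]
        exact hη
    _ = _ := by
        rw [setLIntegral_const, Real.volume_Ioc, sub_zero, mul_comm]

end Limit


/-! ### The equation in the limit -/

section LimitEquation

variable {ι : Type} {κ : ι → ℝ} {τ : ℕ → ℝ} {Φ : ℕ → (ι → ℝ) → ι → ℝ}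
  {a₀ : ι → ι → ℝ} {a : ι → ι → ι → ℝ} {T : ℝ}

theorem orbitPath_zero {τ : ℝ} (hτ : 0 < τ) (Φ : (ι → ℝ) → ι → ℝ) (x : ι → ℝ) (i : ι) {t : Icc (0 : ℝ) T}
    (ht : (t : ℝ) = 0) : orbitPath T τ Φ x i t = x i := by
  change interp τ (steps T τ) (fun k => Φ^[k] x i) (t : ℝ) = x i
  rw [ht, interp_zero hτ]
  rfl

/-- The defect of the truncated equation along a path. -/
def defect (hT : 0 ≤ T) (f : (ι → ℝ) → ℝ) (i : ι) (t : ℝ) (w : ι → C(Icc (0 : ℝ) T, ℝ)) : ℝ :=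
  pathAt hT t w i - pathAt hT 0 w i - ∫ r in (0 : ℝ)..t, f (pathAt hT r w)

theorem continuous_defect_drift (hT : 0 ≤ T) (s : Finset ι) (i : ι) (t : ℝ) :
    Continuous (defect hT (drift a₀ a s i) i t) := by
  have h1 : ∀ r, Continuous fun w : ι → C(Icc (0 : ℝ) T, ℝ) => pathAt hT r w i := fun r =>
    (continuous_pathAt hT i).comp (Continuous.prodMk_left r)
  refine ((h1 t).sub (h1 0)).sub ?_
  exact intervalIntegral.continuous_parametric_intervalIntegral_of_continuous'
    (continuous_drift_pathAt hT s i) 0 t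

theorem measurable_defect (hT : 0 ≤ T) {f : (ι → ℝ) → ℝ} (hf : Measurable f) (i : ι) {t : ℝ}
    (ht : 0 ≤ t) : Measurable (defect hT f i t) := by
  have h1 : ∀ r, Measurable fun w : ι → C(Icc (0 : ℝ) T, ℝ) => pathAt hT r w i := fun r =>
    (measurable_pi_apply i).comp (measurable_pathAt_right hT r)
  refine ((h1 t).sub (h1 0)).sub ?_
  simp only [intervalIntegral.integral_of_le ht]
  have h2 : StronglyMeasurable fun p : (ι → C(Icc (0 : ℝ) T, ℝ)) × ℝ => f (pathAt hT p.2 p.1) :=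
    (hf.comp ((measurable_pathAt hT).comp measurable_swap)).stronglyMeasurable
  exact h2.integral_prod_right.measurable

/-- The defect of a truncated drift is a continuous function on path space, since the drift is a
polynomial in finitely many coordinates. Cut off at 1 it can be tested against the weak limit. The
limiting drift is merely measurable and has to be reached through the truncations. -/
theorem IsApproxFlow.integral_min_defect_le [Countable ι] (h : IsApproxFlow κ τ Φ) (hT : 0 < T)
    {P : Measure (ι → C(Icc (0 : ℝ) T, ℝ))} [IsProbabilityMeasure P] {U : Filter ℕ} [U.NeBot]
    (hU : U ≤ atTop) (hP : ∀ f : (ι → C(Icc (0 : ℝ) T, ℝ)) →ᵇ ℝ,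
      Tendsto (fun n => ∫ x, f (orbitPath T (τ n) (Φ n) x) ∂stdG ι) U (𝓝 (∫ w, f w ∂P)))
    {i : ι} {s : Finset ι} {η : ℝ} (hη0 : 0 ≤ η)
    (hη : ∀ᶠ n in atTop, eLpNorm (fun x => (Φ n x i - x i) / τ n - drift a₀ a s i x) 1 (stdG ι)
      ≤ ENNReal.ofReal η) {t : ℝ} (ht : t ∈ Icc 0 T) :
    ∫⁻ w, min ‖defect hT.le (drift a₀ a s i) i t w‖ₑ 1 ∂P ≤ ENNReal.ofReal (T * η) := by
  set F := defect hT.le (drift a₀ a s i) i t with hF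
  have hFc : Continuous F := continuous_defect_drift hT.le s i t
  have hb : ∀ w, ‖min |F w| 1‖ ≤ 1 := fun w => by
    rw [Real.norm_eq_abs, abs_of_nonneg (by positivity)]
    exact min_le_right _ _
  let f : (ι → C(Icc (0 : ℝ) T, ℝ)) →ᵇ ℝ := BoundedContinuousFunction.ofNormedAddCommGroup
    (fun w => min |F w| 1) (hFc.abs.min continuous_const) 1 hb
  have hf0 : ∀ w, 0 ≤ f w := fun w => by
    change 0 ≤ min |F w| 1
    positivity
  have hfe : ∀ w, ENNReal.ofReal (f w) = min ‖F w‖ₑ 1 := fun w => by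
    change ENNReal.ofReal (min |F w| 1) = _
    rw [Real.enorm_eq_ofReal_abs, ← ENNReal.ofReal_one, ENNReal.ofReal_min]
  set K := ∑ j ∈ s, (|a₀ i j| * κ j + ∑ k ∈ s, |a i j k| * (κ k * (1 + κ j) + κ j)) with hK
  have hK0 : 0 ≤ K := by
    refine Finset.sum_nonneg fun j _ => add_nonneg (mul_nonneg (abs_nonneg _) (h.nonneg j))
      (Finset.sum_nonneg fun k _ => mul_nonneg (abs_nonneg _) ?_)
    have := h.nonneg j
    have := h.nonneg k
    positivity
  have key : ∫ w, f w ∂P ≤ T * η := by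
    have hlim : Tendsto (fun n => T * (η + τ n * K)) U (𝓝 (T * η)) := by
      have := ((h.tendsto.mul_const K).const_add η).const_mul T
      simp only [zero_mul, add_zero] at this
      exact this.mono_left hU
    refine le_of_tendsto_of_tendsto (hP f) hlim ?_
    filter_upwards [hU hη] with n hn
    have hm : Measurable fun x => f (orbitPath T (τ n) (Φ n) x) :=
      f.continuous.measurable.comp (h.measurable_orbitPath T n)
    have hτ := h.pos n
    rw [integral_eq_lintegral_of_nonneg_ae (ae_of_all _ fun x => hf0 _) hm.aestronglyMeasurable]
    refine ENNReal.toReal_le_of_le_ofReal (by positivity) ?_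
    have h1 := h.lintegral_defect_le hT hn ⟨t, ht⟩
    rw [ENNReal.ofReal_mul hT.le, ENNReal.ofReal_add hη0 (by positivity)]
    refine le_trans (lintegral_mono fun x => ?_) h1
    rw [hfe]
    refine (min_le_left _ _).trans (le_of_eq ?_)
    have e0 : pathAt hT.le 0 (orbitPath T (τ n) (Φ n) x) i = x i :=
      orbitPath_zero hτ _ _ _ (by rw [projIcc_of_mem hT.le ⟨le_rfl, hT.le⟩])
    have e1 : pathAt hT.le t (orbitPath T (τ n) (Φ n) x) i = orbitPath T (τ n) (Φ n) x i ⟨t, ht⟩ := by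
      rw [pathAt, projIcc_of_mem hT.le ht]
    rw [hF, defect, e0, e1]
  calc ∫⁻ w, min ‖F w‖ₑ 1 ∂P = ∫⁻ w, ENNReal.ofReal (f w) ∂P :=
        lintegral_congr fun w => (hfe w).symm
    _ = ENNReal.ofReal (∫ w, f w ∂P) :=
        (ofReal_integral_eq_lintegral_ofReal (f.integrable _) (ae_of_all _ hf0)).symm
    _ ≤ _ := ENNReal.ofReal_le_ofReal key

theorem measurePreserving_pathAt {P : Measure (ι → C(Icc (0 : ℝ) T, ℝ))} (hT : 0 ≤ T) (hP : ∀ t : Icc (0 : ℝ) T, P.map (fun w i => w i t) = stdG ι)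
    (r : ℝ) : MeasurePreserving (pathAt hT r) P (stdG ι) :=
  ⟨measurable_pathAt_right hT r, hP _⟩

variable {P : Measure (ι → C(Icc (0 : ℝ) T, ℝ))} [IsProbabilityMeasure P]

/-- Integrals over time and probability of a function of the path reduce to the Gaussian measure. -/
theorem lintegral_lintegral_pathAt (hT : 0 ≤ T)
    (hP : ∀ t : Icc (0 : ℝ) T, P.map (fun w i => w i t) = stdG ι)
    {f : (ι → ℝ) → ℝ≥0∞} (hf : Measurable f) :
    ∫⁻ w, (∫⁻ r in Ioc 0 T, f (pathAt hT r w)) ∂P = ENNReal.ofReal T * ∫⁻ x, f x ∂stdG ι := by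
  have hm : Measurable (Function.uncurry fun (w : ι → C(Icc (0 : ℝ) T, ℝ)) (r : ℝ) =>
      f (pathAt hT r w)) := hf.comp ((measurable_pathAt hT).comp measurable_swap)
  rw [lintegral_lintegral_swap hm.aemeasurable]
  have : ∀ r, ∫⁻ w, f (pathAt hT r w) ∂P = ∫⁻ x, f x ∂stdG ι := fun r =>
    (measurePreserving_pathAt hT hP r).lintegral_comp hf
  simp only [this]
  rw [setLIntegral_const, Real.volume_Ioc, sub_zero, mul_comm]

/-- Almost every path makes an integrable function of the state integrable in time. -/
theorem ae_intervalIntegrable_pathAt (hT : 0 ≤ T)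
    (hP : ∀ t : Icc (0 : ℝ) T, P.map (fun w i => w i t) = stdG ι)
    {f : (ι → ℝ) → ℝ} (hf : Measurable f) (hf1 : Integrable f (stdG ι)) :
    ∀ᵐ w ∂P, IntervalIntegrable (fun r => f (pathAt hT r w)) volume 0 T := by
  have h1 : ∫⁻ w, (∫⁻ r in Ioc 0 T, ‖f (pathAt hT r w)‖ₑ) ∂P ≠ ∞ := by
    rw [lintegral_lintegral_pathAt (f := fun x => ‖f x‖ₑ) hT hP hf.enorm]
    exact ENNReal.mul_ne_top ENNReal.ofReal_ne_top hf1.2.ne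
  have hm : Measurable fun p : (ι → C(Icc (0 : ℝ) T, ℝ)) × ℝ => f (pathAt hT p.2 p.1) :=
    hf.comp ((measurable_pathAt hT).comp measurable_swap)
  have hm2 : Measurable fun w : ι → C(Icc (0 : ℝ) T, ℝ) => ∫⁻ r in Ioc 0 T, ‖f (pathAt hT r w)‖ₑ :=
    hm.enorm.lintegral_prod_right
  filter_upwards [ae_lt_top hm2 h1] with w hw
  rw [intervalIntegrable_iff_integrableOn_Ioc_of_le hT]
  exact ⟨(hm.comp measurable_prodMk_left).aestronglyMeasurable, hw⟩

/-- If the truncated drifts converge, the limit equation holds at a fixed time. -/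
theorem IsApproxFlow.ae_defect_eq_zero [Countable ι] (h : IsApproxFlow κ τ Φ) (hT : 0 < T) {U : Filter ℕ} [U.NeBot]
    (hU : U ≤ atTop) (hP : ∀ f : (ι → C(Icc (0 : ℝ) T, ℝ)) →ᵇ ℝ,
      Tendsto (fun n => ∫ x, f (orbitPath T (τ n) (Φ n) x) ∂stdG ι) U (𝓝 (∫ w, f w ∂P)))
    {i : ι} {b : (ι → ℝ) → ℝ} (hb : Measurable b) (hb2 : MemLp b 2 (stdG ι))
    (hΦ : Tendsto (fun n => eLpNorm (fun x => (Φ n x i - x i) / τ n - b x) 2 (stdG ι)) atTop (𝓝 0))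
    (hs : Tendsto (fun s => eLpNorm (drift a₀ a s i - b) 2 (stdG ι)) atTop (𝓝 0))
    {t : ℝ} (ht : t ∈ Icc 0 T) : ∀ᵐ w ∂P, defect hT.le b i t w = 0 := by
  classical
  have hmap := h.map_eval_eq hU hP
  have hint := ae_intervalIntegrable_pathAt hT.le hmap hb (hb2.integrable (by norm_num))
  have mF := measurable_defect hT.le hb i ht.1
  -- Two of the three multiples of Tε bound the velocity of the approximate flow against the
  -- truncated drift. The third pays for exchanging truncated and limiting drift along the limit
  -- process, whose marginals are Gaussian.
  have key : ∀ ε : ℝ, 0 < ε → ∫⁻ w, min ‖defect hT.le b i t w‖ₑ 1 ∂P ≤ ENNReal.ofReal (3 * T * ε) := by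
    intro ε hε
    have hε' : (0 : ℝ≥0∞) < ENNReal.ofReal ε := ENNReal.ofReal_pos.2 hε
    obtain ⟨s, hs⟩ := (hs.eventually (eventually_le_nhds hε')).exists
    have m1 : Measurable (drift a₀ a s i - b) := (measurable_drift i).sub hb
    have hs1 : eLpNorm (drift a₀ a s i - b) 1 (stdG ι) ≤ ENNReal.ofReal ε :=
      (eLpNorm_le_eLpNorm_of_exponent_le (by norm_num) m1.aestronglyMeasurable).trans hs
    have hη : ∀ᶠ n in atTop, eLpNorm (fun x => (Φ n x i - x i) / τ n - drift a₀ a s i x) 1 (stdG ι)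
        ≤ ENNReal.ofReal (2 * ε) := by
      filter_upwards [hΦ.eventually (eventually_le_nhds hε')] with n hn
      have m2 : Measurable fun x => (Φ n x i - x i) / τ n - b x :=
        ((((measurable_pi_apply i).comp (h.measurePreserving n).measurable).sub
          (measurable_pi_apply i)).div_const _).sub hb
      have e : (fun x => (Φ n x i - x i) / τ n - drift a₀ a s i x)
          = (fun x => (Φ n x i - x i) / τ n - b x) - (drift a₀ a s i - b) := by
        ext x
        simp
      rw [e, two_mul, ENNReal.ofReal_add hε.le hε.le]
      refine (eLpNorm_sub_le m2.aestronglyMeasurable m1.aestronglyMeasurable le_rfl).trans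
        (add_le_add ?_ hs1)
      exact (eLpNorm_le_eLpNorm_of_exponent_le (by norm_num) m2.aestronglyMeasurable).trans hn
    have h1 := h.integral_min_defect_le hT hU hP (by positivity) hη ht
    have h2 : ∀ᵐ w ∂P, min ‖defect hT.le b i t w‖ₑ 1 ≤ min ‖defect hT.le (drift a₀ a s i) i t w‖ₑ 1
        + ∫⁻ r in Ioc 0 T, ‖(drift a₀ a s i - b) (pathAt hT.le r w)‖ₑ := by
      filter_upwards [hint] with w hw
      have i1 : IntervalIntegrable (fun r => b (pathAt hT.le r w)) volume 0 t :=
        hw.mono_set (by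
          rw [uIcc_of_le ht.1, uIcc_of_le hT.le]
          exact Icc_subset_Icc_right ht.2)
      have i2 : IntervalIntegrable (fun r => drift a₀ a s i (pathAt hT.le r w)) volume 0 t :=
        ((continuous_drift_pathAt hT.le s i).comp (Continuous.prodMk_right _)).intervalIntegrable _ _
      have e : defect hT.le b i t w = defect hT.le (drift a₀ a s i) i t w
          + ∫ r in (0 : ℝ)..t, (drift a₀ a s i - b) (pathAt hT.le r w) := by
        simp only [Pi.sub_apply]
        rw [intervalIntegral.integral_sub i2 i1, defect, defect]
        ring
      have h3 : ‖∫ r in (0 : ℝ)..t, (drift a₀ a s i - b) (pathAt hT.le r w)‖ₑ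
          ≤ ∫⁻ r in Ioc 0 T, ‖(drift a₀ a s i - b) (pathAt hT.le r w)‖ₑ := by
        rw [intervalIntegral.integral_of_le ht.1]
        exact (enorm_integral_le_lintegral_enorm _).trans
          (lintegral_mono_set (Ioc_subset_Ioc_right ht.2))
      rw [e]
      calc _ ≤ min (‖defect hT.le (drift a₀ a s i) i t w‖ₑ
            + ∫⁻ r in Ioc 0 T, ‖(drift a₀ a s i - b) (pathAt hT.le r w)‖ₑ) 1 :=
            min_le_min_right _ ((enorm_add_le _ _).trans (by gcongr))
        _ ≤ _ := by
            rcases le_total ‖defect hT.le (drift a₀ a s i) i t w‖ₑ 1 with hc | hc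
            · rw [min_eq_left hc]
              exact min_le_left _ _
            · rw [min_eq_right hc]
              exact (min_le_right _ _).trans le_self_add
    have m4 : Measurable fun w => min ‖defect hT.le (drift a₀ a s i) i t w‖ₑ 1 :=
      (measurable_defect hT.le (measurable_drift i) i ht.1).enorm.min measurable_const
    calc _ ≤ ∫⁻ w, (min ‖defect hT.le (drift a₀ a s i) i t w‖ₑ 1
          + ∫⁻ r in Ioc 0 T, ‖(drift a₀ a s i - b) (pathAt hT.le r w)‖ₑ) ∂P := lintegral_mono_ae h2
      _ ≤ ENNReal.ofReal (T * (2 * ε)) + ENNReal.ofReal T * ENNReal.ofReal ε := by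
          rw [lintegral_add_left m4, lintegral_lintegral_pathAt
            (f := fun x => ‖(drift a₀ a s i - b) x‖ₑ) hT.le hmap m1.enorm,
            ← eLpNorm_one_eq_lintegral_enorm]
          gcongr
      _ = ENNReal.ofReal (3 * T * ε) := by
          rw [← ENNReal.ofReal_mul hT.le, ← ENNReal.ofReal_add (by positivity) (by positivity)]
          congr 1
          ring
  have hzero : ∫⁻ w, min ‖defect hT.le b i t w‖ₑ 1 ∂P = 0 := by
    by_contra hne
    have hpos : 0 < ∫⁻ w, min ‖defect hT.le b i t w‖ₑ 1 ∂P := pos_iff_ne_zero.2 hne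
    have hlim : Tendsto (fun ε : ℝ => ENNReal.ofReal (3 * T * ε)) (𝓝[>] 0) (𝓝 0) := by
      have : Continuous fun ε : ℝ => ENNReal.ofReal (3 * T * ε) :=
      ENNReal.continuous_ofReal.comp (by fun_prop)
      have h0 := this.tendsto 0
      simp only [mul_zero, ENNReal.ofReal_zero] at h0
      exact h0.mono_left nhdsWithin_le_nhds
    have hle := ge_of_tendsto hlim (b := ∫⁻ w, min ‖defect hT.le b i t w‖ₑ 1 ∂P)
      (by filter_upwards [self_mem_nhdsWithin] with ε hε using key ε hε)
    exact absurd hle (not_le.2 hpos)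
  rw [lintegral_eq_zero_iff (mF.enorm.min measurable_const)] at hzero
  filter_upwards [hzero] with w hw
  have : ‖defect hT.le b i t w‖ₑ = 0 := by
    rcases min_eq_iff.1 hw with h' | h'
    · exact h'.1
    · exact absurd h'.1 one_ne_zero
  simpa using this

/-- The limit equation holds at all times simultaneously. -/
theorem ae_forall_of_ae_defect (hT : 0 < T)
    (hP : ∀ t : Icc (0 : ℝ) T, P.map (fun w i => w i t) = stdG ι)
    {i : ι} {b : (ι → ℝ) → ℝ} (hb : Measurable b) (hb1 : Integrable b (stdG ι))
    (h : ∀ t ∈ Icc 0 T, ∀ᵐ w ∂P, defect hT.le b i t w = 0) :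
    ∀ᵐ w ∂P, IntervalIntegrable (fun r => b (pathAt hT.le r w)) volume 0 T ∧
      ∀ t ∈ Icc 0 T, pathAt hT.le t w i - pathAt hT.le 0 w i
        = ∫ r in (0 : ℝ)..t, b (pathAt hT.le r w) := by
  -- The exceptional null sets are united over rational times only. Continuity of the defect in time
  -- covers the others, including the end points.
  have hq : ∀ᵐ w ∂P, ∀ q : ℚ, (q : ℝ) ∈ Ioo 0 T → defect hT.le b i q w = 0 := by
    rw [ae_all_iff]
    intro q
    by_cases hq : (q : ℝ) ∈ Ioo 0 T
    · filter_upwards [h q (Ioo_subset_Icc_self hq)] with w hw _ using hw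
    · exact ae_of_all _ fun w hw => absurd hw hq
  filter_upwards [hq, ae_intervalIntegrable_pathAt hT.le hP hb hb1] with w hw hi
  refine ⟨hi, ?_⟩
  have hc : ContinuousOn (fun t => defect hT.le b i t w) (Icc 0 T) := by
    have h1 : Continuous fun t => pathAt hT.le t w i :=
      (continuous_pathAt hT.le i).comp (Continuous.prodMk_right w)
    have h2 := intervalIntegral.continuousOn_primitive_interval' hi left_mem_uIcc
    rw [uIcc_of_le hT.le] at h2
    exact (h1.continuousOn.sub continuousOn_const).sub h2
  have hEq : EqOn (fun t => defect hT.le b i t w) (fun _ => 0) (Icc 0 T) := by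
    refine EqOn.of_subset_closure (s := Ioo 0 T ∩ range ((↑) : ℚ → ℝ)) ?_ hc continuousOn_const
      (inter_subset_left.trans Ioo_subset_Icc_self) ?_
    · rintro _ ⟨ht, q, rfl⟩
      exact hw q ht
    · rw [← closure_Ioo hT.ne]
      exact closure_minimal (Rat.denseRange_cast.open_subset_closure_inter isOpen_Ioo)
        isClosed_closure
  intro t ht
  have this : defect hT.le b i t w = 0 := hEq ht
  rw [defect] at this
  linarith

end LimitEquation


/-- Existence of a stationary Gaussian process that solves `ẋ_i = b_i(x)`, where `b` is an
`L²`-limit of rotational drifts. -/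
theorem IsRotational.exists_stationary_flow {ι : Type} [Countable ι] {a₀ : ι → ι → ℝ}
    {a : ι → ι → ι → ℝ} (h : IsRotational a₀ a) {b : ι → (ι → ℝ) → ℝ} (hb : ∀ i, Measurable (b i))
    (hb2 : ∀ i, MemLp (b i) 2 (stdG ι))
    (hs : ∀ i, Tendsto (fun s => eLpNorm (drift a₀ a s i - b i) 2 (stdG ι)) atTop (𝓝 0))
    {K : ι → ℝ} (hK0 : ∀ i, 0 ≤ K i)
    (hK : ∀ s i, eLpNorm (drift a₀ a s i) 2 (stdG ι) ≤ ENNReal.ofReal (K i))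
    {T : ℝ} (hT : 0 < T) :
    ∃ P : Measure (ι → C(Icc (0 : ℝ) T, ℝ)), IsProbabilityMeasure P ∧
      (∀ t, P.map (fun w i => w i t) = stdG ι) ∧
      (∀ (κ : Type) (t t' : κ → Icc (0 : ℝ) T) (r : ℝ) (i : κ → ι), 0 ≤ r →
        (∀ k, (t' k : ℝ) = t k + r) →
        P.map (fun w k => w (i k) (t' k)) = P.map (fun w k => w (i k) (t k))) ∧
      (∀ i, ∀ᵐ w ∂P, IntervalIntegrable (fun r => b i (pathAt hT.le r w)) volume 0 T ∧
        ∀ t ∈ Icc 0 T, pathAt hT.le t w i - pathAt hT.le 0 w i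
          = ∫ r in (0 : ℝ)..t, b i (pathAt hT.le r w)) ∧
      ∀ p : ℕ, p ≠ 0 → ∃ C : ℝ, 0 ≤ C ∧
        ∀ i, ∫⁻ w, ‖w i‖ₑ ^ p ∂P ≤ ENNReal.ofReal (C * (2 + K i)) := by
  classical
  obtain ⟨s, hsT⟩ := exists_seq_tendsto (atTop : Filter (Finset ι))
  have hε : ∀ n : ℕ, (0 : ℝ) < 1 / ((n : ℝ) + 1) := fun n => by positivity
  choose τ hτ Φ hMP hfix hdrift using fun n : ℕ => h.exists_splitting (s n) (hε n)
  have hε0 := tendsto_one_div_add_atTop_nhds_zero_nat (𝕜 := ℝ)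
  have mβ : ∀ n i, Measurable fun x : ι → ℝ => (Φ n x i - x i) / τ n := fun n i =>
    ((((measurable_pi_apply i).comp (hMP n).measurable).sub (measurable_pi_apply i)).div_const _)
  -- The truncated drift contributes K i to the velocity bound and the splitting error at most 1.
  -- Coordinates outside the truncation do not move at all.
  have flow : IsApproxFlow (fun i => K i + 1) τ Φ := by
    refine ⟨hMP, fun n => (hτ n).1, fun n => ?_, ?_, fun i => by linarith [hK0 i], fun n i => ?_⟩
    · refine (hτ n).2.le.trans ?_
      rw [div_le_one (by positivity)]
      linarith [Nat.cast_nonneg (α := ℝ) n]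
    · exact squeeze_zero (fun n => (hτ n).1.le) (fun n => (hτ n).2.le) hε0
    · by_cases hi : i ∈ s n
      · have e : (fun x : ι → ℝ => (Φ n x i - x i) / τ n)
            = fun x => drift a₀ a (s n) i x + ((Φ n x i - x i) / τ n - drift a₀ a (s n) i x) := by
          ext x
          ring
        rw [e]
        refine eLpNorm_add_le_ofReal (by norm_num) (measurable_drift i)
          ((mβ n i).sub (measurable_drift i)) (hK0 i) zero_le_one (hK _ _)
          ((hdrift n i hi).trans (ENNReal.ofReal_le_ofReal ?_))
        rw [div_le_one (by positivity)]
        linarith [Nat.cast_nonneg (α := ℝ) n]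
      · have e : (fun x : ι → ℝ => (Φ n x i - x i) / τ n) = fun _ => 0 := by
          ext x
          rw [hfix n x i hi, sub_self, zero_div]
        rw [e]
        simp
  obtain ⟨P, hPr, U, hU, hUT, hP⟩ := flow.exists_limit hT
  refine ⟨P, hPr, flow.map_eval_eq hUT hP, fun κ t t' r i hr ht => flow.map_shift_eq hUT hP t t' hr ht i,
    fun i => ?_, fun p hp => ?_⟩
  · refine ae_forall_of_ae_defect hT (flow.map_eval_eq hUT hP) (hb i)
      ((hb2 i).integrable (by norm_num)) fun t ht =>
        flow.ae_defect_eq_zero hT hUT hP (hb i) (hb2 i) ?_ (hs i) ht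
    have h1 : Tendsto (fun n : ℕ => ENNReal.ofReal (1 / ((n : ℝ) + 1))
        + eLpNorm (drift a₀ a (s n) i - b i) 2 (stdG ι)) atTop (𝓝 0) := by
      have h2 : Tendsto (fun n : ℕ => ENNReal.ofReal (1 / ((n : ℝ) + 1))) atTop (𝓝 0) := by
        have := ENNReal.tendsto_ofReal hε0
        rwa [ENNReal.ofReal_zero] at this
      simpa using h2.add ((hs i).comp hsT)
    refine tendsto_of_tendsto_of_tendsto_of_le_of_le' tendsto_const_nhds h1
      (Eventually.of_forall fun _ => zero_le) ?_
    filter_upwards [hsT.eventually (eventually_ge_atTop {i})] with n hn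
    have hi : i ∈ s n := hn (Finset.mem_singleton_self i)
    have e : (fun x : ι → ℝ => (Φ n x i - x i) / τ n - b i x)
        = (fun x => (Φ n x i - x i) / τ n - drift a₀ a (s n) i x)
          + (drift a₀ a (s n) i - b i) := by
      ext x
      simp
    rw [e]
    exact (eLpNorm_add_le ((mβ n i).sub (measurable_drift i)).aestronglyMeasurable
      ((measurable_drift i).sub (hb i)).aestronglyMeasurable (by norm_num)).trans
      (add_le_add_left (hdrift n i hi) _)
  · obtain ⟨C, hC0, hC⟩ := lintegral_path_pow_le hT hp
    refine ⟨C, hC0, fun i => (hC ι inferInstance _ τ Φ P U flow hPr hU hP i).trans ?_⟩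
    refine ENNReal.ofReal_le_ofReal (le_of_eq ?_)
    ring


/-! ### Averages over the torus -/

section Torus

/-- The normalised Lebesgue measure on `[-π, π]`. -/
def circ : Measure ℝ :=
  (ENNReal.ofReal (2 * Real.pi))⁻¹ • volume.restrict (Icc (-Real.pi) Real.pi)

/-- The normalised Lebesgue measure on the torus. -/
def torus : Measure (ℝ × ℝ) := circ.prod circ

instance : IsProbabilityMeasure circ := by
  refine ⟨?_⟩
  have h : (0 : ℝ) < 2 * Real.pi := by positivity
  rw [circ, Measure.smul_apply, Measure.restrict_apply_univ, Real.volume_Icc, smul_eq_mul,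
    show Real.pi - -Real.pi = 2 * Real.pi by ring]
  exact ENNReal.inv_mul_cancel (ENNReal.ofReal_pos.2 h).ne' ENNReal.ofReal_ne_top

instance : IsProbabilityMeasure torus := by
  unfold torus
  infer_instance

theorem average_torusBox (f : ℝ × ℝ → ℝ) : ⨍ z in torusBox, f z = ∫ z, f z ∂torus := by
  have h : (0 : ℝ) < 2 * Real.pi := by positivity
  have e : (volume.restrict torusBox univ)⁻¹ • volume.restrict torusBox = torus := by
    rw [torus, circ, Measure.prod_smul_left, Measure.prod_smul_right, Measure.prod_restrict, smul_smul,
      ← Measure.volume_eq_prod, Measure.restrict_apply_univ, torusBox, Measure.volume_eq_prod,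
      Measure.prod_prod, Real.volume_Icc, show Real.pi - -Real.pi = 2 * Real.pi by ring,
      ENNReal.mul_inv (Or.inr ENNReal.ofReal_ne_top) (Or.inl ENNReal.ofReal_ne_top)]
  rw [average, e]

theorem integral_circ (f : ℝ → ℝ) :
    ∫ x, f x ∂circ = (2 * Real.pi)⁻¹ * ∫ x in -Real.pi..Real.pi, f x := by
  have h : (0 : ℝ) < 2 * Real.pi := by positivity
  rw [circ, integral_smul_measure, intervalIntegral.integral_of_le (by linarith [Real.pi_pos]),
    integral_Icc_eq_integral_Ioc, ENNReal.toReal_inv, ENNReal.toReal_ofReal h.le, smul_eq_mul]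

theorem ae_circ_mem : ∀ᵐ x ∂circ, x ∈ Icc (-Real.pi) Real.pi := by
  refine Measure.ae_smul_measure ?_ _
  exact ae_restrict_mem measurableSet_Icc

theorem ae_torus_mem : ∀ᵐ z ∂torus, z ∈ torusBox := by
  have h := ae_circ_mem
  unfold torus
  have h1 : ∀ᵐ z ∂circ.prod circ, z.1 ∈ Icc (-Real.pi) Real.pi :=
    Measure.quasiMeasurePreserving_fst.ae h
  have h2 : ∀ᵐ z ∂circ.prod circ, z.2 ∈ Icc (-Real.pi) Real.pi :=
    Measure.quasiMeasurePreserving_snd.ae h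
  filter_upwards [h1, h2] with z hz1 hz2 using ⟨hz1, hz2⟩

theorem isCompact_torusBox : IsCompact torusBox := isCompact_Icc.prod isCompact_Icc

theorem integrable_torus_of_bound {f : ℝ × ℝ → ℝ} (hf : AEStronglyMeasurable f torus) {C : ℝ}
    (hC : ∀ z ∈ torusBox, |f z| ≤ C) : Integrable f torus := by
  refine Integrable.of_bound (C := C) hf ?_
  filter_upwards [ae_torus_mem] with z hz using hC z hz

theorem integrable_torus {f : ℝ × ℝ → ℝ} (hf : Continuous f) : Integrable f torus := by
  obtain ⟨C, hC⟩ := isCompact_torusBox.exists_bound_of_continuousOn hf.continuousOn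
  exact integrable_torus_of_bound hf.aestronglyMeasurable hC

theorem integrable_circ {f : ℝ → ℝ} (hf : Continuous f) : Integrable f circ := by
  obtain ⟨C, hC⟩ := isCompact_Icc.exists_bound_of_continuousOn
    (s := Icc (-Real.pi) Real.pi) hf.continuousOn
  refine Integrable.of_bound (C := C) hf.aestronglyMeasurable ?_
  filter_upwards [ae_circ_mem] with z hz using hC z hz

theorem abs_integral_torus_le {f : ℝ × ℝ → ℝ} {C : ℝ} (hC : ∀ z ∈ torusBox, |f z| ≤ C) :
    |∫ z, f z ∂torus| ≤ C := by
  have h := norm_integral_le_of_norm_le_const (μ := torus) (f := f) (C := C) (by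
    filter_upwards [ae_torus_mem] with z hz using hC z hz)
  simpa using h

theorem integral_deriv_circ {f f' : ℝ → ℝ} (hf : ∀ x, HasDerivAt f (f' x) x) (hc : Continuous f')
    (hper : f (-Real.pi) = f Real.pi) : ∫ x, f' x ∂circ = 0 := by
  rw [integral_circ, intervalIntegral.integral_eq_sub_of_hasDerivAt (fun x _ => hf x)
    (hc.intervalIntegrable _ _), hper, sub_self, mul_zero]

theorem integral_cos_circ (n : ℤ) : ∫ x, Real.cos (n * x) ∂circ = if n = 0 then 1 else 0 := by
  split_ifs with h
  · subst h
    simp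
  · have hn : (n : ℝ) ≠ 0 := by exact_mod_cast h
    refine integral_deriv_circ (f := fun x => Real.sin (n * x) / n) (fun x => ?_) (by fun_prop) ?_
    · have := ((Real.hasDerivAt_sin (n * x)).comp x ((hasDerivAt_id x).const_mul (n : ℝ))).div_const n
      refine this.congr_deriv ?_
      field_simp
    · rw [mul_neg, Real.sin_neg, Real.sin_int_mul_pi]
      simp

theorem integral_sin_circ (n : ℤ) : ∫ x, Real.sin (n * x) ∂circ = 0 := by
  rw [integral_circ]
  have : ∫ x in -Real.pi..Real.pi, Real.sin (n * x) = 0 := by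
    have h := intervalIntegral.integral_comp_neg (a := -Real.pi) (b := Real.pi)
      (fun x => Real.sin (n * x))
    simp only [mul_neg, Real.sin_neg, neg_neg, intervalIntegral.integral_neg] at h
    linarith
  rw [this, mul_zero]

end Torus

/-! ### The Fourier basis -/

section Basis

/-- The factor in `x` of the Fourier basis. -/
def trig (j : ℤ) (x : ℝ) : ℝ :=
  if j = 0 then Real.sqrt 2 else if 0 < j then 2 * Real.cos (j * x) else 2 * Real.sin (j * x)

theorem trig_zero (x : ℝ) : trig 0 x = Real.sqrt 2 := if_pos rfl

theorem trig_of_pos {j : ℤ} (hj : 0 < j) (x : ℝ) : trig j x = 2 * Real.cos (j * x) := by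
  rw [trig, if_neg hj.ne', if_pos hj]

theorem trig_of_neg {j : ℤ} (hj : j < 0) (x : ℝ) : trig j x = 2 * Real.sin (j * x) := by
  rw [trig, if_neg hj.ne, if_neg hj.le.not_gt]

theorem basisFn_eq (l : Mode) (z : ℝ × ℝ) : basisFn l z = trig l.1 z.1 * Real.sin (l.2 * z.2) := rfl

theorem exists_trig_eq (j : ℤ) : ∃ p q : ℝ, ∀ x, trig j x = p * Real.cos (j * x) + q * Real.sin (j * x) := by
  rcases lt_trichotomy j 0 with h | h | h
  · exact ⟨0, 2, fun x => by rw [trig_of_neg h]; ring⟩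
  · subst h
    exact ⟨Real.sqrt 2, 0, fun x => by simp [trig_zero]⟩
  · exact ⟨2, 0, fun x => by rw [trig_of_pos h]; ring⟩

/-- The sign of the index selects cosine or sine, so both functions of frequency |j| are recovered
from the pair j, −j. -/
theorem exists_cos_eq (j : ℤ) : ∃ p q : ℝ, ∀ x, Real.cos (j * x) = p * trig j x + q * trig (-j) x := by
  rcases lt_trichotomy j 0 with h | h | h
  · refine ⟨0, 1 / 2, fun x => ?_⟩
    rw [trig_of_pos (by omega : 0 < -j)]
    push_cast
    rw [neg_mul, Real.cos_neg]
    ring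
  · subst h
    refine ⟨1 / Real.sqrt 2, 0, fun x => ?_⟩
    have : Real.sqrt 2 ≠ 0 := by positivity
    simp [trig_zero, this]
  · exact ⟨1 / 2, 0, fun x => by rw [trig_of_pos h]; ring⟩

theorem exists_sin_eq (j : ℤ) : ∃ p q : ℝ, ∀ x, Real.sin (j * x) = p * trig j x + q * trig (-j) x := by
  rcases lt_trichotomy j 0 with h | h | h
  · exact ⟨1 / 2, 0, fun x => by rw [trig_of_neg h]; ring⟩
  · subst h
    exact ⟨0, 0, fun x => by simp⟩
  · refine ⟨0, -1 / 2, fun x => ?_⟩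
    rw [trig_of_neg (by omega : -j < 0)]
    push_cast
    rw [neg_mul, Real.sin_neg]
    ring

theorem abs_trig_le (j : ℤ) (x : ℝ) : |trig j x| ≤ 2 := by
  unfold trig
  split_ifs
  · rw [abs_of_nonneg (Real.sqrt_nonneg _), Real.sqrt_le_left (by norm_num)]
    norm_num
  · rw [abs_mul, abs_two]
    linarith [Real.abs_cos_le_one (j * x)]
  · rw [abs_mul, abs_two]
    linarith [Real.abs_sin_le_one (j * x)]

theorem contDiff_trig (j : ℤ) : ContDiff ℝ (⊤ : ℕ∞) (trig j) := by
  obtain ⟨p, q, h⟩ := exists_trig_eq j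
  rw [funext h]
  fun_prop

theorem trig_periodic (j : ℤ) (x : ℝ) : trig j (x + 2 * Real.pi) = trig j x := by
  obtain ⟨p, q, h⟩ := exists_trig_eq j
  rw [h, h, mul_add, Real.cos_add_int_mul_two_pi, Real.sin_add_int_mul_two_pi]

/-- The sine keeps its negative frequency in `trig`, and this makes one formula hold for all signs
of j: differentiation is multiplication by j followed by reflection of the index. -/
theorem hasDerivAt_trig (j : ℤ) (x : ℝ) : HasDerivAt (trig j) (j * trig (-j) x) x := by
  have hlin : HasDerivAt (fun x : ℝ => (j : ℝ) * x) j x := by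
    simpa using (hasDerivAt_id x).const_mul (j : ℝ)
  rcases lt_trichotomy j 0 with h | h | h
  · rw [trig_of_pos (by omega : 0 < -j), funext (trig_of_neg h)]
    refine (hlin.sin.const_mul 2).congr_deriv ?_
    push_cast
    rw [neg_mul, Real.cos_neg]
    ring
  · subst h
    rw [funext trig_zero]
    simpa using hasDerivAt_const x (Real.sqrt 2)
  · rw [trig_of_neg (by omega : -j < 0), funext (trig_of_pos h)]
    refine (hlin.cos.const_mul 2).congr_deriv ?_
    push_cast
    rw [neg_mul (j : ℝ) x, Real.sin_neg]
    ring

theorem integral_trig_mul (i j : ℤ) : ∫ x, trig i x * trig j x ∂circ = if i = j then 2 else 0 := by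
  have cc : ∀ a b : ℤ, ∫ x, Real.cos (a * x) * Real.cos (b * x) ∂circ
      = ((if a - b = 0 then 1 else 0) + (if a + b = 0 then 1 else 0)) / 2 := by
    intro a b
    rw [← integral_cos_circ, ← integral_cos_circ, ← integral_add
      (integrable_circ (by fun_prop)) (integrable_circ (by fun_prop)), ← integral_div]
    refine integral_congr_ae (ae_of_all _ fun x => ?_)
    push_cast
    simp only [sub_mul, add_mul, Real.cos_add, Real.cos_sub]
    ring
  have ss : ∀ a b : ℤ, ∫ x, Real.sin (a * x) * Real.sin (b * x) ∂circ
      = ((if a - b = 0 then 1 else 0) - (if a + b = 0 then 1 else 0)) / 2 := by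
    intro a b
    rw [← integral_cos_circ, ← integral_cos_circ, ← integral_sub
      (integrable_circ (by fun_prop)) (integrable_circ (by fun_prop)), ← integral_div]
    refine integral_congr_ae (ae_of_all _ fun x => ?_)
    push_cast
    simp only [sub_mul, add_mul, Real.cos_add, Real.cos_sub]
    ring
  have sc : ∀ a b : ℤ, ∫ x, Real.sin (a * x) * Real.cos (b * x) ∂circ = 0 := by
    intro a b
    have : (0 : ℝ) = (0 + 0) / 2 := by norm_num
    rw [this]
    nth_rewrite 1 [← integral_sin_circ (a + b)]
    rw [← integral_sin_circ (a - b), ← integral_add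
      (integrable_circ (by fun_prop)) (integrable_circ (by fun_prop)), ← integral_div]
    refine integral_congr_ae (ae_of_all _ fun x => ?_)
    push_cast
    simp only [sub_mul, add_mul, Real.sin_add, Real.sin_sub]
    ring
  have form : ∀ j : ℤ, ∃ p q : ℝ, (∀ x, trig j x = p * Real.cos (j * x) + q * Real.sin (j * x)) ∧
      (0 < j ∧ p = 2 ∧ q = 0 ∨ j < 0 ∧ p = 0 ∧ q = 2 ∨ j = 0 ∧ p = Real.sqrt 2 ∧ q = 0) := by
    intro j
    rcases lt_trichotomy j 0 with h | h | h
    · exact ⟨0, 2, fun x => by rw [trig_of_neg h]; ring, Or.inr (Or.inl ⟨h, rfl, rfl⟩)⟩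
    · subst h
      exact ⟨Real.sqrt 2, 0, fun x => by simp [trig_zero], Or.inr (Or.inr ⟨rfl, rfl, rfl⟩)⟩
    · exact ⟨2, 0, fun x => by rw [trig_of_pos h]; ring, Or.inl ⟨h, rfl, rfl⟩⟩
  obtain ⟨p, q, h1, hpq⟩ := form i
  obtain ⟨p', q', h2, hpq'⟩ := form j
  have e : ∫ x, trig i x * trig j x ∂circ
      = p * p' * ∫ x, Real.cos (i * x) * Real.cos (j * x) ∂circ
        + q * q' * ∫ x, Real.sin (i * x) * Real.sin (j * x) ∂circ
        + (q * p' * ∫ x, Real.sin (i * x) * Real.cos (j * x) ∂circ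
        + p * q' * ∫ x, Real.sin (j * x) * Real.cos (i * x) ∂circ) := by
    rw [← integral_const_mul, ← integral_const_mul, ← integral_const_mul, ← integral_const_mul,
      ← integral_add (integrable_circ (by fun_prop)) (integrable_circ (by fun_prop)),
      ← integral_add (integrable_circ (by fun_prop)) (integrable_circ (by fun_prop)),
      ← integral_add (integrable_circ (by fun_prop)) (integrable_circ (by fun_prop))]
    refine integral_congr_ae (ae_of_all _ fun x => ?_)
    simp only [h1, h2]
    ring
  rw [e, sc, sc, cc, ss]
  have h22 : Real.sqrt 2 * Real.sqrt 2 = 2 := Real.mul_self_sqrt (by norm_num)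
  rcases hpq with ⟨hi, rfl, rfl⟩ | ⟨hi, rfl, rfl⟩ | ⟨hi, rfl, rfl⟩ <;>
  rcases hpq' with ⟨hj, rfl, rfl⟩ | ⟨hj, rfl, rfl⟩ | ⟨hj, rfl, rfl⟩ <;>
  by_cases hij : i = j <;>
  simp only [hij, if_true, if_false, sub_eq_zero] <;>
  first
    | omega
    | (rw [if_neg (by omega)]; norm_num)
    | (subst hi; subst hj; simp)
    | simp

theorem integral_sin_mul_sin (k m : ℕ+) :
    ∫ y, Real.sin (k * y) * Real.sin (m * y) ∂circ = if k = m then 1 / 2 else 0 := by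
  have h := integral_trig_mul (-(k : ℤ)) (-(m : ℤ))
  have hk : -(k : ℤ) < 0 := by have := k.pos; omega
  have hm : -(m : ℤ) < 0 := by have := m.pos; omega
  have e : ∀ y : ℝ, trig (-(k : ℤ)) y * trig (-(m : ℤ)) y
      = 4 * (Real.sin (k * y) * Real.sin (m * y)) := fun y => by
    rw [trig_of_neg hk, trig_of_neg hm]
    push_cast
    rw [neg_mul, neg_mul, Real.sin_neg, Real.sin_neg]
    ring
  simp only [e, integral_const_mul, neg_inj, Nat.cast_inj, PNat.coe_inj] at h
  split_ifs at h ⊢ <;> linarith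

/-- Orthonormality of the Fourier basis. -/
theorem fourier_basisFn (l m : Mode) : fourier (basisFn l) m = if l = m then 1 else 0 := by
  rw [fourier, average_torusBox]
  have e : ∀ z : ℝ × ℝ, basisFn l z * basisFn m z
      = (trig l.1 z.1 * trig m.1 z.1) * (Real.sin (l.2 * z.2) * Real.sin (m.2 * z.2)) := fun z => by
    rw [basisFn_eq, basisFn_eq]
    ring
  simp only [e]
  rw [torus, integral_prod_mul (f := fun x => trig l.1 x * trig m.1 x)
    (g := fun y => Real.sin (l.2 * y) * Real.sin (m.2 * y)), integral_trig_mul, integral_sin_mul_sin]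
  by_cases h1 : l.1 = m.1 <;> by_cases h2 : l.2 = m.2 <;> simp [h1, h2, Prod.ext_iff]

end Basis


/-! ### Calculus of test functions -/

section Test

theorem hasDerivAt_dx {φ : ℝ × ℝ → ℝ} (h : ContDiff ℝ (⊤ : ℕ∞) φ) (z : ℝ × ℝ) :
    HasDerivAt (fun x => φ (x, z.2)) (fderiv ℝ φ z (1, 0)) z.1 := by
  have h1 : HasFDerivAt φ (fderiv ℝ φ z) (z.1, z.2) :=
    ((h.differentiable (by simp)) z).hasFDerivAt
  exact h1.comp_hasDerivAt z.1 ((hasDerivAt_id z.1).prodMk (hasDerivAt_const z.1 z.2))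

theorem hasDerivAt_dy {φ : ℝ × ℝ → ℝ} (h : ContDiff ℝ (⊤ : ℕ∞) φ) (z : ℝ × ℝ) :
    HasDerivAt (fun y => φ (z.1, y)) (fderiv ℝ φ z (0, 1)) z.2 := by
  have h1 : HasFDerivAt φ (fderiv ℝ φ z) (z.1, z.2) :=
    ((h.differentiable (by simp)) z).hasFDerivAt
  exact h1.comp_hasDerivAt z.2 ((hasDerivAt_const z.2 z.1).prodMk (hasDerivAt_id z.2))

variable {φ ψ : ℝ × ℝ → ℝ}

theorem dx_eq (h : ContDiff ℝ (⊤ : ℕ∞) φ) : dx φ = fun z => fderiv ℝ φ z (1, 0) :=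
  funext fun z => (hasDerivAt_dx h z).deriv

theorem dy_eq (h : ContDiff ℝ (⊤ : ℕ∞) φ) : dy φ = fun z => fderiv ℝ φ z (0, 1) :=
  funext fun z => (hasDerivAt_dy h z).deriv

theorem IsTest.continuous (h : IsTest φ) : Continuous φ := h.1.continuous

theorem IsTest.hasDerivAt_dx (h : IsTest φ) (z : ℝ × ℝ) :
    HasDerivAt (fun x => φ (x, z.2)) (dx φ z) z.1 := by
  rw [dx_eq h.1]
  exact BQG.hasDerivAt_dx h.1 z

theorem IsTest.hasDerivAt_dy (h : IsTest φ) (z : ℝ × ℝ) :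
    HasDerivAt (fun y => φ (z.1, y)) (dy φ z) z.2 := by
  rw [dy_eq h.1]
  exact BQG.hasDerivAt_dy h.1 z

theorem IsTest.isTest_dx (h : IsTest φ) : IsTest (dx φ) := by
  refine ⟨?_, fun x y => ⟨?_, ?_⟩⟩
  · rw [dx_eq h.1]
    exact (h.1.fderiv_right (m := (⊤ : ℕ∞)) (by simp)).clm_apply contDiff_const
  · have e : (fun x => φ (x, y)) = fun x => φ (x + 2 * Real.pi, y) :=
      funext fun x => ((h.2 x y).1).symm
    change deriv (fun x => φ (x, y)) (x + 2 * Real.pi) = deriv (fun x => φ (x, y)) x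
    conv_rhs => rw [e]
    exact (deriv_comp_add_const (fun x => φ (x, y)) (2 * Real.pi) x).symm
  · change deriv (fun x => φ (x, y + 2 * Real.pi)) x = deriv (fun x => φ (x, y)) x
    congr 1
    exact funext fun x => (h.2 x y).2

theorem IsTest.isTest_dy (h : IsTest φ) : IsTest (dy φ) := by
  refine ⟨?_, fun x y => ⟨?_, ?_⟩⟩
  · rw [dy_eq h.1]
    exact (h.1.fderiv_right (m := (⊤ : ℕ∞)) (by simp)).clm_apply contDiff_const
  · change deriv (fun y => φ (x + 2 * Real.pi, y)) y = deriv (fun y => φ (x, y)) y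
    congr 1
    exact funext fun y => (h.2 x y).1
  · have e : (fun y => φ (x, y)) = fun y => φ (x, y + 2 * Real.pi) :=
      funext fun y => ((h.2 x y).2).symm
    change deriv (fun y => φ (x, y)) (y + 2 * Real.pi) = deriv (fun y => φ (x, y)) y
    conv_rhs => rw [e]
    exact (deriv_comp_add_const (fun y => φ (x, y)) (2 * Real.pi) y).symm

theorem IsTest.mul (h : IsTest φ) (h' : IsTest ψ) : IsTest fun z => φ z * ψ z :=
  ⟨h.1.mul h'.1, fun x y => ⟨by simp only [(h.2 x y).1, (h'.2 x y).1], by simp only [(h.2 x y).2, (h'.2 x y).2]⟩⟩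

theorem IsTest.add (h : IsTest φ) (h' : IsTest ψ) : IsTest fun z => φ z + ψ z :=
  ⟨h.1.add h'.1, fun x y => ⟨by simp only [(h.2 x y).1, (h'.2 x y).1], by simp only [(h.2 x y).2, (h'.2 x y).2]⟩⟩

theorem dx_mul (h : IsTest φ) (h' : IsTest ψ) (z : ℝ × ℝ) :
    dx (fun z => φ z * ψ z) z = dx φ z * ψ z + φ z * dx ψ z :=
  ((h.hasDerivAt_dx z).mul (h'.hasDerivAt_dx z)).deriv

theorem dy_mul (h : IsTest φ) (h' : IsTest ψ) (z : ℝ × ℝ) :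
    dy (fun z => φ z * ψ z) z = dy φ z * ψ z + φ z * dy ψ z :=
  ((h.hasDerivAt_dy z).mul (h'.hasDerivAt_dy z)).deriv

theorem IsTest.integral_dx (h : IsTest φ) : ∫ z, dx φ z ∂torus = 0 := by
  rw [torus, integral_prod_symm _ (integrable_torus h.isTest_dx.continuous)]
  have : ∀ y, ∫ x, BQG.dx φ (x, y) ∂circ = 0 := fun y => by
    refine integral_deriv_circ (f := fun x => φ (x, y)) (fun x => h.hasDerivAt_dx (x, y))
      (h.isTest_dx.continuous.comp (by fun_prop)) ?_
    rw [← (h.2 (-Real.pi) y).1]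
    congr 2
    ring
  simp [this]

theorem IsTest.integral_dy (h : IsTest φ) : ∫ z, dy φ z ∂torus = 0 := by
  rw [torus, integral_prod _ (integrable_torus h.isTest_dy.continuous)]
  have : ∀ x, ∫ y, BQG.dy φ (x, y) ∂circ = 0 := fun x => by
    refine integral_deriv_circ (f := fun y => φ (x, y)) (fun y => h.hasDerivAt_dy (x, y))
      (h.isTest_dy.continuous.comp (by fun_prop)) ?_
    rw [← (h.2 x (-Real.pi)).2]
    congr 2
    ring
  simp [this]

theorem IsTest.integral_dx_mul (h : IsTest φ) (h' : IsTest ψ) :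
    ∫ z, dx φ z * ψ z ∂torus = -∫ z, φ z * dx ψ z ∂torus := by
  have := (h.mul h').integral_dx
  simp only [dx_mul h h'] at this
  rw [integral_add (integrable_torus (h.isTest_dx.mul h').continuous)
    (integrable_torus (h.mul h'.isTest_dx).continuous)] at this
  linarith

theorem IsTest.integral_dy_mul (h : IsTest φ) (h' : IsTest ψ) :
    ∫ z, dy φ z * ψ z ∂torus = -∫ z, φ z * dy ψ z ∂torus := by
  have := (h.mul h').integral_dy
  simp only [dy_mul h h'] at this
  rw [integral_add (integrable_torus (h.isTest_dy.mul h').continuous)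
    (integrable_torus (h.mul h'.isTest_dy).continuous)] at this
  linarith

end Test

/-! ### Derivatives of the Fourier basis -/

section BasisCalculus

/-- The mode with the opposite wave number in `x`. -/
def conj (l : Mode) : Mode := (-l.1, l.2)

@[simp] theorem conj_conj (l : Mode) : conj (conj l) = l := by simp [conj]

@[simp] theorem lam_conj (l : Mode) : lam (conj l) = lam l := by simp [conj, lam]

/-- The companion of the Fourier basis that is even in `y`. -/
def evenFn (l : Mode) (z : ℝ × ℝ) : ℝ := trig l.1 z.1 * Real.cos (l.2 * z.2)

theorem isTest_basisFn (l : Mode) : IsTest (basisFn l) := by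
  refine ⟨?_, fun x y => ⟨?_, ?_⟩⟩
  · exact ((contDiff_trig l.1).comp contDiff_fst).mul
      (Real.contDiff_sin.comp (contDiff_const.mul contDiff_snd))
  · simp only [basisFn_eq, trig_periodic]
  · simp only [basisFn_eq]
    rw [mul_add, Real.sin_add_nat_mul_two_pi]

theorem isTest_evenFn (l : Mode) : IsTest (evenFn l) := by
  refine ⟨?_, fun x y => ⟨?_, ?_⟩⟩
  · exact ((contDiff_trig l.1).comp contDiff_fst).mul
      (Real.contDiff_cos.comp (contDiff_const.mul contDiff_snd))
  · simp only [evenFn, trig_periodic]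
  · simp only [evenFn]
    rw [mul_add, Real.cos_add_nat_mul_two_pi]

theorem continuous_basisFn (l : Mode) : Continuous (basisFn l) := (isTest_basisFn l).continuous

theorem hasDerivAt_basisFn_fst (l : Mode) (x y : ℝ) :
    HasDerivAt (fun x => basisFn l (x, y)) (l.1 * basisFn (conj l) (x, y)) x := by
  refine ((hasDerivAt_trig l.1 x).mul_const (Real.sin (l.2 * y))).congr_deriv ?_
  rw [basisFn_eq, conj]
  ring

theorem hasDerivAt_evenFn_fst (l : Mode) (x y : ℝ) :
    HasDerivAt (fun x => evenFn l (x, y)) (l.1 * evenFn (conj l) (x, y)) x := by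
  refine ((hasDerivAt_trig l.1 x).mul_const (Real.cos (l.2 * y))).congr_deriv ?_
  rw [evenFn, conj]
  ring

theorem hasDerivAt_basisFn_snd (l : Mode) (x y : ℝ) :
    HasDerivAt (fun y => basisFn l (x, y)) (l.2 * evenFn l (x, y)) y := by
  have hlin : HasDerivAt (fun y : ℝ => (l.2 : ℝ) * y) l.2 y := by
    simpa using (hasDerivAt_id y).const_mul (l.2 : ℝ)
  refine (hlin.sin.const_mul (trig l.1 x)).congr_deriv ?_
  rw [evenFn]
  ring

theorem hasDerivAt_evenFn_snd (l : Mode) (x y : ℝ) :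
    HasDerivAt (fun y => evenFn l (x, y)) (-l.2 * basisFn l (x, y)) y := by
  have hlin : HasDerivAt (fun y : ℝ => (l.2 : ℝ) * y) l.2 y := by
    simpa using (hasDerivAt_id y).const_mul (l.2 : ℝ)
  refine (hlin.cos.const_mul (trig l.1 x)).congr_deriv ?_
  rw [basisFn_eq]
  ring

theorem dx_basisFn (l : Mode) (z : ℝ × ℝ) : dx (basisFn l) z = l.1 * basisFn (conj l) z :=
  (hasDerivAt_basisFn_fst l z.1 z.2).deriv

theorem dy_basisFn (l : Mode) (z : ℝ × ℝ) : dy (basisFn l) z = l.2 * evenFn l z :=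
  (hasDerivAt_basisFn_snd l z.1 z.2).deriv

theorem dx_evenFn (l : Mode) (z : ℝ × ℝ) : dx (evenFn l) z = l.1 * evenFn (conj l) z :=
  (hasDerivAt_evenFn_fst l z.1 z.2).deriv

theorem dy_evenFn (l : Mode) (z : ℝ × ℝ) : dy (evenFn l) z = -l.2 * basisFn l z :=
  (hasDerivAt_evenFn_snd l z.1 z.2).deriv

theorem abs_basisFn_le (l : Mode) (z : ℝ × ℝ) : |basisFn l z| ≤ 2 := by
  rw [basisFn_eq, abs_mul]
  have h1 := abs_trig_le l.1 z.1
  have h2 := Real.abs_sin_le_one (l.2 * z.2)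
  nlinarith [abs_nonneg (trig l.1 z.1), abs_nonneg (Real.sin (l.2 * z.2))]

theorem abs_evenFn_le (l : Mode) (z : ℝ × ℝ) : |evenFn l z| ≤ 2 := by
  rw [evenFn, abs_mul]
  have h1 := abs_trig_le l.1 z.1
  have h2 := Real.abs_cos_le_one (l.2 * z.2)
  nlinarith [abs_nonneg (trig l.1 z.1), abs_nonneg (Real.cos (l.2 * z.2))]

theorem abs_fst_le (l : Mode) : |(l.1 : ℝ)| ≤ Real.sqrt (lam l) := by
  refine Real.abs_le_sqrt ?_
  unfold lam
  nlinarith [sq_nonneg (l.2 : ℝ)]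

theorem snd_le (l : Mode) : (l.2 : ℝ) ≤ Real.sqrt (lam l) := by
  refine Real.le_sqrt_of_sq_le ?_
  unfold lam
  nlinarith [sq_nonneg (l.1 : ℝ)]

theorem one_le_snd (l : Mode) : (1 : ℝ) ≤ l.2 := by exact_mod_cast l.2.pos

theorem one_le_lam (l : Mode) : 1 ≤ lam l := by
  unfold lam
  nlinarith [one_le_snd l, sq_nonneg (l.1 : ℝ)]

theorem one_le_sqrt_lam (l : Mode) : 1 ≤ Real.sqrt (lam l) := Real.one_le_sqrt.2 (one_le_lam l)

theorem fourier_eq (f : ℝ × ℝ → ℝ) (l : Mode) : fourier f l = ∫ z, f z * basisFn l z ∂torus :=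
  average_torusBox _

theorem IsTest.fourier_dx {φ : ℝ × ℝ → ℝ} (h : IsTest φ) (l : Mode) :
    fourier (BQG.dx φ) l = -l.1 * fourier φ (conj l) := by
  rw [fourier_eq, h.integral_dx_mul (isTest_basisFn l), fourier_eq, ← integral_const_mul,
    ← integral_neg]
  refine integral_congr_ae (ae_of_all _ fun z => ?_)
  simp only [dx_basisFn]
  ring

theorem IsTest.fourier_dx_dx {φ : ℝ × ℝ → ℝ} (h : IsTest φ) (l : Mode) :
    fourier (BQG.dx (BQG.dx φ)) l = -(l.1 : ℝ) ^ 2 * fourier φ l := by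
  rw [h.isTest_dx.fourier_dx, h.fourier_dx, conj_conj]
  simp only [conj, Int.cast_neg]
  ring

theorem IsTest.fourier_dy_dy {φ : ℝ × ℝ → ℝ} (h : IsTest φ) (l : Mode) :
    fourier (BQG.dy (BQG.dy φ)) l = -(l.2 : ℝ) ^ 2 * fourier φ l := by
  rw [fourier_eq, h.isTest_dy.integral_dy_mul (isTest_basisFn l), fourier_eq]
  have e : ∫ z, BQG.dy φ z * BQG.dy (basisFn l) z ∂torus
      = l.2 * ∫ z, BQG.dy φ z * evenFn l z ∂torus := by
    rw [← integral_const_mul]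
    refine integral_congr_ae (ae_of_all _ fun z => ?_)
    simp only [dy_basisFn]
    ring
  rw [e, h.integral_dy_mul (isTest_evenFn l)]
  have e2 : ∫ z, φ z * BQG.dy (evenFn l) z ∂torus = -l.2 * ∫ z, φ z * basisFn l z ∂torus := by
    rw [← integral_const_mul]
    refine integral_congr_ae (ae_of_all _ fun z => ?_)
    simp only [dy_evenFn]
    ring
  rw [e2]
  ring

theorem IsTest.exists_fourier_bound {φ : ℝ × ℝ → ℝ} (h : IsTest φ) :
    ∃ C, 0 ≤ C ∧ ∀ l, |fourier φ l| ≤ C := by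
  obtain ⟨C, hC⟩ := isCompact_torusBox.exists_bound_of_continuousOn h.continuous.continuousOn
  refine ⟨|C| * 2, by positivity, fun l => ?_⟩
  rw [fourier_eq]
  refine abs_integral_torus_le fun z hz => ?_
  rw [abs_mul]
  exact mul_le_mul ((hC z hz).trans (le_abs_self _)) (abs_basisFn_le l z) (abs_nonneg _)
    (abs_nonneg _)

/-- The Fourier coefficients of a test function decay faster than any power. -/
theorem IsTest.exists_fourier_decay (p : ℕ) : ∀ {φ : ℝ × ℝ → ℝ}, IsTest φ →
    ∃ C, 0 ≤ C ∧ ∀ l, lam l ^ p * |fourier φ l| ≤ C := by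
  induction p with
  | zero => intro φ h; simpa using h.exists_fourier_bound
  | succ p ih =>
    intro φ h
    -- The induction hypothesis is applied to Δφ, whose coefficients are −|l|² φ̂_l. Each Laplacian
    -- gains one factor |l|².
    obtain ⟨C, hC, hl⟩ := ih (h.isTest_dx.isTest_dx.add h.isTest_dy.isTest_dy)
    refine ⟨C, hC, fun l => ?_⟩
    refine le_trans (le_of_eq ?_) (hl l)
    have e : fourier (fun z => BQG.dx (BQG.dx φ) z + BQG.dy (BQG.dy φ) z) l
        = -lam l * fourier φ l := by
      have h1 := h.fourier_dx_dx l
      have h2 := h.fourier_dy_dy l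
      rw [fourier_eq] at h1 h2 ⊢
      simp only [add_mul]
      rw [integral_add (integrable_torus (h.isTest_dx.isTest_dx.mul (isTest_basisFn l)).continuous)
        (integrable_torus (h.isTest_dy.isTest_dy.mul (isTest_basisFn l)).continuous), h1, h2, lam]
      ring
    rw [e, abs_mul, abs_neg, abs_of_pos (lam_pos l), pow_succ]
    ring

end BasisCalculus


/-! ### Triads -/

section Triads

/-- `f` is a linear combination of the functions `e n`, `n ∈ S`. -/
def IsComb {κ X : Type} (e : κ → X → ℝ) (S : Finset κ) (f : X → ℝ) : Prop :=
  ∃ c : κ → ℝ, ∀ x, f x = ∑ n ∈ S, c n * e n x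

/-! ### Finite linear combinations of a family of functions. -/

section IsComb

variable {κ κ' X Y : Type} {e : κ → X → ℝ} {S : Finset κ} {f g : X → ℝ}

theorem IsComb.of_mem [DecidableEq κ] {n : κ} (hn : n ∈ S) : IsComb e S (e n) :=
  ⟨fun k => if k = n then 1 else 0, fun x => by simp [hn]⟩

theorem IsComb.add (hf : IsComb e S f) (hg : IsComb e S g) : IsComb e S fun x => f x + g x := by
  obtain ⟨c, hc⟩ := hf
  obtain ⟨d, hd⟩ := hg
  exact ⟨fun n => c n + d n, fun x => by simp [hc, hd, add_mul, Finset.sum_add_distrib]⟩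

theorem IsComb.const_mul (a : ℝ) (hf : IsComb e S f) : IsComb e S fun x => a * f x := by
  obtain ⟨c, hc⟩ := hf
  exact ⟨fun n => a * c n, fun x => by simp [hc, mul_assoc, Finset.mul_sum]⟩

theorem IsComb.prod {e' : κ' → Y → ℝ} {S' : Finset κ'} {g : Y → ℝ} (hf : IsComb e S f)
    (hg : IsComb e' S' g) :
    IsComb (fun n : κ × κ' => fun z : X × Y => e n.1 z.1 * e' n.2 z.2) (S ×ˢ S')
      fun z => f z.1 * g z.2 := by
  obtain ⟨c, hc⟩ := hf
  obtain ⟨d, hd⟩ := hg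
  refine ⟨fun n => c n.1 * d n.2, fun z => ?_⟩
  simp only [hc, hd]
  rw [Finset.sum_mul_sum, Finset.sum_product]
  exact Finset.sum_congr rfl fun i _ => Finset.sum_congr rfl fun j _ => by ring

end IsComb

/-- The wave numbers in `x` that occur in a product. -/
def nbrX (i j : ℤ) : Finset ℤ := {i + j, -(i + j), i - j, -(i - j)}

/-- The wave numbers in `y` that occur in a product. -/
def nbrY (k m : ℕ+) : Finset ℕ+ := {k + m, k - m, m - k}

/-- The modes that occur in the product of derivatives of two basis functions. -/
def nbr (l l' : Mode) : Finset Mode := nbrX l.1 l'.1 ×ˢ nbrY l.2 l'.2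

theorem card_nbr_le (l l' : Mode) : (nbr l l').card ≤ 12 := by
  rw [nbr, Finset.card_product]
  exact Nat.mul_le_mul (Finset.card_le_four (a := _)) (Finset.card_le_three (a := _))

theorem isComb_trig_mul (i j : ℤ) : IsComb trig (nbrX i j) fun x => trig i x * trig j x := by
  have hc : ∀ n, n ∈ nbrX i j → -n ∈ nbrX i j →
      IsComb trig (nbrX i j) (fun x => Real.cos (n * x)) ∧
      IsComb trig (nbrX i j) (fun x => Real.sin (n * x)) := by
    intro n h1 h2
    obtain ⟨p, q, h⟩ := exists_cos_eq n
    obtain ⟨p', q', h'⟩ := exists_sin_eq n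
    simp only [h, h']
    exact ⟨((IsComb.of_mem h1).const_mul p).add ((IsComb.of_mem h2).const_mul q),
      ((IsComb.of_mem h1).const_mul p').add ((IsComb.of_mem h2).const_mul q')⟩
  obtain ⟨h1, h2⟩ := hc (i + j) (by simp [nbrX]) (by simp [nbrX])
  obtain ⟨h3, h4⟩ := hc (i - j) (by simp [nbrX]) (by simp [nbrX])
  obtain ⟨p, q, hi⟩ := exists_trig_eq i
  obtain ⟨p', q', hj⟩ := exists_trig_eq j
  have e : (fun x => trig i x * trig j x) = fun x =>
      (((p * p' - q * q') / 2) * Real.cos ((i + j : ℤ) * x)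
        + ((q * p' + p * q') / 2) * Real.sin ((i + j : ℤ) * x))
      + (((p * p' + q * q') / 2) * Real.cos ((i - j : ℤ) * x)
        + ((q * p' - p * q') / 2) * Real.sin ((i - j : ℤ) * x)) := by
    ext x
    rw [hi, hj]
    push_cast
    simp only [sub_mul, add_mul, Real.cos_add, Real.cos_sub, Real.sin_add, Real.sin_sub]
    ring
  rw [e]
  exact ((h1.const_mul _).add (h2.const_mul _)).add ((h3.const_mul _).add (h4.const_mul _))

theorem nbrX_neg_right (i j : ℤ) : nbrX i (-j) = nbrX i j := by
  ext n
  simp only [nbrX, Finset.mem_insert, Finset.mem_singleton]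
  omega

theorem nbrX_neg_left (i j : ℤ) : nbrX (-i) j = nbrX i j := by
  ext n
  simp only [nbrX, Finset.mem_insert, Finset.mem_singleton]
  omega

theorem isComb_sin_mul_cos (k m : ℕ+) : IsComb (fun (n : ℕ+) (y : ℝ) => Real.sin (n * y)) (nbrY k m)
    fun y => Real.sin (k * y) * Real.cos (m * y) := by
  have h1 : IsComb (fun (n : ℕ+) (y : ℝ) => Real.sin (n * y)) (nbrY k m)
      (fun y => Real.sin ((k + m : ℕ+) * y)) := IsComb.of_mem (by simp [nbrY])
  -- Subtraction in ℕ+ is truncated at 1, so at most one of k − m and m − k is the true frequency |k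
  -- − m|. For k = m the sine vanishes. Superfluous members of `nbrY` do no harm.
  have h2 : IsComb (fun (n : ℕ+) (y : ℝ) => Real.sin (n * y)) (nbrY k m)
      (fun y => Real.sin ((k - m : ℝ) * y)) := by
    rcases lt_trichotomy k m with h | h | h
    · have h3 : IsComb (fun (n : ℕ+) (y : ℝ) => Real.sin (n * y)) (nbrY k m)
        (fun y => Real.sin ((m - k : ℕ+) * y)) := IsComb.of_mem (by simp [nbrY])
      convert h3.const_mul (-1) using 2 with y
      have : ((m - k : ℕ+) : ℝ) = m - k := by
        rw [eq_sub_iff_add_eq]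
        exact_mod_cast PNat.sub_add_of_lt h
      rw [this, ← neg_sub, neg_mul, Real.sin_neg]
      ring
    · subst h
      convert h1.const_mul 0 using 2 with y
      simp
    · have h3 : IsComb (fun (n : ℕ+) (y : ℝ) => Real.sin (n * y)) (nbrY k m)
        (fun y => Real.sin ((k - m : ℕ+) * y)) := IsComb.of_mem (by simp [nbrY])
      convert h3 using 4 with y
      symm
      rw [eq_sub_iff_add_eq]
      exact_mod_cast PNat.sub_add_of_lt h
  convert (h1.const_mul (1 / 2)).add (h2.const_mul (1 / 2)) using 2 with y
  push_cast
  simp only [sub_mul, add_mul, Real.sin_add, Real.sin_sub]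
  ring

theorem nbrY_comm (k m : ℕ+) : nbrY m k = nbrY k m := by
  ext n
  simp only [nbrY, Finset.mem_insert, Finset.mem_singleton, add_comm m k]
  tauto

theorem jac_basisFn (l l' : Mode) (z : ℝ × ℝ) : jac (basisFn l) (basisFn l') z
    = -(l.2 * evenFn l z) * (l'.1 * basisFn (conj l') z)
      + l.1 * basisFn (conj l) z * (l'.2 * evenFn l' z) := by
  rw [jac, dx_basisFn, dx_basisFn, dy_basisFn, dy_basisFn]

/-- Each term of the Jacobian carries exactly one y-derivative, so in y it is a sine times a cosine,
hence odd. The sine basis is closed under this interaction, which involves only finitely many modes.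
-/
theorem isComb_jac_basisFn (l l' : Mode) : IsComb basisFn (nbr l l') (jac (basisFn l) (basisFn l')) := by
  have hX1 := isComb_trig_mul l.1 (-l'.1)
  rw [nbrX_neg_right] at hX1
  have hX2 := isComb_trig_mul (-l.1) l'.1
  rw [nbrX_neg_left] at hX2
  have hY1 := isComb_sin_mul_cos l'.2 l.2
  rw [nbrY_comm] at hY1
  have hY2 := isComb_sin_mul_cos l.2 l'.2
  have h := ((hX1.prod hY1).const_mul (-(l.2 * l'.1))).add ((hX2.prod hY2).const_mul (l.1 * l'.2))
  refine (show jac (basisFn l) (basisFn l') = _ from ?_) ▸ h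
  ext z
  rw [jac_basisFn, evenFn, evenFn, basisFn_eq, basisFn_eq]
  simp only [conj]
  ring

/-- The interaction coefficients `⨍ (∇^⊥b_l · ∇b_{l'}) b_m`. -/
def triad (l l' m : Mode) : ℝ := fourier (jac (basisFn l) (basisFn l')) m

theorem fourier_sum {κ : Type} (S : Finset κ) (c : κ → ℝ) (f : κ → ℝ × ℝ → ℝ)
    (hf : ∀ n, Continuous (f n)) (m : Mode) :
    fourier (fun z => ∑ n ∈ S, c n * f n z) m = ∑ n ∈ S, c n * fourier (f n) m := by
  simp only [fourier_eq, Finset.sum_mul]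
  have hi : ∀ n, Integrable (fun z => c n * f n z * basisFn m z) torus := fun n =>
    integrable_torus ((continuous_const.mul (hf n)).mul (continuous_basisFn m))
  rw [integral_finsetSum _ fun n _ => hi n]
  refine Finset.sum_congr rfl fun n _ => ?_
  rw [← integral_const_mul]
  exact integral_congr_ae (ae_of_all _ fun z => by ring)

theorem jac_eq_sum_triad (l l' : Mode) (z : ℝ × ℝ) :
    jac (basisFn l) (basisFn l') z = ∑ m ∈ nbr l l', triad l l' m * basisFn m z := by
  obtain ⟨c, hc⟩ := isComb_jac_basisFn l l'
  rw [hc]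
  refine Finset.sum_congr rfl fun m hm => ?_
  rw [triad, funext hc, fourier_sum _ _ _ continuous_basisFn]
  simp [fourier_basisFn, hm]

theorem triad_eq_zero {l l' m : Mode} (h : m ∉ nbr l l') : triad l l' m = 0 := by
  obtain ⟨c, hc⟩ := isComb_jac_basisFn l l'
  rw [triad, funext hc, fourier_sum _ _ _ continuous_basisFn]
  simp [fourier_basisFn, h]

theorem triad_swap (l l' m : Mode) : triad l' l m = -triad l l' m := by
  rw [triad, triad, fourier_eq, fourier_eq, ← integral_neg]
  refine integral_congr_ae (ae_of_all _ fun z => ?_)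
  simp only [jac]
  ring

theorem continuous_jac_basisFn {φ : ℝ × ℝ → ℝ} (h : IsTest φ) (l : Mode) :
    Continuous (jac (basisFn l) φ) := by
  have h1 := (isTest_basisFn l).isTest_dx.continuous
  have h2 := (isTest_basisFn l).isTest_dy.continuous
  have h3 := h.isTest_dx.continuous
  have h4 := h.isTest_dy.continuous
  unfold jac
  fun_prop

/-- Integration by parts for the Jacobian. -/
theorem IsTest.integral_jac_mul {φ ψ : ℝ × ℝ → ℝ} (h : IsTest φ) (h' : IsTest ψ) (l : Mode) :
    ∫ z, jac (basisFn l) φ z * ψ z ∂torus = -∫ z, jac (basisFn l) ψ z * φ z ∂torus := by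
  have hF := h.mul h'
  have c1 := ((isTest_evenFn l).mul hF.isTest_dx).continuous
  have c2 := ((isTest_basisFn (conj l)).mul hF.isTest_dy).continuous
  -- Both integrations by parts produce the mixed derivative of b_l. The two cancel, which says that
  -- ∇^⊥b_l is divergence free.
  have i1 : ∫ z, evenFn l z * BQG.dx (fun z => φ z * ψ z) z ∂torus
      = -(l.1 * ∫ z, evenFn (conj l) z * (φ z * ψ z) ∂torus) := by
    have := (isTest_evenFn l).integral_dx_mul hF
    simp only [dx_evenFn, mul_assoc, integral_const_mul] at this
    linarith
  have i2 : ∫ z, basisFn (conj l) z * BQG.dy (fun z => φ z * ψ z) z ∂torus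
      = -(l.2 * ∫ z, evenFn (conj l) z * (φ z * ψ z) ∂torus) := by
    have := (isTest_basisFn (conj l)).integral_dy_mul hF
    simp only [dy_basisFn, mul_assoc, integral_const_mul] at this
    simp only [conj] at this ⊢
    linarith
  have key : ∫ z, (jac (basisFn l) φ z * ψ z + jac (basisFn l) ψ z * φ z) ∂torus = 0 := by
    have e : ∀ z, jac (basisFn l) φ z * ψ z + jac (basisFn l) ψ z * φ z
        = -l.2 * (evenFn l z * BQG.dx (fun z => φ z * ψ z) z)
          + l.1 * (basisFn (conj l) z * BQG.dy (fun z => φ z * ψ z) z) := fun z => by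
      rw [dx_mul h h', dy_mul h h', jac, jac, dx_basisFn, dy_basisFn]
      ring
    simp only [e]
    rw [integral_add ((integrable_torus c1).const_mul _) ((integrable_torus c2).const_mul _),
      integral_const_mul, integral_const_mul, i1, i2]
    ring
  have i3 : Integrable (fun z => jac (basisFn l) φ z * ψ z) torus :=
    integrable_torus ((continuous_jac_basisFn h l).mul h'.continuous)
  have i4 : Integrable (fun z => jac (basisFn l) ψ z * φ z) torus :=
    integrable_torus ((continuous_jac_basisFn h' l).mul h.continuous)
  rw [integral_add i3 i4] at key
  linarith

/-- Transport by a divergence-free field is antisymmetric. Together with `triad_swap` the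
coefficients are totally antisymmetric, the source of every cancellation below. -/
theorem triad_swap_right (l l' m : Mode) : triad l m l' = -triad l l' m := by
  rw [triad, triad, fourier_eq, fourier_eq]
  have := (isTest_basisFn l').integral_jac_mul (isTest_basisFn m) l
  linarith

theorem triad_self_left (l m : Mode) : triad l l m = 0 := by
  have := triad_swap l l m
  linarith

theorem triad_self (l m : Mode) : triad m l m = 0 := by
  rw [triad_swap_right, triad_self_left, neg_zero]

/-- The third mode does not enter. By antisymmetry any two of the three modes can be chosen to carry
the derivatives. -/
theorem abs_triad_le (l l' m : Mode) :
    |triad l l' m| ≤ 16 * (Real.sqrt (lam l) * Real.sqrt (lam l')) := by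
  rw [triad, fourier_eq]
  refine abs_integral_torus_le fun z _ => ?_
  have b1 := abs_evenFn_le l z
  have b2 := abs_evenFn_le l' z
  have b3 := abs_basisFn_le (conj l) z
  have b4 := abs_basisFn_le (conj l') z
  have b5 := abs_basisFn_le m z
  have k1 : |(l.2 : ℝ)| ≤ Real.sqrt (lam l) := by
    rw [abs_of_nonneg (by positivity)]
    exact snd_le l
  have k2 : |(l'.2 : ℝ)| ≤ Real.sqrt (lam l') := by
    rw [abs_of_nonneg (by positivity)]
    exact snd_le l'
  have j1 := abs_fst_le l
  have j2 := abs_fst_le l'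
  have m1 : |(l.2 : ℝ)| * |evenFn l z| * (|(l'.1 : ℝ)| * |basisFn (conj l') z|)
      ≤ (Real.sqrt (lam l) * 2) * (Real.sqrt (lam l') * 2) := by gcongr
  have m2 : |(l.1 : ℝ)| * |basisFn (conj l) z| * (|(l'.2 : ℝ)| * |evenFn l' z|)
      ≤ (Real.sqrt (lam l) * 2) * (Real.sqrt (lam l') * 2) := by gcongr
  rw [abs_mul]
  calc |jac (basisFn l) (basisFn l') z| * |basisFn m z|
      ≤ ((Real.sqrt (lam l) * 2) * (Real.sqrt (lam l') * 2)
        + (Real.sqrt (lam l) * 2) * (Real.sqrt (lam l') * 2)) * 2 := by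
        refine mul_le_mul ?_ b5 (abs_nonneg _) (by positivity)
        rw [jac_basisFn]
        refine (abs_add_le _ _).trans (add_le_add ?_ ?_)
        · simpa only [abs_mul, abs_neg] using m1
        · simpa only [abs_mul] using m2
    _ = _ := by ring

end Triads


/-! ### Sums over modes -/

/-- For j ≠ 0 the bound |j| k ≤ j² + k² lets the double series factor into two convergent ones. The
row j = 0 is covered by the extra indicator. The exponent s > 1 is the threshold of dimension two.
-/
theorem summable_lam_rpow {s : ℝ} (hs : 1 < s) : Summable fun l : Mode => lam l ^ (-s) := by
  have h1 : Summable fun j : ℤ => |(j : ℝ)| ^ (-s) + (if j = 0 then 1 else 0) :=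
    (Real.summable_abs_int_rpow hs).add (summable_of_ne_finset_zero (s := {0}) (by simp))
  have h2 : Summable fun k : ℕ+ => (k : ℝ) ^ (-s) := by
    have := (Real.summable_nat_rpow (p := -s)).2 (by linarith)
    exact this.comp_injective PNat.coe_injective
  have h3 := h1.mul_of_nonneg h2 (fun j => by positivity) (fun k => by positivity)
  refine h3.of_nonneg_of_le (fun l => (Real.rpow_pos_of_pos (lam_pos l) _).le) fun l => ?_
  have hk := one_le_snd l
  have hk0 : (0 : ℝ) < l.2 := by linarith
  have e2 : ∀ a : ℝ, 0 ≤ a → (a ^ 2) ^ (-s / 2) = a ^ (-s) := fun a ha => by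
    rw [← Real.rpow_natCast, ← Real.rpow_mul ha]
    congr 1
    push_cast
    ring
  by_cases hj : l.1 = 0
  · have e : lam l = (l.2 : ℝ) ^ 2 := by simp [lam, hj]
    have hp : (l.2 : ℝ) ^ (-s) * (l.2 : ℝ) ^ (-s) ≤ (l.2 : ℝ) ^ (-s) := by
      have : (l.2 : ℝ) ^ (-s) ≤ 1 := Real.rpow_le_one_of_one_le_of_nonpos hk (by linarith)
      have h0 := Real.rpow_nonneg hk0.le (-s)
      nlinarith
    have e3 : ((l.2 : ℝ) ^ 2) ^ (-s) = (l.2 : ℝ) ^ (-s) * (l.2 : ℝ) ^ (-s) := by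
      rw [sq, Real.mul_rpow hk0.le hk0.le]
    rw [e, e3, hj]
    simp only [if_true]
    have h0 := Real.rpow_nonneg hk0.le (-s)
    have h1 : (0 : ℝ) ≤ |((0 : ℤ) : ℝ)| ^ (-s) := by positivity
    nlinarith
  · have hj0 : 0 < |(l.1 : ℝ)| := abs_pos.2 (by exact_mod_cast hj)
    have hle : |(l.1 : ℝ)| * l.2 ≤ lam l := by
      unfold lam
      nlinarith [sq_abs (l.1 : ℝ), sq_nonneg (|(l.1 : ℝ)| - l.2), sq_nonneg (|(l.1 : ℝ)|),
        sq_nonneg (l.2 : ℝ)]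
    have := Real.rpow_le_rpow_of_nonpos (by positivity) hle (by linarith : -s ≤ 0)
    rw [Real.mul_rpow hj0.le hk0.le] at this
    simpa [hj] using this

theorem summable_inv_lam_sq : Summable fun l : Mode => (lam l ^ 2)⁻¹ := by
  have := summable_lam_rpow (s := 2) (by norm_num)
  refine this.congr fun l => ?_
  rw [Real.rpow_neg (lam_pos l).le]
  norm_num

/-- Test functions have rapidly decaying coefficients, in summable form. -/
theorem IsTest.summable_fourier {φ : ℝ × ℝ → ℝ} (h : IsTest φ) (p : ℕ) :
    Summable fun l => lam l ^ p * |fourier φ l| := by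
  obtain ⟨C, hC, hl⟩ := h.exists_fourier_decay (p + 2)
  refine (summable_inv_lam_sq.mul_left C).of_nonneg_of_le
    (fun l => mul_nonneg (pow_nonneg (lam_pos l).le _) (abs_nonneg _)) fun l => ?_
  have h1 := hl l
  have h2 := pow_pos (lam_pos l) 2
  rw [← div_eq_mul_inv, le_div_iff₀ h2]
  refine le_trans (le_of_eq ?_) h1
  rw [pow_add]
  ring

theorem IsTest.summable_fourier_sq {φ : ℝ × ℝ → ℝ} (h : IsTest φ) (p : ℕ) :
    Summable fun l => lam l ^ p * fourier φ l ^ 2 := by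
  obtain ⟨C, hC, hl⟩ := h.exists_fourier_decay 0
  refine ((h.summable_fourier p).mul_left C).of_nonneg_of_le
    (fun l => mul_nonneg (pow_nonneg (lam_pos l).le _) (sq_nonneg _)) fun l => ?_
  have h1 := hl l
  rw [pow_zero, one_mul] at h1
  have h2 := pow_nonneg (lam_pos l).le p
  rw [← sq_abs]
  have := mul_le_mul_of_nonneg_left h1 (mul_nonneg h2 (abs_nonneg (fourier φ l)))
  nlinarith

/-! ### The kernel of the nonlinear term -/

section Kernel

/-- The triangle inequality for interacting wave numbers. Antisymmetry permits any of the three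
modes to be regarded as produced by the other two. -/
theorem abs_fst_le_of_triad {l l' m : Mode} (h : triad l l' m ≠ 0) :
    |(l'.1 : ℝ)| ≤ |(l.1 : ℝ)| + |(m.1 : ℝ)| := by
  have h1 : l' ∈ nbr l m := by
    by_contra hc
    have := triad_eq_zero hc
    rw [triad_swap_right] at this
    exact h (by linarith)
  have h2 := (Finset.mem_product.1 h1).1
  have h3 : |l'.1| ≤ |l.1| + |m.1| := by
    simp only [nbrX, Finset.mem_insert, Finset.mem_singleton] at h2
    rcases h2 with h | h | h | h <;> rw [h]
    · exact abs_add_le _ _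
    · rw [abs_neg]
      exact abs_add_le _ _
    · exact abs_sub _ _
    · rw [abs_neg]
      exact abs_sub _ _
  exact_mod_cast h3

theorem snd_le_of_triad {l l' m : Mode} (h : triad l l' m ≠ 0) :
    (l'.2 : ℝ) ≤ l.2 + m.2 := by
  have h1 : l' ∈ nbr l m := by
    by_contra hc
    have := triad_eq_zero hc
    rw [triad_swap_right] at this
    exact h (by linarith)
  have h2 := (Finset.mem_product.1 h1).2
  have h3 : l'.2 ≤ l.2 + m.2 := by
    simp only [nbrY, Finset.mem_insert, Finset.mem_singleton] at h2
    rcases h2 with h | h | h <;> rw [h]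
    · rw [← PNat.coe_le_coe, PNat.sub_coe]
      have := l.2.pos
      have := m.2.pos
      split_ifs <;> simp <;> omega
    · rw [← PNat.coe_le_coe, PNat.sub_coe]
      have := l.2.pos
      have := m.2.pos
      split_ifs <;> simp <;> omega
  exact_mod_cast h3

/-- The arithmetic of the kernel bound, with a, b, c the moduli of l, l', m and D the triad
coefficient. Both a + b and D are of order bc, so the b² in the denominator is absorbed and a⁻² is
left. -/
theorem abs_half_mul_le {a b c D : ℝ} (ha : 1 ≤ a) (hb : 1 ≤ b) (hc : 1 ≤ c)
    (h1 : |a ^ 2 - b ^ 2| ≤ 2 * c * (a + b)) (h2 : a ≤ 3 * (b * c)) (hD : |D| ≤ 16 * (b * c)) :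
    |1 / 2 * (1 / b ^ 2 - 1 / a ^ 2) * D| ≤ 64 * c ^ 3 / a ^ 2 := by
  have e : 1 / 2 * (1 / b ^ 2 - 1 / a ^ 2) * D = (a ^ 2 - b ^ 2) * D / (2 * a ^ 2 * b ^ 2) := by
    field_simp
  rw [e, abs_div, abs_mul, abs_of_pos (by positivity : 0 < 2 * a ^ 2 * b ^ 2),
    div_le_div_iff₀ (by positivity) (by positivity)]
  have h3 : |a ^ 2 - b ^ 2| * |D| ≤ (2 * c * (a + b)) * (16 * (b * c)) :=
    mul_le_mul h1 hD (abs_nonneg _) (by positivity)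
  have h4 : a + b ≤ 4 * (b * c) := by nlinarith
  calc |a ^ 2 - b ^ 2| * |D| * a ^ 2 ≤ (2 * c * (a + b)) * (16 * (b * c)) * a ^ 2 := by gcongr
    _ ≤ (2 * c * (4 * (b * c))) * (16 * (b * c)) * a ^ 2 := by gcongr
    _ = 64 * c ^ 3 * (2 * a ^ 2 * b ^ 2) := by ring

theorem jac_neg_div (l l' : Mode) (z : ℝ × ℝ) :
    jac (fun p => -basisFn l p / lam l) (basisFn l') z = -(jac (basisFn l) (basisFn l') z / lam l) := by
  have h1 : dx (fun p => -basisFn l p / lam l) z = -dx (basisFn l) z / lam l :=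
    ((isTest_basisFn l).hasDerivAt_dx z).fun_neg.div_const (lam l) |>.deriv
  have h2 : dy (fun p => -basisFn l p / lam l) z = -dy (basisFn l) z / lam l :=
    ((isTest_basisFn l).hasDerivAt_dy z).fun_neg.div_const (lam l) |>.deriv
  rw [jac, jac, h1, h2]
  ring

theorem integral_jac_mul_eq_sum {φ : ℝ × ℝ → ℝ} (h : IsTest φ) (l l' : Mode) :
    ∫ z, jac (basisFn l) (basisFn l') z * φ z ∂torus = ∑ m ∈ nbr l l', triad l l' m * fourier φ m := by
  simp only [jac_eq_sum_triad, Finset.sum_mul]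
  have hi : ∀ m, Integrable (fun z => triad l l' m * basisFn m z * φ z) torus := fun m =>
    integrable_torus ((continuous_const.mul (continuous_basisFn m)).mul h.continuous)
  rw [integral_finsetSum _ fun m _ => hi m]
  refine Finset.sum_congr rfl fun m _ => ?_
  rw [fourier_eq, ← integral_const_mul]
  exact integral_congr_ae (ae_of_all _ fun z => by ring)

/-- The Jacobian changes sign when l and l' are exchanged, so symmetrisation turns the Biot–Savart
factors into a difference of inverse eigenvalues. This difference makes the diagonal vanish and the
kernel square summable. -/
theorem kernel_eq {φ : ℝ × ℝ → ℝ} (h : IsTest φ) (l l' : Mode) : kernel φ l l'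
    = 1 / 2 * (1 / lam l' - 1 / lam l) * ∑ m ∈ nbr l l', triad l l' m * fourier φ m := by
  have e : ∀ l l', ⨍ z in torusBox, jac (fun p => -basisFn l p / lam l) (basisFn l') z * φ z
      = -(1 / lam l) * ∫ z, jac (basisFn l) (basisFn l') z * φ z ∂torus := fun l l' => by
    rw [average_torusBox, ← integral_const_mul]
    refine integral_congr_ae (ae_of_all _ fun z => ?_)
    simp only [jac_neg_div]
    ring
  have hs : ∫ z, jac (basisFn l') (basisFn l) z * φ z ∂torus
      = -∫ z, jac (basisFn l) (basisFn l') z * φ z ∂torus := by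
    rw [← integral_neg]
    refine integral_congr_ae (ae_of_all _ fun z => ?_)
    simp only [jac]
    ring
  rw [kernel, e, e, hs, integral_jac_mul_eq_sum h]
  ring

theorem kernel_basisFn (m l l' : Mode) :
    kernel (basisFn m) l l' = 1 / 2 * (1 / lam l' - 1 / lam l) * triad l l' m := by
  rw [kernel_eq (isTest_basisFn m)]
  congr 1
  simp only [fourier_basisFn, mul_ite, mul_one, mul_zero, Finset.sum_ite_eq]
  split_ifs with h
  · rfl
  · exact (triad_eq_zero h).symm

theorem kernel_eq_sum {φ : ℝ × ℝ → ℝ} (h : IsTest φ) (l l' : Mode) :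
    kernel φ l l' = ∑ m ∈ nbr l l', fourier φ m * kernel (basisFn m) l l' := by
  rw [kernel_eq h, Finset.mul_sum]
  refine Finset.sum_congr rfl fun m _ => ?_
  rw [kernel_basisFn]
  ring

theorem kernel_symm (φ : ℝ × ℝ → ℝ) (l l' : Mode) : kernel φ l l' = kernel φ l' l := by
  rw [kernel, kernel, add_comm]

theorem kernel_self {φ : ℝ × ℝ → ℝ} (h : IsTest φ) (l : Mode) : kernel φ l l = 0 := by
  rw [kernel_eq h]
  simp

/-- In a triad the wave numbers of l and l' differ by at most those of m, so |l|² − |l'|² is of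
order |m| (|l| + |l'|), one power better than each eigenvalue. What remains decays like |l|⁻², which
is square summable in dimension two. -/
theorem abs_kernel_basisFn_le (m l l' : Mode) :
    |kernel (basisFn m) l l'| ≤ 64 * lam m ^ 2 / lam l := by
  rw [kernel_basisFn]
  by_cases h : triad l l' m = 0
  · rw [h]
    have := lam_pos l
    have := lam_pos m
    simp only [mul_zero, abs_zero]
    positivity
  have h' : triad l' l m ≠ 0 := by
    rw [triad_swap]
    exact neg_ne_zero.2 h
  have hl := Real.sq_sqrt (lam_pos l).le
  have hl' := Real.sq_sqrt (lam_pos l').le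
  have hm := Real.sq_sqrt (lam_pos m).le
  have a1 := one_le_sqrt_lam l
  have b1 := one_le_sqrt_lam l'
  have c1 := one_le_sqrt_lam m
  have j1 := abs_fst_le_of_triad h
  have j2 := abs_fst_le_of_triad h'
  have k1 := snd_le_of_triad h
  have k2 := snd_le_of_triad h'
  have ja := abs_fst_le l
  have jb := abs_fst_le l'
  have jc := abs_fst_le m
  have ka := snd_le l
  have kb := snd_le l'
  have kc := snd_le m
  have kl := one_le_snd l
  have kl' := one_le_snd l'
  have el : lam l = |(l.1 : ℝ)| ^ 2 + (l.2 : ℝ) ^ 2 := by rw [sq_abs, lam]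
  have el' : lam l' = |(l'.1 : ℝ)| ^ 2 + (l'.2 : ℝ) ^ 2 := by rw [sq_abs, lam]
  set a := Real.sqrt (lam l)
  set b := Real.sqrt (lam l')
  set c := Real.sqrt (lam m)
  have hdiff : |a ^ 2 - b ^ 2| ≤ 2 * c * (a + b) := by
    have e : a ^ 2 - b ^ 2 = (|(l.1 : ℝ)| - |(l'.1 : ℝ)|) * (|(l.1 : ℝ)| + |(l'.1 : ℝ)|)
        + ((l.2 : ℝ) - l'.2) * (l.2 + l'.2) := by
      rw [hl, hl', el, el']
      ring
    have d1 : |(|(l.1 : ℝ)| - |(l'.1 : ℝ)|)| ≤ c := by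
      rw [abs_le]
      constructor <;> linarith
    have d2 : |(l.2 : ℝ) - l'.2| ≤ c := by
      rw [abs_le]
      constructor <;> linarith
    have s1 : |(|(l.1 : ℝ)| + |(l'.1 : ℝ)|)| ≤ a + b := by
      rw [abs_of_nonneg (by positivity)]
      linarith
    have s2 : |(l.2 : ℝ) + l'.2| ≤ a + b := by
      rw [abs_of_nonneg (by positivity)]
      linarith
    rw [e]
    refine (abs_add_le _ _).trans ?_
    rw [abs_mul, abs_mul]
    have t1 := mul_le_mul d1 s1 (abs_nonneg _) (by linarith)
    have t2 := mul_le_mul d2 s2 (abs_nonneg _) (by linarith)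
    linarith
  have h3 : a ≤ 3 * (b * c) := by
    refine abs_le_of_sq_le_sq' ?_ (by positivity) |>.2
    have hbc : b + c ≤ 2 * (b * c) := by nlinarith
    have jj : |(l.1 : ℝ)| ^ 2 ≤ (2 * (b * c)) ^ 2 := by
      refine pow_le_pow_left₀ (abs_nonneg _) ?_ 2
      linarith
    have kk : (l.2 : ℝ) ^ 2 ≤ (2 * (b * c)) ^ 2 := by
      refine pow_le_pow_left₀ (by linarith) ?_ 2
      linarith
    rw [hl, el]
    nlinarith [sq_nonneg (b * c)]
  -- The triad is rotated so that l' and m carry the derivatives: no power of |l| may be spent here.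
  have hD : |triad l l' m| ≤ 16 * (b * c) := by
    have e : triad l l' m = triad l' m l := by
      rw [triad_swap_right l' l m, triad_swap l l' m, neg_neg]
    rw [e]
    exact abs_triad_le l' m l
  have := abs_half_mul_le a1 b1 c1 hdiff h3 hD
  rw [hl, hl'] at this
  refine this.trans ?_
  have hlp := lam_pos l
  gcongr
  rw [← hm]
  nlinarith [pow_pos (by linarith : 0 < c) 3]

theorem kernel_basisFn_eq_zero {m l l' : Mode} (h : l' ∉ nbr l m) : kernel (basisFn m) l l' = 0 := by
  rw [kernel_basisFn, triad_swap_right, triad_eq_zero h]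
  simp

/-- A bound for the `ℓ²`-norms of the kernels of the basis functions. -/
theorem exists_sum_kernel_basisFn_sq_le : ∃ C : ℝ, 0 ≤ C ∧ ∀ (m : Mode) (t : Finset (Mode × Mode)),
    ∑ p ∈ t, kernel (basisFn m) p.1 p.2 ^ 2 ≤ C * lam m ^ 4 := by
  classical
  refine ⟨12 * 4096 * ∑' l : Mode, (lam l ^ 2)⁻¹, by positivity, fun m t => ?_⟩
  -- The double sum is arranged by rows: for given l and m at most twelve l' have a nonzero kernel.
  have hsub : ∑ p ∈ t, kernel (basisFn m) p.1 p.2 ^ 2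
      ≤ ∑ l ∈ t.image Prod.fst, ∑ l' ∈ nbr l m, kernel (basisFn m) l l' ^ 2 := by
    rw [Finset.sum_sigma']
    have hinj : Function.Injective fun p : Mode × Mode => (⟨p.1, p.2⟩ : Σ _ : Mode, Mode) := by
      rintro ⟨a, b⟩ ⟨a', b'⟩ h
      simp only [Sigma.mk.injEq, heq_eq_eq] at h
      rw [h.1, h.2]
    rw [← Finset.sum_filter_ne_zero, ← Finset.sum_image (f := fun q : Σ _ : Mode, Mode =>
      kernel (basisFn m) q.1 q.2 ^ 2) (g := fun p : Mode × Mode => (⟨p.1, p.2⟩ : Σ _ : Mode, Mode))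
      hinj.injOn]
    refine Finset.sum_le_sum_of_subset_of_nonneg (fun q hq => ?_) fun _ _ _ => sq_nonneg _
    obtain ⟨p, hp, rfl⟩ := Finset.mem_image.1 hq
    rw [Finset.mem_filter] at hp
    rw [Finset.mem_sigma]
    refine ⟨Finset.mem_image_of_mem _ hp.1, ?_⟩
    by_contra hc
    exact hp.2 (by rw [kernel_basisFn_eq_zero hc]; simp)
  refine hsub.trans ?_
  have hrow : ∀ l : Mode, ∑ l' ∈ nbr l m, kernel (basisFn m) l l' ^ 2
      ≤ 12 * 4096 * lam m ^ 4 * (lam l ^ 2)⁻¹ := by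
    intro l
    have hb : ∀ l' ∈ nbr l m, kernel (basisFn m) l l' ^ 2 ≤ 4096 * lam m ^ 4 * (lam l ^ 2)⁻¹ := by
      intro l' _
      rw [← sq_abs]
      refine (pow_le_pow_left₀ (abs_nonneg _) (abs_kernel_basisFn_le m l l') 2).trans_eq ?_
      rw [div_pow, mul_pow, div_eq_mul_inv]
      ring
    refine (Finset.sum_le_card_nsmul _ _ _ hb).trans ?_
    rw [nsmul_eq_mul]
    have hc : ((nbr l m).card : ℝ) ≤ 12 := by exact_mod_cast card_nbr_le l m
    have := lam_pos l
    have := lam_pos m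
    calc _ ≤ 12 * (4096 * lam m ^ 4 * (lam l ^ 2)⁻¹) := by gcongr
      _ = _ := by ring
  refine (Finset.sum_le_sum fun l _ => hrow l).trans ?_
  rw [← Finset.mul_sum]
  have := summable_inv_lam_sq.sum_le_tsum (t.image Prod.fst) fun l _ => by
    have := lam_pos l
    positivity
  have hm := lam_pos m
  calc _ ≤ 12 * 4096 * lam m ^ 4 * ∑' l : Mode, (lam l ^ 2)⁻¹ := by gcongr
    _ = _ := by ring

/-- The kernel of a test function is approximated by combinations of kernels of basis functions. -/
theorem exists_sum_kernel_sub_sq_le : ∃ C : ℝ, 0 ≤ C ∧ ∀ (φ : ℝ × ℝ → ℝ), IsTest φ →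
    ∀ (M : Finset Mode) (t : Finset (Mode × Mode)),
      ∑ p ∈ t, (kernel φ p.1 p.2 - ∑ m ∈ M, fourier φ m * kernel (basisFn m) p.1 p.2) ^ 2
        ≤ C * (∑' m, lam m ^ 4 * fourier φ m ^ 2 - ∑ m ∈ M, lam m ^ 4 * fourier φ m ^ 2) := by
  classical
  obtain ⟨C, hC0, hC⟩ := exists_sum_kernel_basisFn_sq_le
  refine ⟨12 * C, by positivity, fun φ h M t => ?_⟩
  -- The modes outside M that any of the finitely many pairs can produce. Their weighted
  -- coefficients are part of the tail beyond M.
  set R : Finset Mode := t.biUnion fun p => nbr p.1 p.2 \ M with hR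
  have hpt : ∀ p ∈ t, (kernel φ p.1 p.2 - ∑ m ∈ M, fourier φ m * kernel (basisFn m) p.1 p.2) ^ 2
      ≤ 12 * ∑ m ∈ R, fourier φ m ^ 2 * kernel (basisFn m) p.1 p.2 ^ 2 := by
    intro p hp
    have hz : ∀ m, m ∉ nbr p.1 p.2 → kernel (basisFn m) p.1 p.2 = 0 := fun m hm => by
      rw [kernel_basisFn, triad_eq_zero hm, mul_zero]
    have e : kernel φ p.1 p.2 - ∑ m ∈ M, fourier φ m * kernel (basisFn m) p.1 p.2
        = ∑ m ∈ nbr p.1 p.2 \ M, fourier φ m * kernel (basisFn m) p.1 p.2 := by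
      rw [kernel_eq_sum h, ← Finset.sum_sdiff_sub_sum_sdiff]
      have : ∑ m ∈ M \ nbr p.1 p.2, fourier φ m * kernel (basisFn m) p.1 p.2 = 0 :=
        Finset.sum_eq_zero fun m hm => by rw [hz m (Finset.mem_sdiff.1 hm).2, mul_zero]
      rw [this, sub_zero]
    rw [e]
    have hcard : ((nbr p.1 p.2 \ M).card : ℝ) ≤ 12 := by
      exact_mod_cast (Finset.card_le_card Finset.sdiff_subset).trans (card_nbr_le _ _)
    -- Since a pair (l, l') involves at most twelve m, Cauchy–Schwarz replaces the square of the sum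
    -- over m by the sum of squares at a fixed cost.
    have hcs := sq_sum_le_card_mul_sum_sq (s := nbr p.1 p.2 \ M)
      (f := fun m => fourier φ m * kernel (basisFn m) p.1 p.2)
    refine hcs.trans (mul_le_mul hcard ?_ (Finset.sum_nonneg fun _ _ => sq_nonneg _) (by norm_num))
    simp only [mul_pow]
    exact Finset.sum_le_sum_of_subset_of_nonneg
      (Finset.subset_biUnion_of_mem (fun p : Mode × Mode => nbr p.1 p.2 \ M) hp)
      fun _ _ _ => by positivity
  refine (Finset.sum_le_sum hpt).trans ?_
  rw [← Finset.mul_sum, Finset.sum_comm, mul_assoc]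
  refine mul_le_mul_of_nonneg_left ?_ (by norm_num)
  have h1 : ∑ m ∈ R, ∑ p ∈ t, fourier φ m ^ 2 * kernel (basisFn m) p.1 p.2 ^ 2
      ≤ ∑ m ∈ R, C * (lam m ^ 4 * fourier φ m ^ 2) := by
    refine Finset.sum_le_sum fun m _ => ?_
    rw [← Finset.mul_sum]
    have := mul_le_mul_of_nonneg_left (hC m t) (sq_nonneg (fourier φ m))
    linarith
  refine h1.trans ?_
  rw [← Finset.mul_sum]
  refine mul_le_mul_of_nonneg_left ?_ hC0
  have hdisj : Disjoint R M := by
    rw [hR, Finset.disjoint_biUnion_left]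
    exact fun _ _ => Finset.sdiff_disjoint
  have := (h.summable_fourier_sq 4).sum_le_tsum (R ∪ M) fun l _ => by
    have := lam_pos l
    positivity
  rw [Finset.sum_union hdisj] at this
  linarith

end Kernel


/-! ### Odd extensions and Bessel's inequality -/

section OddExt

/-- A bounded measurable function on the torus. -/
structure IsBddTorus (f : ℝ × ℝ → ℝ) : Prop where
  meas : AEStronglyMeasurable f torus
  bdd : ∃ C, 0 ≤ C ∧ ∀ z ∈ torusBox, |f z| ≤ C

theorem isBddTorus_of_continuous {f : ℝ × ℝ → ℝ} (hf : Continuous f) : IsBddTorus f := by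
  refine ⟨hf.aestronglyMeasurable, ?_⟩
  obtain ⟨C, hC⟩ := isCompact_torusBox.exists_bound_of_continuousOn hf.continuousOn
  exact ⟨|C|, abs_nonneg _, fun z hz => (hC z hz).trans (le_abs_self _)⟩

theorem IsBddTorus.mul {f g : ℝ × ℝ → ℝ} (hf : IsBddTorus f) (hg : IsBddTorus g) :
    IsBddTorus fun z => f z * g z := by
  obtain ⟨C, hC, h1⟩ := hf.bdd
  obtain ⟨D, hD, h2⟩ := hg.bdd
  refine ⟨hf.meas.mul hg.meas, C * D, by positivity, fun z hz => ?_⟩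
  rw [abs_mul]
  exact mul_le_mul (h1 z hz) (h2 z hz) (abs_nonneg _) hC

theorem IsBddTorus.integrable {f : ℝ × ℝ → ℝ} (hf : IsBddTorus f) : Integrable f torus := by
  obtain ⟨C, hC, h1⟩ := hf.bdd
  exact integrable_torus_of_bound hf.meas h1

theorem IsBddTorus.exists_fourier_bound {f : ℝ × ℝ → ℝ} (hf : IsBddTorus f) :
    ∃ C, 0 ≤ C ∧ ∀ l, |fourier f l| ≤ C := by
  obtain ⟨C, hC, h1⟩ := hf.bdd
  refine ⟨C * 2, by positivity, fun l => ?_⟩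
  rw [fourier_eq]
  refine abs_integral_torus_le fun z hz => ?_
  rw [abs_mul]
  exact mul_le_mul (h1 z hz) (abs_basisFn_le l z) (abs_nonneg _) hC

/-- Bessel's inequality. -/
theorem IsBddTorus.summable_fourier_sq {f : ℝ × ℝ → ℝ} (hf : IsBddTorus f) :
    Summable fun l => fourier f l ^ 2 := by
  refine summable_of_sum_le (c := ∫ z, f z * f z ∂torus) (fun l => sq_nonneg _) fun u => ?_
  set g : ℝ × ℝ → ℝ := fun z => ∑ l ∈ u, fourier f l * basisFn l z with hg
  have hgc : Continuous g := continuous_finsetSum _ fun l _ =>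
    continuous_const.mul (continuous_basisFn l)
  have i1 := (hf.mul hf).integrable
  have i2 := (hf.mul (isBddTorus_of_continuous hgc)).integrable
  have i3 := ((isBddTorus_of_continuous hgc).mul (isBddTorus_of_continuous hgc)).integrable
  have hexp : ∀ {F : ℝ × ℝ → ℝ}, IsBddTorus F →
      ∫ z, F z * g z ∂torus = ∑ l ∈ u, fourier f l * fourier F l := by
    intro F hF
    simp only [hg, Finset.mul_sum, fourier_eq F]
    have hi : ∀ l, Integrable (fun z => F z * (fourier f l * basisFn l z)) torus := fun l =>
      (hF.mul (isBddTorus_of_continuous (continuous_const.mul (continuous_basisFn l)))).integrable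
    rw [integral_finsetSum _ fun l _ => hi l]
    refine Finset.sum_congr rfl fun l _ => ?_
    rw [← integral_const_mul]
    exact integral_congr_ae (ae_of_all _ fun z => by ring)
  have hgl : ∀ l ∈ u, fourier g l = fourier f l := fun l hl => by
    rw [hg, fourier_sum _ _ _ continuous_basisFn]
    simp [fourier_basisFn, hl]
  have e2 : ∫ z, f z * g z ∂torus = ∑ l ∈ u, fourier f l ^ 2 := by
    rw [hexp hf]
    exact Finset.sum_congr rfl fun l _ => (sq _).symm
  have e3 : ∫ z, g z * g z ∂torus = ∑ l ∈ u, fourier f l ^ 2 := by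
    rw [hexp (isBddTorus_of_continuous hgc)]
    exact Finset.sum_congr rfl fun l hl => by rw [hgl l hl, sq]
  have h0 : 0 ≤ ∫ z, (f z * f z - 2 * (f z * g z) + g z * g z) ∂torus :=
    integral_nonneg fun z => by
      simp only [Pi.zero_apply]
      nlinarith [sq_nonneg (f z - g z)]
  have i4 : Integrable (fun z => f z * f z - 2 * (f z * g z)) torus := i1.sub (i2.const_mul 2)
  rw [integral_add i4 i3, integral_sub i1 (i2.const_mul 2), integral_const_mul, e2, e3] at h0
  linarith

/-- The closed channel. -/
def channel : Set (ℝ × ℝ) := univ ×ˢ Icc 0 Real.pi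

/-- Nothing is known of f outside the channel. Clamping y to [0, π] gives a continuous function on
the plane whose odd extension agrees with that of f on the torus box, which settles measurability.
-/
theorem isBddTorus_oddExt {f : ℝ × ℝ → ℝ} (hf : ContinuousOn f channel) : IsBddTorus (oddExt f) := by
  have hpi := Real.pi_pos.le
  set F : ℝ × ℝ → ℝ := fun z => f (z.1, projIcc 0 Real.pi hpi z.2) with hF
  have hFc : Continuous F := by
    refine hf.comp_continuous (by fun_prop) fun z => ⟨mem_univ _, (projIcc 0 Real.pi hpi z.2).2⟩
  have hFm : Measurable (oddExt F) := by
    have h1 : Measurable F := hFc.measurable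
    have h2 : Measurable fun z : ℝ × ℝ => -F (z.1, -z.2) :=
      (hFc.comp (by fun_prop : Continuous fun z : ℝ × ℝ => (z.1, -z.2))).measurable.neg
    exact Measurable.ite (measurableSet_lt measurable_const measurable_snd) h1
      (Measurable.ite (measurableSet_lt measurable_snd measurable_const) h2 measurable_const)
  have heq : ∀ z ∈ torusBox, oddExt F z = oddExt f z := by
    intro z hz
    unfold oddExt
    split_ifs with h1 h2
    · rw [hF]
      simp only [projIcc_of_mem hpi ⟨h1.le, hz.2.2⟩]
    · rw [hF]
      simp only
      rw [projIcc_of_mem hpi ⟨by linarith, by linarith [hz.2.1]⟩]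
    · rfl
  refine ⟨hFm.aestronglyMeasurable.congr ?_, ?_⟩
  · filter_upwards [ae_torus_mem] with z hz using heq z hz
  · obtain ⟨C, hC⟩ := (isCompact_Icc.prod isCompact_Icc :
      IsCompact (Icc (-Real.pi) Real.pi ×ˢ Icc 0 Real.pi)).exists_bound_of_continuousOn
      (hf.mono (prod_mono_left (subset_univ _)))
    refine ⟨|C|, abs_nonneg _, fun z hz => ?_⟩
    unfold oddExt
    split_ifs with h1 h2
    · exact (hC z ⟨hz.1, h1.le, hz.2.2⟩).trans (le_abs_self _)
    · rw [abs_neg]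
      exact (hC (z.1, -z.2) ⟨hz.1, by simp only; linarith, by simp only; linarith [hz.2.1]⟩).trans
        (le_abs_self _)
    · simp

variable {h : ℝ × ℝ → ℝ}

theorem IsTopography.isBddTorus (hh : IsTopography h) : IsBddTorus (oddExt h) :=
  isBddTorus_oddExt hh.1.continuousOn

/-- The derivative in `x` of the topography, up to the walls. -/
def dxWithin (h : ℝ × ℝ → ℝ) (z : ℝ × ℝ) : ℝ := fderivWithin ℝ h channel z (1, 0)

theorem IsTopography.continuousOn_dxWithin (hh : IsTopography h) :
    ContinuousOn (dxWithin h) channel := by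
  have hu : UniqueDiffOn ℝ channel := uniqueDiffOn_univ.prod (uniqueDiffOn_Icc Real.pi_pos)
  exact (hh.1.continuousOn_fderivWithin hu (by simp)).clm_apply continuousOn_const

theorem IsTopography.hasDerivAt (hh : IsTopography h) (x : ℝ) {y : ℝ} (hy : y ∈ Icc 0 Real.pi) :
    HasDerivAt (fun x => h (x, y)) (dxWithin h (x, y)) x := by
  have h1 : HasFDerivWithinAt h (fderivWithin ℝ h channel (x, y)) channel (x, y) :=
    (hh.1.differentiableOn (by simp) (x, y) ⟨mem_univ _, hy⟩).hasFDerivWithinAt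
  exact h1.comp_hasDerivAt (f := fun x => (x, y)) x
    ((hasDerivAt_id x).prodMk (hasDerivAt_const x y))
    (Eventually.of_forall fun x' => ⟨mem_univ _, hy⟩)

theorem IsTopography.hasDerivAt_oddExt (hh : IsTopography h) (x : ℝ) {y : ℝ}
    (hy : y ∈ Icc (-Real.pi) Real.pi) :
    HasDerivAt (fun x => oddExt h (x, y)) (oddExt (dxWithin h) (x, y)) x := by
  unfold oddExt
  simp only
  split_ifs with h1 h2
  · exact hh.hasDerivAt x ⟨h1.le, hy.2⟩
  · exact (hh.hasDerivAt x ⟨by linarith, by linarith [hy.1]⟩).neg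
  · exact hasDerivAt_const x 0

theorem IsTopography.dx_oddExt (hh : IsTopography h) {z : ℝ × ℝ} (hz : z ∈ torusBox) :
    dx (oddExt h) z = oddExt (dxWithin h) z := (hh.hasDerivAt_oddExt z.1 hz.2).deriv

theorem continuous_oddExt_fst {f : ℝ × ℝ → ℝ} (hf : ContinuousOn f channel) {y : ℝ}
    (hy : y ∈ Icc (-Real.pi) Real.pi) : Continuous fun x => oddExt f (x, y) := by
  unfold oddExt
  simp only
  split_ifs with h1 h2
  · exact hf.comp_continuous (by fun_prop) fun x => ⟨mem_univ _, h1.le, hy.2⟩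
  · exact (hf.comp_continuous (by fun_prop) fun x => ⟨mem_univ _, by simp only; linarith,
      by simp only; linarith [hy.1]⟩).neg
  · exact continuous_const

theorem IsTopography.isBddTorus_dx (hh : IsTopography h) : IsBddTorus (dx (oddExt h)) := by
  have h1 := isBddTorus_oddExt hh.continuousOn_dxWithin
  obtain ⟨C, hC, h2⟩ := h1.bdd
  refine ⟨h1.meas.congr ?_, C, hC, fun z hz => ?_⟩
  · filter_upwards [ae_torus_mem] with z hz using (hh.dx_oddExt hz).symm
  · rw [hh.dx_oddExt hz]
    exact h2 z hz

theorem IsTopography.oddExt_periodic (hh : IsTopography h) (x : ℝ) {y : ℝ}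
    (hy : y ∈ Icc (-Real.pi) Real.pi) : oddExt h (x + 2 * Real.pi, y) = oddExt h (x, y) := by
  unfold oddExt
  simp only
  split_ifs with h1 h2
  · exact hh.2 x y ⟨h1.le, hy.2⟩
  · rw [hh.2 x (-y) ⟨by linarith, by linarith [hy.1]⟩]
  · rfl

/-- Integration by parts takes place in x alone, at fixed y, where the extension is smooth and
periodic. The possible jumps of the odd extension across the walls do not enter. -/
theorem IsTopography.fourier_dx (hh : IsTopography h) (l : Mode) :
    fourier (dx (oddExt h)) l = -l.1 * fourier (oddExt h) (conj l) := by
  have b1 := hh.isBddTorus_dx.mul (isBddTorus_of_continuous (continuous_basisFn l))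
  have b2 : IsBddTorus fun z => oddExt h z * (l.1 * basisFn (conj l) z) :=
    hh.isBddTorus.mul (isBddTorus_of_continuous
      (continuous_const.mul (continuous_basisFn (conj l))))
  have i3 : Integrable (fun z => dx (oddExt h) z * basisFn l z
      + oddExt h z * (l.1 * basisFn (conj l) z)) torus := b1.integrable.add b2.integrable
  have key : ∫ z, (dx (oddExt h) z * basisFn l z + oddExt h z * (l.1 * basisFn (conj l) z)) ∂torus
      = 0 := by
    rw [torus] at i3 ⊢
    rw [integral_prod_symm _ i3]
    refine integral_eq_zero_of_ae ?_
    filter_upwards [ae_circ_mem] with y hy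
    have e : ∫ x, (dx (oddExt h) (x, y) * basisFn l (x, y)
        + oddExt h (x, y) * (l.1 * basisFn (conj l) (x, y))) ∂circ
        = ∫ x, (oddExt (dxWithin h) (x, y) * basisFn l (x, y)
        + oddExt h (x, y) * (l.1 * basisFn (conj l) (x, y))) ∂circ := by
      refine integral_congr_ae ?_
      filter_upwards [ae_circ_mem] with x hx
      rw [hh.dx_oddExt ⟨hx, hy⟩]
    rw [e]
    refine integral_deriv_circ (f := fun x => oddExt h (x, y) * basisFn l (x, y)) (fun x => ?_) ?_ ?_
    · exact (hh.hasDerivAt_oddExt x hy).mul (hasDerivAt_basisFn_fst l x y)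
    · have c1 := continuous_oddExt_fst hh.continuousOn_dxWithin hy
      have c2 := continuous_oddExt_fst hh.1.continuousOn hy
      have c3 : ∀ m, Continuous fun x : ℝ => basisFn m (x, y) := fun m =>
        (continuous_basisFn m).comp (by fun_prop)
      exact (c1.mul (c3 l)).add (c2.mul (continuous_const.mul (c3 (conj l))))
    · have e1 : Real.pi = -Real.pi + 2 * Real.pi := by ring
      have h1 := hh.oddExt_periodic (-Real.pi) hy
      have h2 := ((isTest_basisFn l).2 (-Real.pi) y).1
      rw [← e1] at h1 h2
      rw [h1, h2]
  rw [integral_add b1.integrable b2.integrable] at key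
  rw [fourier_eq, fourier_eq]
  have e : ∫ z, oddExt h z * (l.1 * basisFn (conj l) z) ∂torus
      = l.1 * ∫ z, oddExt h z * basisFn (conj l) z ∂torus := by
    rw [← integral_const_mul]
    exact integral_congr_ae (ae_of_all _ fun z => by ring)
  rw [e] at key
  linarith

theorem summable_of_conj {f : Mode → ℝ} (hf : Summable f) : Summable fun l => f (conj l) :=
  hf.comp_injective fun a b h => by rw [← conj_conj a, h, conj_conj]

theorem summable_inv_one_add_mul : Summable fun l : Mode => ((1 + (l.1 : ℝ) ^ 2) * lam l)⁻¹ := by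
  have h1 : Summable fun j : ℤ => |(j : ℝ)| ^ (-2 : ℝ) + (if j = 0 then 1 else 0) :=
    (Real.summable_abs_int_rpow (b := 2) (by norm_num)).add
      (summable_of_ne_finset_zero (s := {0}) (by simp))
  have h2 : Summable fun k : ℕ+ => ((k : ℝ) ^ 2)⁻¹ := by
    have := (Real.summable_nat_pow_inv (p := 2)).2 (by norm_num)
    exact this.comp_injective PNat.coe_injective
  refine (h1.mul_of_nonneg h2 (fun j => by positivity) fun k => by positivity).of_nonneg_of_le
    (fun l => by have := lam_pos l; positivity) fun l => ?_
  have hk := one_le_snd l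
  have hl : (l.2 : ℝ) ^ 2 ≤ lam l := by
    unfold lam
    nlinarith [sq_nonneg (l.1 : ℝ)]
  have hj : (1 + (l.1 : ℝ) ^ 2)⁻¹ ≤ |(l.1 : ℝ)| ^ (-2 : ℝ) + (if l.1 = 0 then 1 else 0) := by
    by_cases h0 : l.1 = 0
    · simp only [h0, if_true]
      norm_num
    · have hj0 : (0 : ℝ) < (l.1 : ℝ) ^ 2 := by
        have : (l.1 : ℝ) ≠ 0 := by exact_mod_cast h0
        positivity
      rw [if_neg h0, add_zero, Real.rpow_neg (abs_nonneg _)]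
      norm_num
      exact inv_anti₀ hj0 (by linarith)
  rw [mul_inv]
  have hlp := lam_pos l
  gcongr

/-- The coefficients of the topography are summable against `|l|⁻¹`. -/
theorem IsTopography.summable_div_sqrt (hh : IsTopography h) :
    Summable fun l => |fourier (oddExt h) l| / Real.sqrt (lam l) := by
  have h1 := hh.isBddTorus.summable_fourier_sq
  have h2 := summable_of_conj hh.isBddTorus_dx.summable_fourier_sq
  have e : ∀ l, fourier (dx (oddExt h)) (conj l) ^ 2 = (l.1 : ℝ) ^ 2 * fourier (oddExt h) l ^ 2 := by
    intro l
    rw [hh.fourier_dx, conj_conj]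
    simp only [conj, Int.cast_neg]
    ring
  simp only [e] at h2
  refine (((h1.add h2).add summable_inv_one_add_mul).mul_left (1 / 2)).of_nonneg_of_le
    (fun l => by positivity) fun l => ?_
  set x := |fourier (oddExt h) l| with hx
  have hx2 : fourier (oddExt h) l ^ 2 = x ^ 2 := by rw [hx, sq_abs]
  rw [hx2]
  have hl := lam_pos l
  have hs := Real.sq_sqrt hl.le
  have hsp := Real.sqrt_pos.2 hl
  set a := Real.sqrt (1 + (l.1 : ℝ) ^ 2) with ha
  have ha2 : a ^ 2 = 1 + (l.1 : ℝ) ^ 2 := Real.sq_sqrt (by positivity)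
  have hap : 0 < a := Real.sqrt_pos.2 (by positivity)
  -- Weighted arithmetic–geometric mean: |ĥ|/|l| is at most half of (1 + j²)|ĥ|² + 1/((1 + j²)|l|²).
  -- Because of the jumps at the walls only the derivative in x is at hand, and the anisotropic
  -- weight 1 + j² is enough for both series to converge.
  have h3 := sq_nonneg (a * x - (a * Real.sqrt (lam l))⁻¹)
  have e1 : (a * Real.sqrt (lam l))⁻¹ ^ 2 = ((1 + (l.1 : ℝ) ^ 2) * lam l)⁻¹ := by
    rw [inv_pow, mul_pow, ha2, hs]
  have e2 : a * x * (a * Real.sqrt (lam l))⁻¹ = x / Real.sqrt (lam l) := by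
    field_simp
  nlinarith

end OddExt


/-! ### The resolvent of the topography -/

section Resolvent

/-- The Fourier coefficients of `(μ - Δ)⁻¹ h`. -/
def resCoeff (μ : ℝ) (h : ℝ × ℝ → ℝ) (l : Mode) : ℝ := fourier (oddExt h) l / (μ + lam l)

variable {μ : ℝ} {h : ℝ × ℝ → ℝ}

/-- The resolvent gains two powers of |l|, of which the gradient uses one. It follows that the
Fourier series of G may be differentiated once term by term. -/
theorem IsTopography.summable_resCoeff (hh : IsTopography h) (hμ : 0 < μ) :
    Summable fun l => |resCoeff μ h l| * Real.sqrt (lam l) := by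
  refine hh.summable_div_sqrt.of_nonneg_of_le (fun l => by positivity) fun l => ?_
  have hl := lam_pos l
  have hs := Real.mul_self_sqrt hl.le
  have hsp := Real.sqrt_pos.2 hl
  rw [resCoeff, abs_div, abs_of_pos (by linarith : 0 < μ + lam l), div_mul_eq_mul_div,
    div_le_div_iff₀ (by linarith) hsp, mul_assoc, hs]
  exact mul_le_mul_of_nonneg_left (by linarith) (abs_nonneg _)

theorem IsTopography.summable_abs_resCoeff (hh : IsTopography h) (hμ : 0 < μ) :
    Summable fun l => |resCoeff μ h l| :=
  (hh.summable_resCoeff hμ).of_nonneg_of_le (fun _ => abs_nonneg _) fun l =>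
    le_mul_of_one_le_right (abs_nonneg _) (one_le_sqrt_lam l)

theorem summable_mul_of_abs_le {c : Mode → ℝ} {f : Mode → ℝ} {B : ℝ} (hc : Summable fun l => |c l|)
    (hf : ∀ l, |f l| ≤ B) : Summable fun l => c l * f l := by
  refine Summable.of_norm_bounded (hc.mul_right B) fun l => ?_
  rw [Real.norm_eq_abs, abs_mul]
  exact mul_le_mul_of_nonneg_left (hf l) (abs_nonneg _)

theorem IsTopography.summable_res_fst (hh : IsTopography h) (hμ : 0 < μ) :
    Summable fun l : Mode => |resCoeff μ h l * l.1| := by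
  refine (hh.summable_resCoeff hμ).of_nonneg_of_le (fun l => abs_nonneg _) fun l => ?_
  rw [abs_mul]
  exact mul_le_mul_of_nonneg_left (abs_fst_le l) (abs_nonneg _)

theorem IsTopography.summable_res_snd (hh : IsTopography h) (hμ : 0 < μ) :
    Summable fun l : Mode => |resCoeff μ h l * l.2| := by
  refine (hh.summable_resCoeff hμ).of_nonneg_of_le (fun l => abs_nonneg _) fun l => ?_
  rw [abs_mul, abs_of_nonneg (by positivity : (0 : ℝ) ≤ l.2)]
  exact mul_le_mul_of_nonneg_left (snd_le l) (abs_nonneg _)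

theorem IsTopography.dx_resolvent (hh : IsTopography h) (hμ : 0 < μ) (z : ℝ × ℝ) :
    dx (resolvent μ h) z = ∑' l : Mode, resCoeff μ h l * l.1 * basisFn (conj l) z := by
  refine (hasDerivAt_tsum (g := fun (l : Mode) x => resCoeff μ h l * basisFn l (x, z.2))
    (g' := fun (l : Mode) x => resCoeff μ h l * l.1 * basisFn (conj l) (x, z.2))
    ((hh.summable_res_fst hμ).mul_right 2) (fun l x => ?_) (fun l x => ?_) (y₀ := 0) ?_ z.1).deriv
  · refine ((hasDerivAt_basisFn_fst l x z.2).const_mul _).congr_deriv ?_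
    ring
  · rw [Real.norm_eq_abs, abs_mul]
    exact mul_le_mul_of_nonneg_left (abs_basisFn_le _ _) (abs_nonneg _)
  · exact summable_mul_of_abs_le (hh.summable_abs_resCoeff hμ) fun l => abs_basisFn_le _ _

theorem IsTopography.dy_resolvent (hh : IsTopography h) (hμ : 0 < μ) (z : ℝ × ℝ) :
    dy (resolvent μ h) z = ∑' l : Mode, resCoeff μ h l * l.2 * evenFn l z := by
  refine (hasDerivAt_tsum (g := fun (l : Mode) y => resCoeff μ h l * basisFn l (z.1, y))
    (g' := fun (l : Mode) y => resCoeff μ h l * l.2 * evenFn l (z.1, y))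
    ((hh.summable_res_snd hμ).mul_right 2) (fun l y => ?_) (fun l y => ?_) (y₀ := 0) ?_ z.2).deriv
  · refine ((hasDerivAt_basisFn_snd l z.1 y).const_mul _).congr_deriv ?_
    ring
  · rw [Real.norm_eq_abs, abs_mul]
    exact mul_le_mul_of_nonneg_left (abs_evenFn_le _ _) (abs_nonneg _)
  · exact summable_mul_of_abs_le (hh.summable_abs_resCoeff hμ) fun l => abs_basisFn_le _ _

theorem HasSum.of_eq {κ : Type} {f g : κ → ℝ} {a b : ℝ} (h : HasSum f a) (hf : ∀ k, g k = f k)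
    (hb : b = a) : HasSum g b := by
  rw [hb, funext hf]
  exact h

/-- Termwise integration of an absolutely convergent series against a bounded function. -/
theorem hasSum_integral_mul {c : Mode → ℝ} (hc : Summable fun l => |c l|)
    {f : Mode → ℝ × ℝ → ℝ} (hf : ∀ l, Continuous (f l)) {B : ℝ}
    (hB : ∀ l, ∀ z ∈ torusBox, |f l z| ≤ B) {g : ℝ × ℝ → ℝ} (hg : IsBddTorus g) :
    HasSum (fun l => c l * ∫ z, f l z * g z ∂torus)
      (∫ z, (∑' l, c l * f l z) * g z ∂torus) := by
  obtain ⟨D, hD, hgD⟩ := hg.bdd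
  have hi : ∀ l, IsBddTorus fun z => c l * f l z * g z := fun l =>
    (isBddTorus_of_continuous (continuous_const.mul (hf l))).mul hg
  have hle : ∀ l, ∀ z ∈ torusBox, |c l * f l z * g z| ≤ |c l| * (B * D) := fun l z hz => by
    rw [abs_mul, abs_mul, mul_assoc]
    exact mul_le_mul_of_nonneg_left (mul_le_mul (hB l z hz) (hgD z hz) (abs_nonneg _)
      ((abs_nonneg _).trans (hB l z hz))) (abs_nonneg _)
  have key := hasSum_integral_of_summable_integral_norm (μ := torus)
    (F := fun l z => c l * f l z * g z) (fun l => (hi l).integrable) (by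
      refine (hc.mul_right (B * D)).of_nonneg_of_le
        (fun l => integral_nonneg fun z => norm_nonneg _) fun l => ?_
      refine (le_abs_self _).trans (abs_integral_torus_le fun z hz => ?_)
      rw [abs_norm]
      exact hle l z hz)
  refine HasSum.of_eq key (fun l => ?_) ?_
  · rw [← integral_const_mul]
    exact integral_congr_ae (ae_of_all _ fun z => by ring)
  · congr 1
    ext z
    rw [← tsum_mul_right]

theorem IsTopography.hasSum_resolvent_dx (hh : IsTopography h) (hμ : 0 < μ) {φ : ℝ × ℝ → ℝ}
    (hφ : IsTest φ) : HasSum (fun l : Mode => resCoeff μ h l * (-l.1 * fourier φ (conj l)))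
      (⨍ z in torusBox, resolvent μ h z * dx φ z) := by
  have := hasSum_integral_mul (hh.summable_abs_resCoeff hμ) continuous_basisFn
    (fun l z _ => abs_basisFn_le l z) (isBddTorus_of_continuous hφ.isTest_dx.continuous)
  rw [average_torusBox]
  refine HasSum.of_eq this (fun l => ?_) rfl
  rw [← hφ.fourier_dx, fourier_eq]
  congr 2
  ext z
  ring

/-- The topographic stress of the mean flow vanishes. -/
theorem IsTopography.stress_const (hh : IsTopography h) (hμ : 0 < μ) :
    ⨍ z in torusBox, oddExt h z * dx (resolvent μ h) z = 0 := by
  have key := hasSum_integral_mul (hh.summable_res_fst hμ) (fun l => continuous_basisFn (conj l))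
    (fun l z _ => abs_basisFn_le (conj l) z) hh.isBddTorus
  have e : (⨍ z in torusBox, oddExt h z * dx (resolvent μ h) z)
      = ∫ z, (∑' l : Mode, resCoeff μ h l * l.1 * basisFn (conj l) z) * oddExt h z ∂torus := by
    rw [average_torusBox]
    refine integral_congr_ae (ae_of_all _ fun z => ?_)
    simp only [hh.dx_resolvent hμ]
    ring
  rw [e, ← key.tsum_eq]
  set F : Mode → ℝ := fun l => resCoeff μ h l * l.1 * ∫ z, basisFn (conj l) z * oddExt h z ∂torus
    with hF
  -- The wave number in x is odd under `conj` and everything else is even, so the series cancels in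
  -- pairs.
  have hanti : ∀ l, F (conj l) = -F l := fun l => by
    have h1 : ∀ l, ∫ z, basisFn l z * oddExt h z ∂torus = fourier (oddExt h) l := fun l => by
      rw [fourier_eq]
      exact integral_congr_ae (ae_of_all _ fun z => by ring)
    simp only [hF, h1, conj_conj, resCoeff, lam_conj]
    simp only [conj, Int.cast_neg]
    ring
  have h2 : ∑' l, F (conj l) = ∑' l, F l :=
    Equiv.tsum_eq (⟨conj, conj, conj_conj, conj_conj⟩ : Mode ≃ Mode) F
  simp only [hanti, tsum_neg] at h2
  linarith

/-- The matrix of `∇^⊥G · ∇` in the Fourier basis. -/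
def resMatrix (μ : ℝ) (h : ℝ × ℝ → ℝ) (l m : Mode) : ℝ := ∑' k, resCoeff μ h k * triad k m l

theorem IsTopography.summable_resMatrix (hh : IsTopography h) (hμ : 0 < μ) (l m : Mode) :
    Summable fun k => |resCoeff μ h k| * |triad k m l| := by
  refine ((hh.summable_resCoeff hμ).mul_right (16 * Real.sqrt (lam m))).of_nonneg_of_le
    (fun k => by positivity) fun k => ?_
  calc _ ≤ |resCoeff μ h k| * (16 * (Real.sqrt (lam k) * Real.sqrt (lam m))) :=
        mul_le_mul_of_nonneg_left (abs_triad_le k m l) (abs_nonneg _)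
    _ = _ := by ring

/-- Inherited from the triads term by term: ∇^⊥G is divergence free. -/
theorem resMatrix_swap (l m : Mode) : resMatrix μ h m l = -resMatrix μ h l m := by
  rw [resMatrix, resMatrix, ← tsum_neg]
  refine tsum_congr fun k => ?_
  rw [triad_swap_right]
  ring

/-- The columns of `∇^⊥G · ∇` are summable, with polynomial bounds. -/
theorem IsTopography.exists_sum_resMatrix_le (hh : IsTopography h) (hμ : 0 < μ) :
    ∃ C : ℝ, 0 ≤ C ∧ ∀ (m : Mode) (t : Finset Mode),
      ∑ l ∈ t, |resMatrix μ h l m| ≤ C * Real.sqrt (lam m) := by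
  classical
  refine ⟨192 * ∑' k, |resCoeff μ h k| * Real.sqrt (lam k), by positivity, fun m t => ?_⟩
  have h1 : ∀ l, |resMatrix μ h l m| ≤ ∑' k, |resCoeff μ h k| * |triad k m l| := fun l => by
    have := norm_tsum_le_tsum_norm (f := fun k => resCoeff μ h k * triad k m l) (by
      simpa only [norm_mul, Real.norm_eq_abs] using hh.summable_resMatrix hμ l m)
    simpa only [resMatrix, norm_mul, Real.norm_eq_abs] using this
  refine (Finset.sum_le_sum fun l _ => h1 l).trans ?_
  rw [← Summable.tsum_finsetSum fun l _ => hh.summable_resMatrix hμ l m]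
  have h2 : ∀ k, ∑ l ∈ t, |resCoeff μ h k| * |triad k m l|
      ≤ |resCoeff μ h k| * Real.sqrt (lam k) * (192 * Real.sqrt (lam m)) := by
    intro k
    rw [← Finset.mul_sum, mul_assoc]
    refine mul_le_mul_of_nonneg_left ?_ (abs_nonneg _)
    -- For each pair (k, m) at most twelve l occur, each with a triad of at most 16 |k| |m|. This is
    -- the origin of 192.
    have h3 : ∑ l ∈ t, |triad k m l| ≤ ∑ l ∈ nbr k m, |triad k m l| := by
      rw [← Finset.sum_filter_ne_zero]
      refine Finset.sum_le_sum_of_subset_of_nonneg (fun l hl => ?_) fun _ _ _ => abs_nonneg _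
      by_contra hc
      exact (Finset.mem_filter.1 hl).2 (by rw [triad_eq_zero hc, abs_zero])
    refine h3.trans ((Finset.sum_le_card_nsmul _ _ _ fun l _ => abs_triad_le k m l).trans ?_)
    rw [nsmul_eq_mul]
    have hc : ((nbr k m).card : ℝ) ≤ 12 := by exact_mod_cast card_nbr_le k m
    calc _ ≤ 12 * (16 * (Real.sqrt (lam k) * Real.sqrt (lam m))) := by gcongr
      _ = _ := by ring
  have hs := (hh.summable_resCoeff hμ).mul_right (192 * Real.sqrt (lam m))
  refine ((Summable.of_nonneg_of_le (fun k => Finset.sum_nonneg fun l _ => by positivity) h2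
    hs).tsum_le_tsum h2 hs).trans_eq ?_
  rw [tsum_mul_right]
  ring

/-- The gradients of b_k grow like |k|. The growth is moved into the coefficients, where
`summable_resCoeff` absorbs it, and the series can be integrated term by term against b_l. -/
theorem IsTopography.hasSum_jac_resolvent (hh : IsTopography h) (hμ : 0 < μ) {φ : ℝ × ℝ → ℝ}
    (hφ : IsTest φ) (l : Mode) :
    HasSum (fun k => resCoeff μ h k * ∑ m ∈ nbr k l, triad k m l * fourier φ m)
      (fourier (jac (resolvent μ h) φ) l) := by
  obtain ⟨B₁, hB₁0, hB₁⟩ := (isBddTorus_of_continuous hφ.isTest_dx.continuous).bdd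
  obtain ⟨B₂, hB₂0, hB₂⟩ := (isBddTorus_of_continuous hφ.isTest_dy.continuous).bdd
  have hb : ∀ k, ∀ z ∈ torusBox, |(Real.sqrt (lam k))⁻¹ * jac (basisFn k) φ z| ≤ 2 * B₁ + 2 * B₂ := by
    intro k z hz
    have hs := one_le_sqrt_lam k
    have hsp : 0 < Real.sqrt (lam k) := by linarith
    have k1 : |(k.2 : ℝ)| ≤ Real.sqrt (lam k) := by
      rw [abs_of_nonneg (by positivity)]
      exact snd_le k
    have m1 : |(k.2 : ℝ)| * |evenFn k z| * |dx φ z| ≤ Real.sqrt (lam k) * 2 * B₁ := by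
      have := abs_evenFn_le k z
      have := hB₁ z hz
      gcongr
    have m2 : |(k.1 : ℝ)| * |basisFn (conj k) z| * |dy φ z| ≤ Real.sqrt (lam k) * 2 * B₂ := by
      have := abs_basisFn_le (conj k) z
      have := hB₂ z hz
      have := abs_fst_le k
      gcongr
    rw [abs_mul, abs_inv, abs_of_pos hsp, inv_mul_le_iff₀ hsp, jac, dx_basisFn, dy_basisFn]
    refine (abs_add_le _ _).trans ?_
    rw [abs_mul, abs_mul, abs_neg, abs_mul, abs_mul]
    linarith
  have hc : Summable fun k => |resCoeff μ h k * Real.sqrt (lam k)| := by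
    simpa only [abs_mul, abs_of_nonneg (Real.sqrt_nonneg _)] using hh.summable_resCoeff hμ
  have key := hasSum_integral_mul hc
    (f := fun k z => (Real.sqrt (lam k))⁻¹ * jac (basisFn k) φ z) (fun k => continuous_const.mul (continuous_jac_basisFn hφ k)) hb
    (isBddTorus_of_continuous (continuous_basisFn l))
  have hsq : ∀ k, Real.sqrt (lam k) ≠ 0 := fun k => by
    have := one_le_sqrt_lam k
    positivity
  rw [fourier_eq]
  refine HasSum.of_eq key (fun k => ?_) ?_
  · have e : ∫ z, (Real.sqrt (lam k))⁻¹ * jac (basisFn k) φ z * basisFn l z ∂torus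
        = (Real.sqrt (lam k))⁻¹ * -∫ z, jac (basisFn k) (basisFn l) z * φ z ∂torus := by
      rw [← hφ.integral_jac_mul (isTest_basisFn l) k, ← integral_const_mul]
      exact integral_congr_ae (ae_of_all _ fun z => by ring)
    rw [e, integral_jac_mul_eq_sum hφ, ← Finset.sum_neg_distrib, ← mul_assoc, mul_assoc _ _ (_)⁻¹,
      mul_inv_cancel₀ (hsq k), mul_one]
    congr 1
    refine Finset.sum_congr rfl fun m _ => ?_
    rw [triad_swap_right k l m]
    ring
  · congr 1
    ext z
    congr 1
    rw [jac, hh.dx_resolvent hμ, hh.dy_resolvent hμ]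
    have s1 := summable_mul_of_abs_le (hh.summable_res_fst hμ) fun l => abs_basisFn_le (conj l) z
    have s2 := summable_mul_of_abs_le (hh.summable_res_snd hμ) fun l => abs_evenFn_le l z
    rw [← tsum_neg, ← tsum_mul_right, ← tsum_mul_right,
      ← (s2.neg.mul_right _).tsum_add (s1.mul_right _)]
    refine tsum_congr fun k => ?_
    rw [jac, dx_basisFn, dy_basisFn]
    have := hsq k
    field_simp

/-- Fubini for the double series over the modes of G and of φ, which converges absolutely by the
decay of both sets of coefficients. -/
theorem IsTopography.hasSum_fourier_jac_resolvent (hh : IsTopography h) (hμ : 0 < μ)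
    {φ : ℝ × ℝ → ℝ} (hφ : IsTest φ) (l : Mode) :
    HasSum (fun m => fourier φ m * resMatrix μ h l m) (fourier (jac (resolvent μ h) φ) l) := by
  have hφs : Summable fun m => 16 * (Real.sqrt (lam m) * |fourier φ m|) := by
    refine ((hφ.summable_fourier 1).mul_left 16).of_nonneg_of_le (fun m => by positivity) fun m => ?_
    have h1 := one_le_lam m
    have : Real.sqrt (lam m) ≤ lam m := by
      rw [Real.sqrt_le_left (by linarith)]
      nlinarith
    rw [pow_one]
    gcongr
  have hS : Summable fun p : Mode × Mode => fourier φ p.1 * (resCoeff μ h p.2 * triad p.2 p.1 l) := by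
    refine Summable.of_norm_bounded (hφs.mul_of_nonneg (hh.summable_resCoeff hμ)
      (fun m => by positivity) fun k => by positivity) fun p => ?_
    rw [Real.norm_eq_abs, abs_mul, abs_mul]
    calc _ ≤ |fourier φ p.1| * (|resCoeff μ h p.2| *
          (16 * (Real.sqrt (lam p.2) * Real.sqrt (lam p.1)))) := by
          gcongr
          exact abs_triad_le _ _ _
      _ = _ := by ring
  have h1 := hS.hasSum.prod_fiberwise fun m => (hS.prod_factor m).hasSum
  have h2 : ∑' p : Mode × Mode, fourier φ p.1 * (resCoeff μ h p.2 * triad p.2 p.1 l)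
      = fourier (jac (resolvent μ h) φ) l := by
    rw [hS.tsum_prod]
    simp only
    rw [← Summable.tsum_comm
      (f := fun m k => fourier φ m * (resCoeff μ h k * triad k m l)) hS, ← (hh.hasSum_jac_resolvent hμ hφ l).tsum_eq]
    refine tsum_congr fun k => ?_
    rw [tsum_eq_sum (s := nbr k l), Finset.mul_sum]
    · exact Finset.sum_congr rfl fun m _ => by ring
    · intro m hm
      have := triad_eq_zero hm
      rw [triad_swap_right] at this
      rw [show triad k m l = 0 by linarith]
      simp
  rw [h2] at h1
  simpa only [tsum_mul_left, resMatrix] using h1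

/-- The columns of `resMatrix` have ℓ¹ norm at most of order |m|, against rapidly decaying φ̂_m.
Consequently ∇^⊥G · ∇φ can be paired with Gaussian coefficients of bounded variance, although G is
not smooth across the walls. -/
theorem IsTopography.summable_abs_fourier_jac (hh : IsTopography h) (hμ : 0 < μ)
    {φ : ℝ × ℝ → ℝ} (hφ : IsTest φ) :
    Summable fun p : Mode × Mode => |fourier φ p.2| * |resMatrix μ h p.1 p.2| := by
  obtain ⟨C, hC0, hC⟩ := hh.exists_sum_resMatrix_le hμ
  have hcol : ∀ m, Summable fun l => |resMatrix μ h l m| := fun m =>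
    summable_of_sum_le (fun l => abs_nonneg _) (hC m)
  have hswap : Summable fun p : Mode × Mode => |fourier φ p.1| * |resMatrix μ h p.2 p.1| := by
    have h0 : ∀ p : Mode × Mode, 0 ≤ |fourier φ p.1| * |resMatrix μ h p.2 p.1| := fun p =>
      mul_nonneg (abs_nonneg _) (abs_nonneg _)
    rw [summable_prod_of_nonneg h0]
    have h1 : ∀ m, Summable fun l => |fourier φ m| * |resMatrix μ h l m| := fun m =>
      (hcol m).mul_left |fourier φ m|
    refine ⟨h1, ?_⟩
    refine ((hφ.summable_fourier 1).mul_left C).of_nonneg_of_le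
      (fun m => tsum_nonneg fun l => mul_nonneg (abs_nonneg _) (abs_nonneg _)) fun m => ?_
    simp only
    rw [tsum_mul_left, pow_one]
    have h1 : ∑' l, |resMatrix μ h l m| ≤ C * Real.sqrt (lam m) := (hcol m).tsum_le_of_sum_le (hC m)
    have h3 := one_le_lam m
    have h2 : Real.sqrt (lam m) ≤ lam m := by
      rw [Real.sqrt_le_left (by linarith)]
      nlinarith
    calc _ ≤ |fourier φ m| * (C * lam m) := by gcongr; exact h1.trans (by gcongr)
      _ = _ := by ring
  exact hswap.comp_injective (i := Prod.swap) Prod.swap_injective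

end Resolvent


/-! ### Convergence in `L²` along a filter -/

section TendstoL2

/-- `F → g` in `L²(P)` along `l`, for measurable functions. -/
structure TendstoL2 {β Ω : Type} [MeasurableSpace Ω] (P : Measure Ω) (l : Filter β) (F : β → Ω → ℝ)
    (g : Ω → ℝ) : Prop where
  meas_left : ∀ s, Measurable (F s)
  meas : Measurable g
  tendsto : Tendsto (fun s => eLpNorm (F s - g) 2 P) l (𝓝 0)

variable {β β' Ω Ω' : Type} [MeasurableSpace Ω] [MeasurableSpace Ω'] {P : Measure Ω}
  {l : Filter β} {F G : β → Ω → ℝ} {f g : Ω → ℝ}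

theorem TendstoL2.of_le (hF : ∀ s, Measurable (F s)) (hf : Measurable f) {u : β → ℝ≥0∞}
    (hu : Tendsto u l (𝓝 0)) (h : ∀ᶠ s in l, eLpNorm (F s - f) 2 P ≤ u s) : TendstoL2 P l F f :=
  ⟨hF, hf, tendsto_of_tendsto_of_tendsto_of_le_of_le' tendsto_const_nhds hu
    (Eventually.of_forall fun _ => zero_le) h⟩

theorem TendstoL2.add (hF : TendstoL2 P l F f) (hG : TendstoL2 P l G g) :
    TendstoL2 P l (fun s x => F s x + G s x) fun x => f x + g x := by
  refine TendstoL2.of_le (fun s => (hF.meas_left s).add (hG.meas_left s)) (hF.meas.add hG.meas)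
    (u := fun s => eLpNorm (F s - f) 2 P + eLpNorm (G s - g) 2 P)
    (by simpa using hF.tendsto.add hG.tendsto) (Eventually.of_forall fun s => ?_)
  have e : ((fun x => F s x + G s x) - fun x => f x + g x) = (F s - f) + (G s - g) := by
    ext x
    simp only [Pi.sub_apply, Pi.add_apply]
    ring
  rw [e]
  exact eLpNorm_add_le ((hF.meas_left s).sub hF.meas).aestronglyMeasurable
    ((hG.meas_left s).sub hG.meas).aestronglyMeasurable (by norm_num)

theorem TendstoL2.const_mul (c : ℝ) (hF : TendstoL2 P l F f) :
    TendstoL2 P l (fun s x => c * F s x) fun x => c * f x := by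
  refine ⟨fun s => (hF.meas_left s).const_mul c, hF.meas.const_mul c, ?_⟩
  have e : ∀ s, ((fun x => c * F s x) - fun x => c * f x) = c • (F s - f) := fun s => by
    ext x
    simp [mul_sub]
  simp only [e, eLpNorm_const_smul]
  have := ENNReal.Tendsto.const_mul hF.tendsto (a := ‖c‖ₑ) (Or.inr enorm_ne_top)
  simpa using this

theorem tendstoL2_const (hf : Measurable f) : TendstoL2 P l (fun _ => f) f :=
  ⟨fun _ => hf, hf, by simp [tendsto_const_nhds]⟩

theorem TendstoL2.finset_sum {κ : Type} (M : Finset κ) {F : κ → β → Ω → ℝ} {f : κ → Ω → ℝ}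
    (h : ∀ m, TendstoL2 P l (F m) (f m)) :
    TendstoL2 P l (fun s x => ∑ m ∈ M, F m s x) fun x => ∑ m ∈ M, f m x := by
  classical
  induction M using Finset.induction_on with
  | empty => simpa using tendstoL2_const (f := fun _ => (0 : ℝ)) measurable_const
  | insert m M hm ih => simpa only [Finset.sum_insert hm] using (h m).add ih

theorem TendstoL2.congr (hF : TendstoL2 P l F f) (hG : ∀ s, Measurable (G s))
    (h : ∀ᶠ s in l, ∀ x, G s x = F s x) : TendstoL2 P l G f :=
  ⟨hG, hF.meas, hF.tendsto.congr' (h.mono fun s hs => by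
    simp only [funext hs])⟩

theorem TendstoL2.comp_index {l' : Filter β'} {u : β' → β} (hF : TendstoL2 P l F f)
    (hu : Tendsto u l' l) : TendstoL2 P l' (fun s => F (u s)) f :=
  ⟨fun _ => hF.meas_left _, hF.meas, hF.tendsto.comp hu⟩

theorem TendstoL2.comp {Q : Measure Ω'} (hF : TendstoL2 P l F f) {S : Ω' → Ω}
    (hS : MeasurePreserving S Q P) : TendstoL2 Q l (fun s x => F s (S x)) fun x => f (S x) := by
  refine ⟨fun s => (hF.meas_left s).comp hS.measurable, hF.meas.comp hS.measurable, ?_⟩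
  refine hF.tendsto.congr fun s => ?_
  rw [← eLpNorm_comp_measurePreserving ((hF.meas_left s).sub hF.meas).aestronglyMeasurable hS]
  rfl

theorem TendstoL2.eLpNorm_le [l.NeBot] (hF : TendstoL2 P l F f) {C : ℝ≥0∞}
    (h : ∀ᶠ s in l, eLpNorm (F s) 2 P ≤ C) : eLpNorm f 2 P ≤ C := by
  have h1 : Tendsto (fun s => C + eLpNorm (F s - f) 2 P) l (𝓝 C) := by
    simpa using hF.tendsto.const_add C
  refine ge_of_tendsto h1 (h.mono fun s hs => ?_)
  have e : f = F s - (F s - f) := by simp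
  conv_lhs => rw [e]
  exact (eLpNorm_sub_le (hF.meas_left s).aestronglyMeasurable
    ((hF.meas_left s).sub hF.meas).aestronglyMeasurable (by norm_num)).trans (add_le_add_left hs _)

theorem TendstoL2.ae_eq [l.NeBot] (hF : TendstoL2 P l F f) (hG : TendstoL2 P l F g) : f =ᵐ[P] g := by
  have h := hF.add (hG.const_mul (-1))
  have h0 : eLpNorm (fun x => f x + -1 * g x) 2 P ≤ 0 :=
    h.eLpNorm_le (Eventually.of_forall fun s => by
      have e : (fun x => F s x + -1 * F s x) = fun _ => 0 := by
        ext x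
        ring
      rw [e]
      simp)
  have := (eLpNorm_eq_zero_iff h.meas.aestronglyMeasurable (by norm_num)).1 (le_antisymm h0 zero_le)
  filter_upwards [this] with x hx
  simp only [Pi.zero_apply] at hx
  linarith

theorem TendstoL2.exists_seq_ae [l.NeBot] [l.IsCountablyGenerated] (hF : TendstoL2 P l F f) :
    ∃ u : ℕ → β, Tendsto u atTop l ∧ ∀ᵐ x ∂P, Tendsto (fun n => F (u n) x) atTop (𝓝 (f x)) := by
  obtain ⟨v, hv⟩ := exists_seq_tendsto l
  have h1 := tendstoInMeasure_of_tendsto_eLpNorm (p := 2) (by norm_num)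
    (fun n => (hF.meas_left (v n)).aestronglyMeasurable) hF.meas.aestronglyMeasurable
    (hF.tendsto.comp hv)
  obtain ⟨ns, hns, h2⟩ := h1.exists_seq_tendsto_ae
  exact ⟨fun n => v (ns n), hv.comp hns.tendsto_atTop, h2⟩

/-- A series with summable norms converges almost surely. -/
theorem ae_summable_of_eLpNorm_le [IsProbabilityMeasure P] {κ : Type} [Countable κ]
    {c : κ → Ω → ℝ} (hc : ∀ k, Measurable (c k)) {A : κ → ℝ} (hA : Summable A)
    (h : ∀ k, eLpNorm (c k) 1 P ≤ ENNReal.ofReal (A k)) :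
    ∀ᵐ x ∂P, Summable fun k => |c k x| := by
  have h1 : ∫⁻ x, ∑' k, ‖c k x‖ₑ ∂P ≠ ∞ := by
    rw [lintegral_tsum fun k => (hc k).enorm.aemeasurable]
    refine ne_top_of_le_ne_top hA.tsum_ofReal_ne_top (ENNReal.tsum_le_tsum fun k => ?_)
    rw [← eLpNorm_one_eq_lintegral_enorm]
    exact h k
  filter_upwards [ae_lt_top (Measurable.tsum fun k => (hc k).enorm) h1] with x hx
  simp only [Real.enorm_eq_ofReal_abs] at hx
  have := ENNReal.summable_toReal hx.ne
  simpa using this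

theorem TendstoL2.ae_eq_tsum {κ : Type} [Countable κ] {c : κ → Ω → ℝ}
    (hF : TendstoL2 P atTop (fun (s : Finset κ) x => ∑ k ∈ s, c k x) f)
    (hs : ∀ᵐ x ∂P, Summable fun k => |c k x|) : ∀ᵐ x ∂P, f x = ∑' k, c k x := by
  obtain ⟨u, hu, h⟩ := hF.exists_seq_ae
  filter_upwards [h, hs] with x hx hxs
  exact tendsto_nhds_unique hx ((summable_abs_iff.1 hxs).hasSum.comp hu)

end TendstoL2

/-! ### Quadratic and linear forms -/

section Forms

variable {ι : Type}

/-- A finite section of a quadratic form. -/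
def quadForm (A : ι → ι → ℝ) (s : Finset ι) (x : ι → ℝ) : ℝ :=
  ∑ a ∈ s, ∑ b ∈ s, A a b * (x a * x b)

/-- A finite section of a linear form. -/
def linForm (A : ι → ℝ) (s : Finset ι) (x : ι → ℝ) : ℝ := ∑ a ∈ s, A a * x a

theorem measurable_quadForm (A : ι → ι → ℝ) (s : Finset ι) : Measurable (quadForm A s) :=
  Finset.measurable_sum _ fun a _ => Finset.measurable_sum _ fun b _ =>
    ((measurable_pi_apply a).mul (measurable_pi_apply b)).const_mul _

theorem measurable_linForm (A : ι → ℝ) (s : Finset ι) : Measurable (linForm A s) :=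
  Finset.measurable_sum _ fun a _ => (measurable_pi_apply a).const_mul _

theorem summable_sq_of_sum_le {A : ι → ι → ℝ} {R : ℝ}
    (hR : ∀ s : Finset (ι × ι), ∑ p ∈ s, A p.1 p.2 ^ 2 ≤ R) :
    Summable fun p : ι × ι => A p.1 p.2 ^ 2 :=
  summable_of_sum_le (fun _ => sq_nonneg _) hR

theorem exists_tendstoL2_quadForm {A : ι → ι → ℝ} (h0 : ∀ a, A a a = 0) {R : ℝ}
    (hR : ∀ s : Finset (ι × ι), ∑ p ∈ s, A p.1 p.2 ^ 2 ≤ R) :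
    ∃ g, TendstoL2 (stdG ι) atTop (quadForm A) g := by
  classical
  obtain ⟨g, hg, _, ht⟩ := exists_quadForm_limit (summable_sq_of_sum_le hR) h0
  exact ⟨g, measurable_quadForm A, hg, ht⟩

theorem eLpNorm_quadForm_le_of_sum_le {A : ι → ι → ℝ} (h0 : ∀ a, A a a = 0) {R : ℝ}
    (hR : ∀ s : Finset (ι × ι), ∑ p ∈ s, A p.1 p.2 ^ 2 ≤ R) (s : Finset ι) :
    eLpNorm (quadForm A s) 2 (stdG ι) ≤ ENNReal.ofReal (Real.sqrt ((2 + fourthMoment) * R)) := by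
  classical
  refine (eLpNorm_quadForm_le s A).trans (ENNReal.ofReal_le_ofReal (Real.sqrt_le_sqrt ?_))
  have h1 := hR (s ×ˢ s)
  rw [Finset.sum_product] at h1
  have h2 : (0 : ℝ) ≤ 2 + fourthMoment := by linarith [fourthMoment_nonneg]
  simp only [h0, Finset.sum_const_zero]
  have := mul_le_mul_of_nonneg_left h1 h2
  linarith

theorem exists_tendstoL2_linForm {A : ι → ℝ} {S : ℝ}
    (hS : ∀ s : Finset ι, ∑ a ∈ s, A a ^ 2 ≤ S) :
    ∃ g, TendstoL2 (stdG ι) atTop (linForm A) g := by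
  classical
  obtain ⟨g, hg, _, ht⟩ := exists_linForm_limit (summable_of_sum_le (fun _ => sq_nonneg _) hS)
  exact ⟨g, measurable_linForm A, hg, ht⟩

theorem eLpNorm_linForm_le_of_sum_le {A : ι → ℝ} {S : ℝ}
    (hS : ∀ s : Finset ι, ∑ a ∈ s, A a ^ 2 ≤ S) (s : Finset ι) :
    eLpNorm (linForm A s) 2 (stdG ι) ≤ ENNReal.ofReal (Real.sqrt S) := by
  classical
  exact (eLpNorm_two_le_of_integral_sq_le (memLp_finsetSum _ fun a _ =>
    (memLp_eval a (by simp)).const_mul _) (integral_linForm_sq s A).le).trans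
    (ENNReal.ofReal_le_ofReal (Real.sqrt_le_sqrt (hS s)))

theorem quadForm_symmetrize (A : ι → ι → ℝ) (s : Finset ι) (x : ι → ℝ) :
    quadForm (fun a b => (A a b + A b a) / 2) s x = quadForm A s x := by
  have h : quadForm A s x = ∑ a ∈ s, ∑ b ∈ s, A b a * (x a * x b) := by
    rw [quadForm, Finset.sum_comm]
    exact Finset.sum_congr rfl fun a _ => Finset.sum_congr rfl fun b _ => by ring
  have h2 : quadForm (fun a b => (A a b + A b a) / 2) s x
      = (quadForm A s x + ∑ a ∈ s, ∑ b ∈ s, A b a * (x a * x b)) / 2 := by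
    rw [quadForm, quadForm, ← Finset.sum_add_distrib, Finset.sum_div]
    refine Finset.sum_congr rfl fun a _ => ?_
    rw [← Finset.sum_add_distrib, Finset.sum_div]
    exact Finset.sum_congr rfl fun b _ => by ring
  rw [h2, ← h]
  ring

variable {a₀ : ι → ι → ℝ} {a : ι → ι → ι → ℝ}

/-- A quadratic form sees only the symmetric part of its coefficients. This matters because the
square summability to be used holds for the symmetrised rates, where the Biot–Savart cancellation is
visible. -/
theorem drift_eq (s : Finset ι) (i : ι) (x : ι → ℝ) :
    drift a₀ a s i x = linForm (a₀ i) s x + quadForm (fun j k => (a i j k + a i k j) / 2) s x := by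
  rw [quadForm_symmetrize, drift, linForm, quadForm, ← Finset.sum_add_distrib]
  refine Finset.sum_congr rfl fun j _ => ?_
  rw [rate, add_mul, Finset.sum_mul]
  congr 1
  exact Finset.sum_congr rfl fun k _ => by ring

/-- Square summable coefficients define a drift. -/
theorem exists_tendstoL2_drift (h0 : ∀ i j, a i j j = 0) {S R : ι → ℝ}
    (hS : ∀ i (s : Finset ι), ∑ j ∈ s, a₀ i j ^ 2 ≤ S i)
    (hR : ∀ i (s : Finset (ι × ι)), ∑ p ∈ s, ((a i p.1 p.2 + a i p.2 p.1) / 2) ^ 2 ≤ R i) (i : ι) :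
    (∃ b, TendstoL2 (stdG ι) atTop (fun s => drift a₀ a s i) b) ∧
    ∀ s, eLpNorm (drift a₀ a s i) 2 (stdG ι)
      ≤ ENNReal.ofReal (2 + S i + (2 + fourthMoment) * R i) := by
  have hd : ∀ j, (a i j j + a i j j) / 2 = 0 := fun j => by rw [h0]; simp
  have e : ∀ s, drift a₀ a s i = fun x => linForm (a₀ i) s x
      + quadForm (fun j k => (a i j k + a i k j) / 2) s x := fun s => funext (drift_eq s i)
  have hS0 : 0 ≤ S i := by simpa using hS i ∅
  have hR0 : 0 ≤ R i := by simpa using hR i ∅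
  have hF := fourthMoment_nonneg
  constructor
  · obtain ⟨f, hf⟩ := exists_tendstoL2_linForm (hS i)
    obtain ⟨g, hg⟩ := exists_tendstoL2_quadForm
      (A := fun j k => (a i j k + a i k j) / 2) hd (hR i)
    exact ⟨_, by simpa only [e] using hf.add hg⟩
  · intro s
    rw [e]
    refine (eLpNorm_add_le_ofReal (by norm_num) (measurable_linForm _ s) (measurable_quadForm _ s)
      (Real.sqrt_nonneg _) (Real.sqrt_nonneg _) (eLpNorm_linForm_le_of_sum_le (hS i) s)
      (eLpNorm_quadForm_le_of_sum_le hd (hR i) s)).trans (ENNReal.ofReal_le_ofReal ?_)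
    -- The constant 2 in the bound is the sum of the two ones spent here on replacing square roots
    -- by linear expressions.
    have hsq : ∀ y : ℝ, 0 ≤ y → Real.sqrt y ≤ 1 + y := fun y hy => by
      rw [Real.sqrt_le_left (by linarith)]
      nlinarith
    have h1 := hsq (S i) hS0
    have h2 := hsq ((2 + fourthMoment) * R i) (by positivity)
    linarith

theorem tendsto_quadForm_sub {A A₀ : ι → ι → ℝ} {x : ι → ℝ} {u : ℕ → Finset ι} {y : ℝ}
    (hu : Tendsto u atTop atTop) (hy : Tendsto (fun n => quadForm A₀ (u n) x) atTop (𝓝 y))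
    (hs : Summable fun p : ι × ι => A p.1 p.2 * (x p.1 * x p.2)) :
    Tendsto (fun n => quadForm (fun a b => A a b - A₀ a b) (u n) x) atTop
      (𝓝 ((∑' p : ι × ι, A p.1 p.2 * (x p.1 * x p.2)) - y)) := by
  have hpair : Tendsto (fun n => (u n, u n)) atTop atTop := by
    rw [← prod_atTop_atTop_eq]
    exact hu.prodMk hu
  have hprod : Tendsto (fun n => u n ×ˢ u n) atTop atTop :=
    (tendsto_finsetProd_atTop (ι := ι) (ι' := ι)).comp hpair
  have h2 : Tendsto (fun n => ∑ p ∈ u n ×ˢ u n, A p.1 p.2 * (x p.1 * x p.2)) atTop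
      (𝓝 (∑' p : ι × ι, A p.1 p.2 * (x p.1 * x p.2))) := hs.hasSum.comp hprod
  refine (h2.sub hy).congr fun k => ?_
  simp only [quadForm]
  rw [Finset.sum_product, ← Finset.sum_sub_distrib]
  refine Finset.sum_congr rfl fun a _ => ?_
  rw [← Finset.sum_sub_distrib]
  exact Finset.sum_congr rfl fun b _ => by ring

/-- The distance of an absolutely convergent quadratic form from a double Wiener integral. -/
theorem eLpNorm_tsum_sub_le [Countable ι] {A A₀ : ι → ι → ℝ} {n : (ι → ℝ) → ℝ}
    (hn : TendstoL2 (stdG ι) atTop (quadForm A₀) n) (h0 : ∀ a, A₀ a a = 0) {t D : ℝ}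
    (hA : HasSum (fun a => A a a) t)
    (hd : HasSum (fun p : ι × ι => (A p.1 p.2 - A₀ p.1 p.2) ^ 2) D)
    (hs : ∀ᵐ x ∂stdG ι, Summable fun p : ι × ι => A p.1 p.2 * (x p.1 * x p.2)) :
    eLpNorm (fun x => (∑' p : ι × ι, A p.1 p.2 * (x p.1 * x p.2)) - n x) 2 (stdG ι)
      ≤ ENNReal.ofReal (Real.sqrt (t ^ 2 + (2 + fourthMoment) * D)) := by
  classical
  obtain ⟨u, hu, hlim⟩ := hn.exists_seq_ae
  -- Lower semicontinuity of the L² norm along an almost surely convergent sequence of sections. The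
  -- second moment of a section involves its trace, which tends to t because A₀ has zero diagonal.
  have key : eLpNorm (fun x => (∑' p : ι × ι, A p.1 p.2 * (x p.1 * x p.2)) - n x) 2 (stdG ι)
      ≤ atTop.liminf fun k => eLpNorm (quadForm (fun a b => A a b - A₀ a b) (u k)) 2 (stdG ι) := by
    refine Lp.eLpNorm_lim_le_liminf_eLpNorm (fun n => (measurable_quadForm _ _).aestronglyMeasurable)
      _ ?_
    filter_upwards [hlim, hs] with x hx hxs using tendsto_quadForm_sub hu hx hxs
  have hb : ∀ k, eLpNorm (quadForm (fun a b => A a b - A₀ a b) (u k)) 2 (stdG ι)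
      ≤ ENNReal.ofReal (Real.sqrt ((∑ a ∈ u k, A a a) ^ 2 + (2 + fourthMoment) * D)) := by
    intro k
    refine (eLpNorm_quadForm_le (u k) _).trans (ENNReal.ofReal_le_ofReal (Real.sqrt_le_sqrt ?_))
    have h1 := sum_le_hasSum (u k ×ˢ u k) (fun _ _ => sq_nonneg _) hd
    rw [Finset.sum_product] at h1
    have h2 : (0 : ℝ) ≤ 2 + fourthMoment := by linarith [fourthMoment_nonneg]
    simp only [h0, sub_zero]
    have := mul_le_mul_of_nonneg_left h1 h2
    linarith
  have ht : Tendsto (fun k => ENNReal.ofReal (Real.sqrt ((∑ a ∈ u k, A a a) ^ 2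
      + (2 + fourthMoment) * D))) atTop
      (𝓝 (ENNReal.ofReal (Real.sqrt (t ^ 2 + (2 + fourthMoment) * D)))) := by
    have h1 : Tendsto (fun k => ∑ a ∈ u k, A a a) atTop (𝓝 t) := hA.comp hu
    exact ENNReal.tendsto_ofReal ((Real.continuous_sqrt.tendsto _).comp
      ((h1.pow 2).add_const _))
  exact (key.trans (liminf_le_liminf (Eventually.of_forall hb))).trans_eq ht.liminf_eq

end Forms


/-! ### The barotropic system in normalised coordinates -/

section Coefficients

/-- The standard deviation of a Fourier mode. -/
def sd (α μ : ℝ) (l : Mode) : ℝ := Real.sqrt (modeVar α μ l)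

variable {α β μ : ℝ} {h : ℝ × ℝ → ℝ}

theorem modeVar_pos (hα : 0 < α) (hμ : 0 < μ) (l : Mode) : 0 < modeVar α μ l := by
  have := lam_pos l
  unfold modeVar
  positivity

theorem sd_pos (hα : 0 < α) (hμ : 0 < μ) (l : Mode) : 0 < sd α μ l :=
  Real.sqrt_pos.2 (modeVar_pos hα hμ l)

theorem sd_sq (hα : 0 < α) (hμ : 0 < μ) (l : Mode) : sd α μ l ^ 2 = modeVar α μ l :=
  Real.sq_sqrt (modeVar_pos hα hμ l).le

theorem sd_conj (l : Mode) : sd α μ (conj l) = sd α μ l := by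
  rw [sd, sd, modeVar, modeVar, lam_conj]

theorem modeVar_le (hα : 0 < α) (hμ : 0 < μ) (l : Mode) : modeVar α μ l ≤ 1 / α := by
  have := lam_pos l
  rw [modeVar, div_le_div_iff₀ (by positivity) hα]
  nlinarith

theorem inv_modeVar (hα : 0 < α) (hμ : 0 < μ) (l : Mode) :
    (modeVar α μ l)⁻¹ = α * (1 + μ / lam l) := by
  have := lam_pos l
  rw [modeVar]
  field_simp
  ring

theorem inv_modeVar_le (hα : 0 < α) (hμ : 0 < μ) (l : Mode) :
    (modeVar α μ l)⁻¹ ≤ α * (1 + μ) := by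
  rw [inv_modeVar hα hμ]
  have : μ / lam l ≤ μ := div_le_self hμ.le (one_le_lam l)
  gcongr

variable (α β μ h)

/-- The coefficients of the topographic stress. -/
def stressCoeff (l : Mode) : ℝ :=
  Real.sqrt (α * μ) * sd α μ l * fourier (dx (oddExt h)) l / lam l

/-- The linear part of the system. -/
def linRate : Option Mode → Option Mode → ℝ
  | none, none => 0
  | none, some l => stressCoeff α μ h l
  | some m, none => -stressCoeff α μ h m
  | some m, some l => resMatrix μ h l m / (α * sd α μ l * sd α μ m)
      + if l = conj m then -β * m.1 * (1 / μ + 1 / lam m) else 0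

/-- The quadratic part of the system. -/
def quadRate : Option Mode → Option Mode → Option Mode → ℝ
  | some m, some l', some l => -(triad l l' m * sd α μ l / (α * μ * sd α μ l' * sd α μ m))
  | some m, some l', none => if l' = conj m then m.1 / Real.sqrt (α * μ) else 0
  | _, _, _ => 0

variable {α β μ h}

theorem eq_conj_comm {l m : Mode} : l = conj m ↔ m = conj l := by
  constructor <;> rintro rfl <;> rw [conj_conj]

/-- The Gibbs structure of the system. Topographic stress and the term μU∂ₓG are mirror images; the
β-term pairs m with `conj m` and is odd in the wave number; `resMatrix` and the triads are
antisymmetric, and their weights are symmetric in the modes exchanged. A repeated mode makes the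
triad vanish. -/
theorem isRotational_rates : IsRotational (linRate α β μ h) (quadRate α μ) := by
  refine ⟨?_, ?_, ?_⟩
  · rintro (_ | m) (_ | l)
    · simp [linRate]
    · simp [linRate]
    · simp [linRate]
    · simp only [linRate]
      rw [resMatrix_swap m l, neg_add]
      congr 1
      · ring
      · by_cases hc : l = conj m
        · rw [if_pos hc, if_pos (eq_conj_comm.1 hc), hc, lam_conj]
          simp only [conj, Int.cast_neg]
          ring
        · rw [if_neg hc, if_neg fun h' => hc (eq_conj_comm.1 h'), neg_zero]
  · rintro (_ | m) (_ | l') (_ | l)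
    any_goals simp [quadRate]
    · by_cases hc : l' = conj m
      · rw [if_pos hc, if_pos (eq_conj_comm.1 hc), hc]
        simp only [conj, Int.cast_neg]
        ring
      · rw [if_neg hc, if_neg fun h' => hc (eq_conj_comm.1 h'), neg_zero]
    · rw [triad_swap_right l m l']
      ring
  · rintro (_ | m) (_ | l')
    any_goals simp [quadRate]
    exact Or.inl (Or.inl (triad_self l' m))

theorem quadRate_self (i j : Option Mode) : quadRate α μ i j j = 0 := by
  rcases i with _ | m <;> rcases j with _ | l <;> simp [quadRate, triad_self_left]

/-- The coefficients of the double Wiener integral of the nonlinear term. -/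
def chaosCoeff (α μ : ℝ) (φ : ℝ × ℝ → ℝ) (l l' : Mode) : ℝ :=
  kernel φ l l' * (sd α μ l * sd α μ l')

/-- Because 1/σ² = α(1 + μ/|l|²), a difference of inverse eigenvalues is a difference of inverse
variances divided by αμ. The antisymmetric choice of rates therefore has the same symmetric part as
the Euler nonlinearity in normalised coordinates, and only that part acts. -/
theorem quadRate_symm (hα : 0 < α) (hμ : 0 < μ) (m l l' : Mode) :
    (quadRate α μ (some m) (some l) (some l') + quadRate α μ (some m) (some l') (some l)) / 2
      = -(sd α μ m)⁻¹ * chaosCoeff α μ (basisFn m) l l' := by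
  have h1 := inv_modeVar hα hμ l
  have h2 := inv_modeVar hα hμ l'
  rw [← sd_sq hα hμ] at h1 h2
  have p1 := sd_pos hα hμ l
  have p2 := sd_pos hα hμ l'
  have p3 := sd_pos hα hμ m
  simp only [quadRate, chaosCoeff]
  rw [kernel_basisFn, triad_swap l l' m]
  have e : 1 / lam l' - 1 / lam l = ((sd α μ l' ^ 2)⁻¹ - (sd α μ l ^ 2)⁻¹) / (α * μ) := by
    rw [h1, h2]
    field_simp
    ring
  rw [e]
  field_simp
  ring

theorem exists_sum_chaosCoeff_sq_le (hα : 0 < α) (hμ : 0 < μ) : ∃ C : ℝ, 0 ≤ C ∧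
    ∀ (m : Mode) (t : Finset (Mode × Mode)),
      ∑ p ∈ t, chaosCoeff α μ (basisFn m) p.1 p.2 ^ 2 ≤ C * lam m ^ 4 := by
  obtain ⟨C, hC0, hC⟩ := exists_sum_kernel_basisFn_sq_le
  refine ⟨(1 / α * (1 / α)) * C, by positivity, fun m t => ?_⟩
  have h1 : ∀ p ∈ t, chaosCoeff α μ (basisFn m) p.1 p.2 ^ 2
      ≤ (1 / α * (1 / α)) * kernel (basisFn m) p.1 p.2 ^ 2 := by
    intro p _
    rw [chaosCoeff, mul_pow, mul_pow, sd_sq hα hμ, sd_sq hα hμ, mul_comm]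
    refine mul_le_mul_of_nonneg_right ?_ (sq_nonneg _)
    exact mul_le_mul (modeVar_le hα hμ _) (modeVar_le hα hμ _) (modeVar_pos hα hμ _).le (by positivity)
  refine (Finset.sum_le_sum h1).trans ?_
  rw [← Finset.mul_sum]
  exact (mul_le_mul_of_nonneg_left (hC m t) (by positivity)).trans_eq (by ring)

theorem sum_option_le {f : Option Mode → ℝ} (hf : ∀ i, 0 ≤ f i) (s : Finset (Option Mode)) :
    ∑ j ∈ s, f j ≤ f none + ∑ l ∈ s.eraseNone, f (some l) := by
  classical
  rw [← Finset.sum_insertNone]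
  refine Finset.sum_le_sum_of_subset_of_nonneg (fun i hi => ?_) fun i _ _ => hf i
  rcases i with _ | l
  · simp
  · simpa using hi

/-- The weights in the polynomial bounds of the coefficients. -/
def weight : Option Mode → ℝ
  | none => 1
  | some m => lam m ^ 4

/-- A column of `resMatrix` is in ℓ¹, hence in ℓ²; the β-term is a single entry of order |m|; the
stress is in ℓ² by Bessel's inequality for ∂ₓh. The power of `weight` is generous and is the one
needed for the quadratic part. -/
theorem exists_sum_linRate_sq_le (hα : 0 < α) (hμ : 0 < μ) (hh : IsTopography h) : ∃ C : ℝ, 0 ≤ C ∧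
    ∀ i (s : Finset (Option Mode)), ∑ j ∈ s, linRate α β μ h i j ^ 2 ≤ C * weight i := by
  classical
  obtain ⟨C₁, hC₁0, hC₁⟩ := hh.exists_sum_resMatrix_le hμ
  have hsum := hh.isBddTorus_dx.summable_fourier_sq
  set D := ∑' l, fourier (dx (oddExt h)) l ^ 2 with hD
  have hD0 : 0 ≤ D := tsum_nonneg fun _ => sq_nonneg _
  have hstress : ∀ l, stressCoeff α μ h l ^ 2 ≤ μ * fourier (dx (oddExt h)) l ^ 2 := by
    intro l
    have h1 := modeVar_le hα hμ l
    have h2 := one_le_lam l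
    have h3 : 1 ≤ lam l ^ 2 := by nlinarith
    rw [stressCoeff, div_pow, mul_pow, mul_pow, Real.sq_sqrt (by positivity), sd_sq hα hμ]
    refine (div_le_self (by have := modeVar_pos hα hμ l; positivity) h3).trans ?_
    refine mul_le_mul_of_nonneg_right ?_ (sq_nonneg _)
    calc α * μ * modeVar α μ l ≤ α * μ * (1 / α) := by gcongr
      _ = μ := by field_simp
  refine ⟨μ * D + 2 * (1 + μ) ^ 2 * C₁ ^ 2 + 2 * (β * (1 / μ + 1)) ^ 2, by positivity, ?_⟩
  rintro (_ | m) s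
  · refine (sum_option_le (fun _ => sq_nonneg _) s).trans ?_
    simp only [linRate, weight, mul_one]
    have h1 : ∑ l ∈ s.eraseNone, stressCoeff α μ h l ^ 2 ≤ μ * D := by
      refine (Finset.sum_le_sum fun l _ => hstress l).trans ?_
      rw [← Finset.mul_sum]
      exact mul_le_mul_of_nonneg_left (hsum.sum_le_tsum _ fun _ _ => sq_nonneg _) hμ.le
    have h2 : 0 ≤ 2 * (1 + μ) ^ 2 * C₁ ^ 2 + 2 * (β * (1 / μ + 1)) ^ 2 := by positivity
    linarith
  · refine (sum_option_le (fun _ => sq_nonneg _) s).trans ?_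
    simp only [linRate, weight, neg_sq]
    set t := s.eraseNone
    have hlm := one_le_lam m
    have h4 : lam m ≤ lam m ^ 4 := by
      calc lam m = lam m ^ 1 := (pow_one _).symm
        _ ≤ lam m ^ 4 := pow_le_pow_right₀ hlm (by norm_num)
    have h1 : stressCoeff α μ h m ^ 2 ≤ μ * D * lam m ^ 4 := by
      have ha := hsum.le_tsum m fun _ _ => sq_nonneg _
      have hb : 1 ≤ lam m ^ 4 := one_le_pow₀ hlm
      calc _ ≤ μ * fourier (dx (oddExt h)) m ^ 2 := hstress m
        _ ≤ μ * D := by gcongr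
        _ ≤ μ * D * lam m ^ 4 := le_mul_of_one_le_right (by positivity) hb
    have hquot : ∀ l, (resMatrix μ h l m / (α * sd α μ l * sd α μ m)) ^ 2
        ≤ (1 + μ) ^ 2 * |resMatrix μ h l m| ^ 2 := by
      intro l
      rw [div_eq_mul_inv, mul_pow, ← sq_abs (resMatrix μ h l m), mul_comm]
      refine mul_le_mul_of_nonneg_right ?_ (sq_nonneg _)
      rw [inv_pow, mul_pow, mul_pow, sd_sq hα hμ, sd_sq hα hμ, mul_inv, mul_inv]
      have e1 := inv_modeVar_le hα hμ l
      have e2 := inv_modeVar_le hα hμ m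
      have e3 := modeVar_pos hα hμ l
      have e4 := modeVar_pos hα hμ m
      calc (α ^ 2)⁻¹ * (modeVar α μ l)⁻¹ * (modeVar α μ m)⁻¹
          ≤ (α ^ 2)⁻¹ * (α * (1 + μ)) * (α * (1 + μ)) := by gcongr
        _ = (1 + μ) ^ 2 := by field_simp
    have hsq : ∑ l ∈ t, |resMatrix μ h l m| ^ 2 ≤ C₁ ^ 2 * lam m := by
      calc ∑ l ∈ t, |resMatrix μ h l m| ^ 2 ≤ (∑ l ∈ t, |resMatrix μ h l m|) ^ 2 :=
            Finset.sum_sq_le_sq_sum_of_nonneg fun _ _ => abs_nonneg _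
        _ ≤ (C₁ * Real.sqrt (lam m)) ^ 2 :=
            pow_le_pow_left₀ (Finset.sum_nonneg fun _ _ => abs_nonneg _) (hC₁ m t) 2
        _ = C₁ ^ 2 * lam m := by rw [mul_pow, Real.sq_sqrt (lam_pos m).le]
    have hrot : ∑ l ∈ t, (if l = conj m then -β * m.1 * (1 / μ + 1 / lam m) else 0) ^ 2
        ≤ (β * (1 / μ + 1)) ^ 2 * lam m := by
      have e : ∀ l, (if l = conj m then -β * m.1 * (1 / μ + 1 / lam m) else 0) ^ 2
          = if l = conj m then (-β * m.1 * (1 / μ + 1 / lam m)) ^ 2 else 0 := fun l => by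
        split_ifs <;> simp
      have hle : (-β * m.1 * (1 / μ + 1 / lam m)) ^ 2 ≤ (β * (1 / μ + 1)) ^ 2 * lam m := by
        have e2 : (m.1 : ℝ) ^ 2 ≤ lam m := by
          unfold lam
          nlinarith [sq_nonneg (m.2 : ℝ)]
        have e3 : (1 / μ + 1 / lam m) ^ 2 ≤ (1 / μ + 1) ^ 2 := by
          have : 1 / lam m ≤ 1 := by rw [div_le_one (by linarith)]; exact hlm
          have := lam_pos m
          gcongr
        calc _ = β ^ 2 * (m.1 : ℝ) ^ 2 * (1 / μ + 1 / lam m) ^ 2 := by ring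
          _ ≤ β ^ 2 * lam m * (1 / μ + 1) ^ 2 := by gcongr
          _ = _ := by ring
      simp only [e, Finset.sum_ite_eq']
      split_ifs
      · exact hle
      · have := lam_pos m
        positivity
    have h2 : ∑ l ∈ t, (resMatrix μ h l m / (α * sd α μ l * sd α μ m)
        + if l = conj m then -β * m.1 * (1 / μ + 1 / lam m) else 0) ^ 2
        ≤ 2 * ((1 + μ) ^ 2 * (C₁ ^ 2 * lam m)) + 2 * ((β * (1 / μ + 1)) ^ 2 * lam m) := by
      refine (Finset.sum_le_sum fun l _ => add_sq_le).trans ?_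
      rw [← Finset.mul_sum, Finset.sum_add_distrib, mul_add]
      have h5 : ∑ l ∈ t, (resMatrix μ h l m / (α * sd α μ l * sd α μ m)) ^ 2
          ≤ (1 + μ) ^ 2 * (C₁ ^ 2 * lam m) := by
        refine (Finset.sum_le_sum fun l _ => hquot l).trans ?_
        rw [← Finset.mul_sum]
        gcongr
      linarith
    calc _ ≤ μ * D * lam m ^ 4
          + (2 * ((1 + μ) ^ 2 * (C₁ ^ 2 * lam m)) + 2 * ((β * (1 / μ + 1)) ^ 2 * lam m)) :=
          add_le_add h1 h2
      _ ≤ μ * D * lam m ^ 4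
          + (2 * ((1 + μ) ^ 2 * (C₁ ^ 2 * lam m ^ 4)) + 2 * ((β * (1 / μ + 1)) ^ 2 * lam m ^ 4)) := by
          gcongr
      _ = _ := by ring

theorem quadRate_none_symm (m : Mode) (j : Option Mode) :
    (quadRate α μ (some m) j none + quadRate α μ (some m) none j) / 2
      = if j = some (conj m) then m.1 / Real.sqrt (α * μ) / 2 else 0 := by
  rcases j with _ | l
  · simp [quadRate]
  · simp only [quadRate, Option.some.injEq, add_zero]
    split_ifs <;> simp

/-- The mean flow has no quadratic drift. In the drift of a mode m the entries with `none` are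
supported on `conj m`, and all others are the coefficients of the double integral of H_{b_m} divided
by σ_m, where σ_m⁻² is bounded. -/
theorem exists_sum_quadRate_sq_le (hα : 0 < α) (hμ : 0 < μ) : ∃ C : ℝ, 0 ≤ C ∧
    ∀ i (s : Finset (Option Mode × Option Mode)),
      ∑ p ∈ s, ((quadRate α μ i p.1 p.2 + quadRate α μ i p.2 p.1) / 2) ^ 2 ≤ C * weight i := by
  classical
  obtain ⟨C, hC0, hC⟩ := exists_sum_chaosCoeff_sq_le hα hμ
  refine ⟨α * (1 + μ) * C + 1 / (α * μ), by positivity, ?_⟩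
  rintro (_ | m) s
  · have : ∀ p : Option Mode × Option Mode,
        ((quadRate α μ none p.1 p.2 + quadRate α μ none p.2 p.1) / 2) ^ 2 = 0 := fun p => by
      simp [quadRate]
    simp only [this, Finset.sum_const_zero, weight]
    positivity
  set B : Option Mode → Option Mode → ℝ := fun j k =>
    ((quadRate α μ (some m) j k + quadRate α μ (some m) k j) / 2) ^ 2 with hB
  have hB0 : ∀ j k, 0 ≤ B j k := fun j k => sq_nonneg _
  set t := s.image Prod.fst
  set t' := s.image Prod.snd
  have hsub : ∑ p ∈ s, B p.1 p.2 ≤ ∑ j ∈ t, ∑ k ∈ t', B j k := by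
    rw [← Finset.sum_product (s := t) (t := t') (f := fun p : Option Mode × Option Mode => B p.1 p.2)]
    refine Finset.sum_le_sum_of_subset_of_nonneg (fun p hp => ?_) fun p _ _ => hB0 _ _
    exact Finset.mem_product.2 ⟨Finset.mem_image_of_mem _ hp, Finset.mem_image_of_mem _ hp⟩
  refine hsub.trans ?_
  have h1 : ∀ u : Finset (Option Mode), ∑ j ∈ u, B j none ≤ lam m ^ 4 / (α * μ) / 4 := by
    intro u
    have e : ∀ j, B j none = if j = some (conj m) then (m.1 / Real.sqrt (α * μ) / 2) ^ 2 else 0 :=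
      fun j => by
        simp only [hB, quadRate_none_symm]
        split_ifs <;> simp
    have hle : ((m.1 : ℝ) / Real.sqrt (α * μ) / 2) ^ 2 ≤ lam m ^ 4 / (α * μ) / 4 := by
      rw [div_pow, div_pow, Real.sq_sqrt (by positivity)]
      have e2 : (m.1 : ℝ) ^ 2 ≤ lam m := by
        unfold lam
        nlinarith [sq_nonneg (m.2 : ℝ)]
      have hlm := one_le_lam m
      have h4 : lam m ≤ lam m ^ 4 := by
        calc lam m = lam m ^ 1 := (pow_one _).symm
          _ ≤ lam m ^ 4 := pow_le_pow_right₀ hlm (by norm_num)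
      have : (m.1 : ℝ) ^ 2 ≤ lam m ^ 4 := e2.trans h4
      norm_num
      gcongr
    simp only [e, Finset.sum_ite_eq']
    split_ifs
    · exact hle
    · have := lam_pos m
      positivity
  have hBs : ∀ j k, B j k = B k j := fun j k => by simp only [hB, add_comm]
  have h2 : ∑ l ∈ t.eraseNone, ∑ l' ∈ t'.eraseNone, B (some l) (some l')
      ≤ α * (1 + μ) * (C * lam m ^ 4) := by
    have e : ∀ l l', B (some l) (some l')
        = (modeVar α μ m)⁻¹ * chaosCoeff α μ (basisFn m) l l' ^ 2 := fun l l' => by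
      simp only [hB]
      rw [quadRate_symm hα hμ, mul_pow, neg_sq, inv_pow, sd_sq hα hμ]
    simp only [e, ← Finset.mul_sum]
    have h3 := hC m (t.eraseNone ×ˢ t'.eraseNone)
    rw [Finset.sum_product] at h3
    exact mul_le_mul (inv_modeVar_le hα hμ m) h3
      (Finset.sum_nonneg fun _ _ => Finset.sum_nonneg fun _ _ => sq_nonneg _) (by positivity)
  calc ∑ j ∈ t, ∑ k ∈ t', B j k
      ≤ ∑ j ∈ t, (B j none + ∑ l' ∈ t'.eraseNone, B j (some l')) :=
        Finset.sum_le_sum fun j _ => sum_option_le (hB0 j) t'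
    _ = ∑ j ∈ t, B j none + ∑ j ∈ t, ∑ l' ∈ t'.eraseNone, B j (some l') := Finset.sum_add_distrib
    _ ≤ lam m ^ 4 / (α * μ) / 4 + (∑ l' ∈ t'.eraseNone, B none (some l')
          + ∑ l ∈ t.eraseNone, ∑ l' ∈ t'.eraseNone, B (some l) (some l')) := by
        refine add_le_add (h1 t) (sum_option_le (f := fun j => ∑ l' ∈ t'.eraseNone, B j (some l'))
          (fun j => Finset.sum_nonneg fun _ _ => hB0 _ _) t)
    _ ≤ lam m ^ 4 / (α * μ) / 4 + (lam m ^ 4 / (α * μ) / 4 + α * (1 + μ) * (C * lam m ^ 4)) := by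
        gcongr
        have h3 := h1 (t'.eraseNone.map Function.Embedding.some)
        rw [Finset.sum_map] at h3
        simpa only [hBs none, Function.Embedding.some_apply] using h3
    _ ≤ (α * (1 + μ) * C + 1 / (α * μ)) * lam m ^ 4 := by
        have : 0 ≤ lam m ^ 4 / (α * μ) := by
          have := lam_pos m
          positivity
        have e : (α * (1 + μ) * C + 1 / (α * μ)) * lam m ^ 4
            = α * (1 + μ) * (C * lam m ^ 4) + lam m ^ 4 / (α * μ) := by ring
        rw [e]
        linarith

end Coefficients


/-! ### Gaussian laws in product coordinates -/

section Laws

variable {ι : Type}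

theorem map_stdG_option :
    (stdG (Option ι)).map (fun x => (x none, fun l => x (some l)))
      = (gaussianReal 0 1).prod (stdG ι) := by
  classical
  let f : (Option ι → ℝ) → ℝ × (ι → ℝ) := fun x => (x none, fun l => x (some l))
  let g : ℝ × (ι → ℝ) → Option ι → ℝ := fun p o => o.elim p.1 p.2
  have hf : Measurable f :=
    (measurable_pi_apply _).prodMk (measurable_pi_lambda _ fun l => measurable_pi_apply _)
  have hg : Measurable g := by
    refine measurable_pi_lambda _ fun o => ?_
    rcases o with _ | l
    · exact measurable_fst
    · exact (measurable_pi_apply l).comp measurable_snd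
  have key : ((gaussianReal 0 1).prod (stdG ι)).map g = stdG (Option ι) := by
    refine Measure.eq_infinitePi _ fun s t ht => ?_
    rw [Measure.map_apply hg (.pi s.countable_toSet fun _ _ => ht _)]
    have e : g ⁻¹' (s : Set (Option ι)).pi t
        = (if none ∈ s then t none else univ) ×ˢ
          (s.eraseNone : Set ι).pi fun l => t (some l) := by
      ext p
      simp only [mem_preimage, Set.mem_pi, SetLike.mem_coe, Set.mem_prod, Finset.mem_eraseNone]
      constructor
      · intro hp
        refine ⟨?_, fun l hl => hp (some l) hl⟩
        split_ifs with hs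
        · exact hp none hs
        · trivial
      · rintro ⟨h1, h2⟩ (_ | l) ho
        · rw [if_pos ho] at h1
          exact h1
        · exact h2 l ho
    rw [e, Measure.prod_prod, stdG, Measure.infinitePi_pi _ fun l _ => ht _]
    by_cases hs : none ∈ s
    · rw [if_pos hs, ← Finset.mul_prod_erase s _ hs, ← Finset.map_some_eraseNone, Finset.prod_map]
      rfl
    · rw [if_neg hs, measure_univ, one_mul]
      conv_rhs => rw [← Finset.erase_eq_of_notMem hs, ← Finset.map_some_eraseNone, Finset.prod_map]
      rfl
  rw [← key, Measure.map_map hf hg]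
  exact Measure.map_id

theorem measurePreserving_some :
    MeasurePreserving (fun (x : Option ι → ℝ) l => x (some l)) (stdG (Option ι)) (stdG ι) := by
  refine ⟨measurable_pi_lambda _ fun l => measurable_pi_apply _, ?_⟩
  have h : (fun (x : Option ι → ℝ) l => x (some l))
      = Prod.snd ∘ fun x : Option ι → ℝ => (x none, fun l => x (some l)) := rfl
  have hm : Measurable fun x : Option ι → ℝ => (x none, fun l => x (some l)) :=
    (measurable_pi_apply _).prodMk (measurable_pi_lambda _ fun l => measurable_pi_apply _)
  rw [h, ← Measure.map_map measurable_snd hm, map_stdG_option]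
  exact measurePreserving_snd.map_eq

theorem map_gaussianReal_affine (m c : ℝ) :
    (gaussianReal 0 1).map (fun x => m + c * x) = gaussianReal m (c ^ 2).toNNReal := by
  have h : (fun x : ℝ => m + c * x) = (fun x => m + x) ∘ fun x => c * x := rfl
  rw [h, ← Measure.map_map (by fun_prop) (by fun_prop), gaussianReal_map_const_mul,
    gaussianReal_map_const_add]
  congr 1
  · ring
  · rw [mul_one]
    ext
    rw [Real.coe_toNNReal _ (sq_nonneg c)]
    rfl

theorem map_stdG_affine (m₀ c₀ : ℝ) (m c : ι → ℝ) :
    (stdG (Option ι)).map (fun x => (m₀ + c₀ * x none, fun l => m l + c l * x (some l)))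
      = (gaussianReal m₀ (c₀ ^ 2).toNNReal).prod
        (Measure.infinitePi fun l => gaussianReal (m l) (c l ^ 2).toNNReal) := by
  have h1 : Measurable fun x : ℝ => m₀ + c₀ * x := by fun_prop
  have h2 : Measurable fun (x : ι → ℝ) l => m l + c l * x l :=
    measurable_pi_lambda _ fun l => ((measurable_pi_apply l).const_mul _).const_add _
  have e : (Measure.infinitePi fun l => gaussianReal (m l) (c l ^ 2).toNNReal)
      = (stdG ι).map fun x l => m l + c l * x l := by
    rw [stdG, Measure.infinitePi_map_pi _ (f := fun l x => m l + c l * x) fun l => by fun_prop]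
    simp only [map_gaussianReal_affine]
  rw [e, ← map_gaussianReal_affine, Measure.map_prod_map _ _ h1 h2, ← map_stdG_option,
    Measure.map_map (h1.prodMap h2) ((measurable_pi_apply _).prodMk
    (measurable_pi_lambda _ fun l => measurable_pi_apply _))]
  rfl

theorem eLpNorm_one_eval_le (i : ι) : eLpNorm (fun x : ι → ℝ => x i) 1 (stdG ι) ≤ 1 := by
  refine (eLpNorm_le_eLpNorm_of_exponent_le (q := 2) (by norm_num)
    (measurable_pi_apply i).aestronglyMeasurable).trans ?_
  have := eLpNorm_two_le_of_integral_sq_le (memLp_eval i (by simp)) (integral_eval_sq i).le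
  simpa using this

theorem ae_summable_mul_eval {κ : Type} [Countable κ] {A : κ → ℝ} (hA : Summable fun k => |A k|)
    (i : κ → ι) : ∀ᵐ x ∂stdG ι, Summable fun k => |A k * x (i k)| := by
  refine ae_summable_of_eLpNorm_le (fun k => (measurable_pi_apply _).const_mul _) hA fun k => ?_
  have h1 := eLpNorm_const_smul (A k) (fun x : ι → ℝ => x (i k)) 1 (stdG ι)
  calc eLpNorm (fun x : ι → ℝ => A k * x (i k)) 1 (stdG ι)
      = ‖A k‖ₑ * eLpNorm (fun x : ι → ℝ => x (i k)) 1 (stdG ι) := h1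
    _ ≤ ‖A k‖ₑ * 1 := by gcongr; exact eLpNorm_one_eval_le _
    _ = ENNReal.ofReal |A k| := by rw [mul_one, Real.enorm_eq_ofReal_abs]

end Laws

/-! ### The double Wiener integral of the nonlinear term -/

section Chaos

variable {α μ : ℝ} {φ : ℝ × ℝ → ℝ}

/-- The double Wiener integral of a symmetric kernel, given by its coefficients in an orthonormal
basis. -/
def chaos {ι : Type} (A : ι → ι → ℝ) : (ι → ℝ) → ℝ :=
  Classical.epsilon fun n => TendstoL2 (stdG ι) atTop (quadForm A) n

theorem tendstoL2_chaos {ι : Type} {A : ι → ι → ℝ} (h0 : ∀ a, A a a = 0) {R : ℝ}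
    (hR : ∀ s : Finset (ι × ι), ∑ p ∈ s, A p.1 p.2 ^ 2 ≤ R) :
    TendstoL2 (stdG ι) atTop (quadForm A) (chaos A) :=
  Classical.epsilon_spec (exists_tendstoL2_quadForm h0 hR)

theorem eLpNorm_chaos_le {ι : Type} {A : ι → ι → ℝ} (h0 : ∀ a, A a a = 0) {R : ℝ}
    (hR : ∀ s : Finset (ι × ι), ∑ p ∈ s, A p.1 p.2 ^ 2 ≤ R) :
    eLpNorm (chaos A) 2 (stdG ι) ≤ ENNReal.ofReal (Real.sqrt ((2 + fourthMoment) * R)) :=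
  (tendstoL2_chaos h0 hR).eLpNorm_le (Eventually.of_forall (eLpNorm_quadForm_le_of_sum_le h0 hR))

theorem chaosCoeff_self (hφ : IsTest φ) (l : Mode) : chaosCoeff α μ φ l l = 0 := by
  rw [chaosCoeff, kernel_self hφ, zero_mul]

theorem exists_sum_chaosCoeff_sub_sq_le (hα : 0 < α) (hμ : 0 < μ) : ∃ C : ℝ, 0 ≤ C ∧
    ∀ φ, IsTest φ → ∀ (M : Finset Mode) (t : Finset (Mode × Mode)),
      ∑ p ∈ t, (chaosCoeff α μ φ p.1 p.2
        - ∑ m ∈ M, fourier φ m * chaosCoeff α μ (basisFn m) p.1 p.2) ^ 2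
      ≤ C * (∑' m, lam m ^ 4 * fourier φ m ^ 2 - ∑ m ∈ M, lam m ^ 4 * fourier φ m ^ 2) := by
  obtain ⟨C, hC0, hC⟩ := exists_sum_kernel_sub_sq_le
  refine ⟨(1 / α * (1 / α)) * C, by positivity, fun φ hφ M t => ?_⟩
  have h1 : ∀ p ∈ t, (chaosCoeff α μ φ p.1 p.2
        - ∑ m ∈ M, fourier φ m * chaosCoeff α μ (basisFn m) p.1 p.2) ^ 2
      ≤ (1 / α * (1 / α)) * (kernel φ p.1 p.2
        - ∑ m ∈ M, fourier φ m * kernel (basisFn m) p.1 p.2) ^ 2 := by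
    intro p _
    have e : chaosCoeff α μ φ p.1 p.2
        - ∑ m ∈ M, fourier φ m * chaosCoeff α μ (basisFn m) p.1 p.2
        = (kernel φ p.1 p.2 - ∑ m ∈ M, fourier φ m * kernel (basisFn m) p.1 p.2)
          * (sd α μ p.1 * sd α μ p.2) := by
      simp only [chaosCoeff, sub_mul, Finset.sum_mul, mul_assoc]
    rw [e, mul_pow, mul_pow, sd_sq hα hμ, sd_sq hα hμ, mul_comm]
    refine mul_le_mul_of_nonneg_right ?_ (sq_nonneg _)
    exact mul_le_mul (modeVar_le hα hμ _) (modeVar_le hα hμ _) (modeVar_pos hα hμ _).le (by positivity)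
  refine (Finset.sum_le_sum h1).trans ?_
  rw [← Finset.mul_sum]
  exact (mul_le_mul_of_nonneg_left (hC φ hφ M t) (by positivity)).trans_eq (by ring)

theorem exists_sum_chaosCoeff_le (hα : 0 < α) (hμ : 0 < μ) (hφ : IsTest φ) :
    ∃ R : ℝ, ∀ t : Finset (Mode × Mode), ∑ p ∈ t, chaosCoeff α μ φ p.1 p.2 ^ 2 ≤ R := by
  obtain ⟨C, _, hC⟩ := exists_sum_chaosCoeff_sub_sq_le hα hμ
  exact ⟨_, fun t => by simpa using hC φ hφ ∅ t⟩

theorem tendstoL2_chaosCoeff (hα : 0 < α) (hμ : 0 < μ) (hφ : IsTest φ) :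
    TendstoL2 (stdG Mode) atTop (quadForm (chaosCoeff α μ φ)) (chaos (chaosCoeff α μ φ)) := by
  obtain ⟨R, hR⟩ := exists_sum_chaosCoeff_le hα hμ hφ
  exact tendstoL2_chaos (chaosCoeff_self hφ) hR

theorem exists_eLpNorm_chaos_basisFn_le (hα : 0 < α) (hμ : 0 < μ) : ∃ C : ℝ, 0 ≤ C ∧
    ∀ m, eLpNorm (chaos (chaosCoeff α μ (basisFn m))) 2 (stdG Mode)
      ≤ ENNReal.ofReal (C * lam m ^ 2) := by
  obtain ⟨C, hC0, hC⟩ := exists_sum_chaosCoeff_sq_le hα hμ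
  refine ⟨Real.sqrt ((2 + fourthMoment) * C), Real.sqrt_nonneg _, fun m => ?_⟩
  refine (eLpNorm_chaos_le (chaosCoeff_self (isTest_basisFn m)) (hC m)).trans_eq ?_
  have h := fourthMoment_nonneg
  rw [← mul_assoc, Real.sqrt_mul (by positivity), show lam m ^ 4 = (lam m ^ 2) ^ 2 by ring,
    Real.sqrt_sq (sq_nonneg _)]

theorem quadForm_sub_sum {ι κ : Type} (A : ι → ι → ℝ) (B : κ → ι → ι → ℝ) (c : κ → ℝ)
    (M : Finset κ) (s : Finset ι) (x : ι → ℝ) :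
    quadForm (fun a b => A a b - ∑ m ∈ M, c m * B m a b) s x
      = quadForm A s x + -1 * ∑ m ∈ M, c m * quadForm (B m) s x := by
  have h : ∑ m ∈ M, c m * quadForm (B m) s x
      = ∑ a ∈ s, ∑ b ∈ s, (∑ m ∈ M, c m * B m a b) * (x a * x b) := by
    simp only [quadForm, Finset.mul_sum, Finset.sum_mul]
    rw [Finset.sum_comm]
    refine Finset.sum_congr rfl fun a _ => ?_
    rw [Finset.sum_comm]
    exact Finset.sum_congr rfl fun b _ => Finset.sum_congr rfl fun m _ => by ring
  rw [h, neg_one_mul, ← sub_eq_add_neg]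
  simp only [quadForm, ← Finset.sum_sub_distrib, sub_mul]

/-- The double Wiener integral of `H_φ` is the superposition of those of the `H_{b_m}`. -/
theorem tendstoL2_sum_chaos (hα : 0 < α) (hμ : 0 < μ) (hφ : IsTest φ) :
    TendstoL2 (stdG Mode) atTop
      (fun (M : Finset Mode) x => ∑ m ∈ M, fourier φ m * chaos (chaosCoeff α μ (basisFn m)) x)
      (chaos (chaosCoeff α μ φ)) := by
  obtain ⟨C, hC0, hC⟩ := exists_sum_chaosCoeff_sub_sq_le hα hμ
  have hn := tendstoL2_chaosCoeff hα hμ hφ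
  have hm := fun m => tendstoL2_chaosCoeff hα hμ (isTest_basisFn m)
  set D : Finset Mode → ℝ := fun M =>
    ∑' m, lam m ^ 4 * fourier φ m ^ 2 - ∑ m ∈ M, lam m ^ 4 * fourier φ m ^ 2 with hD
  refine TendstoL2.of_le (fun M => Finset.measurable_sum _ fun m _ => (hm m).meas.const_mul _)
    hn.meas (u := fun M => ENNReal.ofReal (Real.sqrt ((2 + fourthMoment) * (C * D M)))) ?_
    (Eventually.of_forall fun M => ?_)
  · have hs : HasSum (fun m => lam m ^ 4 * fourier φ m ^ 2) (∑' m, lam m ^ 4 * fourier φ m ^ 2) :=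
      (hφ.summable_fourier_sq 4).hasSum
    have hs' : Tendsto (fun M : Finset Mode => ∑ m ∈ M, lam m ^ 4 * fourier φ m ^ 2) atTop
      (𝓝 (∑' m, lam m ^ 4 * fourier φ m ^ 2)) := hs
    have h1 : Tendsto D atTop (𝓝 0) := by
      rw [← sub_self (∑' m, lam m ^ 4 * fourier φ m ^ 2)]
      exact hs'.const_sub _
    have h2 := ((h1.const_mul C).const_mul (2 + fourthMoment)).sqrt
    simpa using ENNReal.tendsto_ofReal h2
  -- The difference of the integrals is itself the limit of quadratic forms with zero diagonal, so
  -- its norm is governed by the tail estimate for the kernels.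
  · have hA := hn.add ((TendstoL2.finset_sum M fun m => (hm m).const_mul (fourier φ m)).const_mul (-1))
    have hle := hA.eLpNorm_le (C := ENNReal.ofReal (Real.sqrt ((2 + fourthMoment) * (C * D M))))
      (Eventually.of_forall fun s => by
        have := eLpNorm_quadForm_le_of_sum_le (A := fun a b => chaosCoeff α μ φ a b
          - ∑ m ∈ M, fourier φ m * chaosCoeff α μ (basisFn m) a b) (fun a => by
            simp [chaosCoeff_self hφ, chaosCoeff_self (isTest_basisFn _)]) (hC φ hφ M) s
        simpa only [funext (quadForm_sub_sum _ _ _ M s)] using this)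
    refine le_trans (le_of_eq ?_) hle
    rw [← eLpNorm_neg]
    congr 1
    ext x
    simp only [Pi.neg_apply, Pi.sub_apply]
    ring

/-- The norms of the summands are of order |m|⁴ |φ̂_m| and summable, so the series converges
absolutely almost surely, and its sum has to be the L² limit. -/
theorem ae_hasSum_chaos (hα : 0 < α) (hμ : 0 < μ) (hφ : IsTest φ) : ∀ᵐ x ∂stdG Mode,
    HasSum (fun m => fourier φ m * chaos (chaosCoeff α μ (basisFn m)) x)
      (chaos (chaosCoeff α μ φ) x) := by
  obtain ⟨C, hC0, hC⟩ := exists_eLpNorm_chaos_basisFn_le hα hμ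
  have hm := fun m => (tendstoL2_chaosCoeff hα hμ (isTest_basisFn m)).meas
  have hsum : Summable fun m => C * (lam m ^ 2 * |fourier φ m|) := (hφ.summable_fourier 2).mul_left C
  have hs : ∀ᵐ x ∂stdG Mode,
      Summable fun m => |fourier φ m * chaos (chaosCoeff α μ (basisFn m)) x| := by
    refine ae_summable_of_eLpNorm_le (fun m => (hm m).const_mul _) hsum fun m => ?_
    refine (eLpNorm_le_eLpNorm_of_exponent_le (q := 2) (by norm_num)
      ((hm m).const_mul _).aestronglyMeasurable).trans ?_
    refine (eLpNorm_const_smul (fourier φ m) (chaos (chaosCoeff α μ (basisFn m))) 2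
      (stdG Mode)).trans_le ?_
    rw [Real.enorm_eq_ofReal_abs, mul_comm]
    refine (mul_le_mul_left (hC m) _).trans_eq ?_
    rw [← ENNReal.ofReal_mul (by have := lam_pos m; positivity)]
    congr 1
    ring
  filter_upwards [(tendstoL2_sum_chaos hα hμ hφ).ae_eq_tsum hs, hs] with x hx hxs
  rw [hx]
  exact (summable_abs_iff.1 hxs).hasSum

end Chaos


/-! ### Fourier modes of the affine term -/

section Affine

variable {β μ U : ℝ} {h φ : ℝ × ℝ → ℝ} {c : Mode → ℝ}

/-- The pairing of the affine term with the basis function `b_m`. -/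
def affineMode (β μ : ℝ) (h : ℝ × ℝ → ℝ) (U : ℝ) (c : Mode → ℝ) (m : Mode) : ℝ :=
  -(U - β / μ) * (m.1 * c (conj m)) - μ * U * (m.1 * resCoeff μ h (conj m))
    - ∑' l, c l * resMatrix μ h l m + μ * ∑' l, invLap c l * resMatrix μ h l m
    - β * (m.1 * invLap c (conj m))

theorem hasSum_conj {f : Mode → ℝ} {a : ℝ} (hf : HasSum f a) : HasSum (fun l => f (conj l)) a :=
  (Equiv.hasSum_iff (Function.Involutive.toPerm conj conj_conj)).2 hf

theorem hasSum_pair_dx (hφ : IsTest φ) (hc : Summable fun l => |c l| * |fourier (dx φ) l|) :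
    HasSum (fun m => fourier φ m * (m.1 * c (conj m))) (pair c (dx φ)) := by
  have h1 : Summable fun l => c l * fourier (dx φ) l :=
    summable_abs_iff.1 (by simpa only [abs_mul] using hc)
  refine HasSum.of_eq (hasSum_conj h1.hasSum) (fun m => ?_) rfl
  rw [hφ.fourier_dx, conj_conj]
  simp only [conj, Int.cast_neg]
  ring

/-- One absolutely convergent double series, summed by rows to give the pairing and by columns to
give its expansion in the modes of φ. -/
theorem hasSum_pair_jac (hh : IsTopography h) (hμ : 0 < μ) (hφ : IsTest φ)
    (hc : Summable fun p : Mode × Mode => |c p.1| * (|fourier φ p.2| * |resMatrix μ h p.1 p.2|)) :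
    Pairable c (jac (resolvent μ h) φ) ∧
    HasSum (fun m => fourier φ m * ∑' l, c l * resMatrix μ h l m)
      (pair c (jac (resolvent μ h) φ)) := by
  have hF : Summable fun p : Mode × Mode => c p.1 * (fourier φ p.2 * resMatrix μ h p.1 p.2) :=
    summable_abs_iff.1 (by simpa only [abs_mul] using hc)
  have h1 : HasSum (fun l => c l * fourier (jac (resolvent μ h) φ) l)
      (∑' p : Mode × Mode, c p.1 * (fourier φ p.2 * resMatrix μ h p.1 p.2)) :=
    hF.hasSum.prod_fiberwise fun l => (hh.hasSum_fourier_jac_resolvent hμ hφ l).mul_left (c l)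
  have hF' := (Equiv.prodComm Mode Mode).hasSum_iff.2 hF.hasSum
  have h2 : HasSum (fun m => fourier φ m * ∑' l, c l * resMatrix μ h l m)
      (∑' p : Mode × Mode, c p.1 * (fourier φ p.2 * resMatrix μ h p.1 p.2)) := by
    refine hF'.prod_fiberwise fun m => ?_
    have := (hF'.summable.prod_factor m).hasSum
    refine HasSum.of_eq this (fun l => rfl) ?_
    rw [← tsum_mul_left]
    refine tsum_congr fun l => ?_
    simp only [Function.comp_apply, Equiv.prodComm_apply, Prod.swap_prod_mk]
    ring
  refine ⟨h1.summable, ?_⟩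
  rwa [pair, h1.tsum_eq]

theorem abs_invLap_le (l : Mode) : |invLap c l| ≤ |c l| := by
  rw [invLap, abs_div, abs_neg, abs_of_pos (lam_pos l)]
  exact div_le_self (abs_nonneg _) (one_le_lam l)

theorem hasSum_affineMode (hh : IsTopography h) (hμ : 0 < μ) (hφ : IsTest φ)
    (hc : Summable fun l => |c l| * |fourier (dx φ) l|)
    (hc' : Summable fun p : Mode × Mode => |c p.1| * (|fourier φ p.2| * |resMatrix μ h p.1 p.2|)) :
    HasSum (fun m => fourier φ m * affineMode β μ h U c m) (affinePair β μ h U c φ) := by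
  have hi : Summable fun l => |invLap c l| * |fourier (dx φ) l| :=
    hc.of_nonneg_of_le (fun l => by positivity) fun l =>
      mul_le_mul_of_nonneg_right (abs_invLap_le l) (abs_nonneg _)
  have hi' : Summable fun p : Mode × Mode =>
      |invLap c p.1| * (|fourier φ p.2| * |resMatrix μ h p.1 p.2|) :=
    hc'.of_nonneg_of_le (fun l => by positivity) fun l =>
      mul_le_mul_of_nonneg_right (abs_invLap_le _) (by positivity)
  have h1 := (hasSum_pair_dx hφ hc).mul_left (-(U - β / μ))
  have h2 := (hasSum_conj (hh.hasSum_resolvent_dx hμ hφ)).mul_left (μ * U)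
  have h3 := (hasSum_pair_jac hh hμ hφ hc').2
  have h4 := (hasSum_pair_jac hh hμ hφ hi').2.mul_left μ
  have h5 := (hasSum_pair_dx hφ hi).mul_left β
  refine HasSum.of_eq ((((h1.sub h2).sub h3).add h4).sub h5) (fun m => ?_) rfl
  simp only [affineMode, conj_conj]
  simp only [conj, Int.cast_neg]
  ring

end Affine

/-! ### The limit of the truncated drifts -/

section Drift

variable {α β μ : ℝ} {h φ : ℝ × ℝ → ℝ}

/-- The mean flow in the normalised coordinates. -/
def flowVel (α μ : ℝ) (x : Option Mode → ℝ) : ℝ := (Real.sqrt (α * μ))⁻¹ * x none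

/-- The Fourier coefficients of the vorticity in the normalised coordinates. -/
def flowCoeff (α μ : ℝ) (x : Option Mode → ℝ) (l : Mode) : ℝ := sd α μ l * x (some l)

/-- The coordinates of the vorticity. -/
def vortCoord (x : Option Mode → ℝ) (l : Mode) : ℝ := x (some l)

theorem sd_le (hα : 0 < α) (hμ : 0 < μ) (l : Mode) : sd α μ l ≤ Real.sqrt (1 / α) :=
  Real.sqrt_le_sqrt (modeVar_le hα hμ l)

theorem ae_summable_flowCoeff {κ : Type} [Countable κ] (hα : 0 < α) (hμ : 0 < μ) {A : κ → ℝ}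
    (hA : Summable fun k => |A k|) (i : κ → Mode) :
    ∀ᵐ x ∂stdG (Option Mode), Summable fun k => |flowCoeff α μ x (i k)| * |A k| := by
  have h1 : Summable fun k => |A k * sd α μ (i k)| := by
    refine (hA.mul_right (Real.sqrt (1 / α))).of_nonneg_of_le (fun k => abs_nonneg _) fun k => ?_
    rw [abs_mul, abs_of_pos (sd_pos hα hμ _)]
    exact mul_le_mul_of_nonneg_left (sd_le hα hμ _) (abs_nonneg _)
  filter_upwards [ae_summable_mul_eval h1 fun k => some (i k)] with x hx
  refine hx.congr fun k => ?_
  rw [flowCoeff, ← abs_mul]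
  congr 1
  ring

theorem IsTest.summable_abs_fourier (hφ : IsTest φ) : Summable fun l => |fourier φ l| := by
  simpa using hφ.summable_fourier 0

theorem ae_summable_flowCoeff_dx (hα : 0 < α) (hμ : 0 < μ) (hφ : IsTest φ) :
    ∀ᵐ x ∂stdG (Option Mode), Summable fun l => |flowCoeff α μ x l| * |fourier (dx φ) l| :=
  ae_summable_flowCoeff hα hμ hφ.isTest_dx.summable_abs_fourier id

theorem ae_summable_flowCoeff_jac (hα : 0 < α) (hμ : 0 < μ) (hh : IsTopography h) (hφ : IsTest φ) :
    ∀ᵐ x ∂stdG (Option Mode), Summable fun p : Mode × Mode =>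
      |flowCoeff α μ x p.1| * (|fourier φ p.2| * |resMatrix μ h p.1 p.2|) := by
  have := ae_summable_flowCoeff (A := fun p : Mode × Mode => fourier φ p.2 * resMatrix μ h p.1 p.2)
    hα hμ (by simpa only [abs_mul] using hh.summable_abs_fourier_jac hμ hφ) Prod.fst
  simpa only [abs_mul] using this

theorem IsTopography.summable_resMatrix_col (hh : IsTopography h) (hμ : 0 < μ) (m : Mode) :
    Summable fun l => |resMatrix μ h l m| := by
  obtain ⟨C, _, hC⟩ := hh.exists_sum_resMatrix_le hμ
  exact summable_of_sum_le (fun l => abs_nonneg _) (hC m)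

theorem IsTopography.summable_stress (hh : IsTopography h) :
    Summable fun l => |fourier (dx (oddExt h)) l / lam l| := by
  refine ((hh.isBddTorus_dx.summable_fourier_sq).add summable_inv_lam_sq).of_nonneg_of_le
    (fun l => abs_nonneg _) fun l => ?_
  have h1 := lam_pos l
  rw [abs_div, abs_of_pos h1, div_eq_mul_inv]
  have h2 : 0 ≤ (lam l)⁻¹ := by positivity
  have h3 : (lam l)⁻¹ ^ 2 = (lam l ^ 2)⁻¹ := inv_pow _ _
  have h4 := two_mul_le_add_sq |fourier (dx (oddExt h)) l| (lam l)⁻¹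
  rw [sq_abs] at h4
  have h5 : 0 ≤ |fourier (dx (oddExt h)) l| * (lam l)⁻¹ := by positivity
  linarith

theorem ae_pairable_stress (hα : 0 < α) (hμ : 0 < μ) (hh : IsTopography h) :
    ∀ᵐ x ∂stdG (Option Mode), Pairable (invLap (flowCoeff α μ x)) (dx (oddExt h)) := by
  filter_upwards [ae_summable_flowCoeff hα hμ hh.summable_stress id] with x hx
  refine summable_abs_iff.1 (hx.congr fun l => ?_)
  rw [invLap, ← abs_mul, ← abs_neg]
  congr 1
  simp only [id]
  ring

/-- Finite sets that contain `none` are cofinal, so the limit of the drifts can be computed along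
them. -/
theorem tendsto_insertNone {ι : Type} :
    Tendsto (fun s : Finset ι => Finset.insertNone s) atTop atTop := by
  classical
  refine (OrderHomClass.mono Finset.insertNone).tendsto_atTop_atTop fun s => ⟨s.eraseNone, ?_⟩
  rw [Finset.insertNone_eraseNone]
  exact Finset.subset_insert _ _

theorem drift_none_insertNone (s : Finset Mode) (x : Option Mode → ℝ) :
    drift (linRate α β μ h) (quadRate α μ) (Finset.insertNone s) none x
      = ∑ l ∈ s, stressCoeff α μ h l * x (some l) := by
  simp [drift, rate, quadRate, linRate, Finset.sum_insertNone]

/-- As soon as `conj m` belongs to s, the two halves of the symmetrised coupling with the mean flow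
recombine into one complete term. The rest separates into a linear form and the truncated double
integral. -/
theorem drift_some_insertNone (hα : 0 < α) (hμ : 0 < μ) {s : Finset Mode} {m : Mode}
    (hm : conj m ∈ s) (x : Option Mode → ℝ) :
    drift (linRate α β μ h) (quadRate α μ) (Finset.insertNone s) (some m) x
      = -stressCoeff α μ h m * x none
        + linForm (fun l => linRate α β μ h (some m) (some l)) s (vortCoord x)
        + m.1 / Real.sqrt (α * μ) * (x none * x (some (conj m)))
        + -(sd α μ m)⁻¹ * quadForm (chaosCoeff α μ (basisFn m)) s (vortCoord x) := by
  classical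
  rw [drift_eq, linForm, Finset.sum_insertNone, quadForm, Finset.sum_insertNone]
  simp only [Finset.sum_insertNone, Finset.sum_add_distrib]
  have e1 : ∀ j : Option Mode, (quadRate α μ (some m) none j + quadRate α μ (some m) j none) / 2
      = if j = some (conj m) then m.1 / Real.sqrt (α * μ) / 2 else 0 := fun j => by
    rw [add_comm, quadRate_none_symm]
  simp only [e1, quadRate_none_symm, quadRate_symm hα hμ, reduceCtorEq, if_false, Option.some.injEq,
    ite_mul, zero_mul, Finset.sum_ite_eq', if_pos hm, zero_add]
  have e2 : ∑ l ∈ s, ∑ l' ∈ s, -(sd α μ m)⁻¹ * chaosCoeff α μ (basisFn m) l l'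
      * (x (some l) * x (some l'))
      = -(sd α μ m)⁻¹ * quadForm (chaosCoeff α μ (basisFn m)) s (vortCoord x) := by
    simp only [quadForm, Finset.mul_sum, vortCoord, mul_assoc]
  rw [e2]
  simp only [linForm, linRate, vortCoord]
  ring

theorem measurePreserving_vortCoord :
    MeasurePreserving vortCoord (stdG (Option Mode)) (stdG Mode) := measurePreserving_some

theorem measurable_vortCoord : Measurable vortCoord := measurePreserving_vortCoord.measurable

theorem exists_sum_linRate_some_le (hα : 0 < α) (hμ : 0 < μ) (hh : IsTopography h) (m : Mode) :
    ∃ S : ℝ, ∀ s : Finset Mode, ∑ l ∈ s, linRate α β μ h (some m) (some l) ^ 2 ≤ S := by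
  obtain ⟨C, _, hC⟩ := exists_sum_linRate_sq_le (β := β) hα hμ hh
  refine ⟨_, fun s => le_trans (le_of_eq ?_) (hC (some m) (s.map Function.Embedding.some))⟩
  rw [Finset.sum_map]
  rfl

/-- The identity (1 + μ/|l|²) σ_l = 1/(α σ_l): transport of ω by ∇^⊥G and transport of μG by
∇^⊥Δ⁻¹ω, neither antisymmetric alone in normalised coordinates, add up to one antisymmetric matrix.
-/
theorem linRate_some_eq (hα : 0 < α) (hμ : 0 < μ) (l m : Mode) (y : Mode → ℝ) :
    sd α μ m * (linRate α β μ h (some m) (some l) * y l)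
      = (sd α μ l * y l) * resMatrix μ h l m - μ * (invLap (fun l => sd α μ l * y l) l * resMatrix μ h l m)
        + if l = conj m then -β * m.1 * (1 / μ + 1 / lam m) * (sd α μ m * y (conj m)) else 0 := by
  have h1 := inv_modeVar hα hμ l
  rw [← sd_sq hα hμ] at h1
  have p1 := sd_pos hα hμ l
  have p2 := sd_pos hα hμ m
  have p3 := lam_pos l
  have h2 : (1 + μ / lam l) * sd α μ l = 1 / (α * sd α μ l) := by
    field_simp at h1 ⊢
    nlinarith
  have e : sd α μ m * (resMatrix μ h l m / (α * sd α μ l * sd α μ m) * y l)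
      = (sd α μ l * y l) * resMatrix μ h l m
        - μ * (invLap (fun l => sd α μ l * y l) l * resMatrix μ h l m) := by
    have e3 : (sd α μ l * y l) * resMatrix μ h l m
        - μ * (invLap (fun l => sd α μ l * y l) l * resMatrix μ h l m)
        = ((1 + μ / lam l) * sd α μ l) * y l * resMatrix μ h l m := by
      rw [invLap]
      ring
    rw [e3, h2]
    field_simp
  simp only [linRate]
  rw [← e]
  split_ifs with hl
  · rw [hl]
    ring
  · ring

/-- The vorticity components of the limiting drift. -/
theorem ae_drift_some (hα : 0 < α) (hμ : 0 < μ) (hh : IsTopography h) (m : Mode)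
    {b : (Option Mode → ℝ) → ℝ} (hb : TendstoL2 (stdG (Option Mode)) atTop
      (fun s => drift (linRate α β μ h) (quadRate α μ) s (some m)) b) :
    ∀ᵐ x ∂stdG (Option Mode), sd α μ m * b x
      = -chaos (chaosCoeff α μ (basisFn m)) (vortCoord x)
        - affineMode β μ h (flowVel α μ x) (flowCoeff α μ x) m := by
  classical
  obtain ⟨S, hS⟩ := exists_sum_linRate_some_le (β := β) hα hμ hh m
  obtain ⟨f, hf⟩ := exists_tendstoL2_linForm hS
  have hn := tendstoL2_chaosCoeff hα hμ (isTest_basisFn m)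
  have hmv := measurePreserving_vortCoord
  have hx0 : Measurable fun x : Option Mode → ℝ => -stressCoeff α μ h m * x none :=
    (measurable_pi_apply _).const_mul _
  have hx1 : Measurable fun x : Option Mode → ℝ =>
      m.1 / Real.sqrt (α * μ) * (x none * x (some (conj m))) :=
    ((measurable_pi_apply none).mul (measurable_pi_apply (some (conj m)))).const_mul _
  have hg := (((tendstoL2_const (P := stdG (Option Mode)) (l := atTop) hx0).add (hf.comp hmv)).add
    (tendstoL2_const hx1)).add ((hn.comp hmv).const_mul (-(sd α μ m)⁻¹))
  have hb' := (hb.comp_index tendsto_insertNone).ae_eq (hg.congr (fun s => hb.meas_left _) (by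
    filter_upwards [eventually_ge_atTop {conj m}] with s hs x
    exact drift_some_insertNone hα hμ (hs (Finset.mem_singleton_self _)) x))
  have hlin : ∀ᵐ x ∂stdG (Option Mode), Summable fun l => |flowCoeff α μ x l| * |resMatrix μ h l m| :=
    ae_summable_flowCoeff hα hμ (hh.summable_resMatrix_col hμ m) id
  have hf' := hf.comp hmv
  obtain ⟨u, hu, hlim⟩ := hf'.exists_seq_ae
  filter_upwards [hb', hlin, hlim] with x hx hxs hxl
  have s1 : Summable fun l => flowCoeff α μ x l * resMatrix μ h l m :=
    summable_abs_iff.1 (by simpa only [abs_mul] using hxs)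
  have s2 : Summable fun l => invLap (flowCoeff α μ x) l * resMatrix μ h l m := by
    refine summable_abs_iff.1 (hxs.of_nonneg_of_le (fun _ => abs_nonneg _) fun l => ?_)
    rw [abs_mul]
    exact mul_le_mul_of_nonneg_right (abs_invLap_le l) (abs_nonneg _)
  have h3 := (s1.hasSum.sub (s2.hasSum.mul_left μ)).add (hasSum_ite_eq (conj m)
    (-β * m.1 * (1 / μ + 1 / lam m) * (sd α μ m * x (some (conj m)))))
  have h4 : Tendsto (fun n => sd α μ m * linForm (fun l => linRate α β μ h (some m) (some l)) (u n)
      (vortCoord x)) atTop (𝓝 (∑' l, flowCoeff α μ x l * resMatrix μ h l m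
        - μ * ∑' l, invLap (flowCoeff α μ x) l * resMatrix μ h l m
        + -β * m.1 * (1 / μ + 1 / lam m) * (sd α μ m * x (some (conj m))))) := by
    refine (h3.comp hu).congr fun n => ?_
    rw [linForm, Finset.mul_sum]
    exact Finset.sum_congr rfl fun l _ => (linRate_some_eq hα hμ l m (vortCoord x)).symm
  have h5 := tendsto_nhds_unique (hxl.const_mul (sd α μ m)) h4
  have hsd := sd_pos hα hμ m
  have hl := lam_pos m
  have hw : 0 < Real.sqrt (α * μ) := Real.sqrt_pos.2 (by positivity)
  have hw2 := Real.sq_sqrt (by positivity : 0 ≤ α * μ)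
  -- The term μU∂ₓG is the transpose of the topographic stress: the variance σ_m² = |m|²/(α(μ +
  -- |m|²)) converts ĥ/|m|² into the coefficients of G.
  have hstress : sd α μ m * stressCoeff α μ h m * x none
      = -(μ * flowVel α μ x * (m.1 * resCoeff μ h (conj m))) := by
    have e : sd α μ m * stressCoeff α μ h m
        = Real.sqrt (α * μ) * (sd α μ m ^ 2) * fourier (dx (oddExt h)) m / lam m := by
      rw [stressCoeff]
      ring
    rw [e, sd_sq hα hμ, hh.fourier_dx, modeVar, resCoeff, flowVel, lam_conj]
    have : (0 : ℝ) < μ + lam m := by linarith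
    field_simp
    rw [hw2]
  rw [hx]
  have e6 : ∀ y z w v : ℝ, sd α μ m * (y + z + w + -(sd α μ m)⁻¹ * v)
      = sd α μ m * y + sd α μ m * z + sd α μ m * w - v := fun y z w v => by
    field_simp
    ring
  rw [e6, h5, affineMode]
  have e7 : sd α μ m * (-stressCoeff α μ h m * x none)
      = μ * flowVel α μ x * (m.1 * resCoeff μ h (conj m)) := by linarith
  rw [e7]
  have e8 : flowCoeff α μ x (conj m) = sd α μ m * x (some (conj m)) := by rw [flowCoeff, sd_conj]
  -- The factor 1/μ + 1/|m|² of β collects the mean velocity −β/μ in U − β/μ and the Rossby term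
  -- β∂ₓΔ⁻¹ω.
  simp only [invLap, lam_conj, e8, flowVel]
  field_simp
  ring

/-- The mean flow component of the limiting drift. -/
theorem ae_drift_none (hα : 0 < α) (hμ : 0 < μ) (hh : IsTopography h)
    {b : (Option Mode → ℝ) → ℝ} (hb : TendstoL2 (stdG (Option Mode)) atTop
      (fun s => drift (linRate α β μ h) (quadRate α μ) s none) b) :
    ∀ᵐ x ∂stdG (Option Mode), (Real.sqrt (α * μ))⁻¹ * b x = stress μ h (flowCoeff α μ x) := by
  have hw : 0 < Real.sqrt (α * μ) := Real.sqrt_pos.2 (by positivity)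
  obtain ⟨u, hu, hlim⟩ := (hb.comp_index tendsto_insertNone).exists_seq_ae
  filter_upwards [hlim, ae_pairable_stress hα hμ hh] with x hx hxs
  have h1 := (hxs.hasSum.neg).comp hu
  have h2 := tendsto_nhds_unique (hx.const_mul (Real.sqrt (α * μ))⁻¹) (h1.congr fun n => by
    rw [drift_none_insertNone]
    simp only [Function.comp_apply, Finset.mul_sum]
    refine Finset.sum_congr rfl fun l _ => ?_
    rw [invLap, stressCoeff, flowCoeff]
    field_simp)
  rw [h2, stress, hh.stress_const hμ, add_zero, pair]

/-- The limiting drift in the weak formulation. -/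
theorem ae_hasSum_drift (hα : 0 < α) (hμ : 0 < μ) (hh : IsTopography h) (hφ : IsTest φ)
    {b : Mode → (Option Mode → ℝ) → ℝ} (hb : ∀ m, TendstoL2 (stdG (Option Mode)) atTop
      (fun s => drift (linRate α β μ h) (quadRate α μ) s (some m)) (b m)) :
    ∀ᵐ x ∂stdG (Option Mode), HasSum (fun m => fourier φ m * (sd α μ m * b m x))
      (-chaos (chaosCoeff α μ φ) (vortCoord x)
        - affinePair β μ h (flowVel α μ x) (flowCoeff α μ x) φ) := by
  have h1 := ae_all_iff.2 fun m => ae_drift_some hα hμ hh m (hb m)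
  have h2 := measurePreserving_vortCoord.quasiMeasurePreserving.ae (ae_hasSum_chaos hα hμ hφ)
  filter_upwards [h1, h2, ae_summable_flowCoeff_dx hα hμ hφ,
    ae_summable_flowCoeff_jac hα hμ hh hφ] with x hx1 hx2 hx3 hx4
  refine HasSum.of_eq (hx2.neg.sub (hasSum_affineMode hh hμ hφ hx3 hx4)) (fun m => ?_) rfl
  rw [hx1]
  ring

theorem ae_pairable_jac (hα : 0 < α) (hμ : 0 < μ) (hh : IsTopography h) (hφ : IsTest φ) :
    ∀ᵐ x ∂stdG (Option Mode), Pairable (flowCoeff α μ x) (jac (resolvent μ h) φ) := by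
  filter_upwards [ae_summable_flowCoeff_jac hα hμ hh hφ] with x hx
  exact (hasSum_pair_jac hh hμ hφ hx).1

end Drift


/-! ### Approximations of the nonlinear term -/

section Approx

variable {α μ δ : ℝ} {φ : ℝ × ℝ → ℝ}

theorem summable_kernel_sq (hφ : IsTest φ) : Summable fun p : Mode × Mode => kernel φ p.1 p.2 ^ 2 := by
  obtain ⟨C, _, hC⟩ := exists_sum_kernel_sub_sq_le
  exact summable_of_sum_le (fun _ => sq_nonneg _) fun t => by simpa using hC φ hφ ∅ t

theorem chaosCoeff_sq (hα : 0 < α) (hμ : 0 < μ) (p : Mode × Mode) :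
    chaosCoeff α μ φ p.1 p.2 ^ 2 = kernel φ p.1 p.2 ^ 2 * modeVar α μ p.1 * modeVar α μ p.2 := by
  rw [chaosCoeff, mul_pow, mul_pow, sd_sq hα hμ, sd_sq hα hμ, mul_assoc]

theorem summable_chaosCoeff_sq (hα : 0 < α) (hμ : 0 < μ) (hφ : IsTest φ) :
    Summable fun p : Mode × Mode => chaosCoeff α μ φ p.1 p.2 ^ 2 := by
  obtain ⟨R, hR⟩ := exists_sum_chaosCoeff_le hα hμ hφ
  exact summable_of_sum_le (fun _ => sq_nonneg _) hR

/-- The kernel `H_φ` is approximated by its truncations, all of which have trace zero. -/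
theorem exists_isApprox (hα : 0 < α) (hμ : 0 < μ) (hφ : IsTest φ) :
    ∃ Hn, IsApprox α μ δ (kernel φ) Hn := by
  classical
  obtain ⟨u, hu⟩ := exists_seq_tendsto (atTop : Filter (Finset Mode))
  refine ⟨fun n l l' => if l ∈ u n ∧ l' ∈ u n then kernel φ l l' else 0, ?_, fun n => ?_, ?_, ?_, ?_⟩
  · simpa [MemSobolev₂] using summable_kernel_sq hφ
  · refine summable_of_ne_finset_zero (s := u n ×ˢ u n) fun p hp => ?_
    simp only [if_neg fun h => hp (Finset.mem_product.2 h)]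
    simp
  · intro n l l'
    rw [kernel_symm φ l l']
    simp only [and_comm]
  · simp [kernel_self hφ]
  · have hs := summable_chaosCoeff_sq hα hμ hφ
    have hpair : Tendsto (fun n => (u n, u n)) atTop atTop := by
      rw [← prod_atTop_atTop_eq]
      exact hu.prodMk hu
    have hprod : Tendsto (fun n => u n ×ˢ u n) atTop atTop :=
      (tendsto_finsetProd_atTop (ι := Mode) (ι' := Mode)).comp hpair
    have h1 : Tendsto (fun n => ∑ p ∈ u n ×ˢ u n, chaosCoeff α μ φ p.1 p.2 ^ 2) atTop
        (𝓝 (∑' p : Mode × Mode, chaosCoeff α μ φ p.1 p.2 ^ 2)) := hs.hasSum.comp hprod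
    have h2 := h1.const_sub (∑' p : Mode × Mode, chaosCoeff α μ φ p.1 p.2 ^ 2)
    rw [sub_self] at h2
    refine h2.congr fun n => ?_
    have h3 : HasSum (fun p : Mode × Mode => if p ∈ u n ×ˢ u n then chaosCoeff α μ φ p.1 p.2 ^ 2 else 0)
        (∑ p ∈ u n ×ˢ u n, chaosCoeff α μ φ p.1 p.2 ^ 2) := by
      have : HasSum (fun p : Mode × Mode =>
          if p ∈ u n ×ˢ u n then chaosCoeff α μ φ p.1 p.2 ^ 2 else 0)
          (∑ p ∈ u n ×ˢ u n, if p ∈ u n ×ˢ u n then chaosCoeff α μ φ p.1 p.2 ^ 2 else 0) :=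
        hasSum_sum_of_ne_finset_zero fun p hp => if_neg hp
      exact HasSum.of_eq this (fun _ => rfl) (Finset.sum_congr rfl fun p hp => (if_pos hp).symm)
    refine ((hs.hasSum.sub h3).tsum_eq.symm.trans (tsum_congr fun p => ?_))
    simp only [Finset.mem_product, chaosCoeff_sq hα hμ]
    split_ifs <;> ring

/-- Cauchy–Schwarz against (|l| |l'|)^(−2−2δ), which is summable over pairs of modes. This is why 2
+ 2δ is the right regularity for the series in `tensorPair` to converge absolutely almost surely. -/
theorem summable_abs_of_memSobolev₂ (hδ : 0 < δ) {H : Mode → Mode → ℝ}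
    (hH : MemSobolev₂ (2 + 2 * δ) H) : Summable fun p : Mode × Mode => |H p.1 p.2| := by
  have h0 := summable_lam_rpow (s := 1 + δ) (by linarith)
  have h1 : Summable fun p : Mode × Mode => lam p.1 ^ (-(1 + δ)) * lam p.2 ^ (-(1 + δ)) :=
    h0.mul_of_nonneg h0 (fun l => (Real.rpow_pos_of_pos (lam_pos l) _).le)
      fun l => (Real.rpow_pos_of_pos (lam_pos l) _).le
  refine (hH.add h1).of_nonneg_of_le (fun _ => abs_nonneg _) fun p => ?_
  have l1 := lam_pos p.1
  have l2 := lam_pos p.2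
  set A := lam p.1 ^ (1 + δ)
  set B := lam p.2 ^ (1 + δ)
  have hA : 0 < A := Real.rpow_pos_of_pos l1 _
  have hB : 0 < B := Real.rpow_pos_of_pos l2 _
  have e1 : lam p.1 ^ (-(1 + δ)) * lam p.2 ^ (-(1 + δ)) = (A * B)⁻¹ := by
    rw [Real.rpow_neg l1.le, Real.rpow_neg l2.le, mul_inv]
  have e2 : A * B ≤ (lam p.1 + lam p.2) ^ (2 + 2 * δ) := by
    have e3 : (lam p.1 + lam p.2) ^ (2 + 2 * δ)
        = (lam p.1 + lam p.2) ^ (1 + δ) * (lam p.1 + lam p.2) ^ (1 + δ) := by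
      rw [← Real.rpow_add (by linarith)]
      congr 1
      ring
    rw [e3]
    exact mul_le_mul (Real.rpow_le_rpow l1.le (by linarith) (by linarith))
      (Real.rpow_le_rpow l2.le (by linarith) (by linarith)) hB.le (by positivity)
  rw [e1]
  set y := |H p.1 p.2|
  have hy : H p.1 p.2 ^ 2 = y ^ 2 := (sq_abs _).symm
  rw [hy]
  have hy0 : 0 ≤ y := abs_nonneg _
  have hAB : 0 < A * B := mul_pos hA hB
  have h3 : y ≤ A * B * y ^ 2 + (A * B)⁻¹ := by
    have h4 : 0 ≤ (A * B * y - 1) ^ 2 := sq_nonneg _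
    have h5 : A * B * y ^ 2 + (A * B)⁻¹ - y = ((A * B * y) ^ 2 + 1 - A * B * y) / (A * B) := by
      field_simp
    have h6 : 0 ≤ ((A * B * y) ^ 2 + 1 - A * B * y) / (A * B) := by
      apply div_nonneg _ hAB.le
      nlinarith [sq_nonneg (A * B * y)]
    linarith
  calc y ≤ A * B * y ^ 2 + (A * B)⁻¹ := h3
    _ ≤ _ := by gcongr

theorem eLpNorm_one_mul_eval_le {ι : Type} (a b : ι) :
    eLpNorm (fun x : ι → ℝ => x a * x b) 1 (stdG ι) ≤ 1 := by
  have h : ∀ i : ι, eLpNorm (fun x : ι → ℝ => x i) 2 (stdG ι) ≤ 1 := fun i => by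
    simpa using eLpNorm_two_le_of_integral_sq_le (memLp_eval i (by simp)) (integral_eval_sq i).le
  have h1 := eLpNorm_smul_le_mul_eLpNorm (p := 2) (q := 2) (r := 1) (μ := stdG ι)
    (f := fun x : ι → ℝ => x b) (φ := fun x : ι → ℝ => x a)
    (measurable_pi_apply b).aestronglyMeasurable (measurable_pi_apply a).aestronglyMeasurable
  exact h1.trans (by simpa using mul_le_mul' (h a) (h b))

theorem tensorPair_flowCoeff (H : Mode → Mode → ℝ) (x : Option Mode → ℝ) :
    tensorPair (flowCoeff α μ x) H = ∑' p : Mode × Mode,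
      H p.1 p.2 * (sd α μ p.1 * sd α μ p.2) * (vortCoord x p.1 * vortCoord x p.2) := by
  refine tsum_congr fun p => ?_
  simp only [flowCoeff, vortCoord]
  ring

/-- Along every approximation of `H_φ` the quadratic forms converge to the double Wiener integral. -/
theorem IsApprox.tendsto_chaos (hα : 0 < α) (hμ : 0 < μ) (hδ : 0 < δ) (hφ : IsTest φ)
    {Hn : ℕ → Mode → Mode → ℝ} (hH : IsApprox α μ δ (kernel φ) Hn) :
    Tendsto (fun n => eLpNorm (fun x => tensorPair (flowCoeff α μ x) (Hn n)
      - chaos (chaosCoeff α μ φ) (vortCoord x)) 2 (stdG (Option Mode))) atTop (𝓝 0) := by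
  have hn := tendstoL2_chaosCoeff hα hμ hφ
  set A : ℕ → Mode → Mode → ℝ := fun n l l' => Hn n l l' * (sd α μ l * sd α μ l') with hA
  have hsd2 : ∀ l l', |sd α μ l * sd α μ l'| ≤ 1 / α := fun l l' => by
    rw [abs_of_pos (mul_pos (sd_pos hα hμ _) (sd_pos hα hμ _))]
    calc _ ≤ Real.sqrt (1 / α) * Real.sqrt (1 / α) :=
          mul_le_mul (sd_le hα hμ l) (sd_le hα hμ l') (sd_pos hα hμ _).le (Real.sqrt_nonneg _)
      _ = 1 / α := Real.mul_self_sqrt (by positivity)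
  have hsum : ∀ n, Summable fun p : Mode × Mode => |A n p.1 p.2| := fun n => by
    refine ((summable_abs_of_memSobolev₂ hδ (hH.mem n)).mul_right (1 / α)).of_nonneg_of_le
      (fun _ => abs_nonneg _) fun p => ?_
    rw [hA, abs_mul]
    exact mul_le_mul_of_nonneg_left (hsd2 _ _) (abs_nonneg _)
  have hAsq : ∀ n, Summable fun p : Mode × Mode => A n p.1 p.2 ^ 2 := fun n => by
    have h1 := (hsum n).mul_of_nonneg (hsum n) (fun _ => abs_nonneg _) fun _ => abs_nonneg _
    have h2 := h1.comp_injective (i := fun p : Mode × Mode => (p, p)) fun p q hpq => by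
      simpa using hpq
    refine h2.congr fun p => ?_
    simp only [Function.comp_apply]
    rw [← sq, sq_abs]
  have hdiff : ∀ n, Summable fun p : Mode × Mode => (A n p.1 p.2 - chaosCoeff α μ φ p.1 p.2) ^ 2 :=
    fun n => by
      refine (((hAsq n).add (summable_chaosCoeff_sq hα hμ hφ)).mul_left 2).of_nonneg_of_le
        (fun _ => sq_nonneg _) fun p => ?_
      nlinarith [sq_nonneg (A n p.1 p.2 + chaosCoeff α μ φ p.1 p.2)]
  have htr : ∀ n, HasSum (fun l => A n l l) (∑' l, Hn n l l * modeVar α μ l) := fun n => by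
    have h1 : Summable fun l => A n l l := summable_abs_iff.1
      ((hsum n).comp_injective (i := fun l : Mode => (l, l)) fun p q hpq => by simpa using hpq)
    refine HasSum.of_eq h1.hasSum (fun _ => rfl) (tsum_congr fun l => ?_)
    rw [hA, ← sd_sq hα hμ, sq]
  have hD : ∀ n, HasSum (fun p : Mode × Mode => (A n p.1 p.2 - chaosCoeff α μ φ p.1 p.2) ^ 2)
      (∑' p : Mode × Mode,
        (Hn n p.1 p.2 - kernel φ p.1 p.2) ^ 2 * modeVar α μ p.1 * modeVar α μ p.2) := fun n => by
    refine HasSum.of_eq (hdiff n).hasSum (fun _ => rfl) (tsum_congr fun p => ?_)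
    rw [hA, chaosCoeff, ← sd_sq hα hμ, ← sd_sq hα hμ]
    ring
  have hae : ∀ n, ∀ᵐ x ∂stdG Mode, Summable fun p : Mode × Mode => A n p.1 p.2 * (x p.1 * x p.2) :=
    fun n => by
      have h1 : ∀ᵐ x ∂stdG Mode, Summable fun p : Mode × Mode => |A n p.1 p.2 * (x p.1 * x p.2)| := by
        refine ae_summable_of_eLpNorm_le
          (fun p => ((measurable_pi_apply p.1).mul (measurable_pi_apply p.2)).const_mul _)
          (hsum n) fun p => ?_
        refine (eLpNorm_const_smul (A n p.1 p.2) (fun x : Mode → ℝ => x p.1 * x p.2) 1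
          (stdG Mode)).trans_le ?_
        rw [← Real.enorm_eq_ofReal_abs]
        exact mul_le_of_le_one_right zero_le (eLpNorm_one_mul_eval_le p.1 p.2)
      filter_upwards [h1] with x hx using summable_abs_iff.1 hx
  -- The two quantities assumed to vanish in `IsApprox`, the weighted trace and the weighted
  -- ℓ²-distance, are exactly those that bound this norm.
  have hle := fun n => eLpNorm_tsum_sub_le hn (chaosCoeff_self hφ) (htr n) (hD n) (hae n)
  have hlim := ENNReal.tendsto_ofReal
    (((hH.trace.pow 2).add (hH.conv.const_mul (2 + fourthMoment))).sqrt)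
  simp only [ne_eq, OfNat.ofNat_ne_zero, not_false_eq_true, zero_pow, mul_zero, add_zero,
    Real.sqrt_zero, ENNReal.ofReal_zero] at hlim
  refine tendsto_of_tendsto_of_tendsto_of_le_of_le tendsto_const_nhds hlim (fun _ => zero_le)
    fun n => ?_
  refine le_trans (le_of_eq ?_) (hle n)
  have hm : Measurable fun x : Mode → ℝ => (∑' p : Mode × Mode, A n p.1 p.2 * (x p.1 * x p.2))
      - chaos (chaosCoeff α μ φ) x :=
    (Measurable.tsum fun p =>
      ((measurable_pi_apply p.1).mul (measurable_pi_apply p.2)).const_mul _).sub hn.meas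
  rw [← eLpNorm_comp_measurePreserving hm.aestronglyMeasurable measurePreserving_vortCoord]
  congr 1
  ext x
  rw [tensorPair_flowCoeff]
  rfl

end Approx


/-! ### Distributions from their Fourier coefficients -/

section Reconstruction

variable {s : ℝ}

theorem coeff_add (u v : OddSobolev s) (l : Mode) : coeff (u + v) l = coeff u l + coeff v l :=
  mul_add _ _ _

theorem coeff_sub (u v : OddSobolev s) (l : Mode) : coeff (u - v) l = coeff u l - coeff v l :=
  mul_sub _ _ _

theorem coeff_zero (l : Mode) : coeff (0 : OddSobolev s) l = 0 := mul_zero _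

/-- An element of ℓ² is the limit of its finite sections, which are continuous functions of finitely
many coordinates. -/
theorem measurable_lp_of_eval {Ω : Type} [MeasurableSpace Ω]
    [MeasurableSpace (lp (fun _ : Mode => ℝ) 2)] [BorelSpace (lp (fun _ : Mode => ℝ) 2)]
    {f : Ω → lp (fun _ : Mode => ℝ) 2} (h : ∀ l, Measurable fun w => f w l) : Measurable f := by
  classical
  refine measurable_of_tendsto_metrizable' (atTop : Filter (Finset Mode))
    (f := fun F w => ∑ l ∈ F, lp.single 2 l (f w l)) (fun F => ?_)
    (tendsto_pi_nhds.2 fun w => lp.hasSum_single (by norm_num) (f w))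
  have hc : Continuous fun c : Mode → ℝ =>
      ∑ l ∈ F, (lp.single 2 l (c l) : lp (fun _ : Mode => ℝ) 2) :=
    continuous_finsetSum _ fun l _ => (lp.isometry_single l).continuous.comp (continuous_apply l)
  exact hc.measurable.comp (measurable_pi_lambda _ h)

theorem measurable_of_measurable_coeff {Ω : Type} [MeasurableSpace Ω] {f : Ω → OddSobolev s}
    (h : ∀ l, Measurable fun w => coeff (f w) l) : Measurable f := by
  let _ : MeasurableSpace (lp (fun _ : Mode => ℝ) 2) := borel _
  have : BorelSpace (lp (fun _ : Mode => ℝ) 2) := ⟨rfl⟩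
  refine measurable_lp_of_eval (f := f) fun l => ?_
  have e : (fun w => (show lp (fun _ : Mode => ℝ) 2 from f w) l)
      = fun w => lam l ^ (s / 2) * coeff (f w) l := by
    ext w
    rw [coeff, ← mul_assoc, ← Real.rpow_add (lam_pos l)]
    simp
  exact e ▸ (h l).const_mul _

open Classical in
/-- The element of `𝓗^s` with given Fourier coefficients, or zero if there is none. -/
def recon (s : ℝ) (c : Mode → ℝ) : OddSobolev s :=
  if h : Summable fun l => lam l ^ s * c l ^ 2 then (exists_coeff_eq c h).choose else 0

theorem coeff_recon {c : Mode → ℝ} (hc : Summable fun l => lam l ^ s * c l ^ 2) :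
    coeff (recon s c) = c := by
  rw [recon, dif_pos hc]
  exact (exists_coeff_eq c hc).choose_spec

theorem measurableSet_summable_coeff :
    MeasurableSet {c : Mode → ℝ | Summable fun l => lam l ^ s * c l ^ 2} := by
  have h0 : ∀ (c : Mode → ℝ) l, 0 ≤ lam l ^ s * c l ^ 2 := fun c l =>
    mul_nonneg (Real.rpow_nonneg (lam_pos l).le _) (sq_nonneg _)
  have e : {c : Mode → ℝ | Summable fun l => lam l ^ s * c l ^ 2}
      = {c | ∑' l, ENNReal.ofReal (lam l ^ s * c l ^ 2) < ∞} := by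
    ext c
    refine ⟨fun h => h.tsum_ofReal_lt_top, fun h => ?_⟩
    refine (ENNReal.summable_toReal (ne_of_lt h)).congr fun l => ?_
    rw [ENNReal.toReal_ofReal (h0 c l)]
  rw [e]
  refine measurableSet_lt (Measurable.tsum fun l => ?_) measurable_const
  exact (((measurable_pi_apply l).pow_const 2).const_mul _).ennreal_ofReal

theorem measurable_recon : Measurable (recon s) := by
  classical
  refine measurable_of_measurable_coeff fun l => ?_
  have e : (fun c => coeff (recon s c) l)
      = fun c => if c ∈ {c : Mode → ℝ | Summable fun l => lam l ^ s * c l ^ 2} then c l else 0 := by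
    ext c
    split_ifs with hc
    · rw [coeff_recon hc]
    · rw [recon, dif_neg (by simpa using hc), coeff_zero]
  rw [e]
  exact Measurable.ite measurableSet_summable_coeff (measurable_pi_apply l) measurable_const

/-- A path in `𝓗^s` is continuous if its coefficients are, and are square summable uniformly in
time. -/
theorem continuous_of_continuous_coeff {u : ℝ → OddSobolev s}
    (hc : ∀ l, Continuous fun t => coeff (u t) l) {B : Mode → ℝ}
    (hB : Summable fun l => lam l ^ s * B l ^ 2) (hu : ∀ t l, |coeff (u t) l| ≤ B l) :
    Continuous u := by
  refine continuous_iff_continuousAt.2 fun t₀ => ?_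
  rw [ContinuousAt, tendsto_iff_norm_sub_tendsto_zero]
  have h1 : Tendsto (fun t => ‖u t - u t₀‖ ^ 2) (𝓝 t₀) (𝓝 0) := by
    have e : ∀ t, ‖u t - u t₀‖ ^ 2 = ∑' l, lam l ^ s * coeff (u t - u t₀) l ^ 2 := fun t =>
      (hasSum_norm_sq _).tsum_eq.symm
    simp only [e, coeff_sub]
    have h2 := tendsto_tsum_of_dominated_convergence (𝓕 := 𝓝 t₀)
      (f := fun t l => lam l ^ s * (coeff (u t) l - coeff (u t₀) l) ^ 2) (g := fun _ => 0)
      (hB.mul_left 4) (fun l => ?_) (Eventually.of_forall fun t l => ?_)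
    · simpa using h2
    · have h3 : Continuous fun t => lam l ^ s * (coeff (u t) l - coeff (u t₀) l) ^ 2 :=
        continuous_const.mul (((hc l).sub continuous_const).pow 2)
      simpa using h3.tendsto t₀
    · have hl := Real.rpow_pos_of_pos (lam_pos l) s
      rw [Real.norm_eq_abs, abs_of_nonneg (by positivity)]
      have h4 : |coeff (u t) l - coeff (u t₀) l| ≤ 2 * B l := by
        have := abs_sub (coeff (u t) l) (coeff (u t₀) l)
        have := hu t l
        have := hu t₀ l
        linarith
      have h5 : (coeff (u t) l - coeff (u t₀) l) ^ 2 ≤ (2 * B l) ^ 2 := by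
        rw [← sq_abs]
        exact pow_le_pow_left₀ (abs_nonneg _) h4 2
      calc _ ≤ lam l ^ s * (2 * B l) ^ 2 := by gcongr
        _ = _ := by ring
  have h6 := h1.sqrt
  simpa [Real.sqrt_sq] using h6

theorem summable_mul_fourier {φ : ℝ × ℝ → ℝ} (hφ : IsTest φ) {B : Mode → ℝ}
    (hB : Summable fun l => lam l ^ s * B l ^ 2) : Summable fun l => |B l * fourier φ l| := by
  obtain ⟨n, hn⟩ := exists_nat_ge (-s)
  refine (hB.add (hφ.summable_fourier_sq n)).of_nonneg_of_le (fun _ => abs_nonneg _) fun l => ?_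
  have hl := lam_pos l
  set A := lam l ^ s with hA
  have hA0 : 0 < A := Real.rpow_pos_of_pos hl s
  have h1 : A⁻¹ ≤ lam l ^ n := by
    rw [hA, ← Real.rpow_neg hl.le, ← Real.rpow_natCast]
    exact Real.rpow_le_rpow_of_exponent_le (one_le_lam l) hn
  have h2 : 1 ≤ A * lam l ^ n := by
    have := mul_le_mul_of_nonneg_left h1 hA0.le
    rwa [mul_inv_cancel₀ hA0.ne'] at this
  have hL : 0 < lam l ^ n := by positivity
  rw [abs_mul, ← sq_abs (B l), ← sq_abs (fourier φ l)]
  set x := |B l|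
  set y := |fourier φ l|
  have hx : 0 ≤ x := abs_nonneg _
  have hy : 0 ≤ y := abs_nonneg _
  have h3 : y ^ 2 * A⁻¹ ≤ lam l ^ n * y ^ 2 := by
    rw [mul_comm]
    gcongr
  have h4 : x * y ≤ A * x ^ 2 + y ^ 2 * A⁻¹ := by
    have e : A * x ^ 2 + y ^ 2 * A⁻¹ - x * y = ((A * x - y) ^ 2 + A * x * y) / A := by
      field_simp
      ring
    have : 0 ≤ ((A * x - y) ^ 2 + A * x * y) / A := by positivity
    linarith
  linarith

end Reconstruction


/-! ### The stationary flow -/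

section Flow

/-- A stationary solution of `dx/dt = b(x)` with Gaussian marginals, whose trajectories are square
summable with the weights `|l|^{2r}`. -/
structure IsFlow {Ω : Type} [MeasurableSpace Ω] (T r : ℝ) (b : Option Mode → (Option Mode → ℝ) → ℝ)
    (P : Measure Ω) (X : ℝ → Ω → Option Mode → ℝ) : Prop where
  measurable : Measurable fun p : ℝ × Ω => X p.1 p.2
  continuous : ∀ w i, Continuous fun t => X t w i
  map_eq : ∀ t, P.map (X t) = stdG (Option Mode)
  stationary : ∀ (n : ℕ) (t t' : Fin n → ℝ) (τ : ℝ), 0 ≤ τ → (∀ i, t i ∈ Icc 0 T) →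
    (∀ i, t' i ∈ Icc 0 T) → (∀ i, t' i = t i + τ) →
    IdentDistrib (fun w i => X (t i) w) (fun w i => X (t' i) w) P P
  bound : ∀ w, ∃ B : Mode → ℝ, (Summable fun l => lam l ^ r * B l ^ 2) ∧
    ∀ t l, |X t w (some l)| ≤ B l
  equation : ∀ i, ∀ᵐ w ∂P, IntervalIntegrable (fun s => b i (X s w)) volume 0 T ∧
    ∀ t ∈ Icc 0 T, X t w i - X 0 w i = ∫ s in (0 : ℝ)..t, b i (X s w)

/-- The paths with values in `𝓗^r`, uniformly in time. -/
def regularPaths (T r : ℝ) : Set (Option Mode → C(Icc (0 : ℝ) T, ℝ)) :=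
  {w | ∑' l, ENNReal.ofReal (lam l ^ r) * ‖w (some l)‖ₑ ^ 2 < ∞}

theorem measurableSet_regularPaths (T r : ℝ) : MeasurableSet (regularPaths T r) :=
  measurableSet_lt (Measurable.tsum fun l =>
    ((measurable_pi_apply (some l)).enorm.pow_const 2).const_mul _) measurable_const

/-- Either y² ≤ A, or (y²/A)ⁿ ≥ 1 and inserting this factor only helps. A second moment is traded
for a level A plus a high moment divided by Aⁿ. -/
theorem sq_le_add_pow {A y : ℝ} (hA : 0 < A) (n : ℕ) :
    y ^ 2 ≤ A + (A ^ n)⁻¹ * y ^ (2 * (n + 1)) := by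
  have h0 : 0 ≤ (A ^ n)⁻¹ * y ^ (2 * (n + 1)) :=
    mul_nonneg (by positivity) (by rw [pow_mul]; positivity)
  rcases le_total (y ^ 2) A with h | h
  · linarith
  · have h1 : A ^ n ≤ (y ^ 2) ^ n := pow_le_pow_left₀ hA.le h n
    have h2 : 1 ≤ (A ^ n)⁻¹ * (y ^ 2) ^ n := by
      rw [inv_mul_eq_div, one_le_div (by positivity)]
      exact h1
    have h3 : (A ^ n)⁻¹ * y ^ (2 * (n + 1)) = ((A ^ n)⁻¹ * (y ^ 2) ^ n) * y ^ 2 := by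
      rw [pow_mul, pow_succ]
      ring
    rw [h3]
    have := mul_le_mul_of_nonneg_right h2 (sq_nonneg y)
    linarith

/-- Polynomially bounded moments of all orders confine the paths to `𝓗^{-1-δ}`. -/
theorem ae_mem_regularPaths {T δ : ℝ} (hδ : 0 < δ) {P : Measure (Option Mode → C(Icc (0 : ℝ) T, ℝ))}
    [IsProbabilityMeasure P] {C₂ : ℝ} (hC₂ : 0 ≤ C₂)
    (hmom : ∀ p : ℕ, p ≠ 0 → ∃ C : ℝ, 0 ≤ C ∧
      ∀ l : Mode, ∫⁻ w, ‖w (some l)‖ₑ ^ p ∂P ≤ ENNReal.ofReal (C * (2 + C₂ * lam l ^ 4))) :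
    ∀ᵐ w ∂P, w ∈ regularPaths T (-1 - δ) := by
  -- The growth of the moments in l is the same for all orders, so n can be taken so large that Aⁿ =
  -- |l|^(δn) exceeds the factor |l|⁸.
  obtain ⟨n, hn⟩ := exists_nat_ge (8 / δ)
  have hn' : 4 ≤ δ / 2 * n := by
    rw [div_le_iff₀ hδ] at hn
    linarith
  obtain ⟨C, hC0, hC⟩ := hmom (2 * (n + 1)) (by positivity)
  have hme : ∀ l : Mode, Measurable fun w : Option Mode → C(Icc (0 : ℝ) T, ℝ) => ‖w (some l)‖ₑ :=
    fun l => (measurable_pi_apply (some l)).enorm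
  set D := 1 + C * (2 + C₂) with hD
  have hD0 : 0 ≤ D := by positivity
  have hterm : ∀ l : Mode, ∫⁻ w, ENNReal.ofReal (lam l ^ (-1 - δ)) * ‖w (some l)‖ₑ ^ 2 ∂P
      ≤ ENNReal.ofReal (D * lam l ^ (-(1 + δ / 2))) := by
    intro l
    have hl := lam_pos l
    have h1l := one_le_lam l
    -- Half of the surplus δ is spent on the level A; the other half keeps the series of |l|^(−2−δ)
    -- convergent.
    set A := lam l ^ (δ / 2) with hA
    have hA0 : 0 < A := Real.rpow_pos_of_pos hl _
    have hA1 : 1 ≤ A := Real.one_le_rpow h1l (by positivity)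
    have hAn : (A ^ n)⁻¹ * lam l ^ 4 ≤ 1 := by
      rw [inv_mul_eq_div, div_le_one (by positivity), hA, ← Real.rpow_natCast, ← Real.rpow_natCast,
        ← Real.rpow_mul hl.le]
      exact Real.rpow_le_rpow_of_exponent_le h1l (by exact_mod_cast hn')
    have hAn1 : (A ^ n)⁻¹ ≤ 1 := inv_le_one_of_one_le₀ (one_le_pow₀ hA1)
    have hpt : ∀ w : Option Mode → C(Icc (0 : ℝ) T, ℝ), ‖w (some l)‖ₑ ^ 2
        ≤ ENNReal.ofReal A + ENNReal.ofReal (A ^ n)⁻¹ * ‖w (some l)‖ₑ ^ (2 * (n + 1)) := fun w => by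
      have hp := pow_nonneg (norm_nonneg (w (some l))) (2 * (n + 1))
      rw [← ofReal_norm, ← ENNReal.ofReal_pow (norm_nonneg _), ← ENNReal.ofReal_pow (norm_nonneg _),
        ← ENNReal.ofReal_mul (by positivity), ← ENNReal.ofReal_add hA0.le (by positivity)]
      exact ENNReal.ofReal_le_ofReal (sq_le_add_pow hA0 n)
    calc ∫⁻ w, ENNReal.ofReal (lam l ^ (-1 - δ)) * ‖w (some l)‖ₑ ^ 2 ∂P
        = ENNReal.ofReal (lam l ^ (-1 - δ)) * ∫⁻ w, ‖w (some l)‖ₑ ^ 2 ∂P :=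
          lintegral_const_mul _ ((hme l).pow_const 2)
      _ ≤ ENNReal.ofReal (lam l ^ (-1 - δ)) * ∫⁻ w, (ENNReal.ofReal A
            + ENNReal.ofReal (A ^ n)⁻¹ * ‖w (some l)‖ₑ ^ (2 * (n + 1))) ∂P := by
          gcongr with w
          exact hpt w
      _ = ENNReal.ofReal (lam l ^ (-1 - δ)) * (ENNReal.ofReal A
            + ENNReal.ofReal (A ^ n)⁻¹ * ∫⁻ w, ‖w (some l)‖ₑ ^ (2 * (n + 1)) ∂P) := by
          rw [lintegral_add_left measurable_const, lintegral_const_mul _ ((hme l).pow_const _),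
            lintegral_const, measure_univ, mul_one]
      _ ≤ ENNReal.ofReal (lam l ^ (-1 - δ)) * (ENNReal.ofReal A
            + ENNReal.ofReal (A ^ n)⁻¹ * ENNReal.ofReal (C * (2 + C₂ * lam l ^ 4))) := by
          gcongr
          exact hC l
      _ = ENNReal.ofReal (lam l ^ (-1 - δ) * (A + (A ^ n)⁻¹ * (C * (2 + C₂ * lam l ^ 4)))) := by
          rw [← ENNReal.ofReal_mul (by positivity), ← ENNReal.ofReal_add hA0.le (by positivity),
            ← ENNReal.ofReal_mul (Real.rpow_nonneg hl.le _)]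
      _ ≤ ENNReal.ofReal (D * lam l ^ (-(1 + δ / 2))) := by
          refine ENNReal.ofReal_le_ofReal ?_
          have e1 : lam l ^ (-(1 + δ / 2)) = lam l ^ (-1 - δ) * A := by
            rw [hA, ← Real.rpow_add hl]
            congr 1
            ring
          have e2 : (A ^ n)⁻¹ * (C * (2 + C₂ * lam l ^ 4))
              = C * (2 * (A ^ n)⁻¹ + C₂ * ((A ^ n)⁻¹ * lam l ^ 4)) := by ring
          have e3 : C * (2 * (A ^ n)⁻¹ + C₂ * ((A ^ n)⁻¹ * lam l ^ 4)) ≤ C * (2 * 1 + C₂ * 1) := by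
            gcongr
          have e4 : A + (A ^ n)⁻¹ * (C * (2 + C₂ * lam l ^ 4)) ≤ D * A := by
            rw [e2]
            have : C * (2 + C₂) ≤ C * (2 + C₂) * A := le_mul_of_one_le_right (by positivity) hA1
            rw [hD]
            linarith
          rw [e1]
          calc _ ≤ lam l ^ (-1 - δ) * (D * A) :=
                mul_le_mul_of_nonneg_left e4 (Real.rpow_nonneg hl.le _)
            _ = _ := by ring
  have hsum : Summable fun l => D * lam l ^ (-(1 + δ / 2)) :=
    (summable_lam_rpow (by linarith)).mul_left D
  have hfin : ∫⁻ w, ∑' l, ENNReal.ofReal (lam l ^ (-1 - δ)) * ‖w (some l)‖ₑ ^ 2 ∂P ≠ ∞ := by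
    rw [lintegral_tsum fun l => (((hme l).pow_const 2).const_mul _).aemeasurable]
    exact ne_top_of_le_ne_top hsum.tsum_ofReal_ne_top (ENNReal.tsum_le_tsum hterm)
  exact ae_lt_top (Measurable.tsum fun l => ((hme l).pow_const 2).const_mul _) hfin

open Classical in
/-- The given path if it is regular, and the zero path otherwise. -/
def regularize (T r : ℝ) (w : Option Mode → C(Icc (0 : ℝ) T, ℝ)) : Option Mode → C(Icc (0 : ℝ) T, ℝ) :=
  if w ∈ regularPaths T r then w else 0

theorem measurable_regularize (T r : ℝ) : Measurable (regularize T r) := by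
  classical
  exact Measurable.ite (measurableSet_regularPaths T r) measurable_id measurable_const

theorem regularize_of_mem {T r : ℝ} {w : Option Mode → C(Icc (0 : ℝ) T, ℝ)}
    (hw : w ∈ regularPaths T r) : regularize T r w = w := if_pos hw

theorem regularize_bound {T r : ℝ} (w : Option Mode → C(Icc (0 : ℝ) T, ℝ)) :
    Summable fun l => lam l ^ r * ‖regularize T r w (some l)‖ ^ 2 := by
  by_cases hw : w ∈ regularPaths T r
  · rw [regularize_of_mem hw]
    refine (ENNReal.summable_toReal (ne_of_lt hw)).congr fun l => ?_
    rw [ENNReal.toReal_mul, ENNReal.toReal_ofReal (Real.rpow_nonneg (lam_pos l).le _),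
      ENNReal.toReal_pow, toReal_enorm]
  · rw [regularize, if_neg hw]
    simp

variable {a₀ : Option Mode → Option Mode → ℝ} {a : Option Mode → Option Mode → Option Mode → ℝ}

/-- Almost every path of the limit process is regular. The exceptional ones are replaced by the zero
path, so that continuity in 𝓗^{-1-δ} can be had for every sample, while laws and almost sure
equations are unaffected. -/
theorem IsRotational.exists_isFlow (h : IsRotational a₀ a) {b : Option Mode → (Option Mode → ℝ) → ℝ}
    (hb : ∀ i, TendstoL2 (stdG (Option Mode)) atTop (fun s => drift a₀ a s i) (b i))
    {K : Option Mode → ℝ} (hK0 : ∀ i, 0 ≤ K i)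
    (hK : ∀ s i, eLpNorm (drift a₀ a s i) 2 (stdG (Option Mode)) ≤ ENNReal.ofReal (K i))
    {C₂ : ℝ} (hC₂ : 0 ≤ C₂) (hKC : ∀ l, K (some l) ≤ C₂ * lam l ^ 4)
    {T δ : ℝ} (hT : 0 < T) (hδ : 0 < δ) :
    ∃ (P : Measure (Option Mode → C(Icc (0 : ℝ) T, ℝ))) (_ : IsProbabilityMeasure P)
      (X : ℝ → (Option Mode → C(Icc (0 : ℝ) T, ℝ)) → Option Mode → ℝ),
      IsFlow T (-1 - δ) b P X := by
  have hb2 : ∀ i, MemLp (b i) 2 (stdG (Option Mode)) := fun i =>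
    ⟨(hb i).meas.aestronglyMeasurable, ((hb i).eLpNorm_le
      (Eventually.of_forall fun s => hK s i)).trans_lt ENNReal.ofReal_lt_top⟩
  obtain ⟨P, hP, hmap, hstat, heq, hmom⟩ := h.exists_stationary_flow (fun i => (hb i).meas) hb2
    (fun i => (hb i).tendsto) hK0 hK hT
  have hreg : ∀ᵐ w ∂P, regularize T (-1 - δ) w = w := by
    refine (ae_mem_regularPaths hδ hC₂ fun p hp => ?_).mono fun w hw => regularize_of_mem hw
    obtain ⟨C, hC0, hC⟩ := hmom p hp
    refine ⟨C, hC0, fun l => (hC (some l)).trans (ENNReal.ofReal_le_ofReal ?_)⟩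
    have := hKC l
    gcongr
  have hmeas : ∀ t, Measurable fun w => pathAt hT.le t (regularize T (-1 - δ) w) := fun t =>
    (measurable_pathAt_right hT.le t).comp (measurable_regularize _ _)
  refine ⟨P, hP, fun t w => pathAt hT.le t (regularize T (-1 - δ) w), ?_, ?_, ?_, ?_, ?_, ?_⟩
  · exact (measurable_pathAt hT.le).comp
      (measurable_fst.prodMk ((measurable_regularize _ _).comp measurable_snd))
  · exact fun w i => (continuous_pathAt hT.le i).comp (Continuous.prodMk_right _)
  · intro t
    have e : (fun w => pathAt hT.le t (regularize T (-1 - δ) w)) =ᵐ[P] pathAt hT.le t :=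
      hreg.mono fun w hw => by simp only [hw]
    rw [Measure.map_congr e]
    exact (measurePreserving_pathAt hT.le hmap t).map_eq
  · intro n t t' τ hτ ht ht' htt
    refine ⟨(measurable_pi_lambda _ fun i => hmeas _).aemeasurable,
      (measurable_pi_lambda _ fun i => hmeas _).aemeasurable, ?_⟩
    have e : ∀ u : Fin n → ℝ, (fun w i => pathAt hT.le (u i) (regularize T (-1 - δ) w))
        =ᵐ[P] fun w i => pathAt hT.le (u i) w := fun u => hreg.mono fun w hw => by simp only [hw]
    rw [Measure.map_congr (e t), Measure.map_congr (e t')]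
    -- Stationarity was obtained for families of real coordinates; the states at n times form such a
    -- family indexed by pairs of a time and a coordinate.
    let κ := Fin n × Option Mode
    let curry : (κ → ℝ) → Fin n → Option Mode → ℝ := fun y i j => y (i, j)
    have hcurry : Measurable curry := measurable_pi_lambda _ fun i => measurable_pi_lambda _ fun j =>
      measurable_pi_apply (i, j)
    have hs := hstat κ (fun k => ⟨t k.1, ht k.1⟩) (fun k => ⟨t' k.1, ht' k.1⟩) τ Prod.snd hτ
      fun k => htt k.1
    have hk : ∀ u : κ → Icc (0 : ℝ) T,
        Measurable fun (w : Option Mode → C(Icc (0 : ℝ) T, ℝ)) (k : κ) => w k.2 (u k) := fun u =>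
      measurable_pi_lambda _ fun k =>
        (continuous_eval_const (F := C(Icc (0 : ℝ) T, ℝ)) (u k)).measurable.comp
          (measurable_pi_apply k.2)
    have hs' := congrArg (Measure.map curry) hs
    rw [Measure.map_map hcurry (hk _), Measure.map_map hcurry (hk _)] at hs'
    have e2 : ∀ (u : Fin n → ℝ) (hu : ∀ i, u i ∈ Icc 0 T),
        (fun w i => pathAt hT.le (u i) w : (Option Mode → C(Icc (0 : ℝ) T, ℝ)) → _)
          = curry ∘ fun w k => w k.2 ⟨u k.1, hu k.1⟩ := fun u hu => by
      ext w i j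
      simp only [pathAt, projIcc_of_mem hT.le (hu i), Function.comp_apply, curry]
    rw [e2 t ht, e2 t' ht']
    exact hs'.symm
  · exact fun w => ⟨_, regularize_bound w, fun t l => (regularize T (-1 - δ) w (some l)).norm_coe_le_norm _⟩
  · intro i
    filter_upwards [heq i, hreg] with w hw hw'
    simpa only [hw'] using hw

end Flow


/-! ### Time integrals along the stationary flow -/

section TimeIntegrals

variable {Ω : Type} [MeasurableSpace Ω] {T r : ℝ} {b : Option Mode → (Option Mode → ℝ) → ℝ}
  {P : Measure Ω} {X : ℝ → Ω → Option Mode → ℝ}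

theorem IsFlow.measurable_right (hX : IsFlow T r b P X) (t : ℝ) : Measurable (X t) :=
  hX.measurable.comp measurable_prodMk_left

variable [IsProbabilityMeasure P]

/-- Fubini, as the law is the same at every time. Null sets, integrability and norms in time and
probability thereby reduce to `stdG`. -/
theorem IsFlow.map_prod (hX : IsFlow T r b P X) :
    ((volume.restrict (Icc 0 T)).prod P).map (fun p => X p.1 p.2)
      = ENNReal.ofReal T • stdG (Option Mode) := by
  ext A hA
  rw [Measure.map_apply hX.measurable hA, Measure.prod_apply (hX.measurable hA)]
  have e : ∀ s, P (Prod.mk s ⁻¹' ((fun p : ℝ × Ω => X p.1 p.2) ⁻¹' A)) = stdG (Option Mode) A :=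
    fun s => by
      rw [← hX.map_eq s, Measure.map_apply (hX.measurable_right s) hA]
      rfl
  simp only [e, lintegral_const, Measure.restrict_apply_univ, Real.volume_Icc, sub_zero,
    Measure.smul_apply, smul_eq_mul]
  exact mul_comm _ _

theorem IsFlow.ae_prod (hX : IsFlow T r b P X) {p : (Option Mode → ℝ) → Prop}
    (h : ∀ᵐ x ∂stdG (Option Mode), p x) :
    ∀ᵐ q ∂(volume.restrict (Icc 0 T)).prod P, p (X q.1 q.2) := by
  refine ae_of_ae_map hX.measurable.aemeasurable ?_
  rw [hX.map_prod]
  exact Measure.ae_smul_measure h _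

theorem IsFlow.ae_ae (hX : IsFlow T r b P X) {p : (Option Mode → ℝ) → Prop}
    (h : ∀ᵐ x ∂stdG (Option Mode), p x) :
    ∀ᵐ w ∂P, ∀ᵐ s ∂volume.restrict (Icc 0 T), p (X s w) :=
  Measure.ae_ae_of_ae_prod (Measure.measurePreserving_swap.quasiMeasurePreserving.ae (hX.ae_prod h))

theorem IsFlow.ae_lintegral_ne_top (hX : IsFlow T r b P X) {f : (Option Mode → ℝ) → ℝ≥0∞}
    (hf : Measurable f) (hf1 : ∫⁻ x, f x ∂stdG (Option Mode) ≠ ∞) :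
    ∀ᵐ w ∂P, ∫⁻ s in Icc 0 T, f (X s w) ≠ ∞ := by
  have hm : Measurable fun p : ℝ × Ω => f (X p.1 p.2) := hf.comp hX.measurable
  have h1 : ∫⁻ w, (∫⁻ s in Icc 0 T, f (X s w)) ∂P ≠ ∞ := by
    rw [← lintegral_prod_symm _ hm.aemeasurable, ← lintegral_map hf hX.measurable, hX.map_prod,
      lintegral_smul_measure]
    exact ENNReal.mul_ne_top ENNReal.ofReal_ne_top hf1
  exact (ae_lt_top hm.lintegral_prod_left' h1).mono fun w hw => hw.ne

theorem IsFlow.ae_intervalIntegrable (hX : IsFlow T r b P X) (hT : 0 ≤ T)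
    {f : (Option Mode → ℝ) → ℝ} (hf : Measurable f) (hf1 : Integrable f (stdG (Option Mode))) :
    ∀ᵐ w ∂P, IntervalIntegrable (fun s => f (X s w)) volume 0 T := by
  filter_upwards [hX.ae_lintegral_ne_top hf.enorm hf1.2.ne] with w hw
  rw [intervalIntegrable_iff_integrableOn_Icc_of_le hT]
  exact ⟨(hf.comp (hX.measurable.comp measurable_prodMk_right)).aestronglyMeasurable, hw.lt_top⟩

theorem IsFlow.eLpNorm_prod (hX : IsFlow T r b P X) {f : (Option Mode → ℝ) → ℝ}
    (hf : Measurable f) :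
    eLpNorm (fun p : ℝ × Ω => f (X p.1 p.2)) 2 ((volume.restrict (Icc 0 T)).prod P)
      = ENNReal.ofReal T ^ (1 / 2 : ℝ≥0∞).toReal * eLpNorm f 2 (stdG (Option Mode)) := by
  have h := eLpNorm_map_measure (p := 2) (μ := (volume.restrict (Icc 0 T)).prod P)
    (f := fun p : ℝ × Ω => X p.1 p.2) (g := f) hf.aestronglyMeasurable hX.measurable.aemeasurable
  rw [hX.map_prod, eLpNorm_smul_measure_of_ne_top (by norm_num)] at h
  exact h.symm

end TimeIntegrals

/-! ### The weak vorticity formulation -/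

section WeakSolution

variable {Ω : Type} [MeasurableSpace Ω] {P : Measure Ω}
  {α β μ δ T : ℝ} {h : ℝ × ℝ → ℝ} {b : Option Mode → (Option Mode → ℝ) → ℝ}
  {X : ℝ → Ω → Option Mode → ℝ}

theorem summable_flowCoeff (hα : 0 < α) (hμ : 0 < μ) {s : ℝ} {x : Option Mode → ℝ} {B : Mode → ℝ}
    (hB : Summable fun l => lam l ^ s * B l ^ 2) (hx : ∀ l, |x (some l)| ≤ B l) :
    Summable fun l => lam l ^ s * flowCoeff α μ x l ^ 2 := by
  refine (hB.mul_left (1 / α)).of_nonneg_of_le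
    (fun l => mul_nonneg (Real.rpow_nonneg (lam_pos l).le _) (sq_nonneg _)) fun l => ?_
  have hl := Real.rpow_pos_of_pos (lam_pos l) s
  have h1 : x (some l) ^ 2 ≤ B l ^ 2 := by
    rw [← sq_abs]
    exact pow_le_pow_left₀ (abs_nonneg _) (hx l) 2
  rw [flowCoeff, mul_pow, sd_sq hα hμ]
  have h2 := modeVar_le hα hμ l
  calc _ ≤ lam l ^ s * (1 / α * B l ^ 2) := by gcongr
    _ = _ := by ring

theorem IsFlow.coeff_recon (hα : 0 < α) (hμ : 0 < μ) (hX : IsFlow T (-1 - δ) b P X) (t : ℝ) (w : Ω) :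
    coeff (recon (-1 - δ) (flowCoeff α μ (X t w))) = flowCoeff α μ (X t w) := by
  obtain ⟨B, hB, hxB⟩ := hX.bound w
  exact BQG.coeff_recon (summable_flowCoeff hα hμ hB (hxB t))

variable [IsProbabilityMeasure P]

/-- The norm in L²([0,T], L²(P)) of a function of the state is √T times its Gaussian norm, so
`IsApprox.tendsto_chaos` carries over. -/
theorem IsFlow.isDiamond (hα : 0 < α) (hμ : 0 < μ) (hδ : 0 < δ) (hX : IsFlow T (-1 - δ) b P X)
    {φ : ℝ × ℝ → ℝ} (hφ : IsTest φ) :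
    IsDiamond α μ δ T P (fun t w => recon (-1 - δ) (flowCoeff α μ (X t w))) (kernel φ)
      fun s w => chaos (chaosCoeff α μ φ) (vortCoord (X s w)) := by
  have hn := tendstoL2_chaosCoeff hα hμ hφ
  have hmeas : Measurable fun x => chaos (chaosCoeff α μ φ) (vortCoord x) :=
    hn.meas.comp measurable_vortCoord
  obtain ⟨R, hR⟩ := exists_sum_chaosCoeff_le hα hμ hφ
  have hfin : eLpNorm (fun x => chaos (chaosCoeff α μ φ) (vortCoord x)) 2 (stdG (Option Mode)) ≠ ∞ :=
    by
      have e := eLpNorm_comp_measurePreserving (p := 2) hn.meas.aestronglyMeasurable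
        measurePreserving_vortCoord
      refine ne_top_of_le_ne_top ENNReal.ofReal_ne_top
        (e.trans_le (eLpNorm_chaos_le (chaosCoeff_self hφ) hR))
  have hc : ENNReal.ofReal T ^ (1 / 2 : ℝ≥0∞).toReal ≠ ∞ :=
    ENNReal.rpow_ne_top_of_nonneg ENNReal.toReal_nonneg ENNReal.ofReal_ne_top
  refine ⟨⟨(hmeas.comp hX.measurable).aestronglyMeasurable, ?_⟩, exists_isApprox hα hμ hφ,
    fun Hn hH => ?_⟩
  · rw [hX.eLpNorm_prod hmeas]
    exact (ENNReal.mul_ne_top hc hfin).lt_top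
  · have h1 := ENNReal.Tendsto.const_mul (hH.tendsto_chaos hα hμ hδ hφ)
      (a := ENNReal.ofReal T ^ (1 / 2 : ℝ≥0∞).toReal) (Or.inr hc)
    rw [mul_zero] at h1
    refine h1.congr fun n => ?_
    have hm : Measurable fun x => tensorPair (flowCoeff α μ x) (Hn n)
        - chaos (chaosCoeff α μ φ) (vortCoord x) := by
      refine Measurable.sub (Measurable.tsum fun p => ?_) hmeas
      exact (((measurable_pi_apply (some p.1)).const_mul _).mul
        ((measurable_pi_apply (some p.2)).const_mul _)).const_mul _
    rw [← hX.eLpNorm_prod hm]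
    simp only [hX.coeff_recon hα hμ]

/-- The time integrals of the modes of the equation add up. -/
theorem IsFlow.ae_tsum_integral (hα : 0 < α) (hμ : 0 < μ) (hX : IsFlow T (-1 - δ) b P X)
    (hb : ∀ i, Measurable (b i)) {C : ℝ} (hC : 0 ≤ C)
    (hbC : ∀ m, eLpNorm (b (some m)) 1 (stdG (Option Mode)) ≤ ENNReal.ofReal (C * lam m ^ 4))
    {φ : ℝ × ℝ → ℝ} (hφ : IsTest φ) :
    Integrable (fun x => ∑' m, fourier φ m * (sd α μ m * b (some m) x)) (stdG (Option Mode)) ∧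
    ∀ᵐ w ∂P, ∀ t ∈ Icc 0 T, ∫ s in (0 : ℝ)..t, ∑' m, fourier φ m * (sd α μ m * b (some m) (X s w))
      = ∑' m, fourier φ m * (sd α μ m * ∫ s in (0 : ℝ)..t, b (some m) (X s w)) := by
  set F : Mode → (Option Mode → ℝ) → ℝ := fun m x => fourier φ m * (sd α μ m * b (some m) x) with hF
  have hFm : ∀ m, Measurable (F m) := fun m => ((hb _).const_mul _).const_mul _
  -- The drift of the mode m has norm of order |m|⁸, and φ̂_m decays faster. This is what permits
  -- summation and time integration to be exchanged.
  have hsum : Summable fun m => Real.sqrt (1 / α) * C * (lam m ^ 4 * |fourier φ m|) :=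
    (hφ.summable_fourier 4).mul_left _
  have hle : ∀ m, ∫⁻ x, ‖F m x‖ₑ ∂stdG (Option Mode)
      ≤ ENNReal.ofReal (Real.sqrt (1 / α) * C * (lam m ^ 4 * |fourier φ m|)) := fun m => by
    have h1 := eLpNorm_const_mul_le (fourier φ m * sd α μ m) (hbC m)
    rw [eLpNorm_one_eq_lintegral_enorm] at h1
    have e : ∀ x, fourier φ m * sd α μ m * b (some m) x = F m x := fun x => mul_assoc _ _ _
    simp only [e] at h1
    refine h1.trans (ENNReal.ofReal_le_ofReal ?_)
    rw [abs_mul, abs_of_pos (sd_pos hα hμ m)]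
    have h2 := sd_le hα hμ m
    have h3 := lam_pos m
    calc |fourier φ m| * sd α μ m * (C * lam m ^ 4)
        ≤ |fourier φ m| * Real.sqrt (1 / α) * (C * lam m ^ 4) := by gcongr
      _ = _ := by ring
  have hGm : Measurable fun x => ∑' m, ‖F m x‖ₑ := Measurable.tsum fun m => (hFm m).enorm
  have hG : ∫⁻ x, ∑' m, ‖F m x‖ₑ ∂stdG (Option Mode) ≠ ∞ := by
    rw [lintegral_tsum fun m => (hFm m).enorm.aemeasurable]
    exact ne_top_of_le_ne_top hsum.tsum_ofReal_ne_top (ENNReal.tsum_le_tsum hle)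
  refine ⟨⟨(Measurable.tsum hFm).aestronglyMeasurable, ?_⟩, ?_⟩
  · refine lt_of_le_of_lt (lintegral_mono fun x => ?_) hG.lt_top
    exact enorm_tsum_le_tsum_enorm
  · filter_upwards [hX.ae_lintegral_ne_top hGm hG] with w hw t ht
    have hXm : Measurable fun s => X s w := hX.measurable.comp measurable_prodMk_right
    have hfin : ∑' m, ∫⁻ s in Ioc 0 t, ‖F m (X s w)‖ₑ ≠ ∞ := by
      have hFX : ∀ m, Measurable fun s => ‖F m (X s w)‖ₑ := fun m => ((hFm m).comp hXm).enorm
      rw [← lintegral_tsum fun m => (hFX m).aemeasurable]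
      refine ne_top_of_le_ne_top hw (lintegral_mono_set ?_)
      exact Ioc_subset_Icc_self.trans (Icc_subset_Icc_right ht.2)
    rw [intervalIntegral.integral_of_le ht.1]
    refine (integral_tsum (f := fun m s => F m (X s w))
      (fun m => ((hFm m).comp hXm).aestronglyMeasurable) hfin).trans (tsum_congr fun m => ?_)
    simp only [hF]
    rw [integral_const_mul, integral_const_mul, intervalIntegral.integral_of_le ht.1]

/-- The equation of the mode m is multiplied by φ̂_m σ_m and summed over m. At almost every time
`ae_hasSum_drift` identifies the sum of the drifts with the nonlinear and affine terms.
Integrability of the affine term follows from that of the other two. -/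
theorem IsFlow.isWeakVorticitySolution (hα : 0 < α) (hμ : 0 < μ) (hδ : 0 < δ) (hT : 0 < T)
    (hh : IsTopography h) (hX : IsFlow T (-1 - δ) b P X)
    (hb : ∀ i, TendstoL2 (stdG (Option Mode)) atTop
      (fun s => drift (linRate α β μ h) (quadRate α μ) s i) (b i)) {C : ℝ} (hC : 0 ≤ C)
    (hbC : ∀ m, eLpNorm (b (some m)) 1 (stdG (Option Mode)) ≤ ENNReal.ofReal (C * lam m ^ 4)) :
    IsWeakVorticitySolution α β μ δ T h P (fun t w => flowVel α μ (X t w))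
      fun t w => recon (-1 - δ) (flowCoeff α μ (X t w)) := by
  refine ⟨fun φ hφ => ⟨_, hX.isDiamond hα hμ hδ hφ, ?_⟩, ?_⟩
  · simp only [hX.coeff_recon hα hμ]
    obtain ⟨hint, htsum⟩ := hX.ae_tsum_integral hα hμ (fun i => (hb i).meas) hC hbC hφ
    have hn := tendstoL2_chaosCoeff hα hμ hφ
    have hnm : Measurable fun x => chaos (chaosCoeff α μ φ) (vortCoord x) :=
      hn.meas.comp measurable_vortCoord
    have hn1 : Integrable (fun x => chaos (chaosCoeff α μ φ) (vortCoord x)) (stdG (Option Mode)) := by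
      obtain ⟨R, hR⟩ := exists_sum_chaosCoeff_le hα hμ hφ
      have : MemLp (chaos (chaosCoeff α μ φ)) 2 (stdG Mode) := ⟨hn.meas.aestronglyMeasurable,
        (eLpNorm_chaos_le (chaosCoeff_self hφ) hR).trans_lt ENNReal.ofReal_lt_top⟩
      exact (this.comp_measurePreserving measurePreserving_vortCoord).integrable (by norm_num)
    have hDm : Measurable fun x => ∑' m, fourier φ m * (sd α μ m * b (some m) x) :=
      Measurable.tsum fun m => ((hb _).meas.const_mul _).const_mul _
    filter_upwards [htsum, hX.ae_ae (ae_pairable_jac hα hμ hh hφ), hX.ae_intervalIntegrable hT.le hnm hn1,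
      hX.ae_intervalIntegrable hT.le hDm hint,
      hX.ae_ae (ae_hasSum_drift hα hμ hh hφ fun m => hb (some m)),
      ae_all_iff.2 fun m => hX.equation (some m)] with w hsum hpair hN hD hdrift heq
    have hdrift' : ∀ᵐ s ∂volume.restrict (Icc 0 T),
        affinePair β μ h (flowVel α μ (X s w)) (flowCoeff α μ (X s w)) φ
          = -chaos (chaosCoeff α μ φ) (vortCoord (X s w))
            - ∑' m, fourier φ m * (sd α μ m * b (some m) (X s w)) := by
      filter_upwards [hdrift] with s hs
      rw [hs.tsum_eq]
      ring
    have hA : IntervalIntegrable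
        (fun s => affinePair β μ h (flowVel α μ (X s w)) (flowCoeff α μ (X s w)) φ) volume 0 T := by
      rw [intervalIntegrable_iff_integrableOn_Icc_of_le hT.le] at hN hD ⊢
      exact (hN.neg.sub hD).congr (hdrift'.mono fun s hs => hs.symm)
    refine ⟨hpair, hN, hA, fun t ht => ?_⟩
    have hsub : uIcc 0 t ⊆ uIcc 0 T := by
      rw [uIcc_of_le ht.1, uIcc_of_le hT.le]
      exact Icc_subset_Icc_right ht.2
    have hNt : IntervalIntegrable (fun s => -chaos (chaosCoeff α μ φ) (vortCoord (X s w)))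
        volume 0 t := (hN.mono_set hsub).neg
    have hDt := hD.mono_set hsub
    have hAt : ∫ s in (0 : ℝ)..t, affinePair β μ h (flowVel α μ (X s w)) (flowCoeff α μ (X s w)) φ
        = -(∫ s in (0 : ℝ)..t, chaos (chaosCoeff α μ φ) (vortCoord (X s w)))
          - ∫ s in (0 : ℝ)..t, ∑' m, fourier φ m * (sd α μ m * b (some m) (X s w)) := by
      rw [← intervalIntegral.integral_neg, ← intervalIntegral.integral_sub hNt hDt]
      refine intervalIntegral.integral_congr_ae_restrict ?_
      rw [uIoc_of_le ht.1]
      exact ae_restrict_of_ae_restrict_of_subset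
        (Ioc_subset_Icc_self.trans (Icc_subset_Icc_right ht.2)) hdrift'
    obtain ⟨B, hB, hxB⟩ := hX.bound w
    have hps : ∀ t, Summable fun l => flowCoeff α μ (X t w) l * fourier φ l := fun t =>
      summable_abs_iff.1 (summable_mul_fourier hφ (summable_flowCoeff hα hμ hB (hxB t)))
    have hdiff : pair (flowCoeff α μ (X t w)) φ - pair (flowCoeff α μ (X 0 w)) φ
        = ∫ s in (0 : ℝ)..t, ∑' m, fourier φ m * (sd α μ m * b (some m) (X s w)) := by
      rw [hsum t ht, pair, pair, ← (hps t).tsum_sub (hps 0)]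
      refine tsum_congr fun m => ?_
      rw [← (heq m).2 t ht, flowCoeff, flowCoeff]
      ring
    rw [hAt]
    linarith
  · simp only [hX.coeff_recon hα hμ]
    filter_upwards [hX.ae_ae (ae_pairable_stress hα hμ hh), hX.equation none,
      hX.ae_ae (ae_drift_none hα hμ hh (hb none))] with w hpair heq hdrift
    have hA : IntervalIntegrable (fun s => stress μ h (flowCoeff α μ (X s w))) volume 0 T := by
      have h1 := heq.1.const_mul (Real.sqrt (α * μ))⁻¹
      rw [intervalIntegrable_iff_integrableOn_Icc_of_le hT.le] at h1 ⊢
      exact h1.congr hdrift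
    refine ⟨hpair, hA, fun t ht => ?_⟩
    rw [flowVel, flowVel, ← mul_sub, heq.2 t ht, ← intervalIntegral.integral_const_mul]
    refine intervalIntegral.integral_congr_ae_restrict ?_
    rw [uIoc_of_le ht.1]
    exact ae_restrict_of_ae_restrict_of_subset
      (Ioc_subset_Icc_self.trans (Icc_subset_Icc_right ht.2)) hdrift

end WeakSolution


/-! ### Stationarity and the Gibbs laws -/

section Stationary

variable {Ω : Type} [MeasurableSpace Ω] {P : Measure Ω} {α β μ δ T : ℝ} {h : ℝ × ℝ → ℝ}
  {b : Option Mode → (Option Mode → ℝ) → ℝ} {X : ℝ → Ω → Option Mode → ℝ}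

theorem IsFlow.identDistrib (hX : IsFlow T (-1 - δ) b P X) (n : ℕ) (t : Fin n → ℝ) (τ : ℝ)
    (ht : ∀ i, t i ∈ Icc 0 T) (ht' : ∀ i, t i + τ ∈ Icc 0 T) :
    IdentDistrib (fun w i => X (t i) w) (fun w i => X (t i + τ) w) P P := by
  rcases le_total 0 τ with hτ | hτ
  · exact hX.stationary n t (fun i => t i + τ) τ hτ ht ht' fun i => rfl
  · exact (hX.stationary n (fun i => t i + τ) t (-τ) (by linarith) ht' ht fun i => by ring).symm

theorem measurable_flowCoeff : Measurable (flowCoeff α μ) :=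
  measurable_pi_lambda _ fun l => (measurable_pi_apply (some l)).const_mul _

theorem IsFlow.continuous_recon (hα : 0 < α) (hμ : 0 < μ) (hX : IsFlow T (-1 - δ) b P X) (w : Ω) :
    Continuous fun t => recon (-1 - δ) (flowCoeff α μ (X t w)) := by
  obtain ⟨B, hB, hxB⟩ := hX.bound w
  have hB' : Summable fun l => lam l ^ (-1 - δ) * (Real.sqrt (1 / α) * B l) ^ 2 := by
    refine (hB.mul_left (Real.sqrt (1 / α) ^ 2)).congr fun l => ?_
    ring
  refine continuous_of_continuous_coeff (fun l => ?_) hB' fun t l => ?_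
  · simp only [hX.coeff_recon hα hμ]
    exact continuous_const.mul (hX.continuous w (some l))
  · rw [hX.coeff_recon hα hμ, flowCoeff, abs_mul, abs_of_pos (sd_pos hα hμ l)]
    exact mul_le_mul (sd_le hα hμ l) (hxB t l) (abs_nonneg _) (Real.sqrt_nonneg _)

/-- Affine images of the flow are stationary processes. -/
theorem IsFlow.isStationaryProcess (hα : 0 < α) (hμ : 0 < μ) (hX : IsFlow T (-1 - δ) b P X)
    (m₀ : ℝ) (m : OddSobolev (-1 - δ)) :
    IsStationaryProcess T P fun t w =>
      (m₀ + flowVel α μ (X t w), m + recon (-1 - δ) (flowCoeff α μ (X t w))) := by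
  have hΦ : Measurable fun x : Option Mode → ℝ =>
      (m₀ + flowVel α μ x, m + recon (-1 - δ) (flowCoeff α μ x)) := by
    refine Measurable.prodMk (((measurable_pi_apply none).const_mul _).const_add _) ?_
    exact (continuous_const_add m).measurable.comp (measurable_recon.comp measurable_flowCoeff)
  refine ⟨fun t _ => hΦ.comp (hX.measurable_right t), fun w => ?_, fun n t τ ht ht' => ?_⟩
  · refine Continuous.continuousOn (Continuous.prodMk ?_ ?_)
    · exact continuous_const.add (continuous_const.mul (hX.continuous w none))
    · exact continuous_const.add (hX.continuous_recon hα hμ w)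
  · exact (hX.identDistrib n t τ ht ht').comp (u := fun (y : Fin n → Option Mode → ℝ) i =>
      (m₀ + flowVel α μ (y i), m + recon (-1 - δ) (flowCoeff α μ (y i))))
      (measurable_pi_lambda _ fun i => hΦ.comp (measurable_pi_apply i))

theorem IsFlow.hasLaw (hα : 0 < α) (hμ : 0 < μ) (hX : IsFlow T (-1 - δ) b P X) (m₀ : ℝ)
    (m : Mode → ℝ) (t : ℝ) :
    HasLaw (fun w => (m₀ + flowVel α μ (X t w), fun l => m l + flowCoeff α μ (X t w) l))
      ((gaussianReal m₀ (1 / (α * μ)).toNNReal).prod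
        (Measure.infinitePi fun l => gaussianReal (m l) (modeVar α μ l).toNNReal)) P := by
  have hΦ : Measurable fun x : Option Mode → ℝ =>
      (m₀ + flowVel α μ x, fun l => m l + flowCoeff α μ x l) :=
    Measurable.prodMk (((measurable_pi_apply none).const_mul _).const_add _)
      (measurable_pi_lambda _ fun l => ((measurable_pi_apply (some l)).const_mul _).const_add _)
  refine ⟨(hΦ.comp (hX.measurable_right t)).aemeasurable, ?_⟩
  have h1 := map_stdG_affine m₀ (Real.sqrt (α * μ))⁻¹ m (sd α μ)
  have e : ((Real.sqrt (α * μ))⁻¹) ^ 2 = 1 / (α * μ) := by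
    rw [inv_pow, Real.sq_sqrt (by positivity), one_div]
  simp only [sd_sq hα hμ, e] at h1
  rw [← h1, ← hX.map_eq t, Measure.map_map _ (hX.measurable_right t)]
  · rfl
  · exact hΦ

/-- Bounded coefficients already belong to 𝓗^{-1-δ} in dimension two. No more is needed, although βy
jumps at the wall y = π when extended periodically. -/
theorem IsTopography.summable_meanCoeff (hh : IsTopography h) (hμ : 0 < μ) (hδ : 0 < δ) :
    Summable fun l => lam l ^ (-1 - δ) * meanCoeff β μ h l ^ 2 := by
  obtain ⟨C₁, hC₁0, hC₁⟩ := hh.isBddTorus.exists_fourier_bound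
  obtain ⟨C₂, hC₂0, hC₂⟩ := (isBddTorus_of_continuous continuous_snd).exists_fourier_bound
  have h0 := (summable_lam_rpow (s := 1 + δ) (by linarith)).mul_right ((C₁ + |β| * C₂) ^ 2)
  refine h0.of_nonneg_of_le
    (fun l => mul_nonneg (Real.rpow_nonneg (lam_pos l).le _) (sq_nonneg _)) fun l => ?_
  have hl := lam_pos l
  have h1 : |meanCoeff β μ h l| ≤ C₁ + |β| * C₂ := by
    rw [meanCoeff]
    refine (abs_add_le _ _).trans (add_le_add ?_ ?_)
    · rw [abs_mul, abs_of_pos (by positivity)]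
      have : μ / (μ + lam l) ≤ 1 := by
        rw [div_le_one (by linarith)]
        linarith
      exact (mul_le_of_le_one_left (abs_nonneg _) this).trans (hC₁ l)
    · rw [abs_mul]
      exact mul_le_mul_of_nonneg_left (hC₂ l) (abs_nonneg _)
  have h2 : meanCoeff β μ h l ^ 2 ≤ (C₁ + |β| * C₂) ^ 2 := by
    rw [← sq_abs]
    exact pow_le_pow_left₀ (abs_nonneg _) h1 2
  rw [neg_add']
  exact mul_le_mul_of_nonneg_left h2 (Real.rpow_nonneg hl.le _)

/-- The barotropic system has a stationary flow in normalised coordinates. -/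
theorem exists_barotropic_flow (hα : 0 < α) (hμ : 0 < μ) (hδ : 0 < δ) (hT : 0 < T)
    (hh : IsTopography h) :
    ∃ (b : Option Mode → (Option Mode → ℝ) → ℝ) (C : ℝ)
      (P : Measure (Option Mode → C(Icc (0 : ℝ) T, ℝ))) (_ : IsProbabilityMeasure P)
      (X : ℝ → (Option Mode → C(Icc (0 : ℝ) T, ℝ)) → Option Mode → ℝ),
      0 ≤ C ∧ IsFlow T (-1 - δ) b P X ∧
      (∀ i, TendstoL2 (stdG (Option Mode)) atTop
        (fun s => drift (linRate α β μ h) (quadRate α μ) s i) (b i)) ∧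
      ∀ m, eLpNorm (b (some m)) 1 (stdG (Option Mode)) ≤ ENNReal.ofReal (C * lam m ^ 4) := by
  obtain ⟨C₁, hC₁0, hC₁⟩ := exists_sum_linRate_sq_le (β := β) hα hμ hh
  obtain ⟨C₂, hC₂0, hC₂⟩ := exists_sum_quadRate_sq_le hα hμ
  have hdrift := exists_tendstoL2_drift (a₀ := linRate α β μ h) quadRate_self hC₁ hC₂
  choose b hb using fun i => (hdrift i).1
  have hF := fourthMoment_nonneg
  have hw : ∀ i, 0 ≤ weight i := by
    rintro (_ | m)
    · exact zero_le_one
    · exact pow_nonneg (lam_pos m).le 4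
  set K : Option Mode → ℝ := fun i =>
    2 + C₁ * weight i + (2 + fourthMoment) * (C₂ * weight i) with hK
  have hK0 : ∀ i, 0 ≤ K i := fun i => by
    have := hw i
    positivity
  -- As |l| ≥ 1, the additive constant 2 in K is absorbed into the multiple of |l|⁸.
  set C := 2 + C₁ + (2 + fourthMoment) * C₂ with hC
  have hC0 : 0 ≤ C := by positivity
  have hKC : ∀ l, K (some l) ≤ C * lam l ^ 4 := fun l => by
    have : 1 ≤ lam l ^ 4 := one_le_pow₀ (one_le_lam l)
    simp only [hK, hC, weight]
    linarith
  obtain ⟨P, hP, X, hX⟩ := isRotational_rates.exists_isFlow hb hK0 (fun s i => (hdrift i).2 s)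
    hC0 hKC hT hδ
  refine ⟨b, C, P, hP, X, hC0, hX, hb, fun m => ?_⟩
  refine (eLpNorm_le_eLpNorm_of_exponent_le (q := 2) (by norm_num)
    (hb _).meas.aestronglyMeasurable).trans ?_
  exact ((hb _).eLpNorm_le (Eventually.of_forall fun s => (hdrift (some m)).2 s)).trans
    (ENNReal.ofReal_le_ofReal (hKC m))

end Stationary

end BQG

end

/-! ### Assembly of the theorem. -/

theorem theorem1p1 (α β μ δ T : ℝ) (hβ : β ≠ 0) (hα : 0 < α) (hμ : 0 < μ) (hδ : 0 < δ) (hT : 0 < T)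
    (h : ℝ × ℝ → ℝ) (hh : BQG.IsTopography h) :
    ∃ (Ω : Type) (_ : MeasurableSpace Ω) (P : Measure Ω) (_ : IsProbabilityMeasure P)
      (V U : ℝ → Ω → ℝ) (q ω : ℝ → Ω → BQG.OddSobolev (-1 - δ)),
      BQG.IsStationaryProcess T P (fun t w => (V t w, q t w)) ∧
      (∀ t ∈ Set.Icc 0 T,
        HasLaw (fun w => (V t w, BQG.coeff (q t w))) (BQG.nu α β μ h) P) ∧
      (∀ t ∈ Set.Icc 0 T, ∀ w, U t w = V t w + β / μ ∧
        ∀ l, BQG.coeff (ω t w) l = BQG.coeff (q t w) l - BQG.meanCoeff β μ h l) ∧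
      BQG.IsStationaryProcess T P (fun t w => (U t w, ω t w)) ∧
      (∀ t ∈ Set.Icc 0 T,
        HasLaw (fun w => (U t w, BQG.coeff (ω t w))) (BQG.eta α μ) P) ∧
      BQG.IsWeakVorticitySolution α β μ δ T h P U ω := by
  obtain ⟨b, C, P, hP, X, hC, hX, hb, hbC⟩ :=
    BQG.exists_barotropic_flow (β := β) hα hμ hδ hT hh
  -- The mean q̄ as an element of 𝓗^{-1-δ}. The pair (V, q) is the centred pair (U, ω) translated by
  -- (−β/μ, q̄), so stationarity and Gaussian laws of both pairs come from one flow.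
  obtain ⟨m, hm⟩ := BQG.exists_coeff_eq _ (hh.summable_meanCoeff (β := β) hμ hδ)
  refine ⟨_, _, P, hP, fun t w => -β / μ + BQG.flowVel α μ (X t w),
    fun t w => BQG.flowVel α μ (X t w),
    fun t w => m + BQG.recon (-1 - δ) (BQG.flowCoeff α μ (X t w)),
    fun t w => BQG.recon (-1 - δ) (BQG.flowCoeff α μ (X t w)),
    hX.isStationaryProcess hα hμ _ m, fun t _ => ?_, fun t _ w => ⟨by ring, fun l => ?_⟩,
    ?_, fun t _ => ?_, hX.isWeakVorticitySolution hα hμ hδ hT hh hb hC hbC⟩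
  · have e : ∀ w, BQG.coeff (m + BQG.recon (-1 - δ) (BQG.flowCoeff α μ (X t w)))
        = fun l => BQG.meanCoeff β μ h l + BQG.flowCoeff α μ (X t w) l := fun w => by
      ext l
      rw [BQG.coeff_add, hm, hX.coeff_recon hα hμ]
    simp only [e]
    exact hX.hasLaw hα hμ _ _ t
  · rw [BQG.coeff_add, hm]
    ring
  · simpa only [zero_add] using hX.isStationaryProcess hα hμ 0 0
  · simp only [hX.coeff_recon hα hμ]
    have key := hX.hasLaw hα hμ 0 (fun _ => 0) t
    simp only [zero_add] at key
    exact key
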